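/- **Expressions.** Let $\Sigma,\Gamma$ be finite alphabets. Regular transducer expressions (RTEs) are given by $$h ::= e\triangleright v \mid h+h \mid h\cdot h \mid h\cdot_r h \mid h^{\star} \mid h^{\star}_{r} \mid h\odot h \mid [e,h]^{k\star} \mid [e,h]^{k\star}_{r}$$ with $e$ a regular expression over $\Sigma$, $v\in\Gamma^\star$, $k\ge 1$. Let $L(e)$ be the language of $e$ and $\mathrm{nl}(e)$ its number of occurrences of letters. The size is $|e\triangleright v|=2+\mathrm{nl}(e)+\max(1,|v|)$, $|f+g|=|f\cdot g|=|f\cdot_r g|=|f\odot g|=1+|f|+|g|$, $|f^\star|=|f^\star_r|=1+|f|$, $|[e,f]^{k\star}|=|[e,f]^{k\star}_r|=2+\mathrm{nl}(e)+|f|+k$. The width is $w(e\triangleright v)=1$, $w(f+g)=w(f\cdot g)=w(f\cdot_r g)=\max(w(f),w(g))$, $w(f^\star)=w(f^\star_r)=w(f)$, $w(f\odot g)=w(f)+w(g)$, $w([e,f]^{k\star})=w([e,f]^{k\star}_r)=2+k\,w(f)$. **Semantics.** The domain $\mathrm{dom}\,h\subseteq\Sigma^\star$, the unambiguous domain $\mathrm{udom}\,h$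 and the relation $[\![h]\!]^{R}$ are defined inductively. * $e\triangleright v$: $\mathrm{dom}=\mathrm{udom}=L(e)$, with the single output $v$. * $f+g$: $\mathrm{dom}$ and $[\![\cdot]\!]^R$ are the unions; $\mathrm{udom}=(\mathrm{udom}f\setminus\mathrm{dom}\,g)\cup(\mathrm{udom}\,g\setminus\mathrm{dom}f)$. * $f\cdot g$ (resp. $f\cdot_r g$): $\mathrm{dom}=\mathrm{dom}f\cdot\mathrm{dom}\,g$; the outputs on $w$ are $\bigcup_{w=uv}[\![f]\!]^R(u)[\![g]\!]^R(v)$ (resp. $\bigcup_{w=uv}[\![g]\!]^R(v)[\![f]\!]^R(u)$); $\mathrm{udom}$ is the set of $w$ having a unique factorization $w=uv$ in $\mathrm{dom}f\cdot\mathrm{dom}\,g$, with moreover $u\in\mathrm{udom}f$, $v\in\mathrm{udom}\,g$. * $f^\star$ (resp. $f^\star_r$): $\mathrm{dom}=(\mathrm{dom}f)^\star$; the outputs are $\bigcup_{w=u_1\cdots u_n}[\![f]\!]^R(u_1)\cdots[\![f]\!]^R(u_n)$ (resp. in the reverse order); $\mathrm{udom}$ is the set of $w$ having a unique factorization $u_1,\dots,u_n$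 ($n\ge0$) into words of $\mathrm{dom}f$, all of them moreover in $\mathrm{udom}f$. * $f\odot g$: $\mathrm{dom}=\mathrm{dom}f\cap\mathrm{dom}\,g$, $\mathrm{udom}=\mathrm{udom}f\cap\mathrm{udom}\,g$, outputs $[\![f]\!]^R(w)\,[\![g]\!]^R(w)$. * $[e,f]^{k\star}$ (resp. $[e,f]^{k\star}_r$): $\mathrm{dom}$ is the set of $w$ with a factorization $w=u_1\cdots u_n$ such that $(\dagger)$ $n\ge0$, all $u_i\in L(e)$, and $u_{i+1}\cdots u_{i+k}\in\mathrm{dom}f$ for $0\le i\le n-k$; $\mathrm{udom}$ requires that the factorization with $(\dagger)$ is unique and that its blocks $u_{i+1}\cdots u_{i+k}$ are in $\mathrm{udom}f$; the outputs are $\bigcup\prod_{i=0}^{n-k}[\![f]\!]^R(u_{i+1}\cdots u_{i+k})$ (resp. the product in the reverse order) over all factorizations with $u_1,\dots,u_n\in L(e)$, the product being $\{\varepsilon\}$ if $n<k$. **Parsing relation.** Each occurrence $f$ of a subexpression has its own pair of markers $(_f,\ )_f$; a (reverse) $k$-star over $e$ has in addition a separator $\#_e$, and it uses $k$ copies of the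 markers of its argument, with exponents in $\mathbb Z/k$. For a word $\alpha$ over letters and markers, $\pi_\Sigma(\alpha)$ is its projection on $\Sigma$. The set $P_h(w)$ of parsings of $w$ is defined inductively. * $P_{e\triangleright v}(w)=\{(_h w )_h\mid w\in L(e)\}$; $P_{f+g}(w)=\{(_h\alpha)_h\mid\alpha\in P_f(w)\cup P_g(w)\}$. * For $h=f\cdot g$ or $h=f\cdot_r g$: $P_h(w)=\{(_h\alpha\beta)_h\mid w=uv,\ \alpha\in P_f(u),\ \beta\in P_g(v)\}$. * For $h=f^\star$ or $h=f^\star_r$: $P_h(w)=\{(_h\alpha_1\cdots\alpha_n)_h\mid n\ge0,\ w=u_1\cdots u_n,\ \alpha_i\in P_f(u_i)\}$. * $P_{f\odot g}(w)$ is the set of $(_h\alpha)_h$ such that erasing the markers of $g$ (resp. $f$) from $\alpha$ gives an element of $P_f(w)$ (resp. $P_g(w)$), and in $\alpha$ no marker of $g$ is immediately followed by a marker of $f$. * For $h=[e,f]^{k\star}$ or $h=[e,f]^{k\star}_r$, $P_h(w)$ is the set of the words $(_h u_1\#_e u_2\#_e\cdots u_n\#_e)_h$ with $0\le n<k$, $w=u_1\cdots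 u_n$, $u_i\in L(e)$, and of the words $(_h\alpha_1\#_e\alpha_2\#_e\cdots\#_e\alpha_n)_h$ with $n\ge k$ such that $u_i:=\pi_\Sigma(\alpha_i)\in L(e)$, $w=u_1\cdots u_n$, and, for $1\le i\le n$ wherever $i$ indexes some $\alpha_i$: 1. for $0\le i\le n-k$, keeping in $\alpha_{i+1}\cdots\alpha_{i+k}$ the letters and the markers with exponent $i+1$, and deleting this exponent, gives an element of $P_f(u_{i+1}\cdots u_{i+k})$; 2. for $1\le i<j\le k$, $\alpha_i$ has no marker with exponent $j$; 3. for $n-k+1<j\le i\le n$, $\alpha_i$ has no marker with exponent $j$; 4. if $i\ge k$, then $\alpha_i$ ends with $)_f^{i+1}$; 5. if $i\le n-k+1$, then $\alpha_i$ starts with $(_f^{i}$; if $i>n-k+1$, then $\alpha_i$ starts with a letter of $\Sigma$, or $\alpha_i={})_f^{i+1}$, or $i<k$ and $\alpha_i=\varepsilon$; 6. if a marker with exponent $j$ is immediately followed in $\alpha_i$ by a marker with exponent $j'$ other than $)_f^{i+1}$, then $j$ is not after $j'$ in the enumeration $i+1,i+2,\dots,i+k$ of $\mathbb Z/k$. **Machines.**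 A 1NFT is a one-way nondeterministic finite transducer with one initial state and a set of final states; a transition is a triple (state, letter or $\varepsilon$, state), and it produces an output word. A two-way transducer has a finite set of states partitioned into forward states $Q^+$ and backward states $Q^-$, an initial state $q_I\in Q^+$, a set $F\subseteq Q^+$ of final states, a transition relation $\Delta\subseteq Q\times(\text{letters}\cup\{\vdash,\dashv\})\times Q$, and an output word for each transition; the only forward state that has a transition reading $\vdash$ is $q_I$, and the only forward states reached by a transition reading $\dashv$ are the final ones. The head is between cells: a forward (backward) state reads the cell to its right (left), and after a transition $(p,a,q)$ the head is to the right of the cell just read if $q\in Q^+$ and to its left if $q\in Q^-$. A run on $w$ is accepting if it starts in $q_I$ at the left end of ${\vdash}w{\dashv}$ and ends in a final state at its right end. A 2RFT is a two-way transducer that is deterministic (at most one $q$ with $(p,a,q)\in\Delta$ for all $p,a$) and co-deterministic (at most one $p$ with $(p,a,q)\in\Delta$ for all $q,a$) with exactly one final state. $\|\cdot\|$ is the number of states. **Theorem.** Let $h$ be an RTE. 1. $\mathrm{dom}\,P_h=\mathrm{dom}\,h$, and $\mathrm{udom}\,h=\{w\mid |P_h(w)|=1\}$. Moreover $\pi_\Sigma(\alpha)=w$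 for all $w\in\mathrm{dom}\,h$ and $\alpha\in P_h(w)$. 2. There is a 2RFT $\mathcal T_h$ (the evaluator) with $[\![h]\!]^R=[\![\mathcal T_h]\!]\circ P_h$ and $\|\mathcal T_h\|\le 5\,|h|\,w(h)$; if $h$ uses neither $k$-star nor reverse $k$-star, then also $\|\mathcal T_h\|\le 5|h|$. 3. There is a 1NFT $\mathcal P_h$ (the parser) with $[\![\mathcal P_h]\!]^R=P_h$ and $\|\mathcal P_h\|\le |h|^{w(h)}$; if $h$ uses neither Hadamard product nor $k$-star nor reverse $k$-star, then also $\|\mathcal P_h\|\le|h|$. -/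

import Mathlib

/-!
Regular transducer expressions, their relational semantics and unambiguous domain,
the parsing relation, one-way transducers and two-way reversible transducers.
-/

/-- The number `nl(e)` of literals occurring in a regular expression. -/
def RegularExpression.nl {A : Type*} : RegularExpression A → ℕ
  | .zero => 0
  | .epsilon => 0
  | .char _ => 1
  | .plus e₁ e₂ => e₁.nl + e₂.nl
  | .comp e₁ e₂ => e₁.nl + e₂.nl
  | .star e => e.nl

/-- Regular transducer expressions with input alphabet `A` and output alphabet `B`. -/
inductive RTE (A B : Type*) where
  /-- the simple expression `e ▷ v`: constant value `v` on the language of `e` -/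
  | base (e : RegularExpression A) (v : List B)
  /-- sum `f + g` -/
  | sum (f g : RTE A B)
  /-- Cauchy product `f · g` -/
  | cauchy (f g : RTE A B)
  /-- reverse Cauchy product -/
  | rcauchy (f g : RTE A B)
  /-- Kleene star -/
  | star (f : RTE A B)
  /-- reverse Kleene star -/
  | rstar (f : RTE A B)
  /-- Hadamard product `f ⊙ g` -/
  | had (f g : RTE A B)
  /-- `k`-star `[e, f]^{k⋆}`, with `k ≥ 1` -/
  | kstar (k : ℕ+) (e : RegularExpression A) (f : RTE A B)
  /-- reverse `k`-star, with `k ≥ 1` -/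
  | krstar (k : ℕ+) (e : RegularExpression A) (f : RTE A B)

/-- The blocks `u_{i+1} ⋯ u_{i+k}`, `0 ≤ i ≤ n - k`, of a factorization `u_1, …, u_n`, in order
(no block if `n < k`). -/
def RTE.blocks {A : Type*} (k : ℕ) (us : List (List A)) : List (List A) :=
  (List.range (us.length + 1 - k)).map fun i => ((us.drop i).take k).flatten

/-- `us` is a factorization of `w` into words of `L` all of whose blocks of `k` consecutive factors
lie in `D`. -/
def RTE.IsKFact {A : Type*} (k : ℕ) (L D : Language A) (w : List A) (us : List (List A)) : Prop :=
  w = us.flatten ∧ (∀ u ∈ us, u ∈ L) ∧ ∀ b ∈ RTE.blocks k us, b ∈ D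

namespace RTE

variable {A B : Type*}

/-- The size `|h|`. -/
def size : RTE A B → ℕ
  | base e v => 1 + (1 + e.nl) + max 1 v.length
  | sum f g => 1 + f.size + g.size
  | cauchy f g => 1 + f.size + g.size
  | rcauchy f g => 1 + f.size + g.size
  | star f => 1 + f.size
  | rstar f => 1 + f.size
  | had f g => 1 + f.size + g.size
  | kstar k e f => 1 + e.nl + f.size + k + 1
  | krstar k e f => 1 + e.nl + f.size + k + 1

/-- The width `w(h)`. -/
def width : RTE A B → ℕ
  | base _ _ => 1
  | sum f g => max f.width g.width
  | cauchy f g => max f.width g.width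
  | rcauchy f g => max f.width g.width
  | star f => f.width
  | rstar f => f.width
  | had f g => f.width + g.width
  | kstar k _ f => 2 + k * f.width
  | krstar k _ f => 2 + k * f.width

/-- `h` uses a Hadamard product. -/
def UsesHadamard : RTE A B → Prop
  | base _ _ => False
  | sum f g => f.UsesHadamard ∨ g.UsesHadamard
  | cauchy f g => f.UsesHadamard ∨ g.UsesHadamard
  | rcauchy f g => f.UsesHadamard ∨ g.UsesHadamard
  | star f => f.UsesHadamard
  | rstar f => f.UsesHadamard
  | had _ _ => True
  | kstar _ _ f => f.UsesHadamard
  | krstar _ _ f => f.UsesHadamard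

/-- `h` uses a `k`-star or a reverse `k`-star. -/
def UsesKStar : RTE A B → Prop
  | base _ _ => False
  | sum f g => f.UsesKStar ∨ g.UsesKStar
  | cauchy f g => f.UsesKStar ∨ g.UsesKStar
  | rcauchy f g => f.UsesKStar ∨ g.UsesKStar
  | star f => f.UsesKStar
  | rstar f => f.UsesKStar
  | had f g => f.UsesKStar ∨ g.UsesKStar
  | kstar _ _ _ => True
  | krstar _ _ _ => True

/-- The domain of `h`. -/
def dom : RTE A B → Language A
  | base e _ => e.matches'
  | sum f g => f.dom + g.dom
  | cauchy f g => f.dom * g.dom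
  | rcauchy f g => f.dom * g.dom
  | star f => KStar.kstar f.dom
  | rstar f => KStar.kstar f.dom
  | had f g => f.dom ⊓ g.dom
  | kstar k e f => {w | ∃ us, IsKFact k e.matches' f.dom w us}
  | krstar k e f => {w | ∃ us, IsKFact k e.matches' f.dom w us}

/-- Relational semantics: `h.rsem w` is the set of outputs of `h` on the input word `w`.
Products are concatenations of languages, and the empty product is `{ε}`. -/
def rsem : RTE A B → List A → Language B
  | base e v, w => {y | w ∈ e.matches' ∧ y = v}
  | sum f g, w => f.rsem w + g.rsem w
  | cauchy f g, w => {y | ∃ u v, w = u ++ v ∧ y ∈ f.rsem u * g.rsem v}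
  | rcauchy f g, w => {y | ∃ u v, w = u ++ v ∧ y ∈ g.rsem v * f.rsem u}
  | star f, w => {y | ∃ us : List (List A), w = us.flatten ∧ y ∈ (us.map f.rsem).prod}
  | rstar f, w => {y | ∃ us : List (List A), w = us.flatten ∧ y ∈ (us.map f.rsem).reverse.prod}
  | had f g, w => f.rsem w * g.rsem w
  | kstar k e f, w => {y | ∃ us : List (List A), w = us.flatten ∧ (∀ u ∈ us, u ∈ e.matches') ∧
      y ∈ ((blocks k us).map f.rsem).prod}
  | krstar k e f, w => {y | ∃ us : List (List A), w = us.flatten ∧ (∀ u ∈ us, u ∈ e.matches') ∧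
      y ∈ ((blocks k us).map f.rsem).reverse.prod}

/-- Unambiguous words of a Cauchy product. -/
def cauchyUdom (D₁ U₁ D₂ U₂ : Language A) : Language A :=
  {w | ∃ u v, w = u ++ v ∧ u ∈ U₁ ∧ v ∈ U₂ ∧
    ∀ u' v', w = u' ++ v' → u' ∈ D₁ → v' ∈ D₂ → u' = u ∧ v' = v}

/-- Unambiguous words of a Kleene star. -/
def starUdom (D U : Language A) : Language A :=
  {w | ∃ us : List (List A), w = us.flatten ∧ (∀ u ∈ us, u ∈ D) ∧ (∀ u ∈ us, u ∈ U) ∧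
    ∀ us' : List (List A), w = us'.flatten → (∀ u ∈ us', u ∈ D) → us' = us}

/-- Unambiguous words of a `k`-star. -/
def kstarUdom (k : ℕ) (L D U : Language A) : Language A :=
  {w | ∃ us, IsKFact k L D w us ∧ (∀ b ∈ blocks k us, b ∈ U) ∧
    ∀ us', IsKFact k L D w us' → us' = us}

/-- The unambiguous domain of `h`. -/
def udom : RTE A B → Language A
  | base e _ => e.matches'
  | sum f g => {w | (w ∈ f.udom ∧ w ∉ g.dom) ∨ (w ∈ g.udom ∧ w ∉ f.dom)}
  | cauchy f g => cauchyUdom f.dom f.udom g.dom g.udom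
  | rcauchy f g => cauchyUdom f.dom f.udom g.dom g.udom
  | star f => starUdom f.dom f.udom
  | rstar f => starUdom f.dom f.udom
  | had f g => f.udom ⊓ g.udom
  | kstar k e f => kstarUdom k e.matches' f.dom f.udom
  | krstar k e f => kstarUdom k e.matches' f.dom f.udom

end RTE

/-! ### Markers and parsings -/

/-- The markers of an expression `h`: the opening parenthesis `op` and the closing parenthesis `cl`
of (this occurrence of) `h`, and the other markers, taken from `S`. -/
inductive Marker (S : Type) where
  | op
  | cl
  | sub (s : S)

/-- The markers of `h` other than the two parentheses of `h` itself. They are the markers of the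
immediate subexpressions (disjointly, so that distinct occurrences have distinct markers); for a
(reverse) `k`-star, these are the separator `Sum.inl ()`, written `#`, and the markers of `f` indexed
by a residue modulo `k`. -/
def RTE.Sub {A B : Type*} : RTE A B → Type
  | .base _ _ => Empty
  | .sum f g => Marker f.Sub ⊕ Marker g.Sub
  | .cauchy f g => Marker f.Sub ⊕ Marker g.Sub
  | .rcauchy f g => Marker f.Sub ⊕ Marker g.Sub
  | .star f => Marker f.Sub
  | .rstar f => Marker f.Sub
  | .had f g => Marker f.Sub ⊕ Marker g.Sub
  | .kstar k _ f => Unit ⊕ (ZMod k × Marker f.Sub)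
  | .krstar k _ f => Unit ⊕ (ZMod k × Marker f.Sub)

/-- The alphabet of the parsings with respect to `h`: input letters and markers of `h`. -/
abbrev RTE.Sym {A B : Type*} (h : RTE A B) : Type _ := A ⊕ Marker h.Sub

theorem Marker.finite {S : Type} (hS : Finite S) : Finite (Marker S) := by
  refine Finite.of_surjective (fun x : Option (Option S) =>
    match x with
    | none => Marker.op
    | some none => Marker.cl
    | some (some s) => Marker.sub s) ?_
  rintro (_ | _ | s)
  · exact ⟨none, rfl⟩
  · exact ⟨some none, rfl⟩
  · exact ⟨some (some s), rfl⟩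

theorem RTE.sub_finite {A B : Type*} (h : RTE A B) : Finite h.Sub := by
  induction h with
  | base e v => exact inferInstanceAs (Finite Empty)
  | sum f g hf hg | cauchy f g hf hg | rcauchy f g hf hg | had f g hf hg =>
    have := Marker.finite hf
    have := Marker.finite hg
    exact inferInstanceAs (Finite (Marker f.Sub ⊕ Marker g.Sub))
  | star f hf | rstar f hf => exact Marker.finite hf
  | kstar k e f hf | krstar k e f hf =>
    have := Marker.finite hf
    exact inferInstanceAs (Finite (Unit ⊕ (ZMod k × Marker f.Sub)))

/-- The alphabet of parsings is finite. -/
instance RTE.finite_sym {A B : Type*} [Finite A] (h : RTE A B) : Finite h.Sym := by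
  have := Marker.finite h.sub_finite
  infer_instance

namespace Parsing

variable {A : Type*} {M N S : Type}

/-- Projection of a marked word on the input alphabet. -/
def proj {M : Type*} (α : List (A ⊕ M)) : List A := α.filterMap Sum.getLeft?

/-- Put a word between the parentheses of the current expression. -/
def wrap (α : List (A ⊕ S)) : List (A ⊕ Marker S) :=
  [.inr .op] ++ α.map (Sum.map id .sub) ++ [.inr .cl]

/-- Parsings for `e ▷ v`. -/
def base (L : Language A) (w : List A) : Set (List (A ⊕ Marker S)) :=
  {γ | w ∈ L ∧ γ = wrap (w.map .inl)}

/-- Parsings for a sum. -/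
def sum (P : List A → Set (List (A ⊕ M))) (Q : List A → Set (List (A ⊕ N))) (w : List A) :
    Set (List (A ⊕ Marker (M ⊕ N))) :=
  {γ | (∃ α ∈ P w, γ = wrap (α.map (Sum.map id .inl))) ∨
    ∃ β ∈ Q w, γ = wrap (β.map (Sum.map id .inr))}

/-- Parsings for a (reverse) Cauchy product. -/
def cauchy (P : List A → Set (List (A ⊕ M))) (Q : List A → Set (List (A ⊕ N))) (w : List A) :
    Set (List (A ⊕ Marker (M ⊕ N))) :=
  {γ | ∃ u v, w = u ++ v ∧ ∃ α ∈ P u, ∃ β ∈ Q v,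
    γ = wrap (α.map (Sum.map id .inl) ++ β.map (Sum.map id .inr))}

/-- Parsings for a (reverse) Kleene star. The list `xs` holds the pairs `(u_i, α_i)`. -/
def star (P : List A → Set (List (A ⊕ M))) (w : List A) : Set (List (A ⊕ Marker M)) :=
  {γ | ∃ xs : List (List A × List (A ⊕ M)), (∀ x ∈ xs, x.2 ∈ P x.1) ∧
    w = (xs.map Prod.fst).flatten ∧ γ = wrap (xs.map Prod.snd).flatten}

/-- Erase the markers of the second argument of a Hadamard product. -/
def restrictLeft (α : List (A ⊕ (M ⊕ N))) : List (A ⊕ M) :=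
  α.filterMap fun
    | .inl a => some (.inl a)
    | .inr (.inl m) => some (.inr m)
    | .inr (.inr _) => none

/-- Erase the markers of the first argument of a Hadamard product. -/
def restrictRight (α : List (A ⊕ (M ⊕ N))) : List (A ⊕ N) :=
  α.filterMap fun
    | .inl a => some (.inl a)
    | .inr (.inl _) => none
    | .inr (.inr n) => some (.inr n)

/-- Parsings for a Hadamard product: no marker of the second argument is immediately followed by a
marker of the first one. -/
def had (P : List A → Set (List (A ⊕ M))) (Q : List A → Set (List (A ⊕ N))) (w : List A) :
    Set (List (A ⊕ Marker (M ⊕ N))) :=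
  {γ | ∃ α : List (A ⊕ (M ⊕ N)), γ = wrap α ∧ restrictLeft α ∈ P w ∧ restrictRight α ∈ Q w ∧
    ∀ n m, ¬ [.inr (.inr n), .inr (.inl m)] <:+: α}

/-- Keep the letters and the markers with index `j`, and erase the index. -/
def select {k : ℕ} (j : ZMod k) (α : List (A ⊕ (ZMod k × M))) : List (A ⊕ M) :=
  α.filterMap fun
    | .inl a => some (.inl a)
    | .inr (l, m) => if l = j then some (.inr m) else none

/-- The concatenation `α_{i+1} ⋯ α_{i+k}`. -/
def block {X : Type*} (α : ℕ → List X) (i k : ℕ) : List X :=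
  ((List.range' (i + 1) k).map α).flatten

/-- The conditions on `α_1, …, α_n` for a (reverse) `k`-star when `n ≥ k`. Indices modulo `k` are
residue classes; `op` and `cl` are the parentheses of `f`. -/
structure IsLong {k : ℕ} (P : List A → Set (List (A ⊕ Marker S))) (n : ℕ)
    (α : ℕ → List (A ⊕ (ZMod k × Marker S))) : Prop where
  /-- every block, decorated with the markers of the appropriate index, is a parsing for `f` -/
  block_mem : ∀ i, i + k ≤ n →
    select ((i + 1 : ℕ) : ZMod k) (block α i k) ∈ P (proj (block α i k))
  /-- no marker with index `j` before the first block with index `j` -/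
  before : ∀ i j : ℕ, 1 ≤ i → i < j → j ≤ k → ∀ m, .inr ((j : ZMod k), m) ∉ α i
  /-- no marker with index `j` from position `j` on if no block starts there -/
  after : ∀ i j : ℕ, n + 1 < j + k → j ≤ i → i ≤ n → ∀ m, .inr ((j : ZMod k), m) ∉ α i
  /-- a block that ends with the `i`-th factor is closed at the end of `α_i` -/
  close : ∀ i : ℕ, k ≤ i → i ≤ n → [.inr (((i + 1 : ℕ) : ZMod k), Marker.cl)] <:+ α i
  /-- a block that starts with the `i`-th factor is opened at the start of `α_i` -/
  start : ∀ i : ℕ, 1 ≤ i → i + k ≤ n + 1 → [.inr ((i : ZMod k), Marker.op)] <+: α i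
  /-- the start of `α_i` if no block starts with the `i`-th factor -/
  start_late : ∀ i : ℕ, n + 1 < i + k → i ≤ n →
    (∃ a, [.inl a] <+: α i) ∨ α i = [.inr (((i + 1 : ℕ) : ZMod k), Marker.cl)] ∨
      (i < k ∧ α i = [])
  /-- adjacent markers are ordered by the linear order `i+1, i+2, …, i+k` of the residues,
  except before the parenthesis closing a block at the end of `α_i` -/
  order : ∀ i : ℕ, 1 ≤ i → i ≤ n → ∀ (j j' : ZMod k) (m m' : Marker S),
    [.inr (j, m), .inr (j', m')] <:+: α i → (j', m') ≠ (((i + 1 : ℕ) : ZMod k), Marker.cl) →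
      (j - ((i + 1 : ℕ) : ZMod k)).val ≤ (j' - ((i + 1 : ℕ) : ZMod k)).val

/-- Parsings for a (reverse) `k`-star: words `(α_1 # α_2 # ⋯ # α_n)` decorating a factorization with
`n ≥ k` factors, or words `(u_1 # u_2 # ⋯ u_n #)` for a factorization with `n < k` factors. -/
def kstar (k : ℕ) (L : Language A) (P : List A → Set (List (A ⊕ Marker S))) (w : List A) :
    Set (List (A ⊕ Marker (Unit ⊕ (ZMod k × Marker S)))) :=
  {γ | (∃ us : List (List A), us.length < k ∧ (∀ u ∈ us, u ∈ L) ∧ w = us.flatten ∧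
      γ = wrap (us.map fun u => u.map .inl ++ [.inr (.inl ())]).flatten) ∨
    ∃ (n : ℕ) (α : ℕ → List (A ⊕ (ZMod k × Marker S))), k ≤ n ∧
      (∀ i, 1 ≤ i → i ≤ n → proj (α i) ∈ L) ∧ w = proj (block α 0 n) ∧ IsLong P n α ∧
      γ = wrap (List.intercalate [.inr (.inl ())]
        ((List.range' 1 n).map fun i => (α i).map (Sum.map id .inr)))}

/-- The functional domain of a relation: the words with exactly one image. -/
def fdom {X Y : Type*} (P : X → Set Y) : Set X := {w | ∃ α, P w = {α}}

end Parsing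

/-- The parsing relation of `h`: `h.parse w` is the set of parsings of `w` with respect to `h`. -/
def RTE.parse {A B : Type*} : (h : RTE A B) → List A → Set (List h.Sym)
  | .base e _ => Parsing.base e.matches'
  | .sum f g => Parsing.sum f.parse g.parse
  | .cauchy f g => Parsing.cauchy f.parse g.parse
  | .rcauchy f g => Parsing.cauchy f.parse g.parse
  | .star f => Parsing.star f.parse
  | .rstar f => Parsing.star f.parse
  | .had f g => Parsing.had f.parse g.parse
  | .kstar k e f => Parsing.kstar k e.matches' f.parse
  | .krstar k e f => Parsing.kstar k e.matches' f.parse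

/-! ### One-way transducers -/

/-- One-way nondeterministic transducers (1NFT) with input alphabet `A`, output alphabet `B` and set
of states `Q`. A transition reads a letter or nothing (`none`), and produces a word, given by `out`
(whose values outside `trans` are irrelevant). -/
structure OneWayTransducer (A B Q : Type*) where
  init : Q
  final : Set Q
  trans : Set (Q × Option A × Q)
  out : Q × Option A × Q → List B

namespace OneWayTransducer

variable {A B Q : Type*} (T : OneWayTransducer A B Q)

/-- `T.Run p w y q`: there is a run from `p` to `q` that reads `w` and produces `y`. -/
inductive Run : Q → List A → List B → Q → Prop
  | nil (p : Q) : Run p [] [] p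
  | cons {p q r : Q} {x : Option A} {w : List A} {y : List B} :
      (p, x, q) ∈ T.trans → Run q w y r → Run p (x.toList ++ w) (T.out (p, x, q) ++ y) r

/-- The relation computed by the transducer. -/
def sem (w : List A) : Set (List B) := {y | ∃ q ∈ T.final, T.Run T.init w y q}

end OneWayTransducer

/-! ### Two-way transducers -/

/-- Tape symbols: letters and the two endmarkers. -/
inductive TapeSym (A : Type*) where
  | lend
  | sym (a : A)
  | rend

/-- Two-way nondeterministic transducers (2NFT). The states are partitioned into the forward states
`fwd` and the backward states, and the head is between two tape cells: a forward state reads the cell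
to its right, a backward state the cell to its left. The values of `out` outside `trans` are
irrelevant. -/
structure TwoWayTransducer (A B Q : Type*) where
  fwd : Set Q
  init : Q
  final : Set Q
  trans : Set (Q × TapeSym A × Q)
  out : Q × TapeSym A × Q → List B
  init_fwd : init ∈ fwd
  final_fwd : final ⊆ fwd
  /-- the initial state is the only forward state that reads the left endmarker -/
  eq_init : ∀ p q, (p, TapeSym.lend, q) ∈ trans → p ∈ fwd → p = init
  /-- the final states are the only forward states reached by reading the right endmarker -/
  mem_final : ∀ p q, (p, TapeSym.rend, q) ∈ trans → q ∈ fwd → q ∈ final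

namespace TwoWayTransducer

variable {A B Q : Type*} (T : TwoWayTransducer A B Q)

/-- One step from the configuration `u.p.u'` (word to the left of the head, state, word to the right)
producing an output word. -/
inductive Step : List (TapeSym A) × Q × List (TapeSym A) → List B →
    List (TapeSym A) × Q × List (TapeSym A) → Prop
  | ff {u v a p q} : p ∈ T.fwd → q ∈ T.fwd → (p, a, q) ∈ T.trans →
      Step (u, p, a :: v) (T.out (p, a, q)) (u ++ [a], q, v)
  | fb {u v a p q} : p ∈ T.fwd → q ∉ T.fwd → (p, a, q) ∈ T.trans →
      Step (u, p, a :: v) (T.out (p, a, q)) (u, q, a :: v)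
  | bf {u v a p q} : p ∉ T.fwd → q ∈ T.fwd → (p, a, q) ∈ T.trans →
      Step (u ++ [a], p, v) (T.out (p, a, q)) (u ++ [a], q, v)
  | bb {u v a p q} : p ∉ T.fwd → q ∉ T.fwd → (p, a, q) ∈ T.trans →
      Step (u ++ [a], p, v) (T.out (p, a, q)) (u, q, a :: v)

/-- Runs and their outputs. -/
inductive Run : List (TapeSym A) × Q × List (TapeSym A) → List B →
    List (TapeSym A) × Q × List (TapeSym A) → Prop
  | nil (c) : Run c [] c
  | cons {c d e x y} : T.Step c x d → Run d y e → Run c (x ++ y) e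

/-- The input word between the endmarkers. -/
def tape (w : List A) : List (TapeSym A) := [.lend] ++ w.map .sym ++ [.rend]

/-- The relation computed by the transducer: outputs of the accepting runs. -/
def sem (w : List A) : Set (List B) :=
  {y | ∃ q ∈ T.final, T.Run ([], T.init, tape w) y (tape w, q, [])}

/-- Reversible transducers (2RFT): deterministic and co-deterministic, with one final state. -/
structure IsReversible : Prop where
  det : ∀ p a q q', (p, a, q) ∈ T.trans → (p, a, q') ∈ T.trans → q = q'
  codet : ∀ p p' a q, (p, a, q) ∈ T.trans → (p', a, q) ∈ T.trans → p = p'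
  final_eq : ∃ q, T.final = {q}

end TwoWayTransducer

/-! A parsing records along the input word how this word is matched against `h`. The semantics of
`h` is thereby divided into guessing the record, which a one-way nondeterministic machine can do,
and evaluating it, which is deterministic and even reversible because the markers show the head
where to go. Everything is proved by induction on `h`.

Unique parsings. Parsings are words in parentheses, hence self-delimiting: from a parsing for a
product or a star one reads off the factorization and the parsings of the factors
(`wrap_map_append_inj`, `IsEncoding`). For a Hadamard product, the order condition selects one word
among all the shuffles of two parsings of the same input (`Ordered.eq`, `exists_ordered`). For a
`k`-star the blocks overlap, but the blocks that contain a given position start in a window of `k`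
consecutive positions, so their residues modulo `k` are distinct. The parsings of the blocks are cut
along the factors, the markers at a border going to its left, and the pieces at one position are
merged in the order of the residues. This merge exists and is unique (`exists_isBody`,
`IsBody.ext`), and the conditions of `IsLong` describe precisely these merges with the parentheses
restored (`IsBody.isLong`, `IsLong.exists_isBody`). The criteria for existence and uniqueness of a
parsing then have the same shape as the definitions of `dom` and `udom`.

Parser. It suffices to recognize the set of parsings by an automaton with at most one marker between
two states; the markers then become the outputs of silent transitions (`run_toTransducer`). Simple
expressions use the position automaton; sums, products and stars are small graphs with automata on
their edges (`accepts_graph`); the Hadamard product is a synchronized product. For a `k`-star, `k`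
copies of the automaton of the argument, each idle outside of its blocks, run next to an automaton
for the factors and a control of the order of the markers (`accepts_long_iff_exists`); short
factorizations have an automaton of their own. The outer parentheses are left out until the end, so
the induction bounds the number of states plus two (`exists_recognizes`).

Evaluator. The evaluator of an expression runs between its two parentheses, from just after the
opening one to just before the closing one, and has no transition that would clash with entering or
leaving in this way (`Ev.IsRev`). The evaluator of a subexpression ignores the foreign markers
(`Computes.comap`) and is called by a small control on its opening parenthesis (`Frame.IsRev.comp`).
Reverse operators are handled by moving the head back. For `k`-stars, the start or the end of the
adjacent block is found by its marker within the overlap, so the control remembers a residue and a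
phase only, and the residue is brought to a fixed value at the end so that no information is lost
(`run_rewind`, `run_count`). The `k` copies of the argument account for the width in the bound. Four
states serve the endmarkers, and the induction bounds the number of states plus four
(`exists_evaluates`). Since the resulting machine is deterministic, it has just one output on each
parsing. -/

set_option linter.unusedSectionVars false

namespace Parsing

/-! ### Words in parentheses and their projections. -/

section Words

variable {A : Type*} {M N S : Type}

@[simp] theorem proj_nil : proj ([] : List (A ⊕ M)) = [] := rfl

@[simp] theorem proj_inl (a : A) (α : List (A ⊕ M)) : proj (.inl a :: α) = a :: proj α := rfl

@[simp] theorem proj_inr (m : M) (α : List (A ⊕ M)) : proj (.inr m :: α) = proj α := rfl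

@[simp] theorem proj_append (α β : List (A ⊕ M)) : proj (α ++ β) = proj α ++ proj β :=
  List.filterMap_append

@[simp] theorem proj_map (f : M → N) (α : List (A ⊕ M)) : proj (α.map (Sum.map id f)) = proj α := by
  induction α with
  | nil => rfl
  | cons x α ih => rcases x with a | m <;> simp [ih]

@[simp] theorem proj_map_inl (w : List A) : proj (w.map (Sum.inl : A → A ⊕ M)) = w := by
  induction w with
  | nil => rfl
  | cons x α ih => simp [ih]

theorem proj_flatten (l : List (List (A ⊕ M))) : proj l.flatten = (l.map proj).flatten := by
  induction l with
  | nil => rfl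
  | cons x α ih => simp [ih]

@[simp] theorem proj_wrap (α : List (A ⊕ S)) : proj (wrap α) = proj α := by
  simp [wrap]

theorem map_sumMap_injective {f : M → N} (hf : Function.Injective f) :
    Function.Injective (List.map (Sum.map (id : A → A) f)) :=
  List.map_injective_iff.2 (Sum.map_injective.2 ⟨Function.injective_id, hf⟩)

theorem wrap_eq (α : List (A ⊕ S)) :
    wrap α = .inr .op :: (α.map (Sum.map id .sub) ++ [.inr .cl]) := rfl

theorem sub_injective : Function.Injective (Marker.sub : S → Marker S) := fun _ _ h => by
  injection h

theorem wrap_injective : Function.Injective (wrap : List (A ⊕ S) → List (A ⊕ Marker S)) := by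
  intro α β h
  simp only [wrap_eq, List.cons.injEq, true_and] at h
  exact map_sumMap_injective sub_injective (List.append_cancel_right h)

@[simp] theorem wrap_inj {α β : List (A ⊕ S)} : wrap α = wrap β ↔ α = β := wrap_injective.eq_iff

theorem op_notMem_map_sub (α : List (A ⊕ S)) :
    (.inr .op : A ⊕ Marker S) ∉ α.map (Sum.map id .sub) := by
  rintro h
  obtain ⟨x | x, _, h⟩ := List.mem_map.1 h <;> simp at h

theorem cl_notMem_map_sub (α : List (A ⊕ S)) :
    (.inr .cl : A ⊕ Marker S) ∉ α.map (Sum.map id .sub) := by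
  rintro h
  obtain ⟨x | x, _, h⟩ := List.mem_map.1 h <;> simp at h

theorem notMem_map_sumMap {f : M → N} {n : N} (hn : ∀ m, f m ≠ n) (α : List (A ⊕ M)) :
    (.inr n : A ⊕ N) ∉ α.map (Sum.map id f) := by
  rintro h
  obtain ⟨x | x, _, h⟩ := List.mem_map.1 h
  · simp at h
  · simp at h
    exact hn _ h

/-- On both sides the displayed `c` is the first one in the word, so both factorizations cut at the
same place. Decoding by parentheses and by separators rests on this. -/
theorem append_cons_inj {X : Type*} {c : X} {p p' q q' : List X} (hp : c ∉ p) (hp' : c ∉ p')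
    (h : p ++ c :: q = p' ++ c :: q') : p = p' ∧ q = q' := by
  induction p generalizing p' with
  | nil =>
    cases p' with
    | nil => exact ⟨rfl, (List.cons.inj h).2⟩
    | cons x p' => exact absurd (List.mem_cons.2 (.inl (List.cons.inj h).1)) hp'
  | cons x p ih =>
    cases p' with
    | nil => exact absurd (List.mem_cons.2 (.inl (List.cons.inj h).1.symm)) hp
    | cons y p' =>
      simp only [List.mem_cons, not_or, List.cons_append, List.cons.injEq] at hp hp' h ⊢
      exact ⟨⟨h.1, (ih hp.2 hp'.2 h.2).1⟩, (ih hp.2 hp'.2 h.2).2⟩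

/-- A word in parentheses is determined by any longer word of which it is a prefix, up to an
injective relabelling of the markers. -/
theorem wrap_map_append_inj {f : Marker S → N} (hf : Function.Injective f) {α β : List (A ⊕ S)}
    {x y : List (A ⊕ N)}
    (h : (wrap α).map (Sum.map id f) ++ x = (wrap β).map (Sum.map id f) ++ y) : α = β ∧ x = y := by
  simp only [wrap_eq, List.map_cons, List.map_append, List.cons_append, List.append_assoc,
    List.map_nil, List.cons.injEq, true_and, List.nil_append, List.map_map] at h
  -- Injectivity of `f` keeps the image of `.cl` out of the relabelled body, so this image marks the
  -- end of the word.
  have key : ∀ γ : List (A ⊕ S), Sum.map id f (.inr Marker.cl) ∉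
      γ.map (Sum.map id f ∘ Sum.map id Marker.sub) := by
    rintro γ h
    obtain ⟨x | x, _, h⟩ := List.mem_map.1 h
    · simp at h
    · simp at h
      exact absurd (hf h) (by simp)
  replace h := append_cons_inj (key α) (key β) h
  refine ⟨?_, h.2⟩
  have := h.1
  rw [← List.map_map, ← List.map_map] at this
  exact map_sumMap_injective sub_injective (map_sumMap_injective hf this)

theorem wrap_append_inj {α β : List (A ⊕ S)} {x y : List (A ⊕ Marker S)}
    (h : wrap α ++ x = wrap β ++ y) : α = β ∧ x = y := by
  apply wrap_map_append_inj (f := id) Function.injective_id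
  simpa using h

/-- Each word in parentheses ends at its first closing parenthesis, so the list is read back one
word at a time. -/
theorem flatten_map_wrap_injective :
    Function.Injective fun l : List (List (A ⊕ S)) => (l.map wrap).flatten := by
  intro l
  induction l with
  | nil =>
    intro l' h
    cases l' with
    | nil => rfl
    | cons y l' => simp [wrap] at h
  | cons x l ih =>
    intro l' h
    cases l' with
    | nil => simp [wrap] at h
    | cons y l' =>
      simp only [List.map_cons, List.flatten_cons] at h
      obtain ⟨rfl, h'⟩ := wrap_append_inj h
      rw [@ih l' h']

/-- A relation all of whose values on `w` are words in parentheses that project to `w`. -/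
def IsParsing (P : List A → Set (List (A ⊕ Marker S))) : Prop :=
  ∀ ⦃w α⦄, α ∈ P w → ∃ β, α = wrap β ∧ proj β = w

theorem IsParsing.proj_eq {P : List A → Set (List (A ⊕ Marker S))} (hP : IsParsing P) {w α}
    (h : α ∈ P w) : proj α = w := by
  obtain ⟨β, rfl, h⟩ := hP h
  simpa

theorem mem_fdom {X Y : Type*} {P : X → Set Y} {x : X} : x ∈ fdom P ↔ ∃! y, y ∈ P x := by
  simp only [fdom, Set.mem_ofPred_eq, ExistsUnique, Set.eq_singleton_iff_unique_mem]

theorem nonempty_of_mem_fdom {X Y : Type*} {P : X → Set Y} {x : X} (h : x ∈ fdom P) :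
    (P x).Nonempty := by
  obtain ⟨y, h⟩ := h
  simp [h]

end Words

/-! ### Parsings for simple expressions. -/

section Base

variable {A : Type*} {S : Type}

theorem isParsing_base (L : Language A) : IsParsing (base L : _ → Set (List (A ⊕ Marker S))) := by
  rintro w α ⟨-, rfl⟩
  exact ⟨_, rfl, by simp⟩

theorem base_nonempty {L : Language A} {w} :
    (base L w : Set (List (A ⊕ Marker S))).Nonempty ↔ w ∈ L :=
  ⟨fun ⟨_, h, _⟩ => h, fun h => ⟨_, h, rfl⟩⟩

theorem fdom_base (L : Language A) : fdom (base L : _ → Set (List (A ⊕ Marker S))) = L := by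
  ext w
  refine ⟨fun h => base_nonempty.1 (nonempty_of_mem_fdom h), fun h => mem_fdom.2
    ⟨_, ⟨h, rfl⟩, fun y hy => hy.2⟩⟩

end Base

/-! ### Parsings for sums and Cauchy products. -/

section Binary

variable {A : Type*} {M N : Type} {P : List A → Set (List (A ⊕ Marker M))}
  {Q : List A → Set (List (A ⊕ Marker N))}

theorem IsParsing.sum (hP : IsParsing P) (hQ : IsParsing Q) : IsParsing (sum P Q) := by
  rintro w _ (⟨α, h, rfl⟩ | ⟨α, h, rfl⟩)
  · exact ⟨_, rfl, by simpa using hP.proj_eq h⟩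
  · exact ⟨_, rfl, by simpa using hQ.proj_eq h⟩

theorem sum_nonempty {w} : (sum P Q w).Nonempty ↔ (P w).Nonempty ∨ (Q w).Nonempty := by
  constructor
  · rintro ⟨_, ⟨α, h, rfl⟩ | ⟨α, h, rfl⟩⟩
    · exact .inl ⟨_, h⟩
    · exact .inr ⟨_, h⟩
  · rintro (⟨α, h⟩ | ⟨α, h⟩)
    · exact ⟨_, .inl ⟨_, h, rfl⟩⟩
    · exact ⟨_, .inr ⟨_, h, rfl⟩⟩

theorem map_inl_wrap_ne_map_inr_wrap (α : List (A ⊕ M)) (β : List (A ⊕ N)) :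
    (wrap α).map (Sum.map id (Sum.inl : _ → Marker M ⊕ Marker N)) ≠
      (wrap β).map (Sum.map id (Sum.inr : _ → Marker M ⊕ Marker N)) := by
  simp [wrap_eq]

/-- Parsings from the two sides carry different parentheses and never coincide. A disjoint union has
one element when one part has one element and the other is empty. -/
theorem mem_fdom_sum (hP : IsParsing P) (hQ : IsParsing Q) {w} : w ∈ fdom (sum P Q) ↔
    (w ∈ fdom P ∧ ¬ (Q w).Nonempty) ∨ (w ∈ fdom Q ∧ ¬ (P w).Nonempty) := by
  simp only [mem_fdom]
  constructor
  · rintro ⟨_, ⟨α, h, rfl⟩ | ⟨α, h, rfl⟩, hu⟩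
    · refine .inl ⟨⟨α, h, fun α' h' => ?_⟩, ?_⟩
      · have := hu _ (.inl ⟨_, h', rfl⟩)
        exact map_sumMap_injective Sum.inl_injective (wrap_inj.1 this)
      · rintro ⟨β, h'⟩
        have := wrap_inj.1 (hu _ (.inr ⟨_, h', rfl⟩))
        obtain ⟨α', rfl, -⟩ := hP h
        obtain ⟨β', rfl, -⟩ := hQ h'
        exact map_inl_wrap_ne_map_inr_wrap _ _ this.symm
    · refine .inr ⟨⟨α, h, fun α' h' => ?_⟩, ?_⟩
      · have := hu _ (.inr ⟨_, h', rfl⟩)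
        exact map_sumMap_injective Sum.inr_injective (wrap_inj.1 this)
      · rintro ⟨β, h'⟩
        have := wrap_inj.1 (hu _ (.inl ⟨_, h', rfl⟩))
        obtain ⟨α', rfl, -⟩ := hQ h
        obtain ⟨β', rfl, -⟩ := hP h'
        exact map_inl_wrap_ne_map_inr_wrap _ _ this
  · rintro (⟨⟨α, h, hu⟩, hn⟩ | ⟨⟨α, h, hu⟩, hn⟩)
    · refine ⟨_, .inl ⟨α, h, rfl⟩, ?_⟩
      rintro _ (⟨α', h', rfl⟩ | ⟨α', h', rfl⟩)
      · rw [hu _ h']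
      · exact absurd ⟨_, h'⟩ hn
    · refine ⟨_, .inr ⟨α, h, rfl⟩, ?_⟩
      rintro _ (⟨α', h', rfl⟩ | ⟨α', h', rfl⟩)
      · exact absurd ⟨_, h'⟩ hn
      · rw [hu _ h']

theorem IsParsing.cauchy (hP : IsParsing P) (hQ : IsParsing Q) : IsParsing (cauchy P Q) := by
  rintro _ _ ⟨u, v, rfl, α, hα, β, hβ, rfl⟩
  exact ⟨_, rfl, by simp [hP.proj_eq hα, hQ.proj_eq hβ]⟩

theorem cauchy_nonempty {w} : (cauchy P Q w).Nonempty ↔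
    ∃ u v, w = u ++ v ∧ (P u).Nonempty ∧ (Q v).Nonempty := by
  constructor
  · rintro ⟨_, u, v, rfl, α, hα, β, hβ, rfl⟩
    exact ⟨u, v, rfl, ⟨_, hα⟩, ⟨_, hβ⟩⟩
  · rintro ⟨u, v, rfl, ⟨α, hα⟩, ⟨β, hβ⟩⟩
    exact ⟨_, u, v, rfl, α, hα, β, hβ, rfl⟩

theorem mem_fdom_cauchy (hP : IsParsing P) (hQ : IsParsing Q) {w} : w ∈ fdom (cauchy P Q) ↔
    ∃ u v, w = u ++ v ∧ u ∈ fdom P ∧ v ∈ fdom Q ∧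
      ∀ u' v', w = u' ++ v' → (P u').Nonempty → (Q v').Nonempty → u' = u ∧ v' = v := by
  -- The closing parenthesis of the first factor shows where the second one begins, so both parsings
  -- are recovered; the factorization follows by projecting them.
  have key : ∀ {u v u' v' : List A} {α β α' β'}, α ∈ P u → β ∈ Q v → α' ∈ P u' → β' ∈ Q v' →
      wrap (α.map (Sum.map id Sum.inl) ++ β.map (Sum.map id Sum.inr)) =
        wrap (α'.map (Sum.map id Sum.inl) ++ β'.map (Sum.map id Sum.inr)) → α = α' ∧ β = β' := by
    intro u v u' v' α β α' β' hα hβ hα' hβ' h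
    obtain ⟨γ, rfl, -⟩ := hP hα
    obtain ⟨γ', rfl, -⟩ := hP hα'
    obtain ⟨rfl, h'⟩ := wrap_map_append_inj Sum.inl_injective (wrap_inj.1 h)
    exact ⟨rfl, map_sumMap_injective Sum.inr_injective h'⟩
  constructor
  · intro h
    obtain ⟨_, ⟨u, v, rfl, α, hα, β, hβ, rfl⟩, hu⟩ := mem_fdom.1 h
    refine ⟨u, v, rfl, mem_fdom.2 ⟨α, hα, fun α' hα' => ?_⟩, mem_fdom.2 ⟨β, hβ, fun β' hβ' => ?_⟩,
      fun u' v' h ⟨α', hα'⟩ ⟨β', hβ'⟩ => ?_⟩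
    · exact (key hα' hβ hα hβ (hu _ ⟨u, v, rfl, α', hα', β, hβ, rfl⟩)).1
    · exact (key hα hβ' hα hβ (hu _ ⟨u, v, rfl, α, hα, β', hβ', rfl⟩)).2
    · obtain ⟨rfl, rfl⟩ := key hα' hβ' hα hβ (hu _ ⟨u', v', h, α', hα', β', hβ', rfl⟩)
      exact ⟨(hP.proj_eq hα').symm.trans (hP.proj_eq hα),
        (hQ.proj_eq hβ').symm.trans (hQ.proj_eq hβ)⟩
  · rintro ⟨u, v, rfl, hu, hv, h⟩
    obtain ⟨α, hα, hα'⟩ := mem_fdom.1 hu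
    obtain ⟨β, hβ, hβ'⟩ := mem_fdom.1 hv
    refine mem_fdom.2 ⟨_, ⟨u, v, rfl, α, hα, β, hβ, rfl⟩, ?_⟩
    rintro _ ⟨u', v', e, α', h1, β', h2, rfl⟩
    obtain ⟨rfl, rfl⟩ := h _ _ e ⟨_, h1⟩ ⟨_, h2⟩
    rw [hα' _ h1, hβ' _ h2]

end Binary

/-! ### Sets encoded by a factorization and a choice for each of its blocks. -/

section Factorizations

theorem forall₂_mem_exists {X Y : Type*} {P : X → Set Y} {l : List X} :
    (∃ ys, List.Forall₂ (fun x y => y ∈ P x) l ys) ↔ ∀ x ∈ l, (P x).Nonempty := by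
  induction l with
  | nil => simp
  | cons x l ih =>
    rw [List.forall_mem_cons, ← ih]
    constructor
    · rintro ⟨_, h⟩
      cases h with | cons h h' => exact ⟨⟨_, h⟩, _, h'⟩
    · rintro ⟨⟨y, h⟩, ys, h'⟩
      exact ⟨_, .cons h h'⟩

/-- The entries are chosen independently: replacing a single entry of the unique list shows that
this entry had no alternative. -/
theorem forall₂_mem_existsUnique {X Y : Type*} {P : X → Set Y} {l : List X} :
    (∃! ys, List.Forall₂ (fun x y => y ∈ P x) l ys) ↔ ∀ x ∈ l, x ∈ fdom P := by
  induction l with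
  | nil => simp
  | cons x l ih =>
    rw [List.forall_mem_cons, ← ih, mem_fdom]
    constructor
    · rintro ⟨_, h, hu⟩
      cases h with | cons h h' =>
      refine ⟨⟨_, h, fun y hy => ?_⟩, _, h', fun ys hys => ?_⟩
      · exact (List.cons.inj (hu _ (.cons hy h'))).1
      · exact (List.cons.inj (hu _ (.cons h hys))).2
    · rintro ⟨⟨y, h, hu⟩, ys, h', hu'⟩
      refine ⟨_, .cons h h', ?_⟩
      rintro _ (_ | ⟨h1, h2⟩)
      rw [hu _ h1, hu' _ h2]

/-- A set of words is encoded by pairs of a factorization and a list of parsings of its blocks. -/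
structure IsEncoding {U X Y Z : Type*} (G : Set Z) (Φ : U → Prop) (bl : U → List X)
    (P : X → Set Y) (enc : U → List Y → Z → Prop) : Prop where
  mem_iff : ∀ z, z ∈ G ↔ ∃ us ys, Φ us ∧ List.Forall₂ (fun x y => y ∈ P x) (bl us) ys ∧ enc us ys z
  exists_enc : ∀ us ys, Φ us → List.Forall₂ (fun x y => y ∈ P x) (bl us) ys → ∃ z, enc us ys z
  enc_unique : ∀ {us ys z z'}, Φ us → List.Forall₂ (fun x y => y ∈ P x) (bl us) ys →
    enc us ys z → enc us ys z' → z = z'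
  decode : ∀ {us ys us' ys' z}, Φ us → List.Forall₂ (fun x y => y ∈ P x) (bl us) ys → Φ us' →
    List.Forall₂ (fun x y => y ∈ P x) (bl us') ys' → enc us ys z → enc us' ys' z →
    us = us' ∧ ys = ys'

namespace IsEncoding

variable {U X Y Z : Type*} {G : Set Z} {Φ : U → Prop} {bl : U → List X} {P : X → Set Y}
  {enc : U → List Y → Z → Prop}

theorem nonempty_iff (h : IsEncoding G Φ bl P enc) :
    G.Nonempty ↔ ∃ us, Φ us ∧ ∀ b ∈ bl us, (P b).Nonempty := by
  simp only [← forall₂_mem_exists]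
  constructor
  · rintro ⟨z, hz⟩
    obtain ⟨us, ys, h1, h2, -⟩ := (h.mem_iff z).1 hz
    exact ⟨us, h1, ys, h2⟩
  · rintro ⟨us, h1, ys, h2⟩
    obtain ⟨z, hz⟩ := h.exists_enc _ _ h1 h2
    exact ⟨z, (h.mem_iff z).2 ⟨_, _, h1, h2, hz⟩⟩

/-- Encoding is in effect a bijection between `G` and the pairs of a factorization and parsings of
its blocks. Such a pair is unique when only one factorization has all its blocks parsable and each
of these blocks has one parsing. -/
theorem existsUnique_iff (h : IsEncoding G Φ bl P enc) :
    (∃! z, z ∈ G) ↔ ∃ us, Φ us ∧ (∀ b ∈ bl us, b ∈ fdom P) ∧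
      ∀ us', Φ us' → (∀ b ∈ bl us', (P b).Nonempty) → us' = us := by
  simp only [← forall₂_mem_exists, ← forall₂_mem_existsUnique]
  constructor
  · rintro ⟨z, hz, hu⟩
    obtain ⟨us, ys, h1, h2, h3⟩ := (h.mem_iff z).1 hz
    have key : ∀ us' ys', Φ us' → List.Forall₂ (fun x y => y ∈ P x) (bl us') ys' →
        us' = us ∧ ys' = ys := by
      intro us' ys' h1' h2'
      obtain ⟨z', hz'⟩ := h.exists_enc _ _ h1' h2'
      obtain rfl := hu z' ((h.mem_iff z').2 ⟨_, _, h1', h2', hz'⟩)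
      exact h.decode h1' h2' h1 h2 hz' h3
    exact ⟨us, h1, ⟨ys, h2, fun ys' h' => (key _ _ h1 h').2⟩,
      fun us' h1' ⟨ys', h2'⟩ => (key _ _ h1' h2').1⟩
  · rintro ⟨us, h1, ⟨ys, h2, h3⟩, h4⟩
    obtain ⟨z, hz⟩ := h.exists_enc _ _ h1 h2
    refine ⟨z, (h.mem_iff z).2 ⟨_, _, h1, h2, hz⟩, fun z' hz' => ?_⟩
    obtain ⟨us', ys', h1', h2', h3'⟩ := (h.mem_iff z').1 hz'
    obtain rfl := h4 _ h1' ⟨_, h2'⟩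
    obtain rfl := h3 _ h2'
    exact h.enc_unique h1 h2 h3' hz

end IsEncoding

end Factorizations

/-! ### Parsings for stars. -/

section Star

variable {A : Type*} {M : Type} {P : List A → Set (List (A ⊕ Marker M))}

theorem IsParsing.star (hP : IsParsing P) : IsParsing (star P) := by
  rintro _ _ ⟨xs, h, rfl, rfl⟩
  refine ⟨_, rfl, ?_⟩
  rw [proj_flatten, List.map_map]
  exact congrArg _ (List.map_congr_left fun x hx => hP.proj_eq (h x hx))

theorem mem_star_iff {w γ} : γ ∈ star P w ↔ ∃ us ys, w = us.flatten ∧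
    List.Forall₂ (fun x y => y ∈ P x) us ys ∧ γ = wrap ys.flatten := by
  constructor
  · rintro ⟨xs, h, rfl, rfl⟩
    refine ⟨_, _, rfl, ?_, rfl⟩
    rw [List.forall₂_map_left_iff, List.forall₂_map_right_iff]
    exact List.forall₂_same.2 h
  · rintro ⟨us, ys, rfl, h, rfl⟩
    refine ⟨us.zip ys, fun x hx => ?_, ?_, ?_⟩
    · exact List.forall₂_zip h hx
    · rw [List.map_fst_zip h.length_eq.le]
    · rw [List.map_snd_zip h.length_eq.ge]

theorem forall₂_eq_map_wrap (hP : IsParsing P) {us ys}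
    (h : List.Forall₂ (fun x y => y ∈ P x) us ys) : ∃ zs : List (List (A ⊕ M)), ys = zs.map wrap ∧
      us = zs.map proj := by
  induction h with
  | nil => exact ⟨[], rfl, rfl⟩
  | cons h _ ih =>
    obtain ⟨zs, rfl, rfl⟩ := ih
    obtain ⟨z, rfl, rfl⟩ := hP h
    exact ⟨z :: zs, rfl, rfl⟩

/-- Only the decoding is not formal: the parsings are cut out by their parentheses, and the
factorization is the list of their projections. -/
theorem isEncoding_star (hP : IsParsing P) (w : List A) : IsEncoding (star P w)
    (fun us : List (List A) => w = us.flatten) id P (fun _ ys γ => γ = wrap ys.flatten) where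
  mem_iff _ := mem_star_iff
  exists_enc _ _ _ _ := ⟨_, rfl⟩
  enc_unique _ _ h h' := h.trans h'.symm
  decode {us ys us' ys' z} _ h1 _ h2 h h' := by
    obtain ⟨zs, rfl, e1⟩ := forall₂_eq_map_wrap hP h1
    obtain ⟨zs', rfl, e2⟩ := forall₂_eq_map_wrap hP h2
    have := flatten_map_wrap_injective (wrap_inj.1 (h.symm.trans h'))
    subst this
    exact ⟨e1.trans e2.symm, rfl⟩

end Star

/-! ### Parsings for Hadamard products. -/

section Hadamard

variable {A : Type*} {M N : Type}

@[simp] theorem restrictLeft_nil : restrictLeft ([] : List (A ⊕ (M ⊕ N))) = [] := rfl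
@[simp] theorem restrictLeft_inl (a) (α : List (A ⊕ (M ⊕ N))) :
    restrictLeft (.inl a :: α) = .inl a :: restrictLeft α := rfl
@[simp] theorem restrictLeft_inr_inl (m) (α : List (A ⊕ (M ⊕ N))) :
    restrictLeft (.inr (.inl m) :: α) = .inr m :: restrictLeft α := rfl
@[simp] theorem restrictLeft_inr_inr (n) (α : List (A ⊕ (M ⊕ N))) :
    restrictLeft (.inr (.inr n) :: α) = restrictLeft α := rfl
@[simp] theorem restrictRight_nil : restrictRight ([] : List (A ⊕ (M ⊕ N))) = [] := rfl
@[simp] theorem restrictRight_inl (a) (α : List (A ⊕ (M ⊕ N))) :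
    restrictRight (.inl a :: α) = .inl a :: restrictRight α := rfl
@[simp] theorem restrictRight_inr_inl (m) (α : List (A ⊕ (M ⊕ N))) :
    restrictRight (.inr (.inl m) :: α) = restrictRight α := rfl
@[simp] theorem restrictRight_inr_inr (n) (α : List (A ⊕ (M ⊕ N))) :
    restrictRight (.inr (.inr n) :: α) = .inr n :: restrictRight α := rfl

theorem proj_restrictLeft (α : List (A ⊕ (M ⊕ N))) : proj (restrictLeft α) = proj α := by
  induction α with
  | nil => rfl
  | cons x α ih => rcases x with a | m | n <;> simp [ih]

theorem proj_restrictRight (α : List (A ⊕ (M ⊕ N))) : proj (restrictRight α) = proj α := by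
  induction α with
  | nil => rfl
  | cons x α ih => rcases x with a | m | n <;> simp [ih]

/-- No marker of the second kind is immediately followed by a marker of the first kind, and the word
does not start with a marker of the first kind if `b`. -/
def Ordered : Bool → List (A ⊕ (M ⊕ N)) → Prop
  | _, [] => True
  | _, .inl _ :: α => Ordered false α
  | b, .inr (.inl _) :: α => b = false ∧ Ordered false α
  | _, .inr (.inr _) :: α => Ordered true α

theorem infix_cons_iff {X : Type*} {x y z : X} {l : List X} :
    [x, y] <:+: z :: l ↔ (z = x ∧ ∃ l', l = y :: l') ∨ [x, y] <:+: l := by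
  rw [List.infix_cons_iff]
  constructor
  · rintro (h | h)
    · rw [List.cons_prefix_cons] at h
      obtain ⟨rfl, t, ht⟩ := h
      exact .inl ⟨rfl, t, ht.symm⟩
    · exact .inr h
  · rintro (⟨rfl, l', rfl⟩ | h)
    · exact .inl ⟨l', rfl⟩
    · exact .inr h

/-- The flag remembers one symbol to the left, which turns a condition on adjacent pairs into a
structural recursion. -/
theorem ordered_iff (b) (α : List (A ⊕ (M ⊕ N))) : Ordered b α ↔
    (b = true → ∀ m α', α ≠ .inr (.inl m) :: α') ∧
      ∀ n m, ¬ [.inr (.inr n), .inr (.inl m)] <:+: α := by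
  induction α generalizing b with
  | nil => simp [Ordered]
  | cons x α ih =>
    rcases x with a | m | n
    · simp [Ordered, ih, infix_cons_iff]
    · simp [Ordered, ih, infix_cons_iff]
    · simp only [Ordered, ih, infix_cons_iff]
      constructor
      · rintro ⟨h1, h2⟩
        refine ⟨by simp, fun n' m => ?_⟩
        rintro (⟨-, α', rfl⟩ | h)
        · exact h1 trivial _ _ rfl
        · exact h2 _ _ h
      · rintro ⟨-, h⟩
        refine ⟨?_, fun n m h' => h n m (.inr h')⟩
        rintro - m α' rfl
        exact h n m (.inl ⟨rfl, _, rfl⟩)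

/-- Between two letters, the markers of the first kind come before those of the second, so the two
restrictions determine the word symbol by symbol. The only conflict would be two words starting with
markers of different kinds. -/
theorem Ordered.eq {b} {α β : List (A ⊕ (M ⊕ N))} (hα : Ordered b α) (hβ : Ordered b β)
    (h1 : restrictLeft α = restrictLeft β) (h2 : restrictRight α = restrictRight β) : α = β := by
  -- After a marker of the second kind, no marker of the first kind comes before the next letter, so
  -- the left restriction cannot start with a marker.
  have key : ∀ (n : N) (m : M) (γ δ : List (A ⊕ (M ⊕ N))), Ordered true δ →
      .inr m :: restrictLeft γ ≠ restrictLeft δ := by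
    intro n m γ δ hδ h
    induction δ with
    | nil => simp at h
    | cons x δ ih => rcases x with a | m | n <;> simp_all [Ordered]
  induction α generalizing b β with
  | nil =>
    rcases β with _ | ⟨x, β⟩
    · rfl
    · rcases x with a | m | n <;> simp at h1 h2
  | cons x α ih =>
    rcases β with _ | ⟨y, β⟩
    · rcases x with a | m | n <;> simp at h1 h2
    rcases x with a | m | n <;> rcases y with a' | m' | n' <;> simp [Ordered] at hα hβ h1 h2 ⊢
    · exact ⟨h1.1, ih hα hβ h1.2 h2.2⟩
    · exact ⟨h1.1, ih hα.2 hβ.2 h1.2 h2⟩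
    · exact key n' _ _ _ hβ h1
    · exact key n _ _ _ hα h1.symm
    · exact ⟨h2.1, ih hα hβ h1 h2.2⟩

/-- The merge is greedy: the markers of `x` at once, then those of `y`, and a letter when both words
start with it. If `b` is set, a marker of the second kind has just been written, so `x` must not
start with a marker. -/
theorem exists_ordered (x : List (A ⊕ M)) : ∀ (y : List (A ⊕ N)) (b : Bool),
    (b = true → ∀ m x', x ≠ .inr m :: x') → proj x = proj y → ∃ α : List (A ⊕ (M ⊕ N)),
      Ordered b α ∧ restrictLeft α = x ∧ restrictRight α = y := by
  induction x with
  | nil =>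
    intro y
    induction y with
    | nil => exact fun _ _ _ => ⟨[], trivial, rfl, rfl⟩
    | cons s y ih =>
      intro b hb h
      rcases s with a | n
      · simp at h
      · obtain ⟨α, h1, h2, h3⟩ := ih true (by simp) (by simpa using h)
        exact ⟨.inr (.inr n) :: α, h1, by simp [h2], by simp [h3]⟩
  | cons s x ihx =>
    rcases s with a | m
    · intro y
      induction y with
      | nil => intro b _ h; simp at h
      | cons s y ih =>
        intro b hb h
        rcases s with a' | n
        · simp only [proj_inl, List.cons.injEq] at h
          obtain ⟨rfl, h⟩ := h
          obtain ⟨α, h1, h2, h3⟩ := ihx y false (by simp) h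
          exact ⟨.inl a :: α, h1, by simp [h2], by simp [h3]⟩
        · obtain ⟨α, h1, h2, h3⟩ := ih true (by simp) (by simpa using h)
          exact ⟨.inr (.inr n) :: α, h1, by simp [h2], by simp [h3]⟩
    · intro y b hb h
      obtain ⟨α, h1, h2, h3⟩ := ihx y false (by simp) (by simpa using h)
      refine ⟨.inr (.inl m) :: α, ⟨?_, h1⟩, by simp [h2], by simp [h3]⟩
      cases b
      · rfl
      · exact absurd rfl (hb rfl _ _)

variable {P : List A → Set (List (A ⊕ Marker M))} {Q : List A → Set (List (A ⊕ Marker N))}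

theorem mem_had_iff {w γ} : γ ∈ had P Q w ↔ ∃ α, γ = wrap α ∧ restrictLeft α ∈ P w ∧
    restrictRight α ∈ Q w ∧ Ordered false α := by
  simp [had, ordered_iff]

theorem IsParsing.had (hP : IsParsing P) : IsParsing (had P Q) := by
  rintro w _ ⟨α, rfl, h, -⟩
  exact ⟨_, rfl, by rw [← proj_restrictLeft]; exact hP.proj_eq h⟩

theorem exists_had (hP : IsParsing P) (hQ : IsParsing Q) {w x y} (hx : x ∈ P w) (hy : y ∈ Q w) :
    ∃ α, wrap α ∈ had P Q w ∧ restrictLeft α = x ∧ restrictRight α = y := by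
  obtain ⟨α, h1, h2, h3⟩ := exists_ordered x y false (by simp)
    ((hP.proj_eq hx).trans (hQ.proj_eq hy).symm)
  exact ⟨α, mem_had_iff.2 ⟨α, rfl, h2 ▸ hx, h3 ▸ hy, h1⟩, h2, h3⟩

theorem had_nonempty (hP : IsParsing P) (hQ : IsParsing Q) {w} :
    (had P Q w).Nonempty ↔ (P w).Nonempty ∧ (Q w).Nonempty := by
  constructor
  · rintro ⟨_, α, rfl, h1, h2, -⟩
    exact ⟨⟨_, h1⟩, ⟨_, h2⟩⟩
  · rintro ⟨⟨x, hx⟩, ⟨y, hy⟩⟩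
    obtain ⟨α, h, -⟩ := exists_had hP hQ hx hy
    exact ⟨_, h⟩

/-- By the merge, parsings correspond to pairs of parsings of the same word, and a product of two
sets has one element when both factors do. -/
theorem mem_fdom_had (hP : IsParsing P) (hQ : IsParsing Q) {w} :
    w ∈ fdom (had P Q) ↔ w ∈ fdom P ∧ w ∈ fdom Q := by
  simp only [mem_fdom]
  constructor
  · rintro ⟨γ, hγ, hu⟩
    obtain ⟨α, rfl, hx, hy, -⟩ := mem_had_iff.1 hγ
    refine ⟨⟨_, hx, fun x hx' => ?_⟩, ⟨_, hy, fun y hy' => ?_⟩⟩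
    · obtain ⟨α', h1, h2, h3⟩ := exists_had hP hQ hx' hy
      rw [← h2, wrap_inj.1 (hu _ h1)]
    · obtain ⟨α', h1, h2, h3⟩ := exists_had hP hQ hx hy'
      rw [← h3, wrap_inj.1 (hu _ h1)]
  · rintro ⟨⟨x, hx, hux⟩, ⟨y, hy, huy⟩⟩
    obtain ⟨α, h1, h2, h3⟩ := exists_had hP hQ hx hy
    refine ⟨_, h1, fun γ hγ => ?_⟩
    obtain ⟨α', rfl, hx', hy', ho'⟩ := mem_had_iff.1 hγ
    obtain ⟨α'', e, -, -, ho⟩ := mem_had_iff.1 h1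
    obtain rfl := wrap_inj.1 e
    rw [ho'.eq ho ((hux _ hx').trans h2.symm) ((huy _ hy').trans h3.symm)]

end Hadamard

end Parsing

namespace Parsing

/-! ### Residues as indices, and projections on one index. -/

section KStarBasics

variable {A : Type*} {M S : Type} {k : ℕ}

/-- Among `k` consecutive integers no residue occurs twice. Hence residues suffice to name the
blocks that contain a given position, whose starts lie in a window of length `k`. -/
theorem natCast_inj_of_lt {a b : ℕ} (h : a ≤ b) (h' : b < a + k) (e : (a : ZMod k) = b) :
    a = b := by
  rw [ZMod.natCast_eq_natCast_iff, Nat.modEq_iff_dvd' h] at e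
  have := Nat.eq_zero_of_dvd_of_lt e (by omega)
  omega

@[simp] theorem select_nil (j : ZMod k) : select j ([] : List (A ⊕ (ZMod k × M))) = [] := rfl

@[simp] theorem select_inl (j : ZMod k) (a) (α : List (A ⊕ (ZMod k × M))) :
    select j (.inl a :: α) = .inl a :: select j α := rfl

theorem select_inr (j l : ZMod k) (m) (α : List (A ⊕ (ZMod k × M))) :
    select j (.inr (l, m) :: α) = if l = j then .inr m :: select j α else select j α := by
  simp only [select, List.filterMap_cons]
  split_ifs <;> rfl

@[simp] theorem select_inr_self (j : ZMod k) (m) (α : List (A ⊕ (ZMod k × M))) :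
    select j (.inr (j, m) :: α) = .inr m :: select j α := by
  simp [select_inr]

theorem select_inr_of_ne {j l : ZMod k} (h : l ≠ j) (m) (α : List (A ⊕ (ZMod k × M))) :
    select j (.inr (l, m) :: α) = select j α := by
  simp [select_inr, h]

@[simp] theorem select_append (j : ZMod k) (α β : List (A ⊕ (ZMod k × M))) :
    select j (α ++ β) = select j α ++ select j β := List.filterMap_append

@[simp] theorem proj_select (j : ZMod k) (α : List (A ⊕ (ZMod k × M))) :
    proj (select j α) = proj α := by
  induction α with
  | nil => rfl
  | cons x α ih =>
    rcases x with a | ⟨l, m⟩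
    · simp [ih]
    · rw [select_inr]
      split_ifs <;> simp [ih]

theorem inr_mem_select {j : ZMod k} {m} {α : List (A ⊕ (ZMod k × M))} :
    .inr m ∈ select j α ↔ .inr (j, m) ∈ α := by
  induction α with
  | nil => simp
  | cons x α ih =>
    rcases x with a | ⟨l, m'⟩
    · simp [ih]
    · rw [select_inr]
      split_ifs with h
      · subst h; simp [ih]
      · have h' : ¬ j = l := fun e => h e.symm
        simp [ih, h']

theorem select_eq_map_proj {j : ZMod k} {α : List (A ⊕ (ZMod k × M))}
    (h : ∀ m, .inr (j, m) ∉ α) : select j α = (proj α).map .inl := by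
  induction α with
  | nil => rfl
  | cons x α ih =>
    rcases x with a | ⟨l, m'⟩
    · simp only [select_inl, proj_inl, List.map_cons, List.cons.injEq, true_and]
      exact ih fun m hm => h m (List.mem_cons_of_mem _ hm)
    · rw [select_inr_of_ne, ih fun m hm => h m (List.mem_cons_of_mem _ hm)]
      · simp
      · rintro rfl
        exact h m' (List.mem_cons_self ..)

theorem select_flatten (j : ZMod k) (l : List (List (A ⊕ (ZMod k × M)))) :
    select j l.flatten = (l.map (select j)).flatten := by
  induction l with
  | nil => rfl
  | cons x l ih => simp [ih]

/-- The concatenation `f s ++ f (s + 1) ++ ⋯` of `m` words. -/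
def concat {X : Type*} (f : ℕ → List X) (s m : ℕ) : List X := ((List.range' s m).map f).flatten

theorem block_eq_concat {X : Type*} (f : ℕ → List X) (i m : ℕ) : block f i m = concat f (i + 1) m :=
  rfl

@[simp] theorem concat_zero {X : Type*} (f : ℕ → List X) (s : ℕ) : concat f s 0 = [] := rfl

theorem concat_succ {X : Type*} (f : ℕ → List X) (s m : ℕ) :
    concat f s (m + 1) = f s ++ concat f (s + 1) m := by
  simp [concat, List.range'_succ]

theorem concat_succ' {X : Type*} (f : ℕ → List X) (s m : ℕ) :
    concat f s (m + 1) = concat f s m ++ f (s + m) := by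
  simp [concat, List.range'_concat]

theorem concat_congr {X : Type*} {f g : ℕ → List X} {s m : ℕ}
    (h : ∀ i, s ≤ i → i < s + m → f i = g i) : concat f s m = concat g s m := by
  unfold concat
  congr 1
  refine List.map_congr_left fun i hi => ?_
  simp only [List.mem_range'_1] at hi
  exact h i hi.1 hi.2

theorem mem_concat {X : Type*} {f : ℕ → List X} {s m : ℕ} {x : X} :
    x ∈ concat f s m ↔ ∃ i, s ≤ i ∧ i < s + m ∧ x ∈ f i := by
  simp [concat, List.mem_range'_1, and_assoc]

theorem proj_concat (f : ℕ → List (A ⊕ M)) (s m : ℕ) :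
    proj (concat f s m) = concat (fun i => proj (f i)) s m := by
  simp [concat, proj_flatten, Function.comp_def]

theorem select_concat (j : ZMod k) (f : ℕ → List (A ⊕ (ZMod k × M))) (s m : ℕ) :
    select j (concat f s m) = concat (fun i => select j (f i)) s m := by
  simp [concat, select_flatten, Function.comp_def]

end KStarBasics

/-! ### Cutting a parsing along a factorization. -/

section Splitting

variable {A : Type*} {S : Type}

/-- The word does not start with a marker. -/
def Lead (x : List (A ⊕ S)) : Prop := ∀ m x', x ≠ .inr m :: x'

theorem lead_nil : Lead ([] : List (A ⊕ S)) := by simp [Lead]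

theorem lead_inl (a : A) (x : List (A ⊕ S)) : Lead (.inl a :: x) := by simp [Lead]

theorem not_lead_inr (m : S) (x : List (A ⊕ S)) : ¬ Lead (.inr m :: x) := fun h => h _ _ rfl

theorem Lead.append {x y : List (A ⊕ S)} (hx : Lead x) (hy : Lead y) : Lead (x ++ y) := by
  rcases x with _ | ⟨a | m, x⟩
  · exact hy
  · exact lead_inl _ _
  · exact absurd hx (not_lead_inr _ _)

theorem Lead.of_append {x y : List (A ⊕ S)} (h : Lead (x ++ y)) : Lead x := by
  rcases x with _ | ⟨a | m, x⟩
  · exact lead_nil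
  · exact lead_inl _ _
  · exact absurd h (not_lead_inr _ _)

theorem Lead.concat {f : ℕ → List (A ⊕ S)} {s m : ℕ} (h : ∀ i, s ≤ i → i < s + m → Lead (f i)) :
    Lead (concat f s m) := by
  induction m generalizing s with
  | zero => exact lead_nil
  | succ m ih =>
    rw [concat_succ]
    exact (h s le_rfl (by omega)).append (ih fun i h1 h2 => h i (by omega) (by omega))

/-- Markers at the cut go to the left part. This convention makes the cut unique in `split_unique`.
-/
theorem exists_split (b : List (A ⊕ S)) : ∀ {u v : List A}, proj b = u ++ v →
    ∃ c d, b = c ++ d ∧ proj c = u ∧ proj d = v ∧ Lead d := by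
  induction b with
  | nil =>
    intro u v h
    simp only [proj_nil, List.nil_eq, List.append_eq_nil_iff] at h
    exact ⟨[], [], rfl, h.1.symm, h.2.symm, lead_nil⟩
  | cons x b ih =>
    intro u v h
    rcases x with a | m
    · rcases u with _ | ⟨a', u⟩
      · exact ⟨[], .inl a :: b, rfl, rfl, h, lead_inl _ _⟩
      · simp only [proj_inl, List.cons_append, List.cons.injEq] at h
        obtain ⟨c, d, rfl, rfl, h1, h2⟩ := ih h.2
        exact ⟨.inl a' :: c, d, by simp [h.1], rfl, h1, h2⟩
    · obtain ⟨c, d, rfl, rfl, h1, h2⟩ := ih h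
      exact ⟨.inr m :: c, d, rfl, rfl, h1, h2⟩

theorem split_unique {c d c' d' : List (A ⊕ S)} (h : c ++ d = c' ++ d') (hp : proj c = proj c')
    (hd : Lead d) (hd' : Lead d') : c = c' ∧ d = d' := by
  induction c generalizing c' with
  | nil =>
    rcases c' with _ | ⟨a | m, c'⟩
    · exact ⟨rfl, h⟩
    · simp at hp
    · simp only [List.nil_append, List.cons_append] at h
      rw [h] at hd
      exact absurd hd (not_lead_inr _ _)
  | cons x c ih =>
    rcases c' with _ | ⟨y, c'⟩
    · rcases x with a | m
      · simp at hp
      · simp only [List.nil_append, List.cons_append] at h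
        rw [← h] at hd'
        exact absurd hd' (not_lead_inr _ _)
    · simp only [List.cons_append, List.cons.injEq] at h
      obtain ⟨rfl, h⟩ := h
      have hp' : proj c = proj c' := by rcases x with a | m <;> simpa using hp
      obtain ⟨rfl, rfl⟩ := ih h hp'
      exact ⟨rfl, rfl⟩

theorem exists_pieces_of_lead (u : ℕ → List A) (m : ℕ) : ∀ (s : ℕ) (b : List (A ⊕ S)), Lead b →
    proj b = concat u s m → ∃ c : ℕ → List (A ⊕ S), concat c s m = b ∧
      ∀ i, s ≤ i → i < s + m → proj (c i) = u i ∧ Lead (c i) := by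
  induction m with
  | zero =>
    intro s b hb h
    refine ⟨fun _ => [], ?_, fun i h1 h2 => by omega⟩
    rcases b with _ | ⟨a | m, b⟩
    · rfl
    · simp at h
    · exact absurd hb (not_lead_inr _ _)
  | succ m ih =>
    intro s b hb h
    rw [concat_succ] at h
    obtain ⟨c, d, rfl, hc, hd, hl⟩ := exists_split b h
    obtain ⟨f, rfl, hf⟩ := ih (s + 1) d hl hd
    refine ⟨fun i => if i = s then c else f i, ?_, fun i h1 h2 => ?_⟩
    · rw [concat_succ]
      simp only [if_true]
      congr 1
      exact concat_congr fun i h1 h2 => if_neg (by omega)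
    · by_cases hi : i = s
      · subst hi
        simp [hc, hb.of_append]
      · simp only [hi, if_false]
        exact hf i (by omega) (by omega)

/-- Only the first piece may start with markers. Without any piece there would be no room for the
leading markers of `b`, hence `0 < m`. -/
theorem exists_pieces (u : ℕ → List A) (m s : ℕ) (hm : 0 < m) (b : List (A ⊕ S))
    (h : proj b = concat u s m) : ∃ c : ℕ → List (A ⊕ S), concat c s m = b ∧
      ∀ i, s ≤ i → i < s + m → proj (c i) = u i ∧ (i ≠ s → Lead (c i)) := by
  obtain ⟨m, rfl⟩ := Nat.exists_eq_succ_of_ne_zero hm.ne'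
  rw [Nat.succ_eq_add_one, concat_succ] at h
  obtain ⟨c, d, rfl, hc, hd, hl⟩ := exists_split b h
  obtain ⟨f, rfl, hf⟩ := exists_pieces_of_lead u m (s + 1) d hl hd
  refine ⟨fun i => if i = s then c else f i, ?_, fun i h1 h2 => ?_⟩
  · rw [Nat.succ_eq_add_one, concat_succ]
    simp only [if_true]
    congr 1
    exact concat_congr fun i h1 h2 => if_neg (by omega)
  · by_cases hi : i = s
    · subst hi
      simp [hc]
    · simp only [hi, if_false]
      exact ⟨(hf i (by omega) (by omega)).1, fun _ => (hf i (by omega) (by omega)).2⟩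

/-- The first cut is unique by `split_unique`, because what follows it does not start with a marker;
then the argument is repeated. -/
theorem pieces_unique {c c' : ℕ → List (A ⊕ S)} (m : ℕ) : ∀ {s : ℕ},
    concat c s m = concat c' s m → (∀ i, s ≤ i → i < s + m → proj (c i) = proj (c' i)) →
    (∀ i, s < i → i < s + m → Lead (c i)) → (∀ i, s < i → i < s + m → Lead (c' i)) →
    ∀ i, s ≤ i → i < s + m → c i = c' i := by
  induction m with
  | zero => intros; omega
  | succ m ih =>
    intro s h hp hl hl' i h1 h2
    rw [concat_succ, concat_succ] at h
    obtain ⟨e1, e2⟩ := split_unique h (hp s le_rfl (by omega))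
      (Lead.concat fun i h1 h2 => hl i (by omega) (by omega))
      (Lead.concat fun i h1 h2 => hl' i (by omega) (by omega))
    rcases h1.eq_or_lt with rfl | h1
    · exact e1
    · exact ih e2 (fun i h1 h2 => hp i (by omega) (by omega))
        (fun i h1 h2 => hl i (by omega) (by omega)) (fun i h1 h2 => hl' i (by omega) (by omega))
        i (by omega) (by omega)

end Splitting

/-! ### Merging `k` marked copies of the same word. -/

section Sorting

variable {A : Type*} {S : Type} {k : ℕ} [NeZero k]

/-- The position of `j` in the enumeration `r + 1, …, r + k` of the residues, counted from `0`. -/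
def rank (r j : ZMod k) : ℕ := (j - (r + 1)).val

theorem rank_injective (r : ZMod k) : Function.Injective (rank r) := fun j j' h => by
  have := ZMod.val_injective k h
  exact sub_left_injective this

@[simp] theorem rank_succ (r : ZMod k) : rank r (r + 1) = 0 := by simp [rank]

/-- The residue `r` comes last in the enumeration: `r - (r + 1) = -1` has representative `k - 1`. -/
theorem rank_le_rank_self (r j : ZMod k) : rank r j ≤ rank r r := by
  have h : r - (r + 1) = -1 := by ring
  obtain ⟨n, rfl⟩ := Nat.exists_eq_succ_of_ne_zero (NeZero.ne k)
  rw [rank, rank, h, ZMod.val_neg_one]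
  exact Nat.le_of_lt_succ (ZMod.val_lt _)

theorem eq_of_rank_self_le {r j : ZMod k} (h : rank r r ≤ rank r j) : j = r :=
  rank_injective r (le_antisymm (rank_le_rank_self r j) h)

/-- Adjacent markers are ordered by rank, and `t` is the index of the marker before the word (or
`r + 1`, of rank `0`, if there is no marker there). -/
def Sorted (r : ZMod k) : ZMod k → List (A ⊕ (ZMod k × S)) → Prop
  | _, [] => True
  | _, .inl _ :: β => Sorted r (r + 1) β
  | t, .inr (j, _) :: β => rank r t ≤ rank r j ∧ Sorted r j β

/-- If the projection on `j` starts with a marker, no letter comes before this marker in `β`, and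
ranks do not decrease along adjacent markers. -/
theorem Sorted.rank_le {r : ZMod k} {β : List (A ⊕ (ZMod k × S))} : ∀ {t : ZMod k}, Sorted r t β →
    ∀ {j m x}, select j β = .inr m :: x → rank r t ≤ rank r j := by
  induction β with
  | nil => intro t _ j m x h; simp at h
  | cons y β ih =>
    intro t ht j m x h
    rcases y with a | ⟨l, m'⟩
    · simp at h
    · by_cases hl : l = j
      · subst hl; exact ht.1
      · rw [select_inr_of_ne hl] at h
        exact ht.1.trans (ih ht.2 h)

/-- If both words start with markers, the first index of each also leads the corresponding
projection of the other, so each rank is at most the other one and the indices agree. A letter at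
the head is seen by all the projections. -/
theorem Sorted.eq {r : ZMod k} {β : List (A ⊕ (ZMod k × S))} : ∀ {t β'}, Sorted r t β →
    Sorted r t β' → (∀ j, select j β = select j β') → β = β' := by
  induction β with
  | nil =>
    intro t β' _ _ h
    rcases β' with _ | ⟨a | ⟨l, m⟩, β'⟩
    · rfl
    · simpa using h 0
    · simpa using h l
  | cons y β ih =>
    intro t β' hβ hβ' h
    rcases y with a | ⟨l, m⟩
    · rcases β' with _ | ⟨a' | ⟨l', m'⟩, β'⟩
      · simpa using h 0
      · have h0 := h 0
        simp only [select_inl, List.cons.injEq] at h0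
        obtain rfl := Sum.inl.inj h0.1
        rw [ih hβ hβ' fun j => by simpa using h j]
      · simpa using h l'
    · rcases β' with _ | ⟨a' | ⟨l', m'⟩, β'⟩
      · simpa using h l
      · simpa using h l
      · have key : l = l' := by
          by_contra hne
          have h1 := h l
          have h2 := h l'
          rw [select_inr_self, select_inr_of_ne (Ne.symm hne)] at h1
          rw [select_inr_self, select_inr_of_ne hne] at h2
          exact hne (rank_injective r (le_antisymm (hβ.2.rank_le h2) (hβ'.2.rank_le h1.symm)))
        subst key
        have h1 := h l
        simp only [select_inr_self, List.cons.injEq] at h1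
        obtain rfl := Sum.inr.inj h1.1
        rw [ih hβ.2 hβ'.2 fun j => ?_]
        have h2 := h j
        by_cases hj : l = j
        · subst hj; exact h1.2
        · rwa [select_inr_of_ne hj, select_inr_of_ne hj] at h2

/-- Greedy merge, by induction on the total length: write a leading marker of minimal rank if some
projection has one, and otherwise the letter that all of them start with. -/
theorem exists_sorted (r : ZMod k) (N : ℕ) : ∀ (c : ZMod k → List (A ⊕ S)) (t : ZMod k) (u : List A),
    ∑ j, (c j).length = N → (∀ j, proj (c j) = u) →
    (∀ j, ¬ Lead (c j) → rank r t ≤ rank r j) →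
    ∃ β, Sorted r t β ∧ ∀ j, select j β = c j := by
  induction N using Nat.strong_induction_on with
  | _ N ih =>
  intro c t u hN hu ht
  by_cases hl : ∀ j, Lead (c j)
  · cases u with
    | nil =>
      refine ⟨[], trivial, fun j => ?_⟩
      have h1 := hl j
      have h2 := hu j
      rcases hc : c j with _ | ⟨a | m, x⟩ <;> rw [hc] at h1 h2
      · rfl
      · simp at h2
      · exact absurd h1 (not_lead_inr _ _)
    | cons a u =>
      have : ∀ j, ∃ d, c j = .inl a :: d ∧ proj d = u := by
        intro j
        have h1 := hl j
        have h2 := hu j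
        rcases hc : c j with _ | ⟨a' | m, x⟩ <;> rw [hc] at h1 h2
        · simp at h2
        · simp only [proj_inl, List.cons.injEq] at h2
          exact ⟨x, by rw [h2.1], h2.2⟩
        · exact absurd h1 (not_lead_inr _ _)
      choose d hd hd' using this
      -- After a letter the bound restarts at `r + 1`, the residue of rank `0`, so nothing is
      -- required.
      obtain ⟨β, h1, h2⟩ := ih (∑ j, (d j).length) (by
        rw [← hN]
        refine Finset.sum_lt_sum_of_nonempty ⟨0, Finset.mem_univ _⟩ fun j _ => ?_
        simp [hd j]) d (r + 1) u rfl hd' (by simp)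
      exact ⟨.inl a :: β, h1, fun j => by simp [h2, hd]⟩
  · push Not at hl
    obtain ⟨j₀, hj₀⟩ := hl
    obtain ⟨j, hj, hmin⟩ := (Set.toFinite {j | ¬ Lead (c j)}).exists_minimalFor (rank r) _
      ⟨j₀, hj₀⟩
    have hmin' : ∀ j', ¬ Lead (c j') → rank r j ≤ rank r j' := fun j' h' => by
      rcases le_total (rank r j) (rank r j') with h | h
      · exact h
      · exact hmin h' h
    have : ∃ m x, c j = .inr m :: x := by
      have : ¬ Lead (c j) := hj
      unfold Lead at this
      push Not at this
      exact this
    obtain ⟨m, x, hx⟩ := this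
    -- Only the projection on `j` loses a symbol. By minimality of its rank, `j` is a valid bound
    -- for what remains.
    obtain ⟨β, h1, h2⟩ := ih (∑ j', (Function.update c j x j').length) (by
      rw [← hN]
      refine Finset.sum_lt_sum (fun j' _ => ?_) ⟨j, Finset.mem_univ _, ?_⟩
      · by_cases h : j' = j
        · subst h; simp [hx]
        · simp [h]
      · simp [hx]) (Function.update c j x) j u rfl (fun j' => by
        by_cases h : j' = j
        · subst h
          have := hu j'
          simpa [hx] using this
        · simpa [h] using hu j') (fun j' hj' => by
        by_cases h : j' = j
        · rw [h]
        · exact hmin' j' (by simpa [h] using hj'))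
    refine ⟨.inr (j, m) :: β, ⟨ht j hj, h1⟩, fun j' => ?_⟩
    by_cases h : j' = j
    · subst h
      simp [h2, hx]
    · rw [select_inr_of_ne (Ne.symm h), h2]
      simp [h]

theorem Sorted.of_order {r : ZMod k} {β : List (A ⊕ (ZMod k × S))} : ∀ {t : ZMod k},
    (∀ j j' m m', [.inr (j, m), .inr (j', m')] <:+: β → rank r j ≤ rank r j') →
    (∀ j m x, β = .inr (j, m) :: x → rank r t ≤ rank r j) → Sorted r t β := by
  induction β with
  | nil => intros; trivial
  | cons y β ih =>
    intro t h h'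
    have hi : ∀ j j' m m', [.inr (j, m), .inr (j', m')] <:+: β → rank r j ≤ rank r j' :=
      fun j j' m m' hh => h j j' m m' (infix_cons_iff.2 (.inr hh))
    rcases y with a | ⟨l, m⟩
    · exact ih hi (by simp)
    · refine ⟨h' _ _ _ rfl, ih hi fun j m' x hx => h l j m m' (infix_cons_iff.2 (.inl ⟨rfl, x, hx⟩))⟩

end Sorting

end Parsing

namespace Parsing

/-! ### Parsings for a `k`-star without the parentheses of the argument. -/

section Bodies

variable {A : Type*} {S : Type} {k : ℕ} [NeZero k]

/-- The block of `k` factors starting at position `s` exists and contains position `i`. -/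
def Act (k n i s : ℕ) : Prop := 1 ≤ s ∧ s ≤ i ∧ i < s + k ∧ s + k ≤ n + 1

theorem Act.eq {n i s s' : ℕ} (h : Act k n i s) (h' : Act k n i s')
    (e : (s : ZMod k) = s') : s = s' := by
  obtain ⟨h1, h2, h3, h4⟩ := h
  obtain ⟨h1', h2', h3', h4'⟩ := h'
  rcases le_total s s' with h | h
  · exact natCast_inj_of_lt h (by omega) e
  · exact (natCast_inj_of_lt h (by omega) e.symm).symm

/-- The conditions on the words `α_i` of a parsing for a `k`-star stripped of the parentheses of the
argument. -/
structure IsBody (k n : ℕ) (β : ℕ → List (A ⊕ (ZMod k × S))) : Prop where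
  sorted : ∀ i, 1 ≤ i → i ≤ n → Sorted (i : ZMod k) i (β i)
  active : ∀ i j m, 1 ≤ i → i ≤ n → .inr (j, m) ∈ β i → ∃ s, Act k n i s ∧ (s : ZMod k) = j

variable {n : ℕ} {β β' : ℕ → List (A ⊕ (ZMod k × S))}

/-- At position `i` the sorting starts from the bound `i`, of maximal rank, so only markers with
index `i` can precede the first letter. Such a marker needs an active block with residue `i`, and
this block can only start at `i`. -/
theorem IsBody.eq_of_not_lead (h : IsBody k n β) {i : ℕ} {j : ZMod k} (h1 : 1 ≤ i) (h2 : i ≤ n)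
    (hl : ¬ Lead (select j (β i))) : j = i ∧ i + k ≤ n + 1 := by
  unfold Lead at hl
  push Not at hl
  obtain ⟨m, x, hx⟩ := hl
  have hj := eq_of_rank_self_le ((h.sorted i h1 h2).rank_le hx)
  refine ⟨hj, ?_⟩
  have : .inr m ∈ select j (β i) := by simp [hx]
  obtain ⟨s, ⟨h3, h4, h5, h6⟩, hs⟩ := h.active i j m h1 h2 (inr_mem_select.1 this)
  have := natCast_inj_of_lt h4 h5 (hs.trans hj)
  omega

/-- By `IsBody.eq_of_not_lead`, no piece of a block after the first starts with a marker, so the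
pieces are recovered from the whole block by `pieces_unique`. At each position the pieces determine
their sorted merge. -/
theorem IsBody.ext (h : IsBody k n β) (h' : IsBody k n β')
    (hp : ∀ i, 1 ≤ i → i ≤ n → proj (β i) = proj (β' i))
    (hs : ∀ s : ℕ, 1 ≤ s → s + k ≤ n + 1 →
      select (s : ZMod k) (concat β s k) = select (s : ZMod k) (concat β' s k)) :
    ∀ i, 1 ≤ i → i ≤ n → β i = β' i := by
  intro i h1 h2
  refine (h.sorted i h1 h2).eq (h'.sorted i h1 h2) fun j => ?_
  by_cases hj : ∃ s, Act k n i s ∧ (s : ZMod k) = j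
  · obtain ⟨s, ⟨h3, h4, h5, h6⟩, rfl⟩ := hj
    have := hs s h3 h6
    rw [select_concat, select_concat] at this
    have lead : ∀ {β : ℕ → List (A ⊕ (ZMod k × S))}, IsBody k n β → ∀ i, s < i → i < s + k →
        Lead (select (s : ZMod k) (β i)) := by
      intro β h i h1 h2
      by_contra hl
      have := natCast_inj_of_lt h1.le h2 (h.eq_of_not_lead (by omega) (by omega) hl).1
      omega
    refine pieces_unique k this (fun i h7 h8 => ?_) (lead h) (lead h') i h4 h5
    simpa using hp i (by omega) (by omega)
  · rw [select_eq_map_proj, select_eq_map_proj, hp i h1 h2]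
    · exact fun m hm => hj (h'.active i j m h1 h2 hm)
    · exact fun m hm => hj (h.active i j m h1 h2 hm)

/-- Each `b s` is cut at the borders of its factors, and the pieces of the active blocks are merged
at each position. Leading markers occur only in the first piece of a block, whose index has maximal
rank at this position; this is the bound that `exists_sorted` asks for. -/
theorem exists_isBody (u : ℕ → List A) (b : ℕ → List (A ⊕ S))
    (hb : ∀ s, 1 ≤ s → s + k ≤ n + 1 → proj (b s) = concat u s k) :
    ∃ β : ℕ → List (A ⊕ (ZMod k × S)), IsBody k n β ∧ (∀ i, 1 ≤ i → i ≤ n → proj (β i) = u i) ∧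
      ∀ s : ℕ, 1 ≤ s → s + k ≤ n + 1 → select (s : ZMod k) (concat β s k) = b s := by
  classical
  have hpos : 0 < k := Nat.pos_of_ne_zero (NeZero.ne k)
  have hc : ∀ s, ∃ c : ℕ → List (A ⊕ S), 1 ≤ s → s + k ≤ n + 1 → concat c s k = b s ∧
      ∀ i, s ≤ i → i < s + k → proj (c i) = u i ∧ (i ≠ s → Lead (c i)) := by
    intro s
    by_cases h : 1 ≤ s ∧ s + k ≤ n + 1
    · obtain ⟨c, hc⟩ := exists_pieces u k s hpos (b s) (hb s h.1 h.2)
      exact ⟨c, fun _ _ => hc⟩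
    · exact ⟨fun _ => [], fun h1 h2 => absurd ⟨h1, h2⟩ h⟩
  choose c hc using hc
  -- An index without active block receives the bare letters, so that all the words to be merged at
  -- position `i` project to `u i`.
  let d : ℕ → ZMod k → List (A ⊕ S) := fun i j =>
    if h : ∃ s, Act k n i s ∧ (s : ZMod k) = j then c h.choose i else (u i).map .inl
  have hd : ∀ i s, Act k n i s → d i s = c s i := by
    intro i s h
    have h' : ∃ s', Act k n i s' ∧ (s' : ZMod k) = (s : ZMod k) := ⟨s, h, rfl⟩
    simp only [d, dif_pos h']
    rw [Act.eq h'.choose_spec.1 h h'.choose_spec.2]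
  have hd' : ∀ i j, (¬ ∃ s, Act k n i s ∧ (s : ZMod k) = j) → d i j = (u i).map .inl := by
    intro i j h
    simp only [d, dif_neg h]
  have hβ : ∀ i : ℕ, ∃ β : List (A ⊕ (ZMod k × S)), Sorted (i : ZMod k) i β ∧
      ∀ j, select j β = d i j := by
    intro i
    refine exists_sorted (i : ZMod k) _ (d i) i (u i) rfl (fun j => ?_) (fun j hj => ?_)
    · by_cases h : ∃ s, Act k n i s ∧ (s : ZMod k) = j
      · obtain ⟨s, h, rfl⟩ := h
        rw [hd _ _ h]
        exact ((hc s h.1 h.2.2.2).2 i h.2.1 h.2.2.1).1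
      · rw [hd' _ _ h, proj_map_inl]
    · by_cases h : ∃ s, Act k n i s ∧ (s : ZMod k) = j
      · obtain ⟨s, h, rfl⟩ := h
        rw [hd _ _ h] at hj
        by_cases hi : i = s
        · rw [hi]
        · exact absurd (((hc s h.1 h.2.2.2).2 i h.2.1 h.2.2.1).2 hi) hj
      · rw [hd' _ _ h] at hj
        exact absurd (by cases u i <;> simp [lead_nil, lead_inl]) hj
  choose β hβ hsel using hβ
  refine ⟨β, ⟨fun i _ _ => hβ i, fun i j m h1 h2 hm => ?_⟩, fun i h1 h2 => ?_, fun s h1 h2 => ?_⟩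
  · by_contra h
    have := inr_mem_select.2 hm
    rw [hsel, hd' _ _ h] at this
    simp at this
  -- The letters are visible through any index; `0` is an arbitrary choice.
  · rw [← proj_select 0, hsel]
    by_cases h : ∃ s, Act k n i s ∧ (s : ZMod k) = 0
    · obtain ⟨s, h, e⟩ := h
      rw [← e, hd _ _ h]
      exact ((hc s h.1 h.2.2.2).2 i h.2.1 h.2.2.1).1
    · rw [hd' _ _ h, proj_map_inl]
  · rw [select_concat, ← (hc s h1 h2).1]
    exact concat_congr fun i h3 h4 => by rw [hsel, hd _ _ ⟨h1, h3, h4, h2⟩]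

end Bodies

/-! ### Restoring the parentheses of the argument. -/

section Decoration

variable {A : Type*} {S : Type} {k : ℕ}

/-- Markers of the argument of a `k`-star other than its parentheses. -/
def emb : A ⊕ (ZMod k × S) → A ⊕ (ZMod k × Marker S) := Sum.map id (Prod.map id .sub)

@[simp] theorem emb_inl (a : A) : (emb (.inl a) : A ⊕ (ZMod k × Marker S)) = .inl a := rfl

@[simp] theorem emb_inr (j : ZMod k) (m : S) :
    (emb (.inr (j, m)) : A ⊕ (ZMod k × Marker S)) = .inr (j, .sub m) := rfl

theorem emb_injective : Function.Injective (emb : A ⊕ (ZMod k × S) → _) :=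
  Sum.map_injective.2 ⟨Function.injective_id,
    Function.Injective.prodMap Function.injective_id sub_injective⟩

@[simp] theorem proj_map_emb (β : List (A ⊕ (ZMod k × S))) : proj (β.map emb) = proj β :=
  proj_map _ _

theorem select_map_emb (j : ZMod k) (β : List (A ⊕ (ZMod k × S))) :
    select j (β.map emb) = (select j β).map (Sum.map id .sub) := by
  induction β with
  | nil => rfl
  | cons x β ih =>
    rcases x with a | ⟨l, m⟩
    · simp [ih]
    · by_cases h : l = j
      · subst h; simp [ih]
      · simp [select_inr_of_ne h, ih]

theorem exists_map_emb (α : List (A ⊕ (ZMod k × Marker S))) (h : ∀ j, .inr (j, .op) ∉ α)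
    (h' : ∀ j, .inr (j, .cl) ∉ α) : ∃ β, α = List.map emb β := by
  induction α with
  | nil => exact ⟨[], rfl⟩
  | cons x α ih =>
    obtain ⟨β, rfl⟩ := ih (fun j hj => h j (List.mem_cons_of_mem _ hj))
      (fun j hj => h' j (List.mem_cons_of_mem _ hj))
    rcases x with a | ⟨l, _ | _ | m⟩
    · exact ⟨.inl a :: β, rfl⟩
    · exact absurd (List.mem_cons_self ..) (h l)
    · exact absurd (List.mem_cons_self ..) (h' l)
    · exact ⟨.inr (l, m) :: β, rfl⟩

/-- The parenthesis opened at position `i`. -/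
def opening (A : Type*) (S : Type) (k n i : ℕ) : List (A ⊕ (ZMod k × Marker S)) :=
  if i + k ≤ n + 1 then [.inr ((i : ZMod k), .op)] else []

/-- The parenthesis closed at position `i`. -/
def closing (A : Type*) (S : Type) (k i : ℕ) : List (A ⊕ (ZMod k × Marker S)) :=
  if k ≤ i then [.inr ((i + 1 : ℕ), .cl)] else []

/-- The word `α_i`, given what remains of it without the parentheses of the argument. -/
def decorate (n : ℕ) (β : ℕ → List (A ⊕ (ZMod k × S))) (i : ℕ) :
    List (A ⊕ (ZMod k × Marker S)) :=
  opening A S k n i ++ ((β i).map emb ++ closing A S k i)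

@[simp] theorem proj_decorate (n : ℕ) (β : ℕ → List (A ⊕ (ZMod k × S))) (i : ℕ) :
    proj (decorate n β i) = proj (β i) := by
  unfold decorate opening closing
  split_ifs <;> simp

theorem concat_brackets {X : Type*} (f : ℕ → List X) (x y : X) (s m : ℕ) (hm : 0 < m) :
    concat (fun i => (if i = s then [x] else []) ++ (f i ++ if i + 1 = s + m then [y] else [])) s m =
      x :: (concat f s m ++ [y]) := by
  obtain ⟨m, rfl⟩ := Nat.exists_eq_succ_of_ne_zero hm.ne'
  have h1 : ∀ g : ℕ → List X, concat (fun i => (if i = s then [x] else []) ++ g i) s (m + 1) =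
      x :: concat g s (m + 1) := by
    intro g
    rw [concat_succ, concat_succ]
    simp only [if_true, List.cons_append, List.nil_append]
    congr 2
    exact concat_congr fun i h1 h2 => by simp [show i ≠ s by omega]
  have h2 : concat (fun i => f i ++ if i + 1 = s + (m + 1) then [y] else []) s (m + 1) =
      concat f s (m + 1) ++ [y] := by
    rw [concat_succ', concat_succ']
    simp only [add_assoc, if_true, List.append_assoc]
    congr 1
    exact concat_congr fun i h1 h2 => by simp [show i + 1 ≠ s + (m + 1) by omega]
  rw [Nat.succ_eq_add_one, h1, h2]

variable [NeZero k]

/-- Within the window of a block its residue is that of one position only, which gives the opening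
at `s`. The parenthesis closed at position `i` has index `i + 1`, which is `s` modulo `k` only for
`i = s + k - 1`. -/
theorem select_decorate {n s i : ℕ} (h1 : 1 ≤ s) (h2 : s + k ≤ n + 1) (h3 : s ≤ i)
    (h4 : i < s + k) (β : ℕ → List (A ⊕ (ZMod k × S))) :
    select (s : ZMod k) (decorate n β i) = (if i = s then [.inr .op] else []) ++
      ((select (s : ZMod k) (β i)).map (Sum.map id .sub) ++
        if i + 1 = s + k then [.inr .cl] else []) := by
  rw [decorate, select_append, select_append, select_map_emb]
  congr 1
  · unfold opening
    by_cases hi : i = s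
    · subst hi
      simp [h2]
    · rw [if_neg hi]
      split_ifs
      · rw [select_inr_of_ne]
        · rfl
        · exact fun e => hi (natCast_inj_of_lt h3 h4 e.symm).symm
      · rfl
  · congr 1
    unfold closing
    by_cases hi : i + 1 = s + k
    · rw [if_pos hi]
      split_ifs with h
      · rw [hi]
        simp
      · omega
    · rw [if_neg hi]
      split_ifs
      · rw [select_inr_of_ne]
        · rfl
        · exact fun e => by
            have := natCast_inj_of_lt (k := k) (by omega) (by omega) e.symm
            omega
      · rfl

theorem select_concat_decorate {n s : ℕ} (h1 : 1 ≤ s) (h2 : s + k ≤ n + 1)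
    (β : ℕ → List (A ⊕ (ZMod k × S))) :
    select (s : ZMod k) (concat (decorate n β) s k) = wrap (select (s : ZMod k) (concat β s k)) := by
  have hpos : 0 < k := Nat.pos_of_ne_zero (NeZero.ne k)
  rw [select_concat, concat_congr fun i h3 h4 => select_decorate h1 h2 h3 h4 β,
    concat_brackets _ _ _ _ _ hpos, wrap_eq]
  congr 2
  rw [select_concat]
  simp [concat, List.map_flatten, Function.comp_def]

/-- Pairs of adjacent markers inside `β` are compared by sortedness. The only pair that leaves `β`
ends with the closing parenthesis excluded by `hne`. -/
theorem order_of_sorted {r : ZMod k} {β : List (A ⊕ (ZMod k × S))} :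
    ∀ {t γ j j' m m'}, Sorted r t β → (γ = [] ∨ γ = [.inr (r + 1, .cl)]) →
    [.inr (j, m), .inr (j', m')] <:+: β.map emb ++ γ → (j', m') ≠ (r + 1, Marker.cl) →
      rank r j ≤ rank r j' := by
  induction β with
  | nil =>
    rintro t _ j j' m m' - (rfl | rfl) h hne
    · simp at h
    · simp [infix_cons_iff] at h
  | cons x β ih =>
    rintro t γ j j' m m' hs hγ h hne
    rw [List.map_cons, List.cons_append, infix_cons_iff] at h
    rcases h with ⟨rfl', l', hl⟩ | h
    · rcases x with a | ⟨l, m₁⟩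
      · simp at rfl'
      · simp only [emb_inr, Sum.inr.injEq, Prod.mk.injEq] at rfl'
        obtain ⟨rfl, rfl⟩ := rfl'
        rcases β with _ | ⟨a | ⟨l₁, m₂⟩, β⟩
        · rcases hγ with rfl | rfl
          · simp at hl
          · simp at hl
            exact absurd (by simp [hl.1]) hne
        · simp at hl
        · simp at hl
          rw [← hl.1.1]
          exact hs.2.1
    · rcases x with a | ⟨l, m₁⟩
      · exact ih (t := r + 1) hs hγ h hne
      · exact ih hs.2 hγ h hne

variable {P : List A → Set (List (A ⊕ Marker S))} {n : ℕ}

theorem mem_decorate {β : ℕ → List (A ⊕ (ZMod k × S))} {i : ℕ} {j : ZMod k} {m : Marker S} :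
    .inr (j, m) ∈ decorate n β i ↔ (m = .op ∧ i + k ≤ n + 1 ∧ j = i) ∨
      (∃ m', m = .sub m' ∧ .inr (j, m') ∈ β i) ∨ (m = .cl ∧ k ≤ i ∧ j = (i + 1 : ℕ)) := by
  have h1 : .inr (j, m) ∈ (β i).map emb ↔ ∃ m', m = .sub m' ∧ .inr (j, m') ∈ β i := by
    rw [List.mem_map]
    constructor
    · rintro ⟨a | ⟨l, m'⟩, h, e⟩
      · simp at e
      · simp only [emb_inr, Sum.inr.injEq, Prod.mk.injEq] at e
        obtain ⟨rfl, rfl⟩ := e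
        exact ⟨m', rfl, h⟩
    · rintro ⟨m', rfl, h⟩
      exact ⟨_, h, rfl⟩
  have h2 : .inr (j, m) ∈ opening A S k n i ↔ m = .op ∧ i + k ≤ n + 1 ∧ j = i := by
    unfold opening
    split_ifs with h <;> simp [h, and_comm]
  have h3 : .inr (j, m) ∈ closing A S k i ↔ m = .cl ∧ k ≤ i ∧ j = (i + 1 : ℕ) := by
    unfold closing
    split_ifs with h <;> simp [h, and_comm]
  rw [decorate, List.mem_append, List.mem_append, h1, h2, h3]

theorem sorted_lead {i : ℕ} {β : ℕ → List (A ⊕ (ZMod k × S))} (h : IsBody k n β) (h1 : 1 ≤ i)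
    (h2 : i ≤ n) (h3 : n + 1 < i + k) : Lead (β i) := by
  rintro ⟨j, m⟩ x hx
  have := (h.eq_of_not_lead (j := j) h1 h2 (by rw [hx]; simp [not_lead_inr])).2
  omega

/-- Every marker at position `i` belongs to a block that starts between `1` and `n + 1 - k` and
contains `i`. The two exclusion conditions then compare representatives of a residue in a window of
length `k`. -/
theorem IsBody.isLong {β : ℕ → List (A ⊕ (ZMod k × S))} (h : IsBody k n β) (hk : k ≤ n)
    {α : ℕ → List (A ⊕ (ZMod k × Marker S))} (hα : ∀ i, 1 ≤ i → i ≤ n → α i = decorate n β i)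
    (hP : ∀ s : ℕ, 1 ≤ s → s + k ≤ n + 1 →
      wrap (select (s : ZMod k) (concat β s k)) ∈ P (concat (fun i => proj (β i)) s k)) :
    IsLong P n α where
  block_mem i hi := by
    have e : block α i k = concat (decorate n β) (i + 1) k := by
      rw [block_eq_concat]
      exact concat_congr fun j h1 h2 => hα j (by omega) (by omega)
    rw [e, select_concat_decorate (by omega) (by omega), proj_concat]
    simpa using hP (i + 1) (by omega) (by omega)
  before i j h1 h2 h3 m hm := by
    rw [hα i h1 (by omega), mem_decorate] at hm
    rcases hm with ⟨-, -, e⟩ | ⟨m', -, hm⟩ | ⟨-, h4, -⟩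
    · have := natCast_inj_of_lt h2.le (by omega) e.symm
      omega
    · obtain ⟨s, ⟨h4, h5, h6, h7⟩, e⟩ := h.active _ _ _ h1 (by omega) hm
      have := natCast_inj_of_lt (by omega) (by omega) e
      omega
    · omega
  after i j h1 h2 h3 m hm := by
    have hpos : 0 < k := Nat.pos_of_ne_zero (NeZero.ne k)
    rw [hα i (by omega) h3, mem_decorate] at hm
    rcases hm with ⟨-, h4, e⟩ | ⟨m', -, hm⟩ | ⟨-, h4, e⟩
    · omega
    · obtain ⟨s, ⟨h4, h5, h6, h7⟩, e⟩ := h.active _ _ _ (by omega) (by omega) hm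
      have := natCast_inj_of_lt (by omega) (by omega) e
      omega
    · have := natCast_inj_of_lt (by omega) (by omega) e
      omega
  close i h1 h2 := by
    have hpos : 0 < k := Nat.pos_of_ne_zero (NeZero.ne k)
    rw [hα i (by omega) h2, decorate, closing, if_pos h1, ← List.append_assoc]
    exact List.suffix_append ..
  start i h1 h2 := by
    have hpos : 0 < k := Nat.pos_of_ne_zero (NeZero.ne k)
    rw [hα i h1 (by omega), decorate, opening, if_pos h2]
    exact List.prefix_append ..
  start_late i h1 h2 := by
    have h3 : 1 ≤ i := by omega
    have hl := sorted_lead h h3 h2 h1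
    rw [hα i h3 h2, decorate, opening, if_neg (by omega), List.nil_append]
    rcases hb : β i with _ | ⟨a | m, x⟩
    · unfold closing
      split_ifs with hc
      · exact .inr (.inl rfl)
      · exact .inr (.inr ⟨by omega, rfl⟩)
    · exact .inl ⟨a, by simp⟩
    · exact absurd hb (hl _ _)
  order i h1 h2 j j' m m' hm hne := by
    rw [hα i h1 h2, decorate] at hm
    have hs := h.sorted i h1 h2
    have hcl : closing A S k i = [] ∨ closing A S k i = [.inr ((i : ZMod k) + 1, .cl)] := by
      unfold closing
      split_ifs <;> simp
    have e : ((i + 1 : ℕ) : ZMod k) = (i : ZMod k) + 1 := by push_cast; rfl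
    rw [e] at hne ⊢
    change rank (i : ZMod k) j ≤ rank (i : ZMod k) j'
    unfold opening at hm
    split_ifs at hm with ho
    -- A pair that begins with the opening parenthesis: its index `i` is the initial bound of
    -- `Sorted`.
    · rw [List.singleton_append, infix_cons_iff] at hm
      rcases hm with ⟨e', l', hl⟩ | hm
      · simp only [Sum.inr.injEq, Prod.mk.injEq] at e'
        rw [← e'.1]
        rcases hb : β i with _ | ⟨a | ⟨l, m₁⟩, x⟩ <;> rw [hb] at hl hs
        · rcases hcl with hc | hc <;> rw [hc] at hl
          · simp at hl
          · simp at hl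
            exact absurd (by simp [hl.1]) hne
        · simp at hl
        · simp at hl
          rw [← hl.1.1]
          exact hs.1
      · exact order_of_sorted hs hcl hm hne
    · exact order_of_sorted hs hcl hm hne

/-- The parentheses of a block are where `start` and `close` put them and nowhere else, because the
block restricted to its index is a single word in parentheses. Removing them leaves inner markers
only, and the order condition, used also next to the opening parenthesis, becomes sortedness with
initial bound `i`. -/
theorem IsLong.exists_isBody {α : ℕ → List (A ⊕ (ZMod k × Marker S))} (h : IsLong P n α)
    (hP : IsParsing P) (hk : k ≤ n) : ∃ β, IsBody k n β ∧
      (∀ i, 1 ≤ i → i ≤ n → α i = decorate n β i) ∧ ∀ s : ℕ, 1 ≤ s → s + k ≤ n + 1 →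
        wrap (select (s : ZMod k) (concat β s k)) ∈ P (concat (fun i => proj (β i)) s k) := by
  obtain ⟨k', rfl⟩ : ∃ k', k = k' + 1 := Nat.exists_eq_succ_of_ne_zero (NeZero.ne k)
  have hact : ∀ i j m, 1 ≤ i → i ≤ n → .inr (j, m) ∈ α i → ∃ s, Act (k' + 1) n i s ∧ (s : ZMod (k' + 1)) = j := by
    intro i j m h1 h2 hm
    -- the representative of `j` in `i - k', …, i`, shifted by `k' + 1`
    obtain ⟨s, hs1, hs2, hs3⟩ : ∃ s : ℕ, s ≤ i + (k' + 1) ∧ i < s ∧ (s : ZMod (k' + 1)) = j := by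
      refine ⟨i + 1 + (j - ((i + 1 : ℕ) : ZMod (k' + 1))).val, ?_, by omega, ?_⟩
      · have := ZMod.val_lt (j - ((i + 1 : ℕ) : ZMod (k' + 1)))
        omega
      · push_cast
        rw [ZMod.natCast_zmod_val]
        ring
    have e : ∀ t : ℕ, t + (k' + 1) = s → (t : ZMod (k' + 1)) = j := by
      rintro t rfl
      rw [← hs3]
      simp
    -- If `s ≤ k`, the first block with this residue starts after position `i`, against `before`.
    -- Otherwise the start should be `s - k`, and `after` shows that a block does start there.
    by_cases h3 : s ≤ k' + 1
    · exact absurd hm (hs3 ▸ h.before i s h1 hs2 h3 m)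
    · refine ⟨s - (k' + 1), ⟨by omega, by omega, by omega, ?_⟩, e _ (by omega)⟩
      by_contra h4
      have := h.after i (s - (k' + 1)) (by omega) (by omega) h2 m
      rw [e _ (by omega)] at this
      exact this hm
  have hblock : ∀ s : ℕ, 1 ≤ s → s + (k' + 1) ≤ n + 1 →
      select (s : ZMod (k' + 1)) (concat α s (k' + 1)) ∈ P (proj (concat α s (k' + 1))) := by
    intro s h1 h2
    have := h.block_mem (s - 1) (by omega)
    rwa [block_eq_concat, Nat.sub_add_cancel h1] at this
  -- A word in parentheses has one opening parenthesis, and `start` accounts for it at the head of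
  -- `α s`.
  have hop : ∀ s : ℕ, 1 ≤ s → s + (k' + 1) ≤ n + 1 →
      (∀ x, α s = .inr ((s : ZMod (k' + 1)), .op) :: x → .inr ((s : ZMod (k' + 1)), .op) ∉ x) ∧
      ∀ i, s < i → i < s + (k' + 1) → .inr ((s : ZMod (k' + 1)), .op) ∉ α i := by
    intro s h1 h2
    obtain ⟨b, hb, -⟩ := hP (hblock s h1 h2)
    obtain ⟨x, hx⟩ := h.start s h1 h2
    rw [List.singleton_append] at hx
    rw [concat_succ, ← hx, select_append, select_inr_self, wrap_eq, List.cons_append] at hb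
    have hb' := (List.cons.inj hb).2
    have key : .inr Marker.op ∉ select (s : ZMod (k' + 1)) x ++
        select (s : ZMod (k' + 1)) (concat α (s + 1) k') := by
      rw [hb']
      simp [op_notMem_map_sub]
    rw [← select_append, inr_mem_select, List.mem_append, not_or] at key
    refine ⟨fun y hy => ?_, fun i h3 h4 hi => key.2 (mem_concat.2 ⟨i, h3, by omega, hi⟩)⟩
    rw [← hx] at hy
    rw [← (List.cons.inj hy).2]
    exact key.1
  -- Likewise the one closing parenthesis is at the end of the last segment `α (s + k')`, where its
  -- index `s + k' + 1` is `s` modulo `k`.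
  have hcl : ∀ s : ℕ, 1 ≤ s → s + (k' + 1) ≤ n + 1 →
      (∀ y, α (s + k') = y ++ [.inr ((s : ZMod (k' + 1)), .cl)] →
        .inr ((s : ZMod (k' + 1)), .cl) ∉ y) ∧
      ∀ i, s ≤ i → i < s + k' → .inr ((s : ZMod (k' + 1)), .cl) ∉ α i := by
    intro s h1 h2
    obtain ⟨b, hb, -⟩ := hP (hblock s h1 h2)
    obtain ⟨x, hx⟩ := h.close (s + k') (by omega) (by omega)
    have e : ((s + k' + 1 : ℕ) : ZMod (k' + 1)) = s := by
      rw [add_assoc]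
      simp
    rw [e] at hx
    rw [concat_succ', ← hx, select_append, select_append, select_inr_self, select_nil, wrap_eq,
      ← List.append_assoc, ← List.cons_append, List.append_left_inj] at hb
    have key : .inr Marker.cl ∉ select (s : ZMod (k' + 1)) (concat α s k') ++
        select (s : ZMod (k' + 1)) x := by
      rw [hb]
      simp [cl_notMem_map_sub]
    rw [← select_append, inr_mem_select, List.mem_append, not_or] at key
    refine ⟨fun y hy => ?_, fun i h3 h4 hi => key.1 (mem_concat.2 ⟨i, h3, by omega, hi⟩)⟩
    rw [← hx, List.append_left_inj] at hy
    rw [← hy]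
    exact key.2
  have hform : ∀ i, ∃ β, 1 ≤ i → i ≤ n →
      α i = opening A S (k' + 1) n i ++ (List.map emb β ++ closing A S (k' + 1) i) := by
    intro i
    by_cases hi : 1 ≤ i ∧ i ≤ n
    swap
    · exact ⟨[], fun h1 h2 => absurd ⟨h1, h2⟩ hi⟩
    obtain ⟨h1, h2⟩ := hi
    obtain ⟨x, hx, hxo⟩ : ∃ x, α i = opening A S (k' + 1) n i ++ x ∧ ∀ j, .inr (j, .op) ∉ x := by
      unfold opening
      split_ifs with ho
      · obtain ⟨x, hx⟩ := h.start i h1 ho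
        refine ⟨x, hx.symm, fun j hj => ?_⟩
        obtain ⟨s, hs, rfl⟩ := hact i j .op h1 h2 (by rw [← hx]; exact List.mem_append_right _ hj)
        rcases hs.2.1.eq_or_lt with rfl | h3
        · exact (hop s hs.1 hs.2.2.2).1 x hx.symm hj
        · exact (hop s hs.1 hs.2.2.2).2 i h3 hs.2.2.1
            (by rw [← hx]; exact List.mem_append_right _ hj)
      · refine ⟨α i, rfl, fun j hj => ?_⟩
        obtain ⟨s, hs, rfl⟩ := hact i j .op h1 h2 hj
        have := hs.2.2.2
        exact (hop s hs.1 hs.2.2.2).2 i (by have := hs.2.1; rcases hs.2.1.eq_or_lt with rfl | h3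
                                            · omega
                                            · exact h3) hs.2.2.1 hj
    have hcl' : ∀ j, .inr (j, .cl) ∈ α i → i + 1 = (i - k') + (k' + 1) ∧ k' < i ∧
        j = ((i - k' : ℕ) : ZMod (k' + 1)) := by
      intro j hj
      obtain ⟨s, hs, rfl⟩ := hact i j .cl h1 h2 hj
      have h3 : ¬ i < s + k' := fun h3 => (hcl s hs.1 hs.2.2.2).2 i hs.2.1 h3 hj
      obtain ⟨h4, h5, h6, h7⟩ := hs
      have : s = i - k' := by omega
      exact ⟨by omega, by omega, by rw [this]⟩
    obtain ⟨y, hy, hyc⟩ : ∃ y, α i = y ++ closing A S (k' + 1) i ∧ ∀ j, .inr (j, .cl) ∉ y := by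
      unfold closing
      split_ifs with hc
      · obtain ⟨y, hy⟩ := h.close i hc h2
        refine ⟨y, hy.symm, fun j hj => ?_⟩
        obtain ⟨h3, h4, rfl⟩ := hcl' j (by rw [← hy]; exact List.mem_append_left _ hj)
        have h5 : i - k' + k' = i := by omega
        refine (hcl (i - k') (by omega) (by omega)).1 y ?_ hj
        rw [h5, ← hy, h3]
        simp
      · exact ⟨α i, by simp, fun j hj => by have := hcl' j hj; omega⟩
    -- The prefix and the suffix that are removed have at most one symbol each, and these symbols
    -- differ, so they do not overlap.
    obtain ⟨z, hz1, hz2⟩ : ∃ z, x = z ++ closing A S (k' + 1) i ∧ y = opening A S (k' + 1) n i ++ z := by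
      have hxy := hx.symm.trans hy
      rw [List.append_eq_append_iff] at hxy
      rcases hxy with ⟨z, h3, h4⟩ | ⟨z, h3, h4⟩
      · exact ⟨z, h4, h3⟩
      · rcases z with _ | ⟨c, z⟩
        · exact ⟨[], by simpa using h4.symm, by simpa using h3.symm⟩
        · exfalso
          have h5 : c ∈ closing A S (k' + 1) i := by rw [h4]; simp
          have h6 : c ∈ opening A S (k' + 1) n i := by rw [h3]; simp
          unfold closing at h5
          unfold opening at h6
          split_ifs at h5 h6 <;> simp_all
    obtain ⟨β, rfl⟩ := exists_map_emb z
      (fun j hj => hxo j (by rw [hz1]; exact List.mem_append_left _ hj))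
      (fun j hj => hyc j (by rw [hz2]; exact List.mem_append_right _ hj))
    exact ⟨β, fun _ _ => by rw [hx, hz1]⟩
  choose β hβ using hform
  have hb : IsBody (k' + 1) n β := by
    refine ⟨fun i h1 h2 => ?_, fun i j m h1 h2 hm => ?_⟩
    · have e : ((i + 1 : ℕ) : ZMod (k' + 1)) = (i : ZMod (k' + 1)) + 1 := by push_cast; rfl
      refine Sorted.of_order (fun j j' m m' hm => ?_) (fun j m x hx => ?_)
      · have := h.order i h1 h2 j j' (.sub m) (.sub m') ?_ (by simp)
        · rwa [e] at this
        · rw [hβ i h1 h2]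
          have h3 := hm.map (emb : A ⊕ (ZMod (k' + 1) × S) → _)
          exact h3.trans ((List.prefix_append _ _).isInfix.trans (List.suffix_append _ _).isInfix)
      -- The initial bound `i` comes from the adjacent opening parenthesis if there is one;
      -- otherwise `start_late` forbids a leading marker.
      · by_cases ho : i + (k' + 1) ≤ n + 1
        · have := h.order i h1 h2 i j .op (.sub m) ?_ (by simp)
          · rwa [e] at this
          · rw [hβ i h1 h2, opening, if_pos ho, hx]
            exact ⟨[], List.map emb x ++ closing A S (k' + 1) i, by simp⟩
        · have h3 := hβ i h1 h2
          rw [opening, if_neg ho, hx] at h3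
          rcases h.start_late i (by omega) h2 with ⟨a, ha⟩ | ha | ⟨-, ha⟩
          · rw [h3] at ha
            simp at ha
          · rw [h3] at ha
            simp at ha
          · rw [h3] at ha
            simp at ha
    · refine hact i j (.sub m) h1 h2 ?_
      rw [hβ i h1 h2]
      refine List.mem_append_right _ (List.mem_append_left _ ?_)
      exact List.mem_map.2 ⟨_, hm, rfl⟩
  refine ⟨β, hb, hβ, fun s h1 h2 => ?_⟩
  have e : concat α s (k' + 1) = concat (decorate n β) s (k' + 1) :=
    concat_congr fun i h3 h4 => hβ i (by omega) (by omega)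
  have := hblock s h1 h2
  rw [e, select_concat_decorate h1 h2, proj_concat] at this
  simpa using this

end Decoration

end Parsing

namespace Parsing

/-! ### Words with separators, for short and for long factorizations. -/

section KStarWords

variable {A : Type*} {S : Type} {k : ℕ}

theorem flatten_append_sep_injective {X : Type*} {x : X} {l l' : List (List X)}
    (hl : ∀ u ∈ l, x ∉ u) (hl' : ∀ u ∈ l', x ∉ u)
    (h : (l.map (· ++ [x])).flatten = (l'.map (· ++ [x])).flatten) : l = l' := by
  induction l generalizing l' with
  | nil =>
    cases l' with
    | nil => rfl
    | cons u l' => simp at h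
  | cons u l ih =>
    cases l' with
    | nil => simp at h
    | cons u' l' =>
      simp only [List.map_cons, List.flatten_cons, List.append_assoc, List.singleton_append] at h
      obtain ⟨rfl, h'⟩ := append_cons_inj (hl _ (by simp)) (hl' _ (by simp)) h
      rw [ih (fun u hu => hl u (List.mem_cons_of_mem _ hu))
        (fun u hu => hl' u (List.mem_cons_of_mem _ hu)) h']

theorem intercalate_append_sep {X : Type*} (x : X) (l : List (List X)) (hl : l ≠ []) :
    [x].intercalate l ++ [x] = (l.map (· ++ [x])).flatten := by
  induction l with
  | nil => exact absurd rfl hl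
  | cons u l ih =>
    cases l with
    | nil => simp
    | cons v l => rw [List.intercalate_cons_cons, List.append_assoc, ih (by simp)]; simp

theorem intercalate_injective {X : Type*} {x : X} {l l' : List (List X)} (h0 : l ≠ [])
    (h0' : l' ≠ []) (hl : ∀ u ∈ l, x ∉ u) (hl' : ∀ u ∈ l', x ∉ u)
    (h : [x].intercalate l = [x].intercalate l') : l = l' := by
  apply flatten_append_sep_injective hl hl'
  rw [← intercalate_append_sep _ _ h0, ← intercalate_append_sep _ _ h0', h]

/-- The words `u_1 # u_2 # ⋯ u_n #`. -/
def shortWord (us : List (List A)) : List (A ⊕ (Unit ⊕ (ZMod k × Marker S))) :=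
  (us.map fun u => u.map .inl ++ [.inr (.inl ())]).flatten

/-- The words `α_1 # α_2 # ⋯ # α_n`. -/
def longWord (n : ℕ) (α : ℕ → List (A ⊕ (ZMod k × Marker S))) :
    List (A ⊕ (Unit ⊕ (ZMod k × Marker S))) :=
  List.intercalate [.inr (.inl ())] ((List.range' 1 n).map fun i => (α i).map (Sum.map id .inr))

theorem shortWord_injective :
    Function.Injective (shortWord : _ → List (A ⊕ (Unit ⊕ (ZMod k × Marker S)))) := by
  intro us us' h
  have key : ∀ us : List (List A), shortWord us = (((us.map (List.map
      (Sum.inl : A → A ⊕ (Unit ⊕ (ZMod k × Marker S))))).map (· ++ [.inr (.inl ())])).flatten) := by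
    intro us
    simp [shortWord, Function.comp_def]
  rw [key, key] at h
  refine List.map_injective_iff.2 (List.map_injective_iff.2 Sum.inl_injective)
    (flatten_append_sep_injective ?_ ?_ h) <;> simp

theorem sep_notMem (α : List (A ⊕ (ZMod k × Marker S))) :
    (.inr (.inl ()) : A ⊕ (Unit ⊕ (ZMod k × Marker S))) ∉ α.map (Sum.map id .inr) :=
  notMem_map_sumMap (by simp) α

theorem longWord_inj {n n' : ℕ} {α α' : ℕ → List (A ⊕ (ZMod k × Marker S))} (hn : 1 ≤ n)
    (hn' : 1 ≤ n') (h : longWord n α = longWord n' α') :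
    n = n' ∧ ∀ i, 1 ≤ i → i ≤ n → α i = α' i := by
  have := intercalate_injective (by simp; omega) (by simp; omega) ?_ ?_ h
  · have hl : n = n' := by simpa using congrArg List.length this
    subst hl
    refine ⟨rfl, fun i h1 h2 => ?_⟩
    have := List.map_inj_left.1 this i (by simp; omega)
    exact map_sumMap_injective Sum.inr_injective this
  · intro u hu
    obtain ⟨i, -, rfl⟩ := List.mem_map.1 hu
    exact sep_notMem _
  · intro u hu
    obtain ⟨i, -, rfl⟩ := List.mem_map.1 hu
    exact sep_notMem _

theorem range'_add_one (s n : ℕ) : List.range' (s + 1) n = (List.range' s n).map (· + 1) :=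
  List.ext_getElem (by simp) fun i _ _ => by simp; omega

theorem longWord_succ (n : ℕ) (α : ℕ → List (A ⊕ (ZMod k × Marker S))) :
    longWord (n + 1) α = (α 1).map (Sum.map id .inr) ++ (if n = 0 then [] else
      .inr (.inl ()) :: longWord n fun i => α (i + 1)) := by
  rw [longWord, List.range'_succ, range'_add_one, List.map_cons, List.map_map]
  cases n with
  | zero => simp
  | succ n =>
    rw [List.range'_succ, List.map_cons, List.intercalate_cons_cons, longWord, List.range'_succ]
    simp [Function.comp_def]

@[simp] theorem proj_shortWord (us : List (List A)) :
    proj (shortWord us : List (A ⊕ (Unit ⊕ (ZMod k × Marker S)))) = us.flatten := by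
  induction us with
  | nil => rfl
  | cons u us ih =>
    simp only [shortWord, List.map_cons, List.flatten_cons, proj_append, proj_map_inl] at ih ⊢
    rw [ih]
    simp

theorem proj_longWord (n : ℕ) : ∀ α : ℕ → List (A ⊕ (ZMod k × Marker S)),
    proj (longWord n α) = concat (fun i => proj (α i)) 1 n := by
  induction n with
  | zero => intro α; simp [longWord]
  | succ n ih =>
    intro α
    rw [longWord_succ, concat_succ, proj_append, proj_map]
    congr 1
    split_ifs with h
    · subst h; rfl
    · rw [proj_inr, ih]
      simp [concat, range'_add_one 1, Function.comp_def]

/-- Short words consist of letters and separators, so a single marker of the argument tells the two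
kinds apart. For decorated words, `op_mem_decorate_one` provides it. -/
theorem longWord_ne_shortWord {n : ℕ} {α : ℕ → List (A ⊕ (ZMod k × Marker S))} {us}
    (hn : 1 ≤ n) {m} (h : .inr m ∈ α 1) : longWord n α ≠ shortWord us := by
  obtain ⟨n, rfl⟩ := Nat.exists_eq_succ_of_ne_zero (by omega : n ≠ 0)
  intro e
  have h1 : .inr (.inr m) ∈ longWord (n + 1) α := by
    rw [longWord_succ]
    exact List.mem_append_left _ (List.mem_map.2 ⟨_, h, rfl⟩)
  rw [Nat.succ_eq_add_one] at e
  rw [e] at h1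
  simp [shortWord] at h1

end KStarWords

/-! ### Factorizations indexed from `1`, and their blocks. -/

section KStarFactorizations

variable {A : Type*}

theorem exists_eq_map_range' {X : Type*} [Nonempty X] (us : List X) :
    ∃ u : ℕ → X, us = (List.range' 1 us.length).map u := by
  classical
  obtain ⟨x⟩ := ‹Nonempty X›
  refine ⟨fun i => us.getD (i - 1) x, List.ext_getElem (by simp) fun i h1 h2 => ?_⟩
  simp [h1]

theorem flatten_map_range' (u : ℕ → List A) (s n : ℕ) :
    ((List.range' s n).map u).flatten = concat u s n := rfl

theorem blocks_map_range' (k n : ℕ) (u : ℕ → List A) :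
    RTE.blocks k ((List.range' 1 n).map u) =
      (List.range (n + 1 - k)).map fun i => concat u (i + 1) k := by
  simp only [RTE.blocks, List.length_map, List.length_range']
  refine List.map_congr_left fun i hi => ?_
  rw [List.mem_range] at hi
  rw [← List.map_drop, ← List.map_take, concat]
  congr 2
  refine List.ext_getElem ?_ fun j h1 h2 => ?_
  · simp; omega
  · simp; omega

theorem blocks_eq_nil {k : ℕ} {us : List (List A)} (h : us.length < k) : RTE.blocks k us = [] := by
  simp [RTE.blocks, show us.length + 1 - k = 0 by omega]

end KStarFactorizations

/-! ### Parsings for a `k`-star as encodings of factorizations. -/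

section KStarParsing

variable {A : Type*} {S : Type} {k : ℕ} [NeZero k] {L : Language A}
  {P : List A → Set (List (A ⊕ Marker S))}

theorem decorate_inj {n : ℕ} {β β' : ℕ → List (A ⊕ (ZMod k × S))} {i : ℕ}
    (h : decorate n β i = decorate n β' i) : β i = β' i :=
  List.map_injective_iff.2 emb_injective
    (List.append_cancel_right (List.append_cancel_left h))

/-- Trades the conditions of `IsLong` for bodies, the form that both machines work with. -/
theorem mem_kstar_iff (hP : IsParsing P) {w γ} : γ ∈ kstar k L P w ↔
    (∃ us : List (List A), us.length < k ∧ (∀ u ∈ us, u ∈ L) ∧ w = us.flatten ∧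
      γ = wrap (shortWord us)) ∨
    ∃ (n : ℕ) (β : ℕ → List (A ⊕ (ZMod k × S))), k ≤ n ∧ (∀ i, 1 ≤ i → i ≤ n → proj (β i) ∈ L) ∧
      w = concat (fun i => proj (β i)) 1 n ∧ IsBody k n β ∧
      (∀ s : ℕ, 1 ≤ s → s + k ≤ n + 1 →
        wrap (select (s : ZMod k) (concat β s k)) ∈ P (concat (fun i => proj (β i)) s k)) ∧
      γ = wrap (longWord n (decorate n β)) := by
  refine or_congr Iff.rfl ⟨?_, ?_⟩
  · rintro ⟨n, α, hk, hL, rfl, hα, rfl⟩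
    obtain ⟨β, h1, h2, h3⟩ := hα.exists_isBody hP hk
    refine ⟨n, β, hk, fun i h4 h5 => ?_, ?_, h1, h3, ?_⟩
    · have := hL i h4 h5
      rwa [h2 i h4 h5, proj_decorate] at this
    · rw [block_eq_concat, proj_concat]
      exact concat_congr fun i h4 h5 => by rw [h2 i h4 (by omega), proj_decorate]
    · unfold longWord
      congr 2
      refine List.map_congr_left fun i hi => ?_
      simp only [List.mem_range'_1] at hi
      rw [h2 i hi.1 (by omega)]
  · rintro ⟨n, β, hk, hL, rfl, h1, h2, rfl⟩
    refine ⟨n, decorate n β, hk, fun i h4 h5 => ?_, ?_, h1.isLong hk (fun _ _ _ => rfl) h2, rfl⟩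
    · simpa using hL i h4 h5
    · rw [block_eq_concat, proj_concat]
      exact concat_congr fun i h4 h5 => by simp

theorem IsParsing.kstar (hP : IsParsing P) : IsParsing (kstar k L P) := by
  intro w γ h
  rcases (mem_kstar_iff hP).1 h with ⟨us, -, -, rfl, rfl⟩ | ⟨n, β, -, -, rfl, -, -, rfl⟩
  · exact ⟨_, rfl, proj_shortWord us⟩
  · exact ⟨_, rfl, by simp [proj_longWord]⟩

/-- `γ` is the parsing for a `k`-star given by a factorization and by parsings of its blocks. -/
def KStarEnc (k : ℕ) (us : List (List A)) (ys : List (List (A ⊕ Marker S)))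
    (γ : List (A ⊕ Marker (Unit ⊕ (ZMod k × Marker S)))) : Prop :=
  (us.length < k ∧ γ = wrap (shortWord us)) ∨
  (k ≤ us.length ∧ ∃ β : ℕ → List (A ⊕ (ZMod k × S)), IsBody k us.length β ∧
    us = (List.range' 1 us.length).map (fun i => proj (β i)) ∧
    ys = (List.range (us.length + 1 - k)).map
      (fun i => wrap (select ((i + 1 : ℕ) : ZMod k) (concat β (i + 1) k))) ∧
    γ = wrap (longWord us.length (decorate us.length β)))

theorem op_mem_decorate_one {n : ℕ} (hk : k ≤ n) (β : ℕ → List (A ⊕ (ZMod k × S))) :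
    .inr (((1 : ℕ) : ZMod k), Marker.op) ∈ decorate n β 1 :=
  mem_decorate.2 (.inl ⟨rfl, by omega, rfl⟩)

/-- A code exists by `exists_isBody` and is unique by `IsBody.ext`. It is decoded by telling short
from long words, cutting at the separators and removing the parentheses added by `decorate`. -/
theorem isEncoding_kstar (hP : IsParsing P) (w : List A) : IsEncoding (kstar k L P w)
    (fun us : List (List A) => w = us.flatten ∧ ∀ u ∈ us, u ∈ L) (RTE.blocks k) P
    (KStarEnc k) where
  mem_iff γ := by
    rw [mem_kstar_iff hP]
    constructor
    · rintro (⟨us, h1, h2, h3, h4⟩ | ⟨n, β, hk, hL, rfl, h1, h2, h3⟩)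
      · exact ⟨us, [], ⟨h3, h2⟩, by rw [blocks_eq_nil h1]; exact .nil, .inl ⟨h1, h4⟩⟩
      · refine ⟨(List.range' 1 n).map fun i => proj (β i), (List.range (n + 1 - k)).map
            (fun i => wrap (select ((i + 1 : ℕ) : ZMod k) (concat β (i + 1) k))), ⟨rfl, ?_⟩, ?_,
            .inr ?_⟩
        · intro u hu
          obtain ⟨i, hi, rfl⟩ := List.mem_map.1 hu
          simp only [List.mem_range'_1] at hi
          exact hL i hi.1 (by omega)
        · rw [blocks_map_range', List.forall₂_map_left_iff, List.forall₂_map_right_iff,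
            List.forall₂_same]
          intro i hi
          rw [List.mem_range] at hi
          exact h2 (i + 1) (by omega) (by omega)
        · simp only [List.length_map, List.length_range']
          exact ⟨hk, β, h1, rfl, rfl, h3⟩
    · rintro ⟨us, ys, ⟨rfl, h2⟩, h3, ⟨h4, h5⟩ | ⟨h4, β, h5, h6, h7, h8⟩⟩
      · exact .inl ⟨us, h4, h2, rfl, h5⟩
      · refine .inr ⟨us.length, β, h4, fun i h9 h10 => h2 _ ?_, ?_, h5, fun s h9 h10 => ?_, h8⟩
        · rw [h6]
          refine List.mem_map.2 ⟨i, ?_, rfl⟩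
          simp; omega
        · conv_lhs => rw [h6]
          rfl
        · rw [h6, blocks_map_range', h7, List.forall₂_map_left_iff, List.forall₂_map_right_iff] at h3
          rw [List.forall₂_same] at h3
          have := h3 (s - 1) (by rw [List.mem_range]; omega)
          rwa [Nat.sub_add_cancel h9] at this
  exists_enc us ys := by
    rintro ⟨rfl, h2⟩ h3
    by_cases hk : us.length < k
    · exact ⟨_, .inl ⟨hk, rfl⟩⟩
    · push Not at hk
      obtain ⟨u, hu⟩ := exists_eq_map_range' us
      obtain ⟨zs, rfl, hz⟩ := forall₂_eq_map_wrap hP h3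
      rw [hu, blocks_map_range'] at hz
      obtain ⟨z, hz'⟩ := exists_eq_map_range' zs
      have hl : us.length + 1 - k = zs.length := by simpa using congrArg List.length hz
      have hz2 : zs = (List.range zs.length).map fun i => z (i + 1) := by
        conv_lhs => rw [hz']
        rw [List.range_eq_range', range'_add_one 0, List.map_map]
        rfl
      rw [hz2, ← hl, List.map_map, List.map_inj_left] at hz
      obtain ⟨β, h4, h5, h6⟩ := exists_isBody (k := k) (n := us.length) u z (fun s h1 h2 => by
        have := hz (s - 1) (by rw [List.mem_range]; omega)
        simp only [Function.comp_apply, Nat.sub_add_cancel h1] at this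
        exact this.symm)
      refine ⟨_, .inr ⟨hk, β, h4, ?_, ?_, rfl⟩⟩
      · conv_lhs => rw [hu]
        refine List.map_congr_left fun i hi => ?_
        simp only [List.mem_range'_1] at hi
        exact (h5 i hi.1 (by omega)).symm
      · rw [hz2, ← hl, List.map_map]
        refine List.map_congr_left fun i hi => ?_
        rw [List.mem_range] at hi
        simp only [Function.comp_apply]
        rw [h6 (i + 1) (by omega) (by omega)]
  enc_unique {us ys z z'} := by
    rintro - - (⟨h1, rfl⟩ | ⟨h1, β, h2, h3, h4, rfl⟩) (⟨h1', rfl⟩ | ⟨h1', β', h2', h3', h4', rfl⟩)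
    · rfl
    · omega
    · omega
    · have hp : ∀ i, 1 ≤ i → i ≤ us.length → proj (β i) = proj (β' i) := by
        intro i h5 h6
        exact List.map_inj_left.1 (h3.symm.trans h3') i (by simp; omega)
      have hs := List.map_inj_left.1 (h4.symm.trans h4')
      have := h2.ext h2' hp fun s h5 h6 => by
        have := hs (s - 1) (by rw [List.mem_range]; omega)
        rw [Nat.sub_add_cancel h5] at this
        exact wrap_inj.1 this
      unfold longWord
      congr 2
      refine List.map_congr_left fun i hi => ?_
      simp only [List.mem_range'_1] at hi
      simp [decorate, this i hi.1 (by omega)]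
  decode {us ys us' ys' z} := by
    have hpos : 0 < k := Nat.pos_of_ne_zero (NeZero.ne k)
    rintro - h2 - h2' (⟨h3, rfl⟩ | ⟨h3, β, h4, h5, h6, rfl⟩)
      (⟨h3', h7⟩ | ⟨h3', β', h4', h5', h6', h7⟩)
    · obtain rfl := shortWord_injective (wrap_inj.1 h7)
      rw [blocks_eq_nil h3] at h2 h2'
      cases h2
      cases h2'
      exact ⟨rfl, rfl⟩
    · exact absurd (wrap_inj.1 h7).symm
        (longWord_ne_shortWord (by omega) (op_mem_decorate_one h3' β'))
    · exact absurd (wrap_inj.1 h7)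
        (longWord_ne_shortWord (by omega) (op_mem_decorate_one h3 β))
    · obtain ⟨hn, h8⟩ := longWord_inj (by omega) (by omega) (wrap_inj.1 h7)
      rw [← hn] at h5' h6' h8
      have hβ : ∀ i, 1 ≤ i → i ≤ us.length → β i = β' i := fun i h9 h10 => decorate_inj (h8 i h9 h10)
      constructor
      · rw [h5, h5']
        refine List.map_congr_left fun i hi => ?_
        simp only [List.mem_range'_1] at hi
        rw [hβ i hi.1 (by omega)]
      · rw [h6, h6']
        refine List.map_congr_left fun i hi => ?_
        rw [List.mem_range] at hi
        rw [concat_congr fun j h9 h10 => hβ j (by omega) (by omega)]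

end KStarParsing

end Parsing

/-! ### The domain and the unambiguous domain in terms of parsings. -/

namespace RTE

open Parsing

variable {A B : Type*}

theorem isParsing_parse (h : RTE A B) : IsParsing h.parse := by
  induction h with
  | base e v => exact isParsing_base _
  | sum f g hf hg => exact hf.sum hg
  | cauchy f g hf hg | rcauchy f g hf hg => exact hf.cauchy hg
  | star f hf | rstar f hf => exact hf.star
  | had f g hf hg => exact hf.had
  | kstar k e f hf | krstar k e f hf => exact hf.kstar

theorem parse_nonempty_iff (h : RTE A B) : ∀ w, (h.parse w).Nonempty ↔ w ∈ h.dom := by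
  induction h with
  | base e v => exact fun w => base_nonempty
  | sum f g hf hg =>
    intro w
    refine (sum_nonempty (P := f.parse) (Q := g.parse)).trans ?_
    rw [hf, hg]
    exact (Language.mem_add _ _ _).symm
  | cauchy f g hf hg | rcauchy f g hf hg =>
    intro w
    refine (cauchy_nonempty (P := f.parse) (Q := g.parse)).trans ?_
    rw [dom, Language.mem_mul]
    simp only [hf, hg]
    exact ⟨fun ⟨u, v, h, hu, hv⟩ => ⟨u, hu, v, hv, h.symm⟩,
      fun ⟨u, hu, v, hv, h⟩ => ⟨u, v, h.symm, hu, hv⟩⟩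
  | star f hf | rstar f hf =>
    intro w
    refine (isEncoding_star f.isParsing_parse w).nonempty_iff.trans ?_
    rw [dom, Language.mem_kstar]
    simp only [hf, id]
  | had f g hf hg =>
    intro w
    refine (had_nonempty f.isParsing_parse g.isParsing_parse).trans ?_
    rw [hf, hg]
    exact Iff.rfl
  | kstar k e f hf | krstar k e f hf =>
    intro w
    refine (isEncoding_kstar f.isParsing_parse w).nonempty_iff.trans ?_
    simp only [hf, and_assoc]
    exact Iff.rfl

/-- For each operator, the criterion for a unique parsing has the shape of the definition of `udom`.
For stars and `k`-stars the definition also asks that the factors or blocks lie in the domain;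
having a unique parsing implies it. -/
theorem udom_eq_fdom (h : RTE A B) : h.udom = fdom h.parse := by
  induction h with
  | base e v => exact (fdom_base _).symm
  | sum f g hf hg =>
    ext w
    refine Iff.trans ?_ (mem_fdom_sum f.isParsing_parse g.isParsing_parse).symm
    rw [← hf, ← hg, parse_nonempty_iff, parse_nonempty_iff]
    exact Iff.rfl
  | cauchy f g hf hg | rcauchy f g hf hg =>
    ext w
    refine Iff.trans ?_ (mem_fdom_cauchy f.isParsing_parse g.isParsing_parse).symm
    rw [← hf, ← hg]
    simp only [parse_nonempty_iff]
    exact Iff.rfl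
  | star f hf | rstar f hf =>
    ext w
    refine Iff.trans ?_ (mem_fdom.trans (isEncoding_star f.isParsing_parse w).existsUnique_iff).symm
    rw [← hf]
    simp only [parse_nonempty_iff, id]
    constructor
    · rintro ⟨us, h1, h2, h3, h4⟩
      exact ⟨us, h1, h3, h4⟩
    · rintro ⟨us, h1, h3, h4⟩
      refine ⟨us, h1, fun u hu => (f.parse_nonempty_iff u).1 (nonempty_of_mem_fdom ?_), h3, h4⟩
      rw [← hf]
      exact h3 u hu
  | had f g hf hg =>
    ext w
    refine Iff.trans ?_ (mem_fdom_had f.isParsing_parse g.isParsing_parse).symm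
    rw [← hf, ← hg]
    exact Iff.rfl
  | kstar k e f hf | krstar k e f hf =>
    ext w
    refine Iff.trans ?_
      (mem_fdom.trans (isEncoding_kstar f.isParsing_parse w).existsUnique_iff).symm
    rw [← hf]
    simp only [parse_nonempty_iff]
    constructor
    · rintro ⟨us, ⟨h1, h2, h3⟩, h4, h5⟩
      exact ⟨us, ⟨h1, h2⟩, h4, fun us' h6 h7 => h5 us' ⟨h6.1, h6.2, h7⟩⟩
    · rintro ⟨us, ⟨h1, h2⟩, h4, h5⟩
      refine ⟨us, ⟨h1, h2, fun b hb => (f.parse_nonempty_iff b).1 (nonempty_of_mem_fdom ?_)⟩, h4,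
        fun us' h6 => h5 us' ⟨h6.1, h6.2.1⟩ h6.2.2⟩
      rw [← hf]
      exact h4 b hb

end RTE

/-! ### Paths of labelled graphs -/

/-- Paths in a graph labelled by letters. -/
def LPath {Q Y : Type*} (step : Q → Y → Q → Prop) : Q → List Y → Q → Prop
  | p, [], q => p = q
  | p, y :: w, q => ∃ r, step p y r ∧ LPath step r w q

namespace LPath

variable {Q Y : Type*} {step : Q → Y → Q → Prop}

@[simp] theorem nil_iff {p q : Q} : LPath step p [] q ↔ p = q := Iff.rfl

@[simp] theorem cons_iff {p q : Q} {y w} :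
    LPath step p (y :: w) q ↔ ∃ r, step p y r ∧ LPath step r w q := Iff.rfl

theorem append_iff {p q : Q} {u v : List Y} :
    LPath step p (u ++ v) q ↔ ∃ r, LPath step p u r ∧ LPath step r v q := by
  induction u generalizing p with
  | nil => simp
  | cons y u ih =>
    simp only [List.cons_append, cons_iff, ih]
    exact ⟨fun ⟨r, h, s, h1, h2⟩ => ⟨s, ⟨r, h, h1⟩, h2⟩, fun ⟨s, ⟨r, h, h1⟩, h2⟩ => ⟨r, h, s, h1, h2⟩⟩

theorem append {p q r : Q} {u v : List Y} (h : LPath step p u q) (h' : LPath step q v r) :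
    LPath step p (u ++ v) r := append_iff.2 ⟨q, h, h'⟩

theorem concat_iff {f : ℕ → List Y} (m : ℕ) : ∀ {s : ℕ} {p q : Q},
    LPath step p (Parsing.concat f s m) q ↔ ∃ σ : ℕ → Q, σ s = p ∧ σ (s + m) = q ∧
      ∀ i, s ≤ i → i < s + m → LPath step (σ i) (f i) (σ (i + 1)) := by
  induction m with
  | zero =>
    intro s p q
    constructor
    · rintro rfl
      exact ⟨fun _ => p, rfl, rfl, fun i h1 h2 => by omega⟩
    · rintro ⟨σ, rfl, rfl, -⟩
      rfl
  | succ m ih =>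
    intro s p q
    rw [Parsing.concat_succ, append_iff]
    simp only [ih]
    constructor
    · rintro ⟨r, h, σ, rfl, rfl, h'⟩
      refine ⟨fun i => if i = s then p else σ i, by simp, ?_, fun i h1 h2 => ?_⟩
      · simp only [show s + (m + 1) ≠ s by omega, if_false]
        congr 1
        omega
      · rcases h1.eq_or_lt with rfl | h1
        · simpa using h
        · simp only [show i ≠ s by omega, show i + 1 ≠ s by omega, if_false]
          exact h' i h1 (by omega)
    · rintro ⟨σ, rfl, rfl, h⟩
      exact ⟨σ (s + 1), h s le_rfl (by omega), σ, rfl, by congr 1; omega,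
        fun i h1 h2 => h i (by omega) (by omega)⟩

end LPath

/-! ### The position automaton of a regular expression -/

/-- Automata with an initial state (`none`) that has no incoming transition. -/
structure PosAut (A : Type*) where
  P : Type
  fintype : Fintype P
  step : Option P → A → P → Prop
  fin : Option P → Prop

namespace PosAut

variable {A : Type*}

attribute [instance] PosAut.fintype

/-- `G.Acc x w`: the word `w` is accepted from the state `x`. -/
def Acc (G : PosAut A) : Option G.P → List A → Prop
  | x, [] => G.fin x
  | x, a :: w => ∃ q, G.step x a q ∧ G.Acc (some q) w

/-- The accepted language. -/
def lang (G : PosAut A) : Language A := {w | G.Acc none w}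

/-- Union. -/
def plus (G H : PosAut A) : PosAut A where
  P := G.P ⊕ H.P
  fintype := inferInstance
  step
    | none, a, .inl q => G.step none a q
    | none, a, .inr q => H.step none a q
    | some (.inl p), a, .inl q => G.step (some p) a q
    | some (.inr p), a, .inr q => H.step (some p) a q
    | some (.inl _), _, .inr _ => False
    | some (.inr _), _, .inl _ => False
  fin
    | none => G.fin none ∨ H.fin none
    | some (.inl p) => G.fin (some p)
    | some (.inr p) => H.fin (some p)

/-- Concatenation. -/
def comp (G H : PosAut A) : PosAut A where
  P := G.P ⊕ H.P
  fintype := inferInstance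
  step
    | none, a, .inl q => G.step none a q
    | none, a, .inr q => G.fin none ∧ H.step none a q
    | some (.inl p), a, .inl q => G.step (some p) a q
    | some (.inl p), a, .inr q => G.fin (some p) ∧ H.step none a q
    | some (.inr p), a, .inr q => H.step (some p) a q
    | some (.inr _), _, .inl _ => False
  fin
    | none => G.fin none ∧ H.fin none
    | some (.inl p) => G.fin (some p) ∧ H.fin none
    | some (.inr p) => H.fin (some p)

/-- Iteration. -/
def star (G : PosAut A) : PosAut A where
  P := G.P
  fintype := inferInstance
  step x a q := G.step x a q ∨ (G.fin x ∧ G.step none a q)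
  fin x := x = none ∨ G.fin x

theorem acc_plus (G H : PosAut A) (w : List A) :
    (plus G H).Acc none w ↔ G.Acc none w ∨ H.Acc none w := by
  have h1 : ∀ w p, (plus G H).Acc (some (.inl p)) w ↔ G.Acc (some p) w := by
    intro w
    induction w with
    | nil => exact fun p => Iff.rfl
    | cons a w ih =>
      intro p
      constructor
      · rintro ⟨q | q, h, h'⟩
        · exact ⟨q, h, (ih q).1 h'⟩
        · exact h.elim
      · rintro ⟨q, h, h'⟩
        exact ⟨.inl q, h, (ih q).2 h'⟩
  have h2 : ∀ w p, (plus G H).Acc (some (.inr p)) w ↔ H.Acc (some p) w := by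
    intro w
    induction w with
    | nil => exact fun p => Iff.rfl
    | cons a w ih =>
      intro p
      constructor
      · rintro ⟨q | q, h, h'⟩
        · exact h.elim
        · exact ⟨q, h, (ih q).1 h'⟩
      · rintro ⟨q, h, h'⟩
        exact ⟨.inr q, h, (ih q).2 h'⟩
  cases w with
  | nil => exact Iff.rfl
  | cons a w =>
    constructor
    · rintro ⟨q | q, h, h'⟩
      · exact .inl ⟨q, h, (h1 w q).1 h'⟩
      · exact .inr ⟨q, h, (h2 w q).1 h'⟩
    · rintro (⟨q, h, h'⟩ | ⟨q, h, h'⟩)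
      · exact ⟨.inl q, h, (h1 w q).2 h'⟩
      · exact ⟨.inr q, h, (h2 w q).2 h'⟩

theorem acc_comp (G H : PosAut A) (w : List A) :
    (comp G H).Acc none w ↔ ∃ u v, w = u ++ v ∧ G.Acc none u ∧ H.Acc none v := by
  have h2 : ∀ w p, (comp G H).Acc (some (.inr p)) w ↔ H.Acc (some p) w := by
    intro w
    induction w with
    | nil => exact fun p => Iff.rfl
    | cons a w ih =>
      intro p
      constructor
      · rintro ⟨q | q, h, h'⟩
        · exact h.elim
        · exact ⟨q, h, (ih q).1 h'⟩
      · rintro ⟨q, h, h'⟩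
        exact ⟨.inr q, h, (ih q).2 h'⟩
  -- Stated for all states of `G`, since after one letter the run has left the initial state.
  have key : ∀ (x : Option G.P) (w : List A), (comp G H).Acc (x.map .inl) w ↔
      ∃ u v, w = u ++ v ∧ G.Acc x u ∧ H.Acc none v := by
    intro x w
    have hstep : ∀ a q, (comp G H).step (x.map .inl) a (.inl q) ↔ G.step x a q := by
      cases x <;> exact fun _ _ => Iff.rfl
    have hstep' : ∀ a q, (comp G H).step (x.map .inl) a (.inr q) ↔ G.fin x ∧ H.step none a q := by
      cases x <;> exact fun _ _ => Iff.rfl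
    induction w generalizing x with
    | nil =>
      have hfin : (comp G H).fin (x.map .inl) ↔ G.fin x ∧ H.fin none := by
        cases x <;> exact Iff.rfl
      constructor
      · intro h
        exact ⟨[], [], rfl, hfin.1 h⟩
      · rintro ⟨u, v, h, hu, hv⟩
        obtain ⟨rfl, rfl⟩ := List.append_eq_nil_iff.1 h.symm
        exact hfin.2 ⟨hu, hv⟩
    | cons a w ih =>
      constructor
      · rintro ⟨q | q, h, h'⟩
        · obtain ⟨u, v, rfl, hu, hv⟩ := (ih (some q) (fun _ _ => Iff.rfl) (fun _ _ => Iff.rfl)).1 h'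
          exact ⟨a :: u, v, rfl, ⟨q, (hstep _ _).1 h, hu⟩, hv⟩
        · obtain ⟨h3, h4⟩ := (hstep' _ _).1 h
          exact ⟨[], a :: w, rfl, h3, q, h4, (h2 w q).1 h'⟩
      · rintro ⟨u, v, h, hu, hv⟩
        rcases u with _ | ⟨b, u⟩
        · rw [List.nil_append] at h
          subst h
          obtain ⟨q, h3, h4⟩ := hv
          exact ⟨.inr q, (hstep' _ _).2 ⟨hu, h3⟩, (h2 w q).2 h4⟩
        · rw [List.cons_append, List.cons.injEq] at h
          obtain ⟨rfl, rfl⟩ := h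
          obtain ⟨q, h3, h4⟩ := hu
          exact ⟨.inl q, (hstep _ _).2 h3,
            (ih (some q) (fun _ _ => Iff.rfl) (fun _ _ => Iff.rfl)).2 ⟨u, v, rfl, h4, hv⟩⟩
  exact key none w

/-- A run is cut at the transitions borrowed from the initial state: there the current factor is
accepted and a new one begins with the letter read. -/
theorem acc_star (G : PosAut A) (w : List A) :
    (star G).Acc none w ↔ w ∈ KStar.kstar G.lang := by
  -- From `x` the word first completes the factor in progress. In the state `none` there may be no
  -- such factor, hence the alternative `u = []`.
  have h1 : ∀ (w : List A) (x : Option G.P), (star G).Acc x w → ∃ u v, w = u ++ v ∧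
      (x = none ∧ u = [] ∨ G.Acc x u) ∧ v ∈ KStar.kstar G.lang := by
    intro w
    induction w with
    | nil =>
      rintro x (h | h)
      · exact ⟨[], [], rfl, .inl ⟨h, rfl⟩, Language.nil_mem_kstar _⟩
      · exact ⟨[], [], rfl, .inr h, Language.nil_mem_kstar _⟩
    | cons a w ih =>
      rintro x ⟨q, h, h'⟩
      obtain ⟨u, v, rfl, hu, hv⟩ := ih _ h'
      have hu : G.Acc (some q) u := hu.resolve_left fun h => nomatch h.1
      rcases h with h | ⟨h, h3⟩
      · exact ⟨a :: u, v, rfl, .inr ⟨q, h, hu⟩, hv⟩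
      · refine ⟨[], a :: (u ++ v), rfl, .inr h, ?_⟩
        have : a :: u ∈ G.lang := ⟨q, h3, hu⟩
        obtain ⟨L, rfl, hL⟩ := Language.mem_kstar.1 hv
        exact Language.mem_kstar.2 ⟨(a :: u) :: L, rfl, by simpa using ⟨this, hL⟩⟩
  have h3 : ∀ (v : List A), (star G).Acc none v → ∀ (u : List A) (x : Option G.P), G.Acc x u →
      (star G).Acc x (u ++ v) := by
    intro v hv u
    induction u with
    | nil =>
      intro x hx
      cases v with
      | nil => exact .inr hx
      | cons a v =>
        obtain ⟨q, h, h'⟩ := hv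
        refine ⟨q, .inr ⟨hx, ?_⟩, h'⟩
        rcases h with h | ⟨-, h⟩ <;> exact h
    | cons a u ih =>
      rintro x ⟨q, h, h'⟩
      exact ⟨q, .inl h, ih _ h'⟩
  constructor
  · intro h
    obtain ⟨u, v, rfl, ⟨-, rfl⟩ | hu, hv⟩ := h1 _ _ h
    · exact hv
    · obtain ⟨L, rfl, hL⟩ := Language.mem_kstar.1 hv
      exact Language.mem_kstar.2 ⟨u :: L, rfl, by simpa using ⟨hu, hL⟩⟩
  · intro h
    obtain ⟨L, rfl, hL⟩ := Language.mem_kstar.1 h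
    clear h
    induction L with
    | nil => exact .inl rfl
    | cons u L ih =>
      exact h3 _ (ih fun y hy => hL y (List.mem_cons_of_mem _ hy)) u none (hL u (by simp))

/-- A regular expression is recognized by an automaton with one state for each occurrence of a letter,
and an initial state. -/
theorem exists_acc_iff (e : RegularExpression A) : ∃ G : PosAut A, Fintype.card G.P = e.nl ∧
    ∀ w, G.Acc none w ↔ w ∈ e.matches' := by
  induction e with
  | zero =>
    refine ⟨⟨Empty, inferInstance, fun _ _ _ => False, fun _ => False⟩, rfl, fun w => ?_⟩
    cases w with
    | nil => exact ⟨False.elim, False.elim⟩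
    | cons a w => exact ⟨fun ⟨_, h, _⟩ => h.elim, False.elim⟩
  | epsilon =>
    refine ⟨⟨Empty, inferInstance, fun _ _ _ => False, fun _ => True⟩, rfl, fun w => ?_⟩
    cases w with
    | nil => exact ⟨fun _ => rfl, fun _ => trivial⟩
    | cons a w => exact ⟨fun ⟨_, h, _⟩ => h.elim, fun h => by cases h⟩
  | char a =>
    refine ⟨⟨Unit, inferInstance, fun x b _ => x = none ∧ b = a, fun x => x ≠ none⟩, rfl,
      fun w => ?_⟩
    change _ ↔ w = [a]
    rcases w with _ | ⟨b, _ | ⟨c, w⟩⟩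
    · simp [Acc]
    · simp [Acc]
    · simp [Acc]
  | plus e f he hf =>
    obtain ⟨G, hG, hG'⟩ := he
    obtain ⟨H, hH, hH'⟩ := hf
    refine ⟨plus G H, ?_, fun w => ?_⟩
    · rw [RegularExpression.nl, ← hG, ← hH]
      exact Fintype.card_sum
    · rw [acc_plus, hG', hH']
      exact (Language.mem_add _ _ _).symm
  | comp e f he hf =>
    obtain ⟨G, hG, hG'⟩ := he
    obtain ⟨H, hH, hH'⟩ := hf
    refine ⟨comp G H, ?_, fun w => ?_⟩
    · rw [RegularExpression.nl, ← hG, ← hH]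
      exact Fintype.card_sum
    · rw [acc_comp, RegularExpression.matches', Language.mem_mul]
      simp only [hG', hH']
      exact ⟨fun ⟨u, v, h, hu, hv⟩ => ⟨u, hu, v, hv, h.symm⟩,
        fun ⟨u, hu, v, hv, h⟩ => ⟨u, v, h.symm, hu, hv⟩⟩
  | star e he =>
    obtain ⟨G, hG, hG'⟩ := he
    refine ⟨star G, hG, fun w => ?_⟩
    rw [acc_star, RegularExpression.matches']
    have : G.lang = e.matches' := by
      ext w
      exact hG' w
    rw [this]

/-- Transitions between states. -/
def Step (G : PosAut A) (x : Option G.P) (a : A) (y : Option G.P) : Prop :=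
  ∃ q, y = some q ∧ G.step x a q

theorem acc_iff (G : PosAut A) (w : List A) : ∀ x, G.Acc x w ↔ ∃ y, LPath G.Step x w y ∧ G.fin y := by
  induction w with
  | nil => simp [Acc]
  | cons a w ih =>
    intro x
    simp only [Acc, ih, LPath.cons_iff, Step]
    constructor
    · rintro ⟨q, h, y, h1, h2⟩
      exact ⟨y, ⟨some q, ⟨q, rfl, h⟩, h1⟩, h2⟩
    · rintro ⟨y, ⟨_, ⟨q, rfl, h⟩, h1⟩, h2⟩
      exact ⟨q, h, y, h1, h2⟩

end PosAut

/-! ### Automata for the parsings -/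

/-- Nondeterministic automata with a finite type of states. -/
structure Aut (Y : Type*) where
  Q : Type
  fintype : Fintype Q
  step : Q → Y → Q → Prop
  start : Q → Prop
  accept : Q → Prop

namespace Aut

open Parsing

variable {A Y : Type*} {N S : Type}

attribute [instance] Aut.fintype

/-- The automaton accepts the word. -/
def Accepts (M : Aut Y) (w : List Y) : Prop :=
  ∃ p q, M.start p ∧ LPath M.step p w q ∧ M.accept q

/-- There is at most one marker between two states. -/
def Functional (M : Aut (A ⊕ N)) : Prop :=
  ∀ ⦃p q m m'⦄, M.step p (.inr m) q → M.step p (.inr m') q → m = m'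

/-- Relabelling of the markers. -/
def map (M : Aut (A ⊕ S)) (f : S → N) : Aut (A ⊕ N) where
  Q := M.Q
  fintype := inferInstance
  step p y q := ∃ x, M.step p x q ∧ y = Sum.map id f x
  start := M.start
  accept := M.accept

theorem Functional.map {M : Aut (A ⊕ S)} (h : M.Functional) (f : S → N) :
    (M.map f).Functional := by
  rintro p q m m' ⟨a | x, h1, h2⟩ ⟨b | y, h3, h4⟩
  · simp at h2
  · simp at h2
  · simp at h4
  · simp only [Sum.map_inr, Sum.inr.injEq] at h2 h4
    rw [h2, h4, h h1 h3]

theorem path_map {M : Aut (A ⊕ S)} {f : S → N} {w : List (A ⊕ N)} : ∀ {p q : M.Q},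
    LPath (M.map f).step p w q ↔ ∃ u, w = u.map (Sum.map id f) ∧ LPath M.step p u q := by
  induction w with
  | nil =>
    intro p q
    constructor
    · intro h
      exact ⟨[], rfl, h⟩
    · rintro ⟨u, h, h'⟩
      obtain rfl := List.map_eq_nil_iff.1 h.symm
      exact h'
  | cons y w ih =>
    intro p q
    constructor
    · rintro ⟨r, ⟨x, h, rfl⟩, h'⟩
      obtain ⟨u, rfl, hu⟩ := ih.1 h'
      exact ⟨x :: u, rfl, r, h, hu⟩
    · rintro ⟨u, h, h'⟩
      obtain ⟨x, u, rfl, rfl, rfl⟩ := List.map_eq_cons_iff.1 h.symm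
      obtain ⟨r, h1, h2⟩ := h'
      exact ⟨r, ⟨x, h1, rfl⟩, ih.2 ⟨u, rfl, h2⟩⟩

theorem accepts_map {M : Aut (A ⊕ S)} {f : S → N} {w : List (A ⊕ N)} :
    (M.map f).Accepts w ↔ ∃ u, w = u.map (Sum.map id f) ∧ M.Accepts u := by
  constructor
  · rintro ⟨p, q, h1, h2, h3⟩
    obtain ⟨u, rfl, hu⟩ := path_map.1 h2
    exact ⟨u, rfl, p, q, h1, hu, h3⟩
  · rintro ⟨u, rfl, p, q, h1, h2, h3⟩
    exact ⟨p, q, h1, path_map.2 ⟨u, rfl, h2⟩, h3⟩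

/-! ### Graphs whose edges carry automata. -/

section Graph

variable {I Z : Type} [Fintype I] [Fintype Z] (M : I → Aut (A ⊕ N)) (op cl : I → N)
  (src tgt : I → Z)

/-- Transitions of a graph whose edges `src i → tgt i` are replaced by automata `M i`, entered by
`op i` and left by `cl i`. -/
inductive GraphStep : Z ⊕ (Σ i, (M i).Q) → A ⊕ N → Z ⊕ (Σ i, (M i).Q) → Prop
  | enter {i s} : (M i).start s → GraphStep (.inl (src i)) (.inr (op i)) (.inr ⟨i, s⟩)
  | inner {i p y q} : (M i).step p y q → GraphStep (.inr ⟨i, p⟩) y (.inr ⟨i, q⟩)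
  | leave {i p} : (M i).accept p → GraphStep (.inr ⟨i, p⟩) (.inr (cl i)) (.inl (tgt i))

/-- A graph whose edges are replaced by automata. -/
def graph (z₀ z₁ : Z) : Aut (A ⊕ N) where
  Q := Z ⊕ (Σ i, (M i).Q)
  fintype := inferInstance
  step := GraphStep M op cl src tgt
  start := (· = .inl z₀)
  accept := (· = .inl z₁)

/-- An interior state remembers its edge, so the parenthesis on a transition into or out of `M i` is
determined by its ends; no transition joins two vertices. -/
theorem functional_graph {M : I → Aut (A ⊕ N)} (h : ∀ i, (M i).Functional) (z₀ z₁ : Z) :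
    (graph M op cl src tgt z₀ z₁).Functional := by
  rintro p q m m' h1 h2
  cases h1 with
  | @enter i s h1 =>
    generalize hx : (Sum.inl (src i) : Z ⊕ (Σ i, (M i).Q)) = x at h2
    cases h2 with
    | enter => rfl
    | inner => simp at hx
  | inner h1 => cases h2 with | inner h2 => exact h _ h1 h2
  | leave h1 => cases h2; rfl

/-- Words read along paths of the graph. -/
inductive Chain : Z → List (A ⊕ N) → Z → Prop
  | nil (z) : Chain z [] z
  | cons {i z β γ} : (M i).Accepts β → Chain (tgt i) γ z →
      Chain (src i) (.inr (op i) :: (β ++ .inr (cl i) :: γ)) z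

theorem chain_iff {z z' : Z} {γ : List (A ⊕ N)} : Chain M op cl src tgt z γ z' ↔
    (z = z' ∧ γ = []) ∨ ∃ i β γ', z = src i ∧ γ = .inr (op i) :: (β ++ .inr (cl i) :: γ') ∧
      (M i).Accepts β ∧ Chain M op cl src tgt (tgt i) γ' z' := by
  constructor
  · intro h
    cases h with
    | nil => exact .inl ⟨rfl, rfl⟩
    | cons h h' => exact .inr ⟨_, _, _, rfl, rfl, h, h'⟩
  · rintro (⟨rfl, rfl⟩ | ⟨i, β, γ', rfl, rfl, h, h'⟩)
    · exact .nil _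
    · exact .cons h h'

/-- Vertices and interior states are treated together, because reading one symbol may lead from one
kind to the other. -/
theorem chain_of_path {γ : List (A ⊕ N)} {z' : Z} :
    (∀ z, LPath (GraphStep M op cl src tgt) (.inl z) γ (.inl z') → Chain M op cl src tgt z γ z') ∧
    ∀ i p, LPath (GraphStep M op cl src tgt) (.inr ⟨i, p⟩) γ (.inl z') → ∃ β q γ',
      γ = β ++ .inr (cl i) :: γ' ∧ LPath (M i).step p β q ∧ (M i).accept q ∧
        Chain M op cl src tgt (tgt i) γ' z' := by
  induction γ with
  | nil =>
    constructor
    · intro z h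
      cases h
      exact .nil _
    · intro i p h
      cases h
  | cons y γ ih =>
    constructor
    · rintro z ⟨r, h, h'⟩
      cases h with
      | enter h =>
        obtain ⟨β, q, γ', rfl, h1, h2, h3⟩ := ih.2 _ _ h'
        exact .cons ⟨_, _, h, h1, h2⟩ h3
    · rintro i p ⟨r, h, h'⟩
      cases h with
      | inner h =>
        obtain ⟨β, q, γ', rfl, h1, h2, h3⟩ := ih.2 _ _ h'
        exact ⟨_ :: β, q, γ', rfl, ⟨_, h, h1⟩, h2, h3⟩
      | leave h => exact ⟨[], p, γ, rfl, rfl, h, ih.1 _ h'⟩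

theorem path_graph_inner {i : I} {β : List (A ⊕ N)} : ∀ {p q}, LPath (M i).step p β q →
    LPath (GraphStep M op cl src tgt) (.inr ⟨i, p⟩) β (.inr ⟨i, q⟩) := by
  induction β with
  | nil => rintro p q rfl; rfl
  | cons y β ih =>
    rintro p q ⟨r, h, h'⟩
    exact ⟨_, .inner h, ih h'⟩

theorem accepts_graph {z₀ z₁ : Z} {γ : List (A ⊕ N)} :
    (graph M op cl src tgt z₀ z₁).Accepts γ ↔ Chain M op cl src tgt z₀ γ z₁ := by
  constructor
  · rintro ⟨p, q, rfl, h, rfl⟩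
    exact (chain_of_path M op cl src tgt).1 _ h
  · intro h
    refine ⟨_, _, rfl, ?_, rfl⟩
    change LPath (GraphStep M op cl src tgt) _ _ _
    induction h with
    | nil z => rfl
    | cons h _ ih =>
      obtain ⟨p, q, h1, h2, h3⟩ := h
      exact ⟨_, .enter h1, (path_graph_inner M op cl src tgt h2).append ⟨_, .leave h3, ih⟩⟩

theorem card_graph (z₀ z₁ : Z) : Fintype.card (graph M op cl src tgt z₀ z₁).Q =
    Fintype.card Z + ∑ i, Fintype.card (M i).Q :=
  Fintype.card_sum.trans (congrArg _ Fintype.card_sigma)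

end Graph

/-- `M` recognizes the parsings of `P`, without their outer parentheses. -/
structure Recognizes (M : Aut (A ⊕ S)) (P : List A → Set (List (A ⊕ Marker S))) : Prop where
  functional : M.Functional
  accepts_iff : ∀ β, M.Accepts β ↔ wrap β ∈ P (proj β)

/-- There is no marker between the outer parentheses, so the position automaton of `e` serves as it
is. -/
theorem exists_recognizes_base (e : RegularExpression A) : ∃ M : Aut (A ⊕ Empty),
    M.Recognizes (base e.matches') ∧ Fintype.card M.Q = e.nl + 1 := by
  obtain ⟨G, hG, hG'⟩ := PosAut.exists_acc_iff e
  refine ⟨⟨Option G.P, inferInstance, fun p y q => ∃ a, y = .inl a ∧ G.Step p a q, (· = none),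
    G.fin⟩, ⟨fun p q m => m.elim, fun β => ?_⟩, by simp [hG]⟩
  have hβ : ∀ β : List (A ⊕ Empty), β = (proj β).map .inl := by
    intro β
    induction β with
    | nil => rfl
    | cons x β ih =>
      rcases x with a | x
      · rw [proj_inl, List.map_cons, ← ih]
      · exact x.elim
  have h1 : wrap β ∈ base e.matches' (proj β) ↔ proj β ∈ e.matches' :=
    ⟨fun h => h.1, fun h => ⟨h, by rw [← hβ β]⟩⟩
  rw [h1, ← hG', G.acc_iff]
  have h2 : ∀ (β : List (A ⊕ Empty)) (p q : Option G.P),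
      LPath (fun p y q => ∃ a, y = .inl a ∧ G.Step p a q) p β q ↔ LPath G.Step p (proj β) q := by
    intro β
    induction β with
    | nil => simp
    | cons x β ih =>
      intro p q
      rcases x with a | x
      · simp [ih]
      · exact x.elim
  simp only [Accepts]
  constructor
  · rintro ⟨p, q, rfl, h3, h4⟩
    exact ⟨q, (h2 _ _ _).1 h3, h4⟩
  · rintro ⟨q, h3, h4⟩
    exact ⟨none, q, rfl, (h2 _ _ _).2 h3, h4⟩

/-! ### Recognizing the parsings for sums and Cauchy products. -/

section Binary

variable {M₁ M₂ : Type} {P : List A → Set (List (A ⊕ Marker M₁))}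
  {Q : List A → Set (List (A ⊕ Marker M₂))} {F : Aut (A ⊕ M₁)} {G : Aut (A ⊕ M₂)}

/-- The automata of two subexpressions, over the markers of the whole expression. -/
def pair (F : Aut (A ⊕ M₁)) (G : Aut (A ⊕ M₂)) (b : Bool) : Aut (A ⊕ (Marker M₁ ⊕ Marker M₂)) :=
  cond b (G.map (.inr ∘ .sub)) (F.map (.inl ∘ .sub))

theorem functional_pair (hF : F.Functional) (hG : G.Functional) (b : Bool) :
    (pair F G b).Functional := by
  cases b
  · exact hF.map _
  · exact hG.map _

/-- The parentheses of two subexpressions. -/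
def pairMarker (M₁ M₂ : Type) (m : ∀ {S : Type}, Marker S) (b : Bool) : Marker M₁ ⊕ Marker M₂ :=
  cond b (.inr m) (.inl m)

theorem accepts_pair_false (hF : F.Recognizes P) {β} : (pair F G false).Accepts β ↔
    ∃ α, β = α.map (Sum.map id (.inl ∘ .sub)) ∧ wrap α ∈ P (proj α) := by
  simp only [← hF.accepts_iff]
  exact accepts_map

theorem accepts_pair_true (hG : G.Recognizes Q) {β} : (pair F G true).Accepts β ↔
    ∃ α, β = α.map (Sum.map id (.inr ∘ .sub)) ∧ wrap α ∈ Q (proj α) := by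
  simp only [← hG.accepts_iff]
  exact accepts_map

theorem map_wrap {f : Marker S → N} (α : List (A ⊕ S)) : (wrap α).map (Sum.map id f) =
    .inr (f .op) :: (α.map (Sum.map id (f ∘ .sub)) ++ [.inr (f .cl)]) := by
  simp [wrap_eq, Sum.map_comp_map]

theorem mem_sum_iff (hP : IsParsing P) (hQ : IsParsing Q) {γ : List (A ⊕ (Marker M₁ ⊕ Marker M₂))} :
    wrap γ ∈ sum P Q (proj γ) ↔
      (∃ α, wrap α ∈ P (proj α) ∧ γ = (wrap α).map (Sum.map id Sum.inl)) ∨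
      ∃ α, wrap α ∈ Q (proj α) ∧ γ = (wrap α).map (Sum.map id Sum.inr) := by
  constructor
  · rintro (⟨α, h, e⟩ | ⟨α, h, e⟩)
    · obtain rfl := wrap_inj.1 e
      obtain ⟨α, rfl, h'⟩ := hP h
      rw [← h'] at h
      exact .inl ⟨α, h, rfl⟩
    · obtain rfl := wrap_inj.1 e
      obtain ⟨α, rfl, h'⟩ := hQ h
      rw [← h'] at h
      exact .inr ⟨α, h, rfl⟩
  · rintro (⟨α, h, rfl⟩ | ⟨α, h, rfl⟩)
    · exact .inl ⟨_, by simpa using h, rfl⟩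
    · exact .inr ⟨_, by simpa using h, rfl⟩

theorem mem_cauchy_iff (hP : IsParsing P) (hQ : IsParsing Q)
    {γ : List (A ⊕ (Marker M₁ ⊕ Marker M₂))} : wrap γ ∈ cauchy P Q (proj γ) ↔
      ∃ α β, wrap α ∈ P (proj α) ∧ wrap β ∈ Q (proj β) ∧
        γ = (wrap α).map (Sum.map id Sum.inl) ++ (wrap β).map (Sum.map id Sum.inr) := by
  constructor
  · rintro ⟨u, v, -, α, h, β, h', e⟩
    obtain rfl := wrap_inj.1 e
    obtain ⟨α, rfl, rfl⟩ := hP h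
    obtain ⟨β, rfl, rfl⟩ := hQ h'
    exact ⟨α, β, h, h', rfl⟩
  · rintro ⟨α, β, h, h', rfl⟩
    exact ⟨_, _, by simp, _, h, _, h', rfl⟩

/-- Two vertices joined by two parallel edges, one for each subexpression: a path from one vertex to
the other takes exactly one edge. -/
theorem exists_recognizes_sum (hP : IsParsing P) (hQ : IsParsing Q) (hF : F.Recognizes P)
    (hG : G.Recognizes Q) : ∃ M : Aut (A ⊕ (Marker M₁ ⊕ Marker M₂)), M.Recognizes (sum P Q) ∧
      Fintype.card M.Q = Fintype.card F.Q + Fintype.card G.Q + 2 := by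
  refine ⟨graph (pair F G) (pairMarker M₁ M₂ .op) (pairMarker M₁ M₂ .cl) (fun _ => false)
    (fun _ => true) false true, ⟨functional_graph _ _ _ _ (functional_pair hF.functional
      hG.functional) _ _, fun γ => ?_⟩, ?_⟩
  · rw [accepts_graph, mem_sum_iff hP hQ]
    constructor
    · intro h
      obtain ⟨⟨⟩, -⟩ | ⟨i, β, γ', -, rfl, h0, h'⟩ := (chain_iff _ _ _ _ _).1 h
      obtain ⟨-, rfl⟩ | ⟨i', β', γ', ⟨⟩, -⟩ := (chain_iff _ _ _ _ _).1 h'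
      cases i
      · obtain ⟨α, rfl, h1⟩ := (accepts_pair_false hF).1 h0
        exact .inl ⟨α, h1, by rw [map_wrap]; rfl⟩
      · obtain ⟨α, rfl, h1⟩ := (accepts_pair_true hG).1 h0
        exact .inr ⟨α, h1, by rw [map_wrap]; rfl⟩
    · rintro (⟨α, h, rfl⟩ | ⟨α, h, rfl⟩)
      · rw [map_wrap]
        exact .cons (i := false) ((accepts_pair_false hF).2 ⟨α, rfl, h⟩) (.nil _)
      · rw [map_wrap]
        exact .cons (i := true) ((accepts_pair_true hG).2 ⟨α, rfl, h⟩) (.nil _)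
  · rw [card_graph, Fintype.sum_bool, Fintype.card_bool, add_comm, add_comm (Fintype.card F.Q)]
    rfl

/-- Three vertices in a row, `0 → 1 → 2`, with `F` on the first edge and `G` on the second. -/
theorem exists_recognizes_cauchy (hP : IsParsing P) (hQ : IsParsing Q) (hF : F.Recognizes P)
    (hG : G.Recognizes Q) : ∃ M : Aut (A ⊕ (Marker M₁ ⊕ Marker M₂)), M.Recognizes (cauchy P Q) ∧
      Fintype.card M.Q = Fintype.card F.Q + Fintype.card G.Q + 3 := by
  refine ⟨graph (pair F G) (pairMarker M₁ M₂ .op) (pairMarker M₁ M₂ .cl)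
    (fun b => cond b 1 0) (fun b => cond b 2 1) (0 : Fin 3) 2,
    ⟨functional_graph _ _ _ _ (functional_pair hF.functional
      hG.functional) _ _, fun γ => ?_⟩, ?_⟩
  · rw [accepts_graph, mem_cauchy_iff hP hQ]
    constructor
    · intro h
      obtain ⟨h0, -⟩ | ⟨i, β, γ, h0, rfl, h4, h'⟩ := (chain_iff _ _ _ _ _).1 h
      · simp at h0
      cases i
      swap
      · simp at h0
      obtain ⟨h0, -⟩ | ⟨i, β', γ, h0, rfl, h1, h'⟩ := (chain_iff _ _ _ _ _).1 h'
      · simp at h0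
      cases i
      · simp at h0
      obtain ⟨-, rfl⟩ | ⟨i, -, -, h0, -⟩ := (chain_iff _ _ _ _ _).1 h'
      swap
      · cases i <;> simp at h0
      obtain ⟨α, rfl, h2⟩ := (accepts_pair_false hF).1 h4
      obtain ⟨α', rfl, h3⟩ := (accepts_pair_true hG).1 h1
      exact ⟨α, α', h2, h3, by rw [map_wrap, map_wrap]; simp [pairMarker]⟩
    · rintro ⟨α, β, h, h', rfl⟩
      rw [map_wrap, map_wrap]
      have h2 := Chain.cons (op := pairMarker M₁ M₂ .op) (cl := pairMarker M₁ M₂ .cl)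
        (src := fun b => (cond b 1 0 : Fin 3)) (tgt := fun b => (cond b 2 1 : Fin 3))
        (i := true) ((accepts_pair_true (F := F) hG).2 ⟨β, rfl, h'⟩) (.nil _)
      have h3 := Chain.cons (op := pairMarker M₁ M₂ .op) (cl := pairMarker M₁ M₂ .cl)
        (src := fun b => (cond b 1 0 : Fin 3)) (tgt := fun b => (cond b 2 1 : Fin 3))
        (i := false) ((accepts_pair_false (G := G) hF).2 ⟨α, rfl, h⟩) h2
      simpa [pairMarker] using h3
  · rw [card_graph, Fintype.sum_bool, Fintype.card_fin, add_comm, add_comm (Fintype.card F.Q)]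
    rfl

end Binary

/-! ### Outer parentheses, and recognizing the parsings for stars. -/

section Unary

variable {P : List A → Set (List (A ⊕ Marker S))} {F : Aut (A ⊕ S)}

/-- The automaton for the words in parentheses. -/
def wrapAut (F : Aut (A ⊕ S)) : Aut (A ⊕ Marker S) :=
  graph (fun _ : Unit => F.map .sub) (fun _ => .op) (fun _ => .cl) (fun _ => false) (fun _ => true)
    false true

theorem card_wrapAut (F : Aut (A ⊕ S)) : Fintype.card F.wrapAut.Q = Fintype.card F.Q + 2 := by
  rw [wrapAut, card_graph, Fintype.card_bool, add_comm]
  simp only [Finset.univ_unique, Finset.sum_singleton]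
  rfl

theorem functional_wrapAut (hF : F.Recognizes P) : F.wrapAut.Functional :=
  functional_graph _ _ _ _ (fun _ => hF.functional.map _) _ _

theorem accepts_wrapAut (hP : IsParsing P) (hF : F.Recognizes P) {α} :
    F.wrapAut.Accepts α ↔ α ∈ P (proj α) := by
  rw [wrapAut, accepts_graph]
  constructor
  · intro h
    obtain ⟨⟨⟩, -⟩ | ⟨i, β, γ', -, rfl, h0, h'⟩ := (chain_iff _ _ _ _ _).1 h
    obtain ⟨-, rfl⟩ | ⟨i', β', γ', ⟨⟩, -⟩ := (chain_iff _ _ _ _ _).1 h'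
    obtain ⟨β, rfl, h1⟩ := accepts_map.1 h0
    rw [hF.accepts_iff] at h1
    rw [← wrap_eq]
    simpa using h1
  · intro h
    obtain ⟨β, rfl, h'⟩ := hP h
    rw [proj_wrap] at h
    exact .cons (i := ()) (accepts_map.2 ⟨β, rfl, (hF.accepts_iff _).2 h⟩) (.nil _)

theorem mem_star_iff_map (hP : IsParsing P) {γ : List (A ⊕ Marker S)} : wrap γ ∈ star P (proj γ) ↔
    ∃ zs : List (List (A ⊕ S)), (∀ z ∈ zs, wrap z ∈ P (proj z)) ∧ γ = (zs.map wrap).flatten := by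
  rw [mem_star_iff]
  constructor
  · rintro ⟨us, ys, -, h, e⟩
    obtain ⟨zs, rfl, rfl⟩ := forall₂_eq_map_wrap hP h
    rw [List.forall₂_map_left_iff, List.forall₂_map_right_iff, List.forall₂_same] at h
    exact ⟨zs, h, wrap_inj.1 e⟩
  · rintro ⟨zs, h, rfl⟩
    refine ⟨zs.map proj, zs.map wrap, ?_, ?_, rfl⟩
    · simp [proj_flatten, Function.comp_def]
    · rwa [List.forall₂_map_left_iff, List.forall₂_map_right_iff, List.forall₂_same]

/-- One vertex with a loop that carries `F`: its paths spell the sequences of parsings. -/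
theorem exists_recognizes_star (hP : IsParsing P) (hF : F.Recognizes P) :
    ∃ M : Aut (A ⊕ Marker S), M.Recognizes (star P) ∧
      Fintype.card M.Q = Fintype.card F.Q + 1 := by
  refine ⟨graph (fun _ : Unit => F.map .sub) (fun _ => .op) (fun _ => .cl) (fun _ => ()) (fun _ => ())
    () (), ⟨functional_graph _ _ _ _ (fun _ => hF.functional.map _) _ _, fun γ => ?_⟩, ?_⟩
  · rw [accepts_graph, mem_star_iff_map hP]
    constructor
    · intro h
      have key : ∀ z z' γ, Chain (fun _ : Unit => F.map .sub) (fun _ => .op) (fun _ => .cl)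
          (fun _ => ()) (fun _ => ()) z γ z' →
          ∃ zs : List (List (A ⊕ S)), (∀ z ∈ zs, wrap z ∈ P (proj z)) ∧ γ = (zs.map wrap).flatten := by
        intro z z' γ h
        induction h with
        | nil z => exact ⟨[], by simp⟩
        | cons h _ ih =>
          obtain ⟨zs, h1, rfl⟩ := ih
          obtain ⟨z, rfl, h2⟩ := accepts_map.1 h
          exact ⟨z :: zs, by simpa using ⟨(hF.accepts_iff _).1 h2, h1⟩, by simp [wrap_eq]⟩
      exact key _ _ _ h
    · rintro ⟨zs, h, rfl⟩
      induction zs with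
      | nil => exact .nil _
      | cons z zs ih =>
        simp only [List.forall_mem_cons] at h
        have := Chain.cons (M := fun _ : Unit => F.map Marker.sub) (op := fun _ => .op)
          (cl := fun _ => .cl) (src := fun _ => ()) (tgt := fun _ => ()) (i := ())
          (accepts_map.2 ⟨z, rfl, (hF.accepts_iff _).2 h.1⟩) (ih h.2)
        simpa [wrap_eq] using this
  · rw [card_graph, Fintype.card_unit, add_comm]
    simp only [Finset.univ_unique, Finset.sum_singleton]
    rfl

end Unary

/-! ### Recognizing the parsings for Hadamard products. -/

section Hadamard

variable {M₁ M₂ : Type} {P : List A → Set (List (A ⊕ Marker M₁))}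
  {Q : List A → Set (List (A ⊕ Marker M₂))} {F : Aut (A ⊕ M₁)} {G : Aut (A ⊕ M₂)}

/-- Transitions of the synchronized product. The last component tells that the last symbol read is a
marker of the second kind. -/
inductive HadStep (F : Aut (A ⊕ M₁)) (G : Aut (A ⊕ M₂)) :
    F.Q × G.Q × Bool → A ⊕ (M₁ ⊕ M₂) → F.Q × G.Q × Bool → Prop
  | letter {p p' q q' b a} : F.step p (.inl a) p' → G.step q (.inl a) q' →
      HadStep F G (p, q, b) (.inl a) (p', q', false)
  | left {p p' q m} : F.step p (.inr m) p' →
      HadStep F G (p, q, false) (.inr (.inl m)) (p', q, false)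
  | right {p q q' b m} : G.step q (.inr m) q' →
      HadStep F G (p, q, b) (.inr (.inr m)) (p, q', true)

/-- Letters are read by both automata and a marker by one of them. The flag is a memory of one
symbol and refuses exactly what `Ordered` refuses. -/
theorem path_hadStep {F : Aut (A ⊕ M₁)} {G : Aut (A ⊕ M₂)} {α : List (A ⊕ (M₁ ⊕ M₂))} :
    ∀ {p q b p' q'}, (∃ b', LPath (HadStep F G) (p, q, b) α (p', q', b')) ↔
      LPath F.step p (restrictLeft α) p' ∧ LPath G.step q (restrictRight α) q' ∧ Ordered b α := by
  induction α with
  | nil => simp [Ordered]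
  | cons x α ih =>
    intro p q b p' q'
    rcases x with a | m | m
    · simp only [restrictLeft_inl, restrictRight_inl, LPath.cons_iff, Ordered]
      constructor
      · rintro ⟨b', _, h, h'⟩
        obtain ⟨h1, h2⟩ := h
        obtain ⟨h3, h4, h5⟩ := ih.1 ⟨_, h'⟩
        exact ⟨⟨_, h1, h3⟩, ⟨_, h2, h4⟩, h5⟩
      · rintro ⟨⟨p1, h1, h3⟩, ⟨q1, h2, h4⟩, h5⟩
        obtain ⟨b', h⟩ := ih.2 ⟨h3, h4, h5⟩
        exact ⟨b', _, .letter h1 h2, h⟩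
    · simp only [restrictLeft_inr_inl, restrictRight_inr_inl, LPath.cons_iff, Ordered]
      constructor
      · rintro ⟨b', _, h, h'⟩
        obtain h1 | h1 := h
        obtain ⟨h3, h4, h5⟩ := ih.1 ⟨_, h'⟩
        exact ⟨⟨_, h1, h3⟩, h4, rfl, h5⟩
      · rintro ⟨⟨p1, h1, h3⟩, h4, rfl, h5⟩
        obtain ⟨b', h⟩ := ih.2 ⟨h3, h4, h5⟩
        exact ⟨b', _, .left h1, h⟩
    · simp only [restrictLeft_inr_inr, restrictRight_inr_inr, LPath.cons_iff, Ordered]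
      constructor
      · rintro ⟨b', _, h, h'⟩
        cases h with
        | right h1 =>
          obtain ⟨h3, h4, h5⟩ := ih.1 ⟨_, h'⟩
          exact ⟨h3, ⟨_, h1, h4⟩, h5⟩
      · rintro ⟨h3, ⟨q1, h1, h4⟩, h5⟩
        obtain ⟨b', h⟩ := ih.2 ⟨h3, h4, h5⟩
        exact ⟨b', _, .right h1, h⟩

/-- The two parsings keep their own parentheses here, hence `wrapAut` with two more states for each
factor; the flag doubles the number of states. -/
theorem exists_recognizes_had (hP : IsParsing P) (hQ : IsParsing Q) (hF : F.Recognizes P)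
    (hG : G.Recognizes Q) : ∃ M : Aut (A ⊕ (Marker M₁ ⊕ Marker M₂)), M.Recognizes (had P Q) ∧
      Fintype.card M.Q = 2 * ((Fintype.card F.Q + 2) * (Fintype.card G.Q + 2)) := by
  refine ⟨⟨F.wrapAut.Q × G.wrapAut.Q × Bool, inferInstance, HadStep F.wrapAut G.wrapAut,
    fun x => F.wrapAut.start x.1 ∧ G.wrapAut.start x.2.1 ∧ x.2.2 = false,
    fun x => F.wrapAut.accept x.1 ∧ G.wrapAut.accept x.2.1⟩, ⟨?_, fun α => ?_⟩, ?_⟩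
  · rintro p q m m' h1 h2
    cases h1 with
    | left h1 => cases h2 with | left h2 => rw [functional_wrapAut hF h1 h2]
    | right h1 => cases h2 with | right h2 => rw [functional_wrapAut hG h1 h2]
  · have h1 := accepts_wrapAut hP hF (α := restrictLeft α)
    have h2 := accepts_wrapAut hQ hG (α := restrictRight α)
    rw [proj_restrictLeft] at h1
    rw [proj_restrictRight] at h2
    rw [mem_had_iff]
    have h3 : (∃ α', wrap α = wrap α' ∧ restrictLeft α' ∈ P (proj α) ∧
        restrictRight α' ∈ Q (proj α) ∧ Ordered false α') ↔ restrictLeft α ∈ P (proj α) ∧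
        restrictRight α ∈ Q (proj α) ∧ Ordered false α := by
      constructor
      · rintro ⟨α', h, h'⟩
        obtain rfl := wrap_inj.1 h
        exact h'
      · exact fun h => ⟨α, rfl, h⟩
    rw [h3, ← h1, ← h2]
    constructor
    · rintro ⟨⟨p, q, b⟩, ⟨p', q', b'⟩, ⟨h4, h5, rfl⟩, h6, h7, h8⟩
      obtain ⟨h9, h10, h11⟩ := path_hadStep.1 ⟨_, h6⟩
      exact ⟨⟨p, p', h4, h9, h7⟩, ⟨q, q', h5, h10, h8⟩, h11⟩
    · rintro ⟨⟨p, p', h4, h9, h7⟩, ⟨q, q', h5, h10, h8⟩, h11⟩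
      obtain ⟨b', h⟩ := path_hadStep.2 ⟨h9, h10, h11⟩
      exact ⟨_, _, ⟨h4, h5, rfl⟩, h, h7, h8⟩
  · rw [← card_wrapAut, ← card_wrapAut]
    simp only [Fintype.card_prod, Fintype.card_bool]
    ring

end Hadamard

end Aut

namespace Aut

open Parsing

/-! ### Unions, to be used for short and long factorizations. -/

section Union

variable {A : Type*} {N : Type}

/-- Disjoint union of two automata. -/
def union (M₁ M₂ : Aut (A ⊕ N)) : Aut (A ⊕ N) where
  Q := M₁.Q ⊕ M₂.Q
  fintype := inferInstance
  step p y q := Sum.LiftRel (M₁.step · y ·) (M₂.step · y ·) p q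
  start := Sum.elim M₁.start M₂.start
  accept := Sum.elim M₁.accept M₂.accept

variable {M₁ M₂ : Aut (A ⊕ N)}

theorem functional_union (h₁ : M₁.Functional) (h₂ : M₂.Functional) : (union M₁ M₂).Functional := by
  rintro p q m m' (h | h) h'
  · cases h' with | inl h' => exact h₁ h h'
  · cases h' with | inr h' => exact h₂ h h'

theorem accepts_union {w : List (A ⊕ N)} :
    (union M₁ M₂).Accepts w ↔ M₁.Accepts w ∨ M₂.Accepts w := by
  have h1 : ∀ (w : List (A ⊕ N)) p q, LPath (union M₁ M₂).step p w q ↔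
      Sum.LiftRel (LPath M₁.step · w ·) (LPath M₂.step · w ·) p q := by
    intro w
    induction w with
    | nil =>
      intro p q
      rw [LPath.nil_iff]
      constructor
      · rintro rfl
        rcases p with p | p
        · exact .inl rfl
        · exact .inr rfl
      · rintro (h | h)
        · exact congrArg _ h
        · exact congrArg _ h
    | cons y w ih =>
      intro p q
      simp only [LPath.cons_iff, ih]
      constructor
      · rintro ⟨r, h | h, h'⟩
        · cases h' with | inl h' => exact .inl ⟨_, h, h'⟩
        · cases h' with | inr h' => exact .inr ⟨_, h, h'⟩
      · rintro (⟨r, h, h'⟩ | ⟨r, h, h'⟩)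
        · exact ⟨.inl r, .inl h, .inl h'⟩
        · exact ⟨.inr r, .inr h, .inr h'⟩
  constructor
  · rintro ⟨p, q, h, h', h''⟩
    rcases (h1 _ _ _).1 h' with h3 | h3
    · exact .inl ⟨_, _, h, h3, h''⟩
    · exact .inr ⟨_, _, h, h3, h''⟩
  · rintro (⟨p, q, h, h', h''⟩ | ⟨p, q, h, h', h''⟩)
    · exact ⟨.inl p, .inl q, h, (h1 _ _ _).2 (.inl h'), h''⟩
    · exact ⟨.inr p, .inr q, h, (h1 _ _ _).2 (.inr h'), h''⟩

end Union

/-! ### A copy of the automaton of the argument, idle between its blocks. -/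

section Cycle

variable {A : Type*} {S : Type}

/-- Transitions of an automaton that reads letters and words in parentheses accepted by `F`. -/
inductive Cycle (F : Aut (A ⊕ S)) : Option F.Q → A ⊕ Marker S → Option F.Q → Prop
  | out {a} : Cycle F none (.inl a) none
  | op {s} : F.start s → Cycle F none (.inr .op) (some s)
  | inner {p x q} : F.step p x q → Cycle F (some p) (Sum.map id .sub x) (some q)
  | cl {p} : F.accept p → Cycle F (some p) (.inr .cl) none

variable {F : Aut (A ⊕ S)}

theorem path_cycle_some {x : List (A ⊕ S)} : ∀ {p o}, LPath (Cycle F) (some p)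
    (x.map (Sum.map id .sub)) o ↔ ∃ q, o = some q ∧ LPath F.step p x q := by
  induction x with
  | nil =>
    intro p o
    exact ⟨fun h => ⟨p, h.symm, rfl⟩, fun ⟨q, h, h'⟩ => by rw [h, LPath.nil_iff.1 h']; rfl⟩
  | cons y x ih =>
    intro p o
    constructor
    · rintro ⟨r, h, h'⟩
      generalize hy : Sum.map id Marker.sub y = z at h
      cases h with
      | inner h =>
        obtain rfl := Sum.map_injective.2 ⟨Function.injective_id, sub_injective⟩ hy
        obtain ⟨q, rfl, h1⟩ := ih.1 h'
        exact ⟨q, rfl, _, h, h1⟩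
      | cl => rcases y with y | y <;> simp at hy
    · rintro ⟨q, rfl, r, h, h'⟩
      exact ⟨_, .inner h, ih.2 ⟨q, rfl, h'⟩⟩

theorem path_cycle_none {x : List (A ⊕ S)} {o} : LPath (Cycle F) none
    (x.map (Sum.map id .sub)) o ↔ o = none ∧ ∀ m, .inr m ∉ x := by
  induction x with
  | nil => simp [eq_comm]
  | cons y x ih =>
    constructor
    · rintro ⟨r, h, h'⟩
      rcases y with a | m
      · cases h with
        | out => simpa using ih.1 h'
      · cases h
    · rintro ⟨rfl, h⟩
      rcases y with a | m
      · exact ⟨none, .out, ih.2 ⟨rfl, fun m hm => h m (by simp [hm])⟩⟩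
      · exact absurd (List.mem_cons_self) (h m)

theorem path_cycle_map {x : List (A ⊕ S)} {o o'} (h : LPath (Cycle F) o
    (x.map (Sum.map id .sub)) o') : (o' ≠ none ↔ o ≠ none) ∧ ∀ m, .inr m ∈ x → o ≠ none := by
  cases o with
  | none =>
    obtain ⟨rfl, h1⟩ := path_cycle_none.1 h
    exact ⟨Iff.rfl, fun m hm => absurd hm (h1 m)⟩
  | some p =>
    obtain ⟨q, rfl, h⟩ := path_cycle_some.1 h
    simp

theorem path_cycle_op {x : List (A ⊕ S)} {o o'} : LPath (Cycle F) o
    (.inr .op :: x.map (Sum.map id .sub)) o' ↔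
      o = none ∧ ∃ s q, o' = some q ∧ F.start s ∧ LPath F.step s x q := by
  constructor
  · rintro ⟨r, h, h'⟩
    generalize hy : (Sum.inr Marker.op : A ⊕ Marker S) = z at h
    cases h with
    | out => simp at hy
    | op h =>
      obtain ⟨q, rfl, h1⟩ := path_cycle_some.1 h'
      exact ⟨rfl, _, q, rfl, h, h1⟩
    | @inner p x q => rcases x with x | x <;> simp at hy
    | cl => simp at hy
  · rintro ⟨rfl, s, q, rfl, h, h'⟩
    exact ⟨_, .op h, path_cycle_some.2 ⟨q, rfl, h'⟩⟩

theorem path_cycle_cl {o o' : Option F.Q} : LPath (Cycle F) o [.inr .cl] o' ↔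
    o' = none ∧ ∃ q, o = some q ∧ F.accept q := by
  constructor
  · rintro ⟨r, h, rfl⟩
    generalize hy : (Sum.inr Marker.cl : A ⊕ Marker S) = z at h
    cases h with
    | out => simp at hy
    | op h => simp at hy
    | @inner p x q => rcases x with x | x <;> simp at hy
    | cl h => exact ⟨rfl, _, rfl, h⟩
  · rintro ⟨rfl, q, rfl, h⟩
    exact ⟨_, .cl h, rfl⟩

theorem path_cycle_wrap {x : List (A ⊕ S)} :
    LPath (Cycle F) none (wrap x) none ↔ F.Accepts x := by
  have h1 : wrap x = (.inr .op :: x.map (Sum.map id .sub)) ++ [.inr .cl] := wrap_eq x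
  rw [h1, LPath.append_iff]
  constructor
  · rintro ⟨r, h, h'⟩
    obtain ⟨-, s, q, rfl, h2, h3⟩ := path_cycle_op.1 h
    obtain ⟨-, q', ⟨⟩, h4⟩ := path_cycle_cl.1 h'
    exact ⟨s, q, h2, h3, h4⟩
  · rintro ⟨s, q, h2, h3, h4⟩
    exact ⟨some q, path_cycle_op.2 ⟨rfl, s, q, rfl, h2, h3⟩, path_cycle_cl.2 ⟨rfl, q, rfl, h4⟩⟩

/-- Only the idleness of the copy matters: inner markers and a closing parenthesis need a running
copy. These equivalences later determine which blocks are open at each position. -/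
theorem path_cycle_segment {b c : Prop} [Decidable b] [Decidable c] {x : List (A ⊕ S)} {o o'}
    (h : LPath (Cycle F) o ((if b then [.inr .op] else []) ++ (x.map (Sum.map id .sub) ++
      if c then [.inr .cl] else [])) o') :
    (c → b ∨ o ≠ none) ∧ (o' ≠ none ↔ (b ∨ o ≠ none) ∧ ¬ c) ∧ ∀ m, .inr m ∈ x → b ∨ o ≠ none := by
  rw [← List.append_assoc, LPath.append_iff] at h
  obtain ⟨r, h, h'⟩ := h
  have h1 : (r ≠ none ↔ b ∨ o ≠ none) ∧ ∀ m, .inr m ∈ x → b ∨ o ≠ none := by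
    split_ifs at h with hb
    · obtain ⟨rfl, s, q, rfl, -⟩ := path_cycle_op.1 h
      simp [hb]
    · simpa [hb] using path_cycle_map h
  refine ⟨fun hc => ?_, ?_, h1.2⟩
  · rw [if_pos hc] at h'
    obtain ⟨-, q, rfl, -⟩ := path_cycle_cl.1 h'
    exact h1.1.1 (by simp)
  · split_ifs at h' with hc
    · obtain ⟨rfl, -⟩ := path_cycle_cl.1 h'
      simp [hc]
    · rw [← LPath.nil_iff.1 h', h1.1]
      simp [hc]

theorem Functional.cycle (h : F.Functional) {o o' : Option F.Q} {m m' : Marker S}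
    (h1 : Cycle F o (.inr m) o') (h2 : Cycle F o (.inr m') o') : m = m' := by
  generalize hy : (Sum.inr m : A ⊕ Marker S) = y at h1
  generalize hy' : (Sum.inr m' : A ⊕ Marker S) = y' at h2
  cases h1 with
  | out => simp at hy
  | op => cases h2 with | op => exact Sum.inr_injective (hy.trans hy'.symm)
  | cl => cases h2 with | cl => exact Sum.inr_injective (hy.trans hy'.symm)
  | @inner p x q h1 =>
    cases h2 with
    | @inner _ x' _ h2 =>
      rcases x with x | x
      · simp at hy
      rcases x' with x' | x'
      · simp at hy'
      simp only [Sum.map_inr, Sum.inr.injEq] at hy hy'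
      rw [hy, hy', h h1 h2]

end Cycle

/-! ### Checking the order of the markers within one segment. -/

section Control

variable {A : Type*} {S : Type} {k : ℕ}

/-- Transitions that control the order of the markers in `α_i`, where `r` is the residue of `i`. The
state is `none` before the opening parenthesis, `some none` after the closing parenthesis, and
`some (some t)` otherwise, where `t` bounds the rank of the next marker from below. -/
inductive Control (r : ZMod k) :
    Option (Option (ZMod k)) → A ⊕ (ZMod k × Marker S) → Option (Option (ZMod k)) → Prop
  | op : Control r none (.inr (r, .op)) (some (some r))
  | letter {t a} : Control r (some (some t)) (.inl a) (some (some (r + 1)))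
  | sub {t j m} : rank r t ≤ rank r j → Control r (some (some t)) (.inr (j, .sub m)) (some (some j))
  | cl {t} : Control r (some (some t)) (.inr (r + 1, .cl)) (some none)

/-- The control state at the start of `α_i`. -/
def initControl (r : ZMod k) (late : Bool) : Option (Option (ZMod k)) :=
  if late then some (some r) else none

theorem path_control_some {r : ZMod k} {α : List (A ⊕ (ZMod k × Marker S))} : ∀ {t},
    (∃ m, LPath (Control r) (some (some t)) α m) ↔ ∃ β, ∃ c : Bool, Sorted r t β ∧
      α = β.map emb ++ if c then [.inr (r + 1, .cl)] else [] := by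
  induction α with
  | nil =>
    intro t
    exact ⟨fun _ => ⟨[], false, trivial, by simp⟩, fun _ => ⟨_, rfl⟩⟩
  | cons y α ih =>
    intro t
    constructor
    · rintro ⟨m, p, h, h'⟩
      cases h with
      | letter =>
        obtain ⟨β, c, h1, rfl⟩ := ih.1 ⟨_, h'⟩
        exact ⟨.inl _ :: β, c, h1, rfl⟩
      | sub h =>
        obtain ⟨β, c, h1, rfl⟩ := ih.1 ⟨_, h'⟩
        exact ⟨.inr (_, _) :: β, c, ⟨h, h1⟩, rfl⟩
      | cl =>
        refine ⟨[], true, trivial, ?_⟩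
        cases α with
        | nil => simp
        | cons => obtain ⟨_, h, _⟩ := h'; cases h
    · rintro ⟨β, c, h, e⟩
      rcases β with _ | ⟨a | ⟨j, m⟩, β⟩
      · by_cases hc : c
        · simp only [List.map_nil, List.nil_append, hc, if_true, List.cons.injEq] at e
          obtain ⟨rfl, rfl⟩ := e
          exact ⟨_, _, .cl, rfl⟩
        · simp [hc] at e
      · simp only [List.map_cons, emb_inl, List.cons_append, List.cons.injEq] at e
        obtain ⟨rfl, rfl⟩ := e
        obtain ⟨m, hm⟩ := ih.2 ⟨β, c, h, rfl⟩
        exact ⟨m, _, .letter, hm⟩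
      · simp only [List.map_cons, emb_inr, List.cons_append, List.cons.injEq] at e
        obtain ⟨rfl, rfl⟩ := e
        obtain ⟨m, hm⟩ := ih.2 ⟨β, c, h.2, rfl⟩
        exact ⟨m, _, .sub h.1, hm⟩

theorem path_control_ne_none {r : ZMod k} {α : List (A ⊕ (ZMod k × Marker S))} : ∀ {m m'},
    m ≠ none → LPath (Control r) m α m' → m' ≠ none := by
  induction α with
  | nil => rintro m m' h rfl; exact h
  | cons y α ih =>
    rintro m m' - ⟨p, h, h'⟩
    exact ih (by cases h <;> simp) h'

/-- Excluding `none` at the end forces the opening parenthesis to be read when the segment is not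
late. -/
theorem path_control {r : ZMod k} {late : Bool} {α : List (A ⊕ (ZMod k × Marker S))} :
    (∃ m, LPath (Control r) (initControl r late) α m ∧ m ≠ none) ↔ ∃ β, ∃ c : Bool, Sorted r r β ∧
      α = (if late then [] else [.inr (r, .op)]) ++
        (β.map emb ++ if c then [.inr (r + 1, .cl)] else []) := by
  cases late
  · constructor
    · rintro ⟨m, h, h'⟩
      cases α with
      | nil => exact absurd h.symm h'
      | cons y α =>
        obtain ⟨p, h, h1⟩ := h
        cases h with
        | op =>
          obtain ⟨β, c, h2, rfl⟩ := path_control_some.1 ⟨_, h1⟩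
          exact ⟨β, c, h2, rfl⟩
    · rintro ⟨β, c, h, rfl⟩
      obtain ⟨m, hm⟩ := path_control_some.2 ⟨β, c, h, rfl⟩
      exact ⟨m, ⟨_, .op, hm⟩, path_control_ne_none (by simp) hm⟩
  · simp only [initControl, if_true, List.nil_append]
    rw [← path_control_some]
    exact ⟨fun ⟨m, h, _⟩ => ⟨m, h⟩, fun ⟨m, h⟩ => ⟨m, h, path_control_ne_none (by simp) h⟩⟩

end Control

end Aut

namespace Aut

open Parsing

/-! ### Runs cut at the separators. -/

section Separators

variable {A : Type*} {S : Type} {k : ℕ} {Q : Type}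

/-- Transitions `T` for the symbols other than the separator, and `U` for the separator. -/
def SepStep (T : Q → A ⊕ (ZMod k × Marker S) → Q → Prop) (U : Q → Q → Prop) :
    Q → A ⊕ (Unit ⊕ (ZMod k × Marker S)) → Q → Prop
  | p, .inl a, q => T p (.inl a) q
  | p, .inr (.inl _), q => U p q
  | p, .inr (.inr m), q => T p (.inr m) q

variable {T : Q → A ⊕ (ZMod k × Marker S) → Q → Prop} {U : Q → Q → Prop}

theorem path_sepStep_map {α : List (A ⊕ (ZMod k × Marker S))} : ∀ {p q},
    LPath (SepStep T U) p (α.map (Sum.map id .inr)) q ↔ LPath T p α q := by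
  induction α with
  | nil => exact Iff.rfl
  | cons y α ih =>
    intro p q
    rcases y with a | m <;>
    · simp only [List.map_cons, LPath.cons_iff, ih]
      rfl

/-- A word with `n` separators has `n + 1` segments, possibly empty; in particular the empty word
has one. -/
theorem exists_eq_longWord (γ : List (A ⊕ (Unit ⊕ (ZMod k × Marker S)))) :
    ∃ n α, γ = longWord (n + 1) α := by
  induction γ with
  | nil => exact ⟨0, fun _ => [], by simp [longWord_succ]⟩
  | cons y γ ih =>
    obtain ⟨n, α, rfl⟩ := ih
    have key : ∀ x : A ⊕ (ZMod k × Marker S), ∃ n' α',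
        Sum.map id Sum.inr x :: longWord (n + 1) α = longWord (n' + 1) α' := by
      intro x
      refine ⟨n, fun i => if i = 1 then x :: α 1 else α i, ?_⟩
      rw [longWord_succ, longWord_succ]
      simp only [if_true, List.map_cons, List.cons_append, List.cons.injEq, true_and]
      split_ifs with hn
      · rfl
      · congr 2
        unfold longWord
        congr 1
        refine List.map_congr_left fun i hi => ?_
        have : i ≠ 0 := by simp at hi; omega
        simp [this]
    rcases y with a | ⟨⟨⟩⟩ | m
    · exact key (.inl a)
    · refine ⟨n + 1, fun i => if i = 1 then [] else α (i - 1), ?_⟩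
      rw [longWord_succ (n + 1)]
      simp only [if_true, List.map_nil, List.nil_append, Nat.succ_ne_zero, if_false]
      congr 1
      unfold longWord
      congr 1
      refine List.map_congr_left fun i hi => ?_
      have : i ≠ 0 := by simp at hi; omega
      simp [this]
    · exact key (.inr m)

theorem path_sepStep_longWord (n : ℕ) : ∀ {α p q},
    LPath (SepStep T U) p (longWord (n + 1) α) q ↔ ∃ ρ ρ' : ℕ → Q, ρ 1 = p ∧ ρ' (n + 1) = q ∧
      (∀ i, 1 ≤ i → i ≤ n + 1 → LPath T (ρ i) (α i) (ρ' i)) ∧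
      ∀ i, 1 ≤ i → i ≤ n → U (ρ' i) (ρ (i + 1)) := by
  induction n with
  | zero =>
    intro α p q
    rw [longWord_succ, if_pos rfl, List.append_nil, path_sepStep_map]
    constructor
    · intro h
      exact ⟨fun _ => p, fun _ => q, rfl, rfl, fun i h1 h2 => by
        obtain rfl : i = 1 := by omega
        exact h, fun i h1 h2 => by omega⟩
    · rintro ⟨ρ, ρ', rfl, rfl, h, -⟩
      exact h 1 le_rfl le_rfl
  | succ n ih =>
    intro α p q
    rw [longWord_succ, if_neg (Nat.succ_ne_zero n), LPath.append_iff]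
    simp only [path_sepStep_map, LPath.cons_iff, ih]
    constructor
    · rintro ⟨r, h, s, hU, ρ, ρ', rfl, rfl, h1, h2⟩
      refine ⟨fun i => if i ≤ 1 then p else ρ (i - 1), fun i => if i ≤ 1 then r else ρ' (i - 1),
        by simp, by simp, fun i h3 h4 => ?_, fun i h3 h4 => ?_⟩
      · rcases h3.eq_or_lt with rfl | h3
        · simpa using h
        · have := h1 (i - 1) (by omega) (by omega)
          rw [Nat.sub_add_cancel (by omega)] at this
          simpa [show ¬ i ≤ 1 by omega] using this
      · rcases h3.eq_or_lt with rfl | h3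
        · exact hU
        · have := h2 (i - 1) (by omega) (by omega)
          rw [Nat.sub_add_cancel (by omega)] at this
          simpa [show ¬ i ≤ 1 by omega, show ¬ i = 0 by omega] using this
    · rintro ⟨ρ, ρ', rfl, rfl, h1, h2⟩
      exact ⟨_, h1 1 le_rfl (by omega), _, h2 1 le_rfl (by omega), fun i => ρ (i + 1),
        fun i => ρ' (i + 1), rfl, rfl, fun i h3 h4 => h1 (i + 1) (by omega) (by omega),
        fun i h3 h4 => h2 (i + 1) (by omega) (by omega)⟩

end Separators

/-! ### The automaton for parsings with at least `k` factors. -/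

section Long

variable {A : Type*} {S : Type} {k : ℕ} (G : PosAut A) (F : Aut (A ⊕ S))

/-- States: the state of the automaton for the factors, the residue of the position and whether no
block starts from now on, the control state, and the states of the copies of the automaton for the
blocks. -/
abbrev LongState (k : ℕ) (G : PosAut A) (F : Aut (A ⊕ S)) : Type :=
  Option G.P × (ZMod k × Bool) × Option (Option (ZMod k)) × (ZMod k → Option F.Q)

/-- Transitions inside `α_i`. -/
def InnerStep (p : LongState k G F) (y : A ⊕ (ZMod k × Marker S)) (q : LongState k G F) : Prop :=
  p.2.1 = q.2.1 ∧ Control p.2.1.1 p.2.2.1 y q.2.2.1 ∧ LPath G.Step p.1 (proj [y]) q.1 ∧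
    ∀ j, LPath (Cycle F) (p.2.2.2 j) (select j [y]) (q.2.2.2 j)

/-- Conditions at the end of `α_i`. -/
def Complete (p : LongState k G F) : Prop :=
  G.fin p.1 ∧ p.2.2.1 ≠ none ∧ p.2.2.2 (p.2.1.1 + 1) = none

/-- The state at the start of `α_i`. -/
def segmentStart (r : ZMod k) (late : Bool) (σ : ZMod k → Option F.Q) : LongState k G F :=
  (none, (r, late), initControl r late, σ)

/-- Transitions that read the separator. -/
def SeparatorStep (p q : LongState k G F) : Prop :=
  Complete G F p ∧ ∃ late : Bool, (p.2.1.2 = true → late = true) ∧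
    (late = true → ∃ j, p.2.2.2 j ≠ none) ∧ q = segmentStart G F (p.2.1.1 + 1) late p.2.2.2

variable {G F}

/-- The components read the same word side by side, each copy through its own projection; the
residue on which the control depends is constant between separators. -/
theorem path_innerStep {α : List (A ⊕ (ZMod k × Marker S))} : ∀ {p q : LongState k G F},
    LPath (InnerStep G F) p α q ↔ p.2.1 = q.2.1 ∧ LPath (Control p.2.1.1) p.2.2.1 α q.2.2.1 ∧
      LPath G.Step p.1 (proj α) q.1 ∧
      ∀ j, LPath (Cycle F) (p.2.2.2 j) (select j α) (q.2.2.2 j) := by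
  induction α with
  | nil =>
    rintro ⟨x, c, m, σ⟩ ⟨x', c', m', σ'⟩
    simp only [LPath.nil_iff, Prod.mk.injEq, proj_nil, select_nil, funext_iff]
    tauto
  | cons y α ih =>
    intro p q
    have h1 : proj (y :: α) = proj [y] ++ proj α := by rw [← proj_append]; rfl
    have h2 : ∀ j, select j (y :: α) = select j [y] ++ select j α := fun j => by
      rw [← select_append]; rfl
    simp only [LPath.cons_iff, ih, h1, h2, LPath.append_iff]
    constructor
    · rintro ⟨r, ⟨h3, h4, h5, h6⟩, h7, h8, h9, h10⟩
      exact ⟨h3.trans h7, ⟨_, h4, h3 ▸ h8⟩, ⟨_, h5, h9⟩, fun j => ⟨_, h6 j, h10 j⟩⟩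
    · rintro ⟨h3, ⟨m, h4, h5⟩, ⟨x, h6, h7⟩, h8⟩
      choose σ h9 h10 using h8
      exact ⟨(x, p.2.1, m, σ), ⟨rfl, h4, h6, h9⟩, h3, h5, h7, h10⟩

variable (G F) [NeZero k]

/-- The automaton for the parsings with at least `k` factors. -/
def long (k : ℕ) [NeZero k] (G : PosAut A) (F : Aut (A ⊕ S)) :
    Aut (A ⊕ (Unit ⊕ (ZMod k × Marker S))) where
  Q := LongState k G F
  fintype := by classical infer_instance
  step := SepStep (InnerStep G F) (SeparatorStep G F)
  start := (· = segmentStart G F 1 false fun _ => none)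
  accept p := Complete G F p ∧ ∀ j, p.2.2.2 j = none

theorem card_long : Fintype.card (long k G F).Q =
    (Fintype.card G.P + 1) * ((k * 2) * ((k + 2) * (Fintype.card F.Q + 1) ^ k)) := by
  classical
  have : Fintype.card (long k G F).Q = Fintype.card (LongState k G F) :=
    Fintype.card_congr (Equiv.refl _)
  rw [this]
  simp [ZMod.card]

variable {G F}

/-- The two control states determine the index of a marker, and then the copy with this index
determines the marker. A separator changes the residue unless `k = 1`, so this case alone needs an
argument to tell a separator from a marker. -/
theorem functional_long (hF : F.Functional) : (long k G F).Functional := by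
  have h1 : ∀ {p q : LongState k G F} {m}, SeparatorStep G F p q → InnerStep G F p (.inr m) q →
      False := by
    rintro ⟨x, ⟨r, l⟩, m, σ⟩ q m' ⟨h, l', -, h1, rfl⟩ ⟨h2, h3, h4, h5⟩
    simp only [segmentStart, Prod.mk.injEq] at h2
    -- The separator adds `1` to the residue, which an inner transition preserves; so `k = 1` and
    -- there is a single copy.
    have hr : ∀ j : ZMod k, j = r + 1 := by
      have : k = 1 := by
        have h10 : (1 : ZMod k) = 0 := by simpa using h2.1.symm
        rwa [← Nat.cast_one, ZMod.natCast_eq_zero_iff, Nat.dvd_one] at h10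
      subst this
      exact fun j => Subsingleton.elim _ _
    -- A late target needs a running copy, while `Complete` says that the only copy is idle. A
    -- target that is not late has control state `none`, which no inner transition reaches.
    cases l' with
    | true =>
      obtain ⟨j, hj⟩ := h1 rfl
      rw [hr j] at hj
      exact hj h.2.2
    | false =>
      simp only [segmentStart, initControl] at h3
      have h0 : m ≠ none := h.2.1
      change Control r m _ none at h3
      generalize hn : (none : Option (Option (ZMod k))) = n at h3
      cases h3 <;> simp at hn
  have h2 : ∀ {p q : LongState k G F} {m m'}, InnerStep G F p (.inr m) q →
      InnerStep G F p (.inr m') q → m = m' := by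
    rintro ⟨x, ⟨r, l⟩, m, σ⟩ ⟨x', c', m', σ'⟩ ⟨j, y⟩ ⟨j', y'⟩ ⟨-, h1, -, h2⟩ ⟨-, h1', -, h2'⟩
    have hj : j = j' := by
      simp only at h1 h1'
      generalize e1 : (Sum.inr (j, y) : A ⊕ (ZMod k × Marker S)) = z at h1
      generalize e2 : (Sum.inr (j', y') : A ⊕ (ZMod k × Marker S)) = z' at h1'
      cases h1 with
      | op => cases h1'; simp_all
      | letter => simp at e1
      | sub => cases h1' with
        | letter => simp at e2
        | sub => simp_all
      | cl => cases h1'; simp_all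
    subst hj
    have h3 := h2 j
    have h3' := h2' j
    simp only [select_inr_self, select_nil, LPath.cons_iff, LPath.nil_iff, exists_eq_right] at h3 h3'
    rw [hF.cycle h3 h3']
  rintro p q (⟨⟨⟩⟩ | m) (⟨⟨⟩⟩ | m') h h'
  · rfl
  · exact (h1 h h').elim
  · exact (h1 h' h).elim
  · exact congrArg _ (h2 h h')

theorem accepts_long_iff {w : List (A ⊕ (Unit ⊕ (ZMod k × Marker S)))} :
    (long k G F).Accepts w ↔ ∃ q : LongState k G F, LPath (SepStep (InnerStep G F) (SeparatorStep G F))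
      (segmentStart G F 1 false fun _ => none) w q ∧ Complete G F q ∧ ∀ j, q.2.2.2 j = none := by
  constructor
  · rintro ⟨p, q, rfl, h, h'⟩
    exact ⟨q, h, h'⟩
  · rintro ⟨q, h, h'⟩
    exact ⟨_, q, rfl, h, h'⟩

/-- `σ i` holds the states of the copies at the start of `α i`, and `late i` is the guess that no
block starts from there on. The automaton for the factors and the control restart at each separator,
so their runs are quantified segment by segment. -/
theorem accepts_long {n : ℕ} {α : ℕ → List (A ⊕ (ZMod k × Marker S))} :
    (long k G F).Accepts (longWord (n + 1) α) ↔
      ∃ (late : ℕ → Bool) (σ : ℕ → ZMod k → Option F.Q), late 1 = false ∧ (∀ j, σ 1 j = none) ∧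
        (∀ j, σ (n + 2) j = none) ∧
        (∀ i : ℕ, 1 ≤ i → i ≤ n + 1 →
          (∃ m, LPath (Control i) (initControl i (late i)) (α i) m ∧ m ≠ none) ∧
          (∃ x, LPath G.Step none (proj (α i)) x ∧ G.fin x) ∧
          (∀ j, LPath (Cycle F) (σ i j) (select j (α i)) (σ (i + 1) j)) ∧
          σ (i + 1) ((i + 1 : ℕ) : ZMod k) = none) ∧
        ∀ i, 1 ≤ i → i ≤ n → (late i = true → late (i + 1) = true) ∧
          (late (i + 1) = true → ∃ j, σ (i + 1) j ≠ none) := by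
  rw [accepts_long_iff]
  constructor
  · rintro ⟨q, h, h', h''⟩
    obtain ⟨ρ, ρ', h1, rfl, h2, h3⟩ := (path_sepStep_longWord n).1 h
    have h4 : ∀ i : ℕ, i ≤ n → ∃ late, ρ (i + 1) = segmentStart G F ((i + 1 : ℕ) : ZMod k) late
        (if i = 0 then fun _ => none else (ρ' i).2.2.2) ∧ (i = 0 → late = false) := by
      intro i
      induction i with
      | zero => exact fun _ => ⟨false, by rw [h1, zero_add, Nat.cast_one, if_pos rfl], fun _ => rfl⟩
      | succ i ih =>
        intro hi
        obtain ⟨l, hl, -⟩ := ih (by omega)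
        obtain ⟨-, l', -, -, h5⟩ := h3 (i + 1) (by omega) hi
        have h6 := (path_innerStep.1 (h2 (i + 1) (by omega) (by omega))).1
        refine ⟨l', ?_, by simp⟩
        rw [h5, ← h6, hl, if_neg (Nat.succ_ne_zero i), Nat.cast_succ (i + 1)]
        rfl
    choose! late h5 h6 using h4
    have h7 : ∀ i, 1 ≤ i → i ≤ n + 1 → ρ i = segmentStart G F (i : ZMod k) (late (i - 1))
        (if i = 1 then fun _ => none else (ρ' (i - 1)).2.2.2) := by
      intro i hi hi'
      have := h5 (i - 1) (by omega)
      rw [Nat.sub_add_cancel hi] at this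
      rw [this]
      congr 1
      simp only [show i - 1 = 0 ↔ i = 1 by omega]
    refine ⟨fun i => late (i - 1), fun i => if i = 1 then fun _ => none else (ρ' (i - 1)).2.2.2,
      h6 0 (by omega) rfl, by simp, by simpa using h'', fun i hi hi' => ?_, fun i hi hi' => ?_⟩
    · have h8 := h2 i hi hi'
      rw [h7 i hi hi', path_innerStep] at h8
      obtain ⟨h9, h10, h11, h12⟩ := h8
      have h13 : Complete G F (ρ' i) := by
        rcases hi'.eq_or_lt with rfl | hi'
        · exact h'
        · exact (h3 i hi (by omega)).1
      refine ⟨⟨_, h10, h13.2.1⟩, ⟨_, h11, h13.1⟩, ?_, ?_⟩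
      · simpa [show ¬ i = 0 by omega, segmentStart] using h12
      · have := h13.2.2
        rw [← h9] at this
        simpa [show ¬ i = 0 by omega, segmentStart] using this
    · obtain ⟨h8, l, h9, h10, h11⟩ := h3 i hi hi'
      have h12 := (path_innerStep.1 (h2 i hi (by omega))).1
      rw [h7 i hi (by omega)] at h12
      rw [h7 (i + 1) (by omega) (by omega)] at h11
      have h13 : late i = l := congrArg (fun p : LongState k G F => p.2.1.2) h11
      rw [← h12, ← h13] at h9
      rw [← h13] at h10
      exact ⟨h9, by simpa [show ¬ i = 0 by omega] using h10⟩
  · rintro ⟨late, σ, h1, h2, h3, h4, h5⟩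
    have h6 : ∀ i : ℕ, ∃ q : LongState k G F, 1 ≤ i → i ≤ n + 1 → q.2.1 = (↑i, late i) ∧
        Complete G F q ∧ q.2.2.2 = σ (i + 1) ∧
        LPath (InnerStep G F) (segmentStart G F i (late i) (σ i)) (α i) q := by
      intro i
      by_cases hi : 1 ≤ i ∧ i ≤ n + 1
      · obtain ⟨⟨m, h6, h7⟩, ⟨x, h8, h9⟩, h10, h11⟩ := h4 i hi.1 hi.2
        refine ⟨(x, (i, late i), m, σ (i + 1)), fun _ _ => ⟨rfl, ⟨h9, h7, ?_⟩, rfl, ?_⟩⟩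
        · simpa using h11
        · exact path_innerStep.2 ⟨rfl, h6, h8, h10⟩
      · exact ⟨segmentStart G F i (late i) (σ i), fun h h' => absurd ⟨h, h'⟩ hi⟩
    choose ρ' h6 using h6
    refine ⟨ρ' (n + 1), (path_sepStep_longWord n).2 ⟨fun i => segmentStart G F i (late i) (σ i),
      ρ', ?_, rfl, fun i hi hi' => (h6 i hi hi').2.2.2, fun i hi hi' => ?_⟩,
      (h6 (n + 1) (by omega) le_rfl).2.1, fun j => ?_⟩
    · simp only [h1, funext h2, Nat.cast_one]
    · obtain ⟨h7, h8, h9, -⟩ := h6 i hi (by omega)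
      refine ⟨h8, late (i + 1), ?_, ?_, ?_⟩
      · rw [h7]
        exact (h5 i hi hi').1
      · rw [h9]
        exact (h5 i hi hi').2
      · rw [h7, h9]
        simp
    · rw [(h6 (n + 1) (by omega) le_rfl).2.2.1]
      exact h3 j

end Long

end Aut

namespace Aut

open Parsing

/-! ### Correctness of the automaton for long factorizations. -/

section Long

variable {A : Type*} {S : Type} {k : ℕ} [NeZero k] {G : PosAut A} {F : Aut (A ⊕ S)}
  {P : List A → Set (List (A ⊕ Marker S))} {n : ℕ}

theorem select_segment (b c : Prop) [Decidable b] [Decidable c] (r r' j : ZMod k)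
    (β : List (A ⊕ (ZMod k × S))) :
    select j ((if b then [.inr (r, .op)] else []) ++
      (β.map emb ++ if c then [.inr (r', .cl)] else [])) =
    (if b ∧ r = j then [.inr .op] else []) ++ ((select j β).map (Sum.map id .sub) ++
      if c ∧ r' = j then [.inr .cl] else []) := by
  rw [select_append, select_append, select_map_emb]
  congr 1
  · by_cases hb : b <;> simp [hb, select_inr]
  · congr 1
    by_cases hc : c <;> simp [hc, select_inr]

/-- Copy `j` of the automaton for the blocks is running between positions `i - 1` and `i`, when the
last block starts at position `p`. -/
def Running (k p i : ℕ) (j : ZMod k) : Prop := ∃ s : ℕ, 1 ≤ s ∧ s < i ∧ i < s + k ∧ s ≤ p ∧ (s : ZMod k) = j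

/-- In passing position `i`, a block may start with index `i`, and the block whose residue is `i +
1` comes to its end after `k` positions. -/
theorem running_succ {p i : ℕ} {j : ZMod k} (hi : 1 ≤ i) :
    Running k p (i + 1) j ↔ ((i ≤ p ∧ (i : ZMod k) = j) ∨ Running k p i j) ∧
      ((i + 1 : ℕ) : ZMod k) ≠ j := by
  have hk : 0 < k := Nat.pos_of_ne_zero (NeZero.ne k)
  constructor
  · rintro ⟨s, h1, h2, h3, h4, rfl⟩
    refine ⟨?_, fun e => ?_⟩
    · rcases (show s ≤ i by omega).eq_or_lt with rfl | h5
      · exact .inl ⟨h4, rfl⟩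
      · exact .inr ⟨s, h1, h5, by omega, h4, rfl⟩
    · have := natCast_inj_of_lt h2.le h3 e.symm
      omega
  · rintro ⟨h | ⟨s, h1, h2, h3, h4, rfl⟩, h5⟩
    · refine ⟨i, hi, by omega, ?_, h.1, h.2⟩
      rcases Nat.lt_or_ge 1 k with h6 | h6
      · omega
      · obtain rfl : k = 1 := by omega
        exact absurd (Subsingleton.elim _ _) h5
    · refine ⟨s, h1, by omega, ?_, h4, rfl⟩
      rcases (show i + 1 ≤ s + k by omega).eq_or_lt with h6 | h6
      · rw [h6] at h5
        simp at h5
      · exact h6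

/-- The guess `late` is monotone, so there is a last position `p` where a block starts. By induction
on the position, the running copies are those of the open blocks. This fixes the number of segments
and the place of every closing parenthesis. -/
theorem IsBody.exists_eq_decorate {α : ℕ → List (A ⊕ (ZMod k × Marker S))} {late : ℕ → Bool}
    {σ : ℕ → ZMod k → Option F.Q} (hl : late 1 = false) (h0 : ∀ j, σ 1 j = none)
    (h1 : ∀ j, σ (n + 2) j = none)
    (h2 : ∀ i : ℕ, 1 ≤ i → i ≤ n + 1 →
      (∃ m, LPath (Control (i : ZMod k)) (initControl i (late i)) (α i) m ∧ m ≠ none) ∧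
      (∀ j, LPath (Cycle F) (σ i j) (select j (α i)) (σ (i + 1) j)) ∧
      σ (i + 1) ((i + 1 : ℕ) : ZMod k) = none)
    (h3 : ∀ i, 1 ≤ i → i ≤ n → (late i = true → late (i + 1) = true) ∧
      (late (i + 1) = true → ∃ j, σ (i + 1) j ≠ none)) :
    ∃ β, k ≤ n + 1 ∧ IsBody k (n + 1) β ∧ (∀ i, 1 ≤ i → i ≤ n + 1 → α i = decorate (n + 1) β i) ∧
      ∀ s : ℕ, 1 ≤ s → s + k ≤ n + 2 → F.Accepts (select (s : ZMod k) (concat β s k)) := by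
  have hk : 0 < k := Nat.pos_of_ne_zero (NeZero.ne k)
  -- the last position where a block starts
  obtain ⟨p, hp1, hp2, hp⟩ : ∃ p, 1 ≤ p ∧ p ≤ n + 1 ∧
      ∀ i, 1 ≤ i → i ≤ n + 1 → (late i = true ↔ p < i) := by
    have : ∀ m, 1 ≤ m → m ≤ n + 1 → ∃ p, 1 ≤ p ∧ p ≤ m ∧
        ∀ i, 1 ≤ i → i ≤ m → (late i = true ↔ p < i) := by
      intro m hm
      induction m, hm using Nat.le_induction with
      | base =>
        exact fun _ => ⟨1, le_rfl, le_rfl, fun i hi hi' => by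
          obtain rfl : i = 1 := by omega
          simp [hl]⟩
      | succ m hm ih =>
        intro h
        obtain ⟨p, h4, h5, h6⟩ := ih (by omega)
        by_cases h7 : late (m + 1) = true
        · refine ⟨p, h4, by omega, fun i hi hi' => ?_⟩
          rcases hi'.eq_or_lt with rfl | hi'
          · exact ⟨fun _ => by omega, fun _ => h7⟩
          · exact h6 i hi (by omega)
        · have h8 : p = m := by
            by_contra h8
            exact h7 ((h3 m hm (by omega)).1 ((h6 m hm le_rfl).2 (by omega)))
          refine ⟨m + 1, by omega, le_rfl, fun i hi hi' => ?_⟩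
          rcases hi'.eq_or_lt with rfl | hi'
          · simp [h7]
          · rw [h6 i hi (by omega)]
            omega
    exact this (n + 1) (by omega) le_rfl
  -- The control gives the shape of each segment up to the presence of a closing parenthesis,
  -- recorded in `c i` and determined only in `h8`.
  have h4 : ∀ i : ℕ, ∃ β, ∃ c : Bool, 1 ≤ i → i ≤ n + 1 → Sorted (i : ZMod k) i β ∧
      α i = (if i ≤ p then [.inr ((i : ZMod k), .op)] else []) ++
        (β.map emb ++ if c then [.inr (((i + 1 : ℕ) : ZMod k), .cl)] else []) := by
    intro i
    by_cases hi : 1 ≤ i ∧ i ≤ n + 1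
    · obtain ⟨β, c, h5, h6⟩ := path_control.1 (h2 i hi.1 hi.2).1
      refine ⟨β, c, fun _ _ => ⟨h5, ?_⟩⟩
      have := hp i hi.1 hi.2
      rw [h6]
      by_cases h7 : i ≤ p
      · have h8 : late i = false := by
          rw [← Bool.not_eq_true, this]; omega
        simp [h7, h8]
      · have h8 : late i = true := by
          rw [this]; omega
        simp [h7, h8]
    · exact ⟨[], true, fun h h' => absurd ⟨h, h'⟩ hi⟩
  choose β c h4 using h4
  have h5 : ∀ i : ℕ, 1 ≤ i → i ≤ n + 1 → ∀ j : ZMod k,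
      (c i = true ∧ ((i + 1 : ℕ) : ZMod k) = j → (i ≤ p ∧ (i : ZMod k) = j) ∨ σ i j ≠ none) ∧
      (σ (i + 1) j ≠ none ↔ ((i ≤ p ∧ (i : ZMod k) = j) ∨ σ i j ≠ none) ∧
        ¬ (c i = true ∧ ((i + 1 : ℕ) : ZMod k) = j)) ∧
      ∀ m, .inr m ∈ select j (β i) → (i ≤ p ∧ (i : ZMod k) = j) ∨ σ i j ≠ none := by
    intro i hi hi' j
    have := (h2 i hi hi').2.1 j
    rw [(h4 i hi hi').2, select_segment] at this
    exact path_cycle_segment this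
  -- The clause of `h2` that makes the copy with residue `i + 1` idle after segment `i` ends every
  -- block exactly `k` positions after its start.
  have h6 : ∀ i, 1 ≤ i → i ≤ n + 2 → ∀ j, σ i j ≠ none ↔ Running k p i j := by
    intro i hi
    induction i, hi using Nat.le_induction with
    | base =>
      intro _ j
      simp only [h0, ne_eq, not_true_eq_false, false_iff]
      rintro ⟨s, h, h', -⟩
      omega
    | succ i hi ih =>
      intro hi' j
      rw [running_succ hi, ← ih (by omega), (h5 i hi (by omega) j).2.1]
      refine and_congr_right fun h => ?_
      constructor
      · rintro h' rfl
        exact (h5 i hi (by omega) _).2.1.2 ⟨h, h'⟩ ((h2 i hi (by omega)).2.2)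
      · exact fun h' h'' => h' h''.2
  -- With too few segments the last block would still be open at the end. With too many, some late
  -- segment would begin after all the blocks are closed, although it requires a running copy.
  have hn : n + 2 = p + k := by
    rcases Nat.lt_trichotomy (n + 2) (p + k) with h | h | h
    · exact absurd (h1 p) ((h6 (n + 2) (by omega) le_rfl p).2 ⟨p, hp1, by omega, h, le_rfl, rfl⟩)
    · exact h
    · obtain ⟨i, hi⟩ : ∃ i, p + k = i + 1 := ⟨p + k - 1, by omega⟩
      obtain ⟨j, hj⟩ := (h3 i (by omega) (by omega)).2 ((hp (i + 1) (by omega) (by omega)).2 (by omega))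
      obtain ⟨s, h7, h8, h9, h10, -⟩ := (h6 (i + 1) (by omega) (by omega) j).1 hj
      omega
  have h7 : ∀ i, 1 ≤ i → i ≤ n + 1 → ∀ j, (i ≤ p ∧ (i : ZMod k) = j) ∨ σ i j ≠ none →
      ∃ s, Act k (n + 1) i s ∧ (s : ZMod k) = j := by
    rintro i hi hi' j (⟨h, rfl⟩ | h)
    · exact ⟨i, ⟨hi, le_rfl, by omega, by omega⟩, rfl⟩
    · obtain ⟨s, h7, h8, h9, h10, h11⟩ := (h6 i hi (by omega) j).1 h
      exact ⟨s, ⟨h7, h8.le, h9, by omega⟩, h11⟩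
  -- A closing parenthesis needs an open block with residue `i + 1`, whose start can only be `i + 1
  -- - k`. Conversely this block must be closed at `i`, since its copy is idle afterwards.
  have h8 : ∀ i, 1 ≤ i → i ≤ n + 1 → (c i = true ↔ k ≤ i) := by
    intro i hi hi'
    constructor
    · intro h
      obtain ⟨s, ⟨h9, h10, h11, h12⟩, h13⟩ := h7 i hi hi' _ ((h5 i hi hi' _).1 ⟨h, rfl⟩)
      by_contra h14
      have := natCast_inj_of_lt (show s ≤ i + 1 by omega) (show i + 1 < s + k by omega) h13
      omega
    · intro h
      by_contra h9
      have h10 : ((i + 1 - k : ℕ) : ZMod k) = ((i + 1 : ℕ) : ZMod k) := by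
        rw [Nat.cast_sub (by omega)]
        simp
      refine (h5 i hi hi' _).2.1.2 ⟨?_, fun h' => h9 h'.1⟩ (h2 i hi hi').2.2
      rcases (show i + 1 - k ≤ i by omega).eq_or_lt with h11 | h11
      · exact .inl ⟨by omega, by rw [← h10, h11]⟩
      · exact .inr ((h6 i hi (by omega) _).2 ⟨i + 1 - k, by omega, by omega, by omega, by omega, h10⟩)
  have h9 : ∀ i, 1 ≤ i → i ≤ n + 1 → α i = decorate (n + 1) β i := by
    intro i hi hi'
    rw [(h4 i hi hi').2]
    simp only [decorate, opening, closing, h8 i hi hi', show i ≤ p ↔ i + k ≤ n + 1 + 1 by omega]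
  refine ⟨β, by omega, ⟨fun i hi hi' => (h4 i hi hi').1, fun i j m hi hi' h => ?_⟩, h9,
    fun s hs hs' => ?_⟩
  · exact h7 i hi hi' j ((h5 i hi hi' j).2.2 m (inr_mem_select.2 h))
  · have h10 : σ s s = none := by
      by_contra h
      obtain ⟨t, h10, h11, h12, h13, h14⟩ := (h6 s hs (by omega) s).1 h
      have := natCast_inj_of_lt h11.le h12 h14
      omega
    have h11 : σ (s + k) s = none := by
      by_contra h
      obtain ⟨t, h10, h11, h12, h13, h14⟩ := (h6 (s + k) (by omega) (by omega) s).1 h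
      have := natCast_inj_of_lt (show s ≤ t by omega) (by omega) h14.symm
      omega
    rw [← path_cycle_wrap, ← select_concat_decorate hs (show s + k ≤ n + 1 + 1 by omega),
      select_concat, LPath.concat_iff]
    refine ⟨fun i => σ i s, h10, h11, fun i hi hi' => ?_⟩
    rw [← h9 i (by omega) (by omega)]
    exact (h2 i (by omega) (by omega)).2.1 s

/-- The accepting runs of the blocks are glued: copy `j` follows the run of the open block with
residue `j`, and is idle if there is none. By `Act.eq` this block is unique. -/
theorem exists_path_of_isBody {β : ℕ → List (A ⊕ (ZMod k × S))} (hk : k ≤ n) (hβ : IsBody k n β)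
    (hF : ∀ s : ℕ, 1 ≤ s → s + k ≤ n + 1 → F.Accepts (select (s : ZMod k) (concat β s k))) :
    ∃ σ : ℕ → ZMod k → Option F.Q, (∀ i j, σ i j ≠ none ↔ Running k (n + 1 - k) i j) ∧
      ∀ i j, 1 ≤ i → i ≤ n → LPath (Cycle F) (σ i j) (select j (decorate n β i)) (σ (i + 1) j) := by
  classical
  have hpos : 0 < k := Nat.pos_of_ne_zero (NeZero.ne k)
  have h1 : ∀ s : ℕ, ∃ τ : ℕ → Option F.Q, 1 ≤ s → s + k ≤ n + 1 → (∀ i, τ i ≠ none) ∧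
      (∃ p, τ s = some p ∧ F.start p) ∧ (∃ p, τ (s + k) = some p ∧ F.accept p) ∧
      ∀ i, s ≤ i → i < s + k → LPath (Cycle F) (τ i) ((select (s : ZMod k) (β i)).map
        (Sum.map id .sub)) (τ (i + 1)) := by
    intro s
    by_cases hs : 1 ≤ s ∧ s + k ≤ n + 1
    · obtain ⟨p, q, h2, h3, h4⟩ := hF s hs.1 hs.2
      rw [select_concat, LPath.concat_iff] at h3
      obtain ⟨τ, rfl, rfl, h5⟩ := h3
      exact ⟨fun i => some (τ i), fun _ _ => ⟨by simp, ⟨_, rfl, h2⟩, ⟨_, rfl, h4⟩, fun i h6 h7 =>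
        path_cycle_some.2 ⟨_, rfl, h5 i h6 h7⟩⟩⟩
    · exact ⟨fun _ => none, fun h h' => absurd ⟨h, h'⟩ hs⟩
  choose τ h1 using h1
  let σ : ℕ → ZMod k → Option F.Q := fun i j =>
    if h : Running k (n + 1 - k) i j then τ h.choose i else none
  have h2 : ∀ {i s j}, 1 ≤ s → s < i → i < s + k → s ≤ n + 1 - k → (s : ZMod k) = j → σ i j = τ s i := by
    intro i s j h3 h4 h5 h6 h7
    have h8 : Running k (n + 1 - k) i j := ⟨s, h3, h4, h5, h6, h7⟩
    obtain ⟨h9, h10, h11, h12, h13⟩ := h8.choose_spec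
    have : h8.choose = s := Act.eq (n := n) (i := i) ⟨h9, h10.le, h11, by omega⟩
      ⟨h3, h4.le, h5, by omega⟩ (h13.trans h7.symm)
    simp only [σ, dif_pos h8, this]
  have h3 : ∀ {i j}, ¬ Running k (n + 1 - k) i j → σ i j = none := fun h => by
    simp only [σ, dif_neg h]
  refine ⟨σ, fun i j => ⟨fun h => ?_, ?_⟩, fun i j hi hi' => ?_⟩
  · by_contra h'
    exact h (h3 h')
  · rintro ⟨s, h4, h5, h6, h7, h8⟩
    rw [h2 h4 h5 h6 h7 h8]
    exact (h1 s h4 (by omega)).1 i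
  · by_cases hj : ∃ s, Act k n i s ∧ (s : ZMod k) = j
    · obtain ⟨s, hs, rfl⟩ := hj
      obtain ⟨h4, h5, h6, h7⟩ := hs
      obtain ⟨h8, ⟨p, h9, h10⟩, ⟨q, h11, h12⟩, h13⟩ := h1 s h4 h7
      rw [select_decorate h4 h7 h5 h6, LPath.append_iff]
      refine ⟨τ s i, ?_, LPath.append_iff.2 ⟨τ s (i + 1), h13 i h5 h6, ?_⟩⟩
      · split_ifs with h
        · subst h
          rw [h3, h9]
          · exact ⟨_, .op h10, rfl⟩
          · rintro ⟨t, h14, h15, h16, h17, h18⟩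
            have := natCast_inj_of_lt h15.le h16 h18
            omega
        · exact h2 h4 (by omega) h6 (by omega) rfl
      · split_ifs with h
        · rw [h3, h, h11]
          · exact ⟨_, .cl h12, rfl⟩
          · rintro ⟨t, h14, h15, h16, h17, h18⟩
            have := natCast_inj_of_lt (show s ≤ t by omega) (by omega) h18.symm
            omega
        · exact (h2 h4 (by omega) (by omega) (by omega) rfl).symm
    · have h4 : ∀ m, .inr (j, m) ∉ decorate n β i := by
        intro m h
        refine hj ?_
        rcases mem_decorate.1 h with ⟨-, h5, rfl⟩ | ⟨m', -, h5⟩ | ⟨-, h5, rfl⟩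
        · exact ⟨i, ⟨hi, le_rfl, by omega, h5⟩, rfl⟩
        · exact hβ.active i j m' hi hi' h5
        · refine ⟨i + 1 - k, ⟨by omega, by omega, by omega, by omega⟩, ?_⟩
          rw [Nat.cast_sub (by omega)]
          simp
      have h5 : σ i j = none := h3 fun ⟨s, h5, h6, h7, h8, h9⟩ =>
        hj ⟨s, ⟨h5, h6.le, h7, by omega⟩, h9⟩
      have h6 : σ (i + 1) j = none := h3 fun ⟨s, h5, h6, h7, h8, h9⟩ =>
        hj ⟨s, ⟨h5, by omega, by omega, by omega⟩, h9⟩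
      rw [h5, h6, select_eq_map_proj h4]
      have := path_cycle_none (F := F) (x := (proj (decorate n β i)).map .inl) (o := none)
      simpa [Function.comp_def] using this

theorem accepts_long_iff_exists {L : Language A} (hG : ∀ w, G.Acc none w ↔ w ∈ L)
    (hF : F.Recognizes P) {γ : List (A ⊕ (Unit ⊕ (ZMod k × Marker S)))} :
    (long k G F).Accepts γ ↔ ∃ (n : ℕ) (β : ℕ → List (A ⊕ (ZMod k × S))), k ≤ n ∧
      (∀ i, 1 ≤ i → i ≤ n → proj (β i) ∈ L) ∧ IsBody k n β ∧
      (∀ s : ℕ, 1 ≤ s → s + k ≤ n + 1 →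
        wrap (select (s : ZMod k) (concat β s k)) ∈ P (concat (fun i => proj (β i)) s k)) ∧
      γ = longWord n (decorate n β) := by
  have hpos : 0 < k := Nat.pos_of_ne_zero (NeZero.ne k)
  have hF' : ∀ (β : ℕ → List (A ⊕ (ZMod k × S))) (s : ℕ),
      F.Accepts (select (s : ZMod k) (concat β s k)) ↔
        wrap (select (s : ZMod k) (concat β s k)) ∈ P (concat (fun i => proj (β i)) s k) := by
    intro β s
    rw [hF.accepts_iff, proj_select, proj_concat]
  simp only [← hF', ← hG, PosAut.acc_iff]
  constructor
  · intro h
    obtain ⟨n, α, rfl⟩ := exists_eq_longWord γ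
    obtain ⟨late, σ, h1, h2, h3, h4, h5⟩ := accepts_long.1 h
    obtain ⟨β, h6, h7, h8, h9⟩ := IsBody.exists_eq_decorate h1 h2 h3
      (fun i hi hi' => ⟨(h4 i hi hi').1, (h4 i hi hi').2.2⟩) h5
    refine ⟨n + 1, β, h6, fun i hi hi' => ?_, h7, h9, ?_⟩
    · have := (h4 i hi hi').2.1
      rwa [h8 i hi hi', proj_decorate] at this
    · unfold longWord
      congr 1
      refine List.map_congr_left fun i hi => ?_
      simp only [List.mem_range'_1] at hi
      rw [h8 i hi.1 (by omega)]
  · rintro ⟨n, β, hk, h1, h2, h3, rfl⟩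
    obtain ⟨n, rfl⟩ : ∃ m, n = m + 1 := ⟨n - 1, by omega⟩
    obtain ⟨σ, h4, h5⟩ := exists_path_of_isBody hk h2 h3
    have h6 : ∀ {i j}, ¬ Running k (n + 1 + 1 - k) i j → σ i j = none := fun {i j} h => by
      by_contra h'
      exact h ((h4 i j).1 h')
    -- There are `n + 1` factors here, so a block starts at `i` when `i + k ≤ n + 2`; `late` is the
    -- negation.
    refine accepts_long.2 ⟨fun i => decide (n + 2 < i + k), σ, by simp; omega, fun j => h6 ?_,
      fun j => h6 ?_, fun i hi hi' => ⟨?_, ?_, fun j => h5 i j hi hi', h6 ?_⟩, fun i hi hi' => ⟨?_, ?_⟩⟩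
    · rintro ⟨s, h7, h8, -⟩
      omega
    · rintro ⟨s, h7, h8, h9, h10, -⟩
      omega
    · refine path_control.2 ⟨β i, decide (k ≤ i), h2.sorted i hi hi', ?_⟩
      unfold decorate opening closing
      by_cases h7 : i + k ≤ n + 1 + 1
      · simp [h7, show ¬ n + 2 < i + k by omega]
      · simp [h7, show n + 2 < i + k by omega]
    · rw [proj_decorate]
      exact h1 i hi hi'
    · rintro ⟨s, h7, h8, h9, h10, h11⟩
      have := natCast_inj_of_lt h8.le h9 h11
      omega
    · simp only [decide_eq_true_eq]
      omega
    · simp only [decide_eq_true_eq]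
      intro h7
      -- The last block, which starts at `n + 2 - k`, is still open at the start of a late segment.
      exact ⟨_, (h4 (i + 1) _).2 ⟨n + 2 - k, by omega, by omega, by omega, by omega, rfl⟩⟩

end Long

/-! ### The automaton for parsings with fewer than `k` factors. -/

section Short

variable {A : Type*} {S : Type} {k : ℕ} {G : PosAut A}

/-- Transitions for factorizations with less than `k` factors. The second component is the number of
factors read. -/
inductive ShortStep (k : ℕ) (S : Type) (G : PosAut A) : Option G.P × Fin k →
    A ⊕ (Unit ⊕ (ZMod k × Marker S)) → Option G.P × Fin k → Prop
  | letter {x a q c} : G.step x a q → ShortStep k S G (x, c) (.inl a) (some q, c)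
  | sep {x c c'} : G.fin x → c'.val = c.val + 1 →
      ShortStep k S G (x, c) (.inr (.inl ())) (none, c')

/-- The automaton for the parsings with less than `k` factors. -/
def short (k : ℕ) (S : Type) (G : PosAut A) : Aut (A ⊕ (Unit ⊕ (ZMod k × Marker S))) where
  Q := Option G.P × Fin k
  fintype := inferInstance
  step := ShortStep k S G
  start p := p.1 = none ∧ p.2.val = 0
  accept p := p.1 = none

theorem card_short : Fintype.card (short k S G).Q = (Fintype.card G.P + 1) * k := by
  have : Fintype.card (short k S G).Q = Fintype.card (Option G.P × Fin k) :=
    Fintype.card_congr (Equiv.refl _)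
  simp [this]

theorem functional_short : (short k S G).Functional := by
  rintro p q m m' h h'
  cases h
  cases h'
  rfl

theorem path_short_letters {u : List A} {c : Fin k} : ∀ {x}, G.Acc x u → ∃ y, G.fin y ∧
    LPath (ShortStep k S G) (x, c) (u.map .inl) (y, c) := by
  induction u with
  | nil => exact fun h => ⟨_, h, rfl⟩
  | cons a u ih =>
    rintro x ⟨q, h, h'⟩
    obtain ⟨y, h1, h2⟩ := ih h'
    exact ⟨y, h1, _, .letter h, h2⟩

/-- The counter in `Fin k` leaves room for at most `k - 1` separators. No letter leads back to
`none`, so acceptance in `none` means that the word is empty or ends with a separator. -/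
theorem accepts_short {L : Language A} (hk : 0 < k) (hG : ∀ w, G.Acc none w ↔ w ∈ L)
    {γ : List (A ⊕ (Unit ⊕ (ZMod k × Marker S)))} : (short k S G).Accepts γ ↔
      ∃ us : List (List A), us.length < k ∧ (∀ u ∈ us, u ∈ L) ∧ γ = shortWord us := by
  constructor
  · rintro ⟨⟨_, c⟩, ⟨_, c'⟩, ⟨rfl, hc⟩, h, rfl⟩
    have key : ∀ (γ : List (A ⊕ (Unit ⊕ (ZMod k × Marker S)))) (x : Option G.P) (c c' : Fin k),
        LPath (ShortStep k S G) (x, c) γ (none, c') → (x = none ∧ γ = [] ∧ c = c') ∨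
        ∃ (u : List A) (us : List (List A)), G.Acc x u ∧ (∀ u ∈ us, u ∈ L) ∧
          c.val + us.length + 1 = c'.val ∧
          γ = u.map .inl ++ .inr (.inl ()) :: shortWord us := by
      intro γ
      induction γ with
      | nil =>
        intro x c c' h
        simpa using h
      | cons y γ ih =>
        rintro x c c' ⟨⟨z, d⟩, h, h'⟩
        right
        cases h with
        | letter h =>
          obtain ⟨⟨⟩, -⟩ | ⟨u, us, h1, h2, h3, rfl⟩ := ih _ _ _ h'
          exact ⟨_ :: u, us, ⟨_, h, h1⟩, h2, h3, rfl⟩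
        | sep h hc =>
          obtain ⟨-, rfl, rfl⟩ | ⟨u, us, h1, h2, h3, rfl⟩ := ih _ _ _ h'
          · exact ⟨[], [], h, by simp, by simp [hc], rfl⟩
          · exact ⟨[], u :: us, h, by simpa using ⟨(hG _).1 h1, h2⟩, by simp; omega,
              by simp [shortWord]⟩
    obtain ⟨-, rfl, -⟩ | ⟨u, us, h1, h2, h3, rfl⟩ := key γ _ _ _ h
    · exact ⟨[], hk, by simp, rfl⟩
    · exact ⟨u :: us, by simp; omega, by simpa using ⟨(hG _).1 h1, h2⟩, by simp [shortWord]⟩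
  · rintro ⟨us, h, h', rfl⟩
    have key : ∀ (us : List (List A)), (∀ u ∈ us, u ∈ L) → ∀ c c' : Fin k,
        c.val + us.length = c'.val →
        LPath (ShortStep k S G) (none, c) (shortWord us) (none, c') := by
      intro us
      induction us with
      | nil =>
        rintro - c c' h
        rw [show c = c' from Fin.ext h]
        rfl
      | cons u us ih =>
        intro h1 c c' h2
        rw [List.length_cons] at h2
        simp only [List.forall_mem_cons] at h1
        obtain ⟨y, h3, h4⟩ := path_short_letters (S := S) (c := c) ((hG u).2 h1.1)
        have h5 := ih h1.2 ⟨c + 1, by omega⟩ c' (by simp; omega)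
        have : shortWord (k := k) (S := S) (u :: us) =
            u.map .inl ++ .inr (.inl ()) :: shortWord us := by
          simp [shortWord]
        rw [this]
        exact h4.append ⟨_, .sep h3 rfl, h5⟩
    exact ⟨(none, ⟨0, hk⟩), (none, ⟨us.length, h⟩), ⟨rfl, rfl⟩, key us h' _ _ (by simp), rfl⟩

end Short

theorem exists_recognizes_kstar {A : Type*} {S : Type} {k : ℕ} [NeZero k] (e : RegularExpression A)
    {P : List A → Set (List (A ⊕ Marker S))} (hP : IsParsing P) {F : Aut (A ⊕ S)}
    (hF : F.Recognizes P) : ∃ M : Aut (A ⊕ (Unit ⊕ (ZMod k × Marker S))),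
      M.Recognizes (kstar k e.matches' P) ∧ Fintype.card M.Q = (e.nl + 1) * k +
        (e.nl + 1) * ((k * 2) * ((k + 2) * (Fintype.card F.Q + 1) ^ k)) := by
  obtain ⟨G, hG, hG'⟩ := PosAut.exists_acc_iff e
  have hk : 0 < k := Nat.pos_of_ne_zero (NeZero.ne k)
  refine ⟨union (short k S G) (long k G F),
    ⟨functional_union functional_short (functional_long hF.functional), fun γ => ?_⟩, ?_⟩
  · rw [accepts_union, accepts_short hk hG', accepts_long_iff_exists hG' hF, mem_kstar_iff hP]
    refine or_congr (exists_congr fun us => ?_) (exists_congr fun n => exists_congr fun β => ?_)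
    · constructor
      · rintro ⟨h1, h2, rfl⟩
        exact ⟨h1, h2, by simp, rfl⟩
      · rintro ⟨h1, h2, -, h3⟩
        exact ⟨h1, h2, wrap_inj.1 h3⟩
    · constructor
      · rintro ⟨h1, h2, h3, h4, rfl⟩
        refine ⟨h1, h2, ?_, h3, h4, rfl⟩
        rw [proj_longWord]
        simp
      · rintro ⟨h1, h2, -, h3, h4, h5⟩
        exact ⟨h1, h2, h3, h4, wrap_inj.1 h5⟩
  · rw [← hG, ← card_short (S := S), ← card_long]
    exact Fintype.card_sum

end Aut

/-- The left side consists of the first two terms of the binomial expansion of the right side. The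
second term absorbs a factor `k` in the bound for `k`-stars. -/
theorem Nat.pow_mul_add_le_add_pow (a b : ℕ) (n : ℕ) :
    a ^ n * (a + (n + 1) * b) ≤ (a + b) ^ (n + 1) := by
  induction n with
  | zero => simp
  | succ n ih =>
    calc a ^ (n + 1) * (a + (n + 1 + 1) * b) ≤ a ^ n * (a + (n + 1) * b) * (a + b) := by
          refine (Nat.le_add_right _ (a ^ n * ((n + 1) * b * b))).trans (le_of_eq ?_)
          ring
      _ ≤ (a + b) ^ (n + 1) * (a + b) := Nat.mul_le_mul_right _ ih
      _ = (a + b) ^ (n + 1 + 1) := (pow_succ _ _).symm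

namespace Aut

open Parsing

/-! ### From automata to one-way transducers. -/

section Transducer

variable {A : Type*} {N : Type}

open Classical in
/-- The transducer that outputs the words accepted by an automaton with at most one marker between
two states. -/
noncomputable def toTransducer (M : Aut (A ⊕ N)) (p q : M.Q) : OneWayTransducer A (A ⊕ N) M.Q where
  init := p
  final := {q}
  trans := {t | match t with
    | (p, some a, q) => M.step p (.inl a) q
    | (p, none, q) => ∃ m, M.step p (.inr m) q}
  out
    | (_, some a, _) => [.inl a]
    | (p, none, q) => if h : ∃ m, M.step p (.inr m) q then [.inr h.choose] else []

/-- The output is a function of the transition, and a silent transition shows only its two states;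
`Functional` makes the chosen marker the right one. -/
theorem run_toTransducer {M : Aut (A ⊕ N)} (hM : M.Functional) {p₀ q₀ p q : M.Q} {w y} :
    (M.toTransducer p₀ q₀).Run p w y q ↔ LPath M.step p y q ∧ proj y = w := by
  constructor
  · intro h
    induction h with
    | nil p => exact ⟨rfl, rfl⟩
    | @cons p q r x w y h _ ih =>
      obtain ⟨h1, rfl⟩ := ih
      rcases x with _ | a
      · have h' : ∃ m, M.step p (.inr m) q := h
        have : (M.toTransducer p₀ q₀).out (p, none, q) = [.inr h'.choose] := dif_pos h'
        rw [this]
        exact ⟨⟨q, h'.choose_spec, h1⟩, by simp⟩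
      · exact ⟨⟨q, h, h1⟩, by simp [toTransducer]⟩
  · rintro ⟨h, rfl⟩
    induction y generalizing p with
    | nil =>
      rw [LPath.nil_iff.1 h]
      exact .nil _
    | cons x y ih =>
      obtain ⟨r, h, h'⟩ := h
      rcases x with a | m
      · exact .cons (x := some a) (T := M.toTransducer p₀ q₀) (p := p) (q := r) h (ih h')
      · have h1 : ∃ m, M.step p (.inr m) r := ⟨m, h⟩
        have h2 : (M.toTransducer p₀ q₀).out (p, none, r) = [.inr h1.choose] := dif_pos h1
        have := OneWayTransducer.Run.cons (x := none) (T := M.toTransducer p₀ q₀) (p := p) (q := r)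
          h1 (ih h')
        rw [h2, hM h1.choose_spec h] at this
        simpa using this

end Transducer

end Aut

/-! ### State bound for the parser. -/

namespace RTE

open Parsing

variable {A B : Type*}

theorem three_le_size (h : RTE A B) : 3 ≤ h.size := by
  induction h <;> simp only [size] <;> omega

theorem one_le_width (h : RTE A B) : 1 ≤ h.width := by
  induction h <;> simp only [width] <;> omega

/-- The summand `2` is reserved for the outer parentheses. In the linear bound the steps for
products and stars leave no slack: a product adds `3` states but saves one reserve of `2`, and a
star adds one state. -/
theorem exists_recognizes (h : RTE A B) : ∃ M : Aut (A ⊕ h.Sub), M.Recognizes h.parse ∧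
    Fintype.card M.Q + 2 ≤ h.size ^ h.width ∧
    (¬ h.UsesHadamard → ¬ h.UsesKStar → Fintype.card M.Q + 2 ≤ h.size) := by
  -- Peeling off one factor lets powers with different exponents be added, as multiples of one power
  -- of `N`.
  have hpow : ∀ {x a n N : ℕ}, 1 ≤ x → 1 ≤ a → a ≤ n → x ≤ N → x ^ a ≤ x * N ^ (n - 1) := by
    intro x a n N h1 h2 h3 h4
    obtain ⟨a, rfl⟩ : ∃ b, a = b + 1 := ⟨a - 1, by omega⟩
    rw [pow_succ']
    exact Nat.mul_le_mul_left _ ((Nat.pow_le_pow_left h4 a).trans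
      (Nat.pow_le_pow_right (by omega) (by omega)))
  have hpow' : ∀ {n N : ℕ}, 1 ≤ n → N ^ n = N * N ^ (n - 1) := by
    intro n N h
    rw [← pow_succ', Nat.sub_add_cancel h]
  have hsum : ∀ {c F G a b : ℕ}, 3 ≤ F → 3 ≤ G → 1 ≤ a → 1 ≤ b → c ≤ F ^ a + G ^ b + 1 →
      c ≤ (1 + F + G) ^ max a b := by
    intro c F G a b h1 h2 h3 h4 h5
    have h6 := hpow (N := 1 + F + G) (by omega : 1 ≤ F) h3 (le_max_left a b) (by omega)
    have h7 := hpow (N := 1 + F + G) (by omega : 1 ≤ G) h4 (le_max_right a b) (by omega)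
    rw [hpow' (h3.trans (le_max_left a b))]
    have h8 : 1 ≤ (1 + F + G) ^ (max a b - 1) := Nat.one_le_pow _ _ (by omega)
    nlinarith
  have hstar : ∀ {c F a : ℕ}, 3 ≤ F → 1 ≤ a → c ≤ F ^ a + 1 → c ≤ (1 + F) ^ a := by
    intro c F a h1 h2 h3
    have h6 := hpow (N := 1 + F) (by omega : 1 ≤ F) h2 le_rfl (by omega)
    rw [hpow' h2]
    have h8 : 1 ≤ (1 + F) ^ (a - 1) := Nat.one_le_pow _ _ (by omega)
    nlinarith
  have hhad : ∀ {x y F G a b : ℕ}, 3 ≤ F → 3 ≤ G → 1 ≤ a → 1 ≤ b → x ≤ F ^ a → y ≤ G ^ b →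
      2 * (x * y) + 2 ≤ (1 + F + G) ^ (a + b) := by
    intro x y F G a b h1 h2 h3 h4 h5 h6
    obtain ⟨a, rfl⟩ : ∃ c, a = c + 1 := ⟨a - 1, by omega⟩
    obtain ⟨b, rfl⟩ : ∃ c, b = c + 1 := ⟨b - 1, by omega⟩
    have h7 : x * y ≤ F ^ a * G ^ b * (F * G) := by
      calc x * y ≤ F ^ (a + 1) * G ^ (b + 1) := Nat.mul_le_mul h5 h6
        _ = _ := by ring
    have h8 : F ^ a * G ^ b * ((1 + F + G) * (1 + F + G)) ≤ (1 + F + G) ^ (a + 1 + (b + 1)) := by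
      calc _ ≤ (1 + F + G) ^ a * (1 + F + G) ^ b * ((1 + F + G) * (1 + F + G)) :=
            Nat.mul_le_mul_right _ (Nat.mul_le_mul (Nat.pow_le_pow_left (by omega) _)
              (Nat.pow_le_pow_left (by omega) _))
        _ = _ := by ring
    have h9 : 1 ≤ F ^ a * G ^ b :=
      Nat.mul_pos (Nat.one_le_pow _ _ (by omega)) (Nat.one_le_pow _ _ (by omega))
    -- The cross term of the square pays for the flag of the synchronized product.
    have h10 : 2 * (F * G) + 2 ≤ (1 + F + G) * (1 + F + G) := by nlinarith
    nlinarith [Nat.mul_le_mul_left (F ^ a * G ^ b) h10]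
  have hk : ∀ {l k c F w : ℕ}, 1 ≤ k → 1 ≤ w → 3 ≤ F → c + 2 ≤ F ^ w →
      (l + 1) * k + (l + 1) * ((k * 2) * ((k + 2) * (c + 1) ^ k)) + 2 ≤
        (1 + l + F + k + 1) ^ (2 + k * w) := by
    intro l k c F w h1 h2 h3 h4
    obtain ⟨n, hn⟩ : ∃ n, k * w = n + 1 := ⟨k * w - 1, by
      have := Nat.mul_pos h1 h2
      omega⟩
    have h5 : (c + 1) ^ k ≤ F ^ n * F := by
      rw [← pow_succ, ← hn, mul_comm k w, pow_mul]
      exact Nat.pow_le_pow_left (by omega) _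
    have h6 : 1 ≤ F ^ n := Nat.one_le_pow _ _ (by omega)
    -- Since `k ≤ k * w = n + 1`, the second binomial term yields the factor `k` that the two extra
    -- units of width do not cover.
    have h7 : F ^ n * (F + k * (l + k + 2)) ≤ (F + (l + k + 2)) ^ (n + 1) := by
      refine le_trans (Nat.mul_le_mul_left _ ?_) (Nat.pow_mul_add_le_add_pow F (l + k + 2) n)
      have : k ≤ n + 1 := hn ▸ Nat.le_mul_of_pos_right _ h2
      exact Nat.add_le_add_left (Nat.mul_le_mul_right _ this) _
    have h8 : (1 + l + F + k + 1) ^ (2 + k * w) =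
        (F + (l + k + 2)) ^ 2 * (F + (l + k + 2)) ^ (n + 1) := by
      rw [hn, pow_add]
      congr 2 <;> ring
    have h9 : F * ((l + 1) * k * (2 * k + 5)) + 2 ≤
        (F + (l + k + 2)) ^ 2 * (F + k * (l + k + 2)) := by
      have h10 : (l + 1) * (2 * k + 5) ≤ (F + (l + k + 2)) * (l + k + 2) := by nlinarith
      have h11 : F * ((F + (l + k + 2)) * (l + k + 2)) ≤
          (F + (l + k + 2)) * ((F + (l + k + 2)) * (l + k + 2)) :=
        Nat.mul_le_mul_right _ (by omega)
      have h12 : F * ((l + 1) * (2 * k + 5)) * k ≤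
          (F + (l + k + 2)) * ((F + (l + k + 2)) * (l + k + 2)) * k :=
        Nat.mul_le_mul_right _ ((Nat.mul_le_mul_left _ h10).trans h11)
      have h13 : 2 ≤ (F + (l + k + 2)) ^ 2 * F := by nlinarith
      nlinarith
    rw [h8]
    refine le_trans ?_ (Nat.mul_le_mul_left _ h7)
    -- Here `2 * (k + 2) + 1 = 2 * k + 5`: the automaton for short factorizations is charged to one
    -- more multiple of the power.
    have h10 : (l + 1) * k + (l + 1) * ((k * 2) * ((k + 2) * (c + 1) ^ k)) + 2 ≤
        F ^ n * (F * ((l + 1) * k * (2 * k + 5)) + 2) := by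
      have h11 : (l + 1) * ((k * 2) * ((k + 2) * (c + 1) ^ k)) ≤
          (l + 1) * ((k * 2) * ((k + 2) * (F ^ n * F))) := by gcongr
      have h12 : 1 ≤ F ^ n * F := Nat.mul_pos h6 (by omega)
      have h13 : (l + 1) * k ≤ (l + 1) * k * (F ^ n * F) := Nat.le_mul_of_pos_right _ h12
      nlinarith
    refine h10.trans ((Nat.mul_le_mul_left _ h9).trans (le_of_eq ?_))
    ring
  induction h with
  | base e v =>
    obtain ⟨M, hM, hc⟩ := Aut.exists_recognizes_base e
    refine ⟨M, hM, ?_, fun _ _ => ?_⟩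
    · simp only [size, width, pow_one]; omega
    · simp only [size]; omega
  | sum f g hf hg =>
    obtain ⟨F, hF, hF1, hF2⟩ := hf
    obtain ⟨G, hG, hG1, hG2⟩ := hg
    obtain ⟨M, hM, hc⟩ := Aut.exists_recognizes_sum (isParsing_parse f) (isParsing_parse g) hF hG
    refine ⟨M, hM, hsum f.three_le_size g.three_le_size f.one_le_width g.one_le_width
      (by omega), fun h1 h2 => ?_⟩
    simp only [UsesHadamard, UsesKStar, not_or] at h1 h2
    have := hF2 h1.1 h2.1
    have := hG2 h1.2 h2.2
    simp only [size]; omega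
  | cauchy f g hf hg | rcauchy f g hf hg =>
    obtain ⟨F, hF, hF1, hF2⟩ := hf
    obtain ⟨G, hG, hG1, hG2⟩ := hg
    obtain ⟨M, hM, hc⟩ := Aut.exists_recognizes_cauchy (isParsing_parse f) (isParsing_parse g) hF hG
    refine ⟨M, hM, hsum f.three_le_size g.three_le_size f.one_le_width g.one_le_width
      (by omega), fun h1 h2 => ?_⟩
    simp only [UsesHadamard, UsesKStar, not_or] at h1 h2
    have := hF2 h1.1 h2.1
    have := hG2 h1.2 h2.2
    simp only [size]; omega
  | star f hf | rstar f hf =>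
    obtain ⟨F, hF, hF1, hF2⟩ := hf
    obtain ⟨M, hM, hc⟩ := Aut.exists_recognizes_star (isParsing_parse f) hF
    refine ⟨M, hM, hstar (a := f.width) f.three_le_size f.one_le_width (by omega), fun h1 h2 => ?_⟩
    simp only [UsesHadamard, UsesKStar] at h1 h2
    have := hF2 h1 h2
    simp only [size]; omega
  | had f g hf hg =>
    obtain ⟨F, hF, hF1, -⟩ := hf
    obtain ⟨G, hG, hG1, -⟩ := hg
    obtain ⟨M, hM, hc⟩ := Aut.exists_recognizes_had (isParsing_parse f) (isParsing_parse g) hF hG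
    refine ⟨M, hM, ?_, fun h1 => absurd trivial h1⟩
    rw [hc]
    exact hhad f.three_le_size g.three_le_size f.one_le_width g.one_le_width hF1 hG1
  | kstar k e f hf | krstar k e f hf =>
    obtain ⟨F, hF, hF1, -⟩ := hf
    obtain ⟨M, hM, hc⟩ := Aut.exists_recognizes_kstar (k := k) e (isParsing_parse f) hF
    refine ⟨M, hM, ?_, fun _ h1 => absurd trivial h1⟩
    rw [hc]
    exact hk k.pos f.one_le_width f.three_le_size hF1

/-- The parser. -/
theorem exists_parser (h : RTE A B) : ∃ (Q : Type) (_ : Fintype Q) (P : OneWayTransducer A h.Sym Q),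
    (∀ w, P.sem w = h.parse w) ∧ Fintype.card Q ≤ h.size ^ h.width ∧
      (¬ h.UsesHadamard → ¬ h.UsesKStar → Fintype.card Q ≤ h.size) := by
  obtain ⟨M, hM, h1, h2⟩ := h.exists_recognizes
  -- The outer parentheses are read at the expense of the two states in reserve.
  rw [← Aut.card_wrapAut] at h1 h2
  refine ⟨M.wrapAut.Q, inferInstance, M.wrapAut.toTransducer (.inl false) (.inl true), fun w => ?_,
    h1, h2⟩
  ext α
  have h3 := Aut.accepts_wrapAut (isParsing_parse h) hM (α := α)
  constructor
  · rintro ⟨q, rfl, h4⟩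
    obtain ⟨h5, rfl⟩ := (Aut.run_toTransducer (Aut.functional_wrapAut hM)).1 h4
    exact h3.1 ⟨_, _, rfl, h5, rfl⟩
  · intro h4
    obtain rfl := (isParsing_parse h).proj_eq h4
    obtain ⟨_, _, rfl, h5, rfl⟩ := h3.2 h4
    exact ⟨_, rfl, (Aut.run_toTransducer (Aut.functional_wrapAut hM)).2 ⟨h5, rfl⟩⟩

end RTE

/-! ### Two-way machines -/

/-- Two-way machines with a finite type of states, without endmarkers. A machine evaluates a word
between two symbols `op` and `cl`: it starts in the state `inn` after `op`, and ends in the state `fin`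
before `cl`. -/
structure Ev (X B : Type*) where
  Q : Type
  fintype : Fintype Q
  fwd : Q → Bool
  tr : Q → X → List B → Q → Prop
  inn : Q
  fin : Q

namespace Ev

attribute [instance] Ev.fintype

variable {X Y B : Type*}

/-- Steps between configurations; the word to the left of the head is reversed. -/
inductive Step (E : Ev X B) : List X × E.Q × List X → List B → List X × E.Q × List X → Prop
  | ff {L V x o p q} : E.fwd p = true → E.fwd q = true → E.tr p x o q →
      Step E (L, p, x :: V) o (x :: L, q, V)
  | fb {L V x o p q} : E.fwd p = true → E.fwd q = false → E.tr p x o q →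
      Step E (L, p, x :: V) o (L, q, x :: V)
  | bf {L V x o p q} : E.fwd p = false → E.fwd q = true → E.tr p x o q →
      Step E (x :: L, p, V) o (x :: L, q, V)
  | bb {L V x o p q} : E.fwd p = false → E.fwd q = false → E.tr p x o q →
      Step E (x :: L, p, V) o (L, q, x :: V)

/-- Runs and their outputs. -/
inductive Run (E : Ev X B) : List X × E.Q × List X → List B → List X × E.Q × List X → Prop
  | nil (c) : Run E c [] c
  | cons {c d e o y} : Step E c o d → Run E d y e → Run E c (o ++ y) e

variable {E : Ev X B}

theorem Run.trans {c d e : List X × E.Q × List X} {y z : List B} (h : E.Run c y d)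
    (h' : E.Run d z e) : E.Run c (y ++ z) e := by
  induction h with
  | nil => exact h'
  | cons h _ ih =>
    rw [List.append_assoc]
    exact .cons h (ih h')

theorem Run.silent {c d e : List X × E.Q × List X} {y : List B} (h : E.Run c y d)
    (h' : E.Run d [] e) : E.Run c y e := by
  simpa using h.trans h'

theorem Step.run {c d : List X × E.Q × List X} {o : List B} (h : E.Step c o d) : E.Run c o d := by
  simpa using Run.cons h (.nil d)

theorem Step.context {c d : List X × E.Q × List X} {o : List B} (h : E.Step c o d) (L V : List X) :
    E.Step (c.1 ++ L, c.2.1, c.2.2 ++ V) o (d.1 ++ L, d.2.1, d.2.2 ++ V) := by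
  cases h with
  | ff h h' h'' => exact .ff h h' h''
  | fb h h' h'' => exact .fb h h' h''
  | bf h h' h'' => exact .bf h h' h''
  | bb h h' h'' => exact .bb h h' h''

/-- A run sees only the cells that it visits. This is how the evaluator of a subexpression runs
inside a larger parsing. -/
theorem Run.context {c d : List X × E.Q × List X} {y : List B} (h : E.Run c y d) (L V : List X) :
    E.Run (c.1 ++ L, c.2.1, c.2.2 ++ V) y (d.1 ++ L, d.2.1, d.2.2 ++ V) := by
  induction h with
  | nil => exact .nil _
  | cons h _ ih => exact .cons (h.context L V) ih

theorem run_scan {p : E.Q} (hp : E.fwd p = true) {γ : List X} (h : ∀ x ∈ γ, E.tr p x [] p) :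
    ∀ L V : List X, E.Run (L, p, γ ++ V) [] (γ.reverse ++ L, p, V) := by
  induction γ with
  | nil => exact fun L V => .nil _
  | cons x γ ih =>
    intro L V
    simp only [List.forall_mem_cons] at h
    have := ih h.2 (x :: L) V
    rw [List.reverse_cons, List.append_assoc]
    exact .cons (.ff hp hp h.1) this

theorem run_scan_back {p : E.Q} (hp : E.fwd p = false) {γ : List X} (h : ∀ x ∈ γ, E.tr p x [] p)
    (L V : List X) : E.Run (γ.reverse ++ L, p, V) [] (L, p, γ ++ V) := by
  have key : ∀ (γ V : List X), (∀ x ∈ γ, E.tr p x [] p) →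
      E.Run (γ ++ L, p, V) [] (L, p, γ.reverse ++ V) := by
    intro γ
    induction γ with
    | nil => exact fun V _ => .nil _
    | cons x γ ih =>
      intro V h
      simp only [List.forall_mem_cons] at h
      have := ih (x :: V) h.2
      rw [List.reverse_cons, List.append_assoc]
      exact .cons (.bb hp hp h.1) this
  have := key γ.reverse V (by simpa using h)
  rwa [List.reverse_reverse] at this

/-- Evaluation of a word between the symbols `op` and `cl`. -/
def Computes (E : Ev X B) (op cl : X) (β : List X) (y : List B) : Prop :=
  E.Run ([op], E.inn, β ++ [cl]) y (β.reverse ++ [op], E.fin, [cl])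

theorem Computes.run {op cl : X} {β : List X} {y : List B} (h : E.Computes op cl β y)
    (L V : List X) :
    E.Run (op :: L, E.inn, β ++ cl :: V) y (β.reverse ++ op :: L, E.fin, cl :: V) := by
  have := h.context L V
  simpa using this

/-- Reversibility, including the transitions that enter and leave the machine. -/
structure IsRev (E : Ev X B) (op cl : X) : Prop where
  det : ∀ {p x o q o' q'}, E.tr p x o q → E.tr p x o' q' → o = o' ∧ q = q'
  codet : ∀ {p x o q o' p'}, E.tr p x o q → E.tr p' x o' q → p = p'
  inn_fwd : E.fwd E.inn = true
  fin_fwd : E.fwd E.fin = true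
  inn_op : ∀ {p o}, ¬ E.tr p op o E.inn
  fin_cl : ∀ {o q}, ¬ E.tr E.fin cl o q

section Comap

/-- The machine that ignores the symbols `x` with `φ x = none`, and reads `φ x` otherwise. -/
def comap (E : Ev Y B) (φ : X → Option Y) : Ev X B where
  Q := E.Q
  fintype := inferInstance
  fwd := E.fwd
  tr p x o q := (φ x = none ∧ o = [] ∧ p = q) ∨ ∃ y, φ x = some y ∧ E.tr p y o q
  inn := E.inn
  fin := E.fin

variable {E : Ev Y B} {φ : X → Option Y} {op cl : Y} {op' cl' : X}

/-- An ignored symbol gives a loop at every state, which is deterministic and co-deterministic; on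
the other symbols nothing changes. -/
theorem IsRev.comap (h : E.IsRev op cl) (h1 : φ op' = some op) (h2 : φ cl' = some cl) :
    (E.comap φ).IsRev op' cl' where
  det := by
    rintro p x o q o' q' (⟨h3, rfl, rfl⟩ | ⟨y, h3, h4⟩) (⟨h5, rfl, rfl⟩ | ⟨y', h5, h6⟩)
    · exact ⟨rfl, rfl⟩
    · rw [h3] at h5; cases h5
    · rw [h3] at h5; cases h5
    · rw [h3] at h5; cases h5; exact h.det h4 h6
  codet := by
    rintro p x o q o' p' (⟨h3, rfl, rfl⟩ | ⟨y, h3, h4⟩) (⟨h5, rfl, rfl⟩ | ⟨y', h5, h6⟩)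
    · rfl
    · rw [h3] at h5; cases h5
    · rw [h3] at h5; cases h5
    · rw [h3] at h5; cases h5; exact h.codet h4 h6
  inn_fwd := h.inn_fwd
  fin_fwd := h.fin_fwd
  inn_op := by
    rintro p o (⟨h3, -⟩ | ⟨y, h3, h4⟩)
    · rw [h1] at h3; cases h3
    · rw [h1] at h3; cases h3; exact h.inn_op h4
  fin_cl := by
    rintro o q (⟨h3, -⟩ | ⟨y, h3, h4⟩)
    · rw [h2] at h3; cases h3
    · rw [h2] at h3; cases h3; exact h.fin_cl h4

theorem exists_run_ahead {p : E.Q} (hp : E.fwd p = true) {L V : List X} {y : Y} {W : List Y}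
    (h : V.filterMap φ = y :: W) : ∃ V₁ x V₂, V = V₁ ++ x :: V₂ ∧ (∀ z ∈ V₁, φ z = none) ∧
      φ x = some y ∧ V₂.filterMap φ = W ∧
      (E.comap φ).Run (L, p, V) [] (V₁.reverse ++ L, p, x :: V₂) := by
  obtain ⟨V₁, x, V₂, rfl, h1, h2, h3⟩ := List.filterMap_eq_cons_iff.1 h
  exact ⟨V₁, x, V₂, rfl, h1, h2, h3, run_scan (E := E.comap φ) hp
    (fun z hz => .inl ⟨h1 z hz, rfl, rfl⟩) _ _⟩

theorem exists_run_behind {p : E.Q} (hp : E.fwd p = false) {L V : List X} {y : Y} {W : List Y}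
    (h : L.filterMap φ = y :: W) : ∃ L₁ x L₂, L = L₁ ++ x :: L₂ ∧ (∀ z ∈ L₁, φ z = none) ∧
      φ x = some y ∧ L₂.filterMap φ = W ∧
      (E.comap φ).Run (L, p, V) [] (x :: L₂, p, L₁.reverse ++ V) := by
  obtain ⟨L₁, x, L₂, rfl, h1, h2, h3⟩ := List.filterMap_eq_cons_iff.1 h
  refine ⟨L₁, x, L₂, rfl, h1, h2, h3, ?_⟩
  have := run_scan_back (E := E.comap φ) hp (γ := L₁.reverse)
    (fun z hz => .inl ⟨h1 z (List.mem_reverse.1 hz), rfl, rfl⟩) (x :: L₂) V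
  rwa [List.reverse_reverse] at this

theorem filterMap_of_forall_eq_none {l : List X} (h : ∀ z ∈ l, φ z = none) :
    l.filterMap φ = [] := List.filterMap_eq_nil_iff.2 h

/-- Before each step the head slides in its direction over ignored symbols to the next visible one.
The tape `L.reverse ++ V` stays the same. -/
theorem Step.exists_comap {c d : List Y × E.Q × List Y} {o : List B} (h : E.Step c o d)
    {L V : List X} (hL : L.filterMap φ = c.1) (hV : V.filterMap φ = c.2.2) :
    ∃ L' V', L'.filterMap φ = d.1 ∧ V'.filterMap φ = d.2.2 ∧ L'.reverse ++ V' = L.reverse ++ V ∧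
      (E.comap φ).Run (L, c.2.1, V) o (L', d.2.1, V') := by
  cases h with
  | @ff L₀ V₀ y o p q h h' h'' =>
    obtain ⟨V₁, x, V₂, rfl, h1, h2, h3, h4⟩ := exists_run_ahead (L := L) h hV
    refine ⟨x :: (V₁.reverse ++ L), V₂, ?_, h3, by simp, h4.trans (Step.run (.ff h h' ?_))⟩
    · rw [List.filterMap_cons_some h2, List.filterMap_append,
        filterMap_of_forall_eq_none (by simpa using h1), hL, List.nil_append]
    · exact .inr ⟨y, h2, h''⟩
  | @fb L₀ V₀ y o p q h h' h'' =>
    obtain ⟨V₁, x, V₂, rfl, h1, h2, h3, h4⟩ := exists_run_ahead (L := L) h hV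
    refine ⟨V₁.reverse ++ L, x :: V₂, ?_, ?_, by simp, h4.trans (Step.run (.fb h h' ?_))⟩
    · rw [List.filterMap_append,
        filterMap_of_forall_eq_none (by simpa using h1), hL, List.nil_append]
    · rw [List.filterMap_cons_some h2, h3]
    · exact .inr ⟨y, h2, h''⟩
  | @bf L₀ V₀ y o p q h h' h'' =>
    obtain ⟨L₁, x, L₂, rfl, h1, h2, h3, h4⟩ := exists_run_behind (V := V) h hL
    refine ⟨x :: L₂, L₁.reverse ++ V, ?_, ?_, by simp, h4.trans (Step.run (.bf h h' ?_))⟩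
    · rw [List.filterMap_cons_some h2, h3]
    · rw [List.filterMap_append,
        filterMap_of_forall_eq_none (by simpa using h1), hV, List.nil_append]
    · exact .inr ⟨y, h2, h''⟩
  | @bb L₀ V₀ y o p q h h' h'' =>
    obtain ⟨L₁, x, L₂, rfl, h1, h2, h3, h4⟩ := exists_run_behind (V := V) h hL
    refine ⟨L₂, x :: (L₁.reverse ++ V), h3, ?_, by simp, h4.trans (Step.run (.bb h h' ?_))⟩
    · rw [List.filterMap_cons_some h2, List.filterMap_append,
        filterMap_of_forall_eq_none (by simpa using h1), hV, List.nil_append]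
    · exact .inr ⟨y, h2, h''⟩

theorem Run.exists_comap {c d : List Y × E.Q × List Y} {y : List B} (h : E.Run c y d) :
    ∀ {L V : List X}, L.filterMap φ = c.1 → V.filterMap φ = c.2.2 →
    ∃ L' V', L'.filterMap φ = d.1 ∧ V'.filterMap φ = d.2.2 ∧ L'.reverse ++ V' = L.reverse ++ V ∧
      (E.comap φ).Run (L, c.2.1, V) y (L', d.2.1, V') := by
  induction h with
  | nil c => exact fun {L V} hL hV => ⟨L, V, hL, hV, rfl, .nil _⟩
  | cons h _ ih =>
    intro L V hL hV
    obtain ⟨L₁, V₁, h1, h2, h3, h4⟩ := h.exists_comap hL hV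
    obtain ⟨L₂, V₂, h5, h6, h7, h8⟩ := ih h1 h2
    exact ⟨L₂, V₂, h5, h6, h7.trans h3, h4.trans h8⟩

/-- The simulation may leave the head among ignored symbols before `cl'`. Since the final state is
forward, it slides on to `cl'`. -/
theorem Computes.comap {γ : List X} {y : List B} (h : E.Computes op cl (γ.filterMap φ) y)
    (hf : E.fwd E.fin = true) (h1 : φ op' = some op) (h2 : φ cl' = some cl) :
    (E.comap φ).Computes op' cl' γ y := by
  obtain ⟨L, V, h3, h4, h5, h6⟩ := Run.exists_comap (φ := φ) h (L := [op']) (V := γ ++ [cl'])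
    (by simp [h1]) (by simp [h2])
  obtain ⟨V₁, x, V₂, rfl, h7, h8, h9, h10⟩ := exists_run_ahead (L := L) hf h4
  -- Otherwise `cl'`, the last cell, would be one of the ignored symbols of `V₂`.
  have h11 : V₂ = [] := by
    by_contra h12
    obtain ⟨V₃, z, rfl⟩ : ∃ V₃ z, V₂ = V₃ ++ [z] :=
      ⟨_, _, (List.dropLast_append_getLast h12).symm⟩
    have h13 : (L.reverse ++ V₁ ++ x :: V₃) ++ [z] = ([op'].reverse ++ γ) ++ [cl'] := by
      simpa using h5
    obtain ⟨-, h14⟩ := List.append_inj' h13 rfl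
    simp only [List.cons.injEq, and_true] at h14
    rw [h14] at h9
    have := List.filterMap_eq_nil_iff.1 h9 cl' (by simp)
    rw [h2] at this
    cases this
  subst h11
  have h13 : (L.reverse ++ V₁) ++ [x] = ([op'].reverse ++ γ) ++ [cl'] := by simpa using h5
  obtain ⟨h14, h15⟩ := List.append_inj' h13 rfl
  simp only [List.cons.injEq, and_true] at h15
  subst h15
  have h16 : V₁.reverse ++ L = γ.reverse ++ [op'] := by
    simpa using congrArg List.reverse h14
  rw [h16] at h10
  exact h6.silent h10

end Comap

end Ev

/-! ### Machines that call other machines -/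

/-- Control of a machine that calls machines indexed by `I`: `keep z x` tells that the control state
`z` loops on `x`, `move` lists the other transitions; machine `i` is called in the state `src i`, and
returns in the state `ret i`. -/
structure Frame (I : Type) (X : Type*) where
  Z : Type
  fintype : Fintype Z
  fwd : Z → Bool
  keep : Z → X → Prop
  move : Z → X → Z → Prop
  src : I → Z
  ret : I → Z
  inn : Z
  fin : Z

namespace Frame

attribute [instance] Frame.fintype

variable {I : Type} {X B : Type*}

/-- Reversibility, when the machines are called by the symbols `op i` and return on the symbols
`cl i`. -/
structure IsRev (T : Frame I X) (op cl : I → X) (op₀ cl₀ : X) : Prop where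
  op_injective : Function.Injective op
  cl_injective : Function.Injective cl
  cl_ne : ∀ i, cl i ≠ op₀
  op_ne : ∀ i, op i ≠ cl₀
  det : ∀ {z x z' z''}, T.move z x z' → T.move z x z'' → z' = z''
  codet : ∀ {z x z' z''}, T.move z x z'' → T.move z' x z'' → z = z'
  keep_move : ∀ {z x z'}, T.keep z x → ¬ T.move z x z'
  move_keep : ∀ {z x z'}, T.move z x z' → ¬ T.keep z' x
  keep_src : ∀ i, ¬ T.keep (T.src i) (op i)
  move_src : ∀ i z, ¬ T.move (T.src i) (op i) z
  keep_ret : ∀ i, ¬ T.keep (T.ret i) (cl i)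
  move_ret : ∀ i z, ¬ T.move z (cl i) (T.ret i)
  keep_inn : ¬ T.keep T.inn op₀
  move_inn : ∀ z, ¬ T.move z op₀ T.inn
  keep_fin : ¬ T.keep T.fin cl₀
  move_fin : ∀ z, ¬ T.move T.fin cl₀ z
  inn_fwd : T.fwd T.inn = true

variable [Fintype I] (T : Frame I X) (E : I → Ev X B) (op cl : I → X)

/-- Transitions of the composite machine. -/
inductive Tr : T.Z ⊕ (Σ i, (E i).Q) → X → List B → T.Z ⊕ (Σ i, (E i).Q) → Prop
  | keep {z x} : T.keep z x → Tr (.inl z) x [] (.inl z)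
  | move {z x z'} : T.move z x z' → Tr (.inl z) x [] (.inl z')
  | call {i z x} : z = T.src i → x = op i → Tr (.inl z) x [] (.inr ⟨i, (E i).inn⟩)
  | inner {i p x o q} : (E i).tr p x o q → Tr (.inr ⟨i, p⟩) x o (.inr ⟨i, q⟩)
  | ret {i z x} : x = cl i → z = T.ret i → Tr (.inr ⟨i, (E i).fin⟩) x [] (.inl z)

/-- The composite machine. -/
def comp : Ev X B where
  Q := T.Z ⊕ (Σ i, (E i).Q)
  fintype := inferInstance
  fwd := Sum.elim T.fwd fun p => (E p.1).fwd p.2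
  tr := Tr T E op cl
  inn := .inl T.inn
  fin := .inl T.fin

theorem card_comp : Fintype.card (T.comp E op cl).Q =
    Fintype.card T.Z + ∑ i, Fintype.card (E i).Q :=
  Fintype.card_sum.trans (congrArg _ Fintype.card_sigma)

variable {T E op cl} {op₀ cl₀ : X}

/-- Conflicts could arise only at calls and returns. A call enters `inn` on `op i`, which no
transition of machine `i` does, and injectivity of `op` identifies the machine that is called;
returns are symmetric. -/
theorem IsRev.comp (hT : T.IsRev op cl op₀ cl₀) (hf : T.fwd T.fin = true) (hE : ∀ i, (E i).IsRev (op i) (cl i)) :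
    (T.comp E op cl).IsRev op₀ cl₀ where
  det := by
    intro p x o q o' q' h h'
    change Tr T E op cl p x o q at h
    change Tr T E op cl p x o' q' at h'
    cases h with
    | keep h =>
      cases h' with
      | keep => exact ⟨rfl, rfl⟩
      | move h' => exact (hT.keep_move h h').elim
      | call h1 h2 => subst h1 h2; exact (hT.keep_src _ h).elim
    | move h =>
      cases h' with
      | keep h' => exact (hT.keep_move h' h).elim
      | move h' => exact ⟨rfl, congrArg _ (hT.det h h')⟩
      | call h1 h2 => subst h1 h2; exact (hT.move_src _ _ h).elim
    | call h1 h2 =>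
      cases h' with
      | keep h => subst h1 h2; exact (hT.keep_src _ h).elim
      | move h => subst h1 h2; exact (hT.move_src _ _ h).elim
      | call h3 h4 => obtain rfl := hT.op_injective (h2.symm.trans h4); exact ⟨rfl, rfl⟩
    | inner h =>
      generalize hp : (Sum.inr ⟨_, _⟩ : T.Z ⊕ (Σ i, (E i).Q)) = p at h'
      cases h' with
      | keep | move | call => simp at hp
      | inner h' =>
        cases hp
        obtain ⟨rfl, rfl⟩ := (hE _).det h h'
        exact ⟨rfl, rfl⟩
      | ret h1 h2 => cases hp; subst h1; exact ((hE _).fin_cl h).elim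
    | ret h1 h2 =>
      generalize hp : (Sum.inr ⟨_, _⟩ : T.Z ⊕ (Σ i, (E i).Q)) = p at h'
      cases h' with
      | keep | move | call => simp at hp
      | inner h' => cases hp; subst h1; exact ((hE _).fin_cl h').elim
      | ret h3 h4 => cases hp; subst h2 h4; exact ⟨rfl, rfl⟩
  codet := by
    intro p x o q o' p' h h'
    change Tr T E op cl p x o q at h
    change Tr T E op cl p' x o' q at h'
    cases h with
    | keep h =>
      cases h' with
      | keep => rfl
      | move h' => exact (hT.move_keep h' h).elim
      | ret h1 h2 => subst h1 h2; exact (hT.keep_ret _ h).elim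
    | move h =>
      cases h' with
      | keep h' => exact (hT.move_keep h h').elim
      | move h' => exact congrArg _ (hT.codet h h')
      | ret h1 h2 => subst h1 h2; exact (hT.move_ret _ _ h).elim
    | call h1 h2 =>
      generalize hp : (Sum.inr ⟨_, _⟩ : T.Z ⊕ (Σ i, (E i).Q)) = p at h'
      cases h' with
      | keep | move | ret => simp at hp
      | inner h' => cases hp; subst h2; exact ((hE _).inn_op h').elim
      | call h3 h4 => cases hp; rw [h1, h3]
    | inner h =>
      generalize hp : (Sum.inr ⟨_, _⟩ : T.Z ⊕ (Σ i, (E i).Q)) = p at h'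
      cases h' with
      | keep | move | ret => simp at hp
      | inner h' => cases hp; rw [(hE _).codet h h']
      | call h3 h4 => cases hp; subst h4; exact ((hE _).inn_op h).elim
    | ret h1 h2 =>
      cases h' with
      | keep h => subst h1 h2; exact (hT.keep_ret _ h).elim
      | move h => subst h1 h2; exact (hT.move_ret _ _ h).elim
      | ret h3 h4 => obtain rfl := hT.cl_injective (h1.symm.trans h3); rfl
  inn_fwd := hT.inn_fwd
  fin_fwd := hf
  inn_op := by
    intro p o h
    change Tr T E op cl p op₀ o (.inl T.inn) at h
    cases h with
    | keep h => exact hT.keep_inn h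
    | move h => exact hT.move_inn _ h
    | ret h => exact hT.cl_ne _ h.symm
  fin_cl := by
    intro o q h
    change Tr T E op cl (.inl T.fin) cl₀ o q at h
    cases h with
    | keep h => exact hT.keep_fin h
    | move h => exact hT.move_fin _ h
    | call _ h => exact hT.op_ne _ h.symm

section Runs

variable {z z' : T.Z} {x : X} {γ L V : List X}

theorem run_keep (hz : T.fwd z = true) (h : ∀ x ∈ γ, T.keep z x) :
    (T.comp E op cl).Run (L, .inl z, γ ++ V) [] (γ.reverse ++ L, .inl z, V) :=
  Ev.run_scan (E := T.comp E op cl) (p := .inl z) hz (fun x hx => Tr.keep (h x hx)) L V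

theorem run_keep_back (hz : T.fwd z = false) (h : ∀ x ∈ γ, T.keep z x) :
    (T.comp E op cl).Run (γ.reverse ++ L, .inl z, V) [] (L, .inl z, γ ++ V) :=
  Ev.run_scan_back (E := T.comp E op cl) (p := .inl z) hz (fun x hx => Tr.keep (h x hx)) L V

theorem run_ff (hz : T.fwd z = true) (hz' : T.fwd z' = true) (h : T.move z x z') :
    (T.comp E op cl).Run (L, .inl z, x :: V) [] (x :: L, .inl z', V) :=
  Ev.Step.run (.ff (E := T.comp E op cl) (p := .inl z) (q := .inl z') hz hz' (Tr.move h))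

theorem run_fb (hz : T.fwd z = true) (hz' : T.fwd z' = false) (h : T.move z x z') :
    (T.comp E op cl).Run (L, .inl z, x :: V) [] (L, .inl z', x :: V) :=
  Ev.Step.run (.fb (E := T.comp E op cl) (p := .inl z) (q := .inl z') hz hz' (Tr.move h))

theorem run_bf (hz : T.fwd z = false) (hz' : T.fwd z' = true) (h : T.move z x z') :
    (T.comp E op cl).Run (x :: L, .inl z, V) [] (x :: L, .inl z', V) :=
  Ev.Step.run (.bf (E := T.comp E op cl) (p := .inl z) (q := .inl z') hz hz' (Tr.move h))

theorem run_bb (hz : T.fwd z = false) (hz' : T.fwd z' = false) (h : T.move z x z') :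
    (T.comp E op cl).Run (x :: L, .inl z, V) [] (L, .inl z', x :: V) :=
  Ev.Step.run (.bb (E := T.comp E op cl) (p := .inl z) (q := .inl z') hz hz' (Tr.move h))

theorem run_inner {i : I} {c d : List X × (E i).Q × List X} {y : List B} (h : (E i).Run c y d) :
    (T.comp E op cl).Run (c.1, .inr ⟨i, c.2.1⟩, c.2.2) y (d.1, .inr ⟨i, d.2.1⟩, d.2.2) := by
  induction h with
  | nil => exact .nil _
  | cons h _ ih =>
    refine .cons ?_ ih
    cases h with
    | @ff L V x o p q h h' h'' =>
      exact .ff (E := T.comp E op cl) (p := .inr ⟨i, p⟩) (q := .inr ⟨i, q⟩) h h' (Tr.inner h'')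
    | @fb L V x o p q h h' h'' =>
      exact .fb (E := T.comp E op cl) (p := .inr ⟨i, p⟩) (q := .inr ⟨i, q⟩) h h' (Tr.inner h'')
    | @bf L V x o p q h h' h'' =>
      exact .bf (E := T.comp E op cl) (p := .inr ⟨i, p⟩) (q := .inr ⟨i, q⟩) h h' (Tr.inner h'')
    | @bb L V x o p q h h' h'' =>
      exact .bb (E := T.comp E op cl) (p := .inr ⟨i, p⟩) (q := .inr ⟨i, q⟩) h h' (Tr.inner h'')

variable {i : I} {y : List B}

theorem run_call (hE : (E i).IsRev (op i) (cl i)) (hz : T.fwd (T.src i) = true)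
    (h : (E i).Computes (op i) (cl i) γ y) :
    (T.comp E op cl).Run (L, .inl (T.src i), op i :: (γ ++ cl i :: V)) y
      (γ.reverse ++ op i :: L, .inr ⟨i, (E i).fin⟩, cl i :: V) :=
  .cons (.ff (E := T.comp E op cl) (p := .inl (T.src i)) (q := .inr ⟨i, (E i).inn⟩) hz hE.inn_fwd
    (Tr.call rfl rfl)) (run_inner (h.run L V))

theorem run_call_back (hE : (E i).IsRev (op i) (cl i)) (hz : T.fwd (T.src i) = false)
    (h : (E i).Computes (op i) (cl i) γ y) :
    (T.comp E op cl).Run (op i :: L, .inl (T.src i), γ ++ cl i :: V) y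
      (γ.reverse ++ op i :: L, .inr ⟨i, (E i).fin⟩, cl i :: V) :=
  .cons (.bf (E := T.comp E op cl) (p := .inl (T.src i)) (q := .inr ⟨i, (E i).inn⟩) hz hE.inn_fwd
    (Tr.call rfl rfl)) (run_inner (h.run L V))

theorem run_ret (hE : (E i).IsRev (op i) (cl i)) (hz : T.fwd (T.ret i) = true) :
    (T.comp E op cl).Run (L, .inr ⟨i, (E i).fin⟩, cl i :: V) [] (cl i :: L, .inl (T.ret i), V) :=
  Ev.Step.run (.ff (E := T.comp E op cl) (p := .inr ⟨i, (E i).fin⟩) (q := .inl (T.ret i))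
    hE.fin_fwd hz (Tr.ret rfl rfl))

theorem run_ret_back (hE : (E i).IsRev (op i) (cl i)) (hz : T.fwd (T.ret i) = false) :
    (T.comp E op cl).Run (L, .inr ⟨i, (E i).fin⟩, cl i :: V) [] (L, .inl (T.ret i), cl i :: V) :=
  Ev.Step.run (.fb (E := T.comp E op cl) (p := .inr ⟨i, (E i).fin⟩) (q := .inl (T.ret i))
    hE.fin_fwd hz (Tr.ret rfl rfl))

end Runs

end Frame

open Parsing

open Aut (mem_sum_iff mem_cauchy_iff mem_star_iff_map)

/-! ### Evaluation of parsings -/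

namespace Ev

variable {A B : Type*} {S M N : Type}

theorem computes_of_run {X : Type*} {E : Ev X B} {op cl : X} {β L V : List X} {y : List B}
    (h : E.Run ([op], E.inn, V) y (L, E.fin, [cl])) (hV : V = β ++ [cl])
    (hL : L = β.reverse ++ [op]) : E.Computes op cl β y := by
  subst hV hL
  exact h

/-- `E` evaluates the parsings `P`, with the outputs `R`. -/
structure Evaluates (E : Ev (A ⊕ Marker S) B) (P : List A → Set (List (A ⊕ Marker S)))
    (R : List A → Language B) : Prop where
  rev : E.IsRev (.inr .op) (.inr .cl)
  sound : ∀ β, wrap β ∈ P (proj β) → ∃ y ∈ R (proj β),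
    E.Computes (.inr .op) (.inr .cl) (β.map (Sum.map id .sub)) y
  complete : ∀ w, ∀ y ∈ R w, ∃ β, proj β = w ∧ wrap β ∈ P w ∧
    E.Computes (.inr .op) (.inr .cl) (β.map (Sum.map id .sub)) y

/-- The symbols seen by the evaluator of a subexpression, whose markers are selected by `ψ`. -/
def observe (ψ : N → Option M) : A ⊕ Marker N → Option (A ⊕ M)
  | .inl a => some (.inl a)
  | .inr (.sub n) => (ψ n).map .inr
  | .inr .op => none
  | .inr .cl => none

theorem filterMap_observe_map {ψ : N → Option M} {f : M → N} (h : ∀ m, ψ (f m) = some m)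
    (α : List (A ⊕ M)) : (α.map (Sum.map id (.sub ∘ f))).filterMap (observe ψ) = α := by
  induction α with
  | nil => rfl
  | cons x α ih =>
    rw [List.map_cons, List.filterMap_cons_some (b := x), ih]
    rcases x with a | m
    · rfl
    · simp [observe, h]

/-- A subexpression evaluated on its own part of the parsing. -/
theorem Computes.observe {E : Ev (A ⊕ Marker M) B} {ψ : N → Option (Marker M)} {f : Marker M → N}
    (hE : E.IsRev (.inr .op) (.inr .cl)) (h : ∀ m, ψ (f m) = some m) {α : List (A ⊕ M)} {y : List B}
    (hα : E.Computes (.inr .op) (.inr .cl) (α.map (Sum.map id .sub)) y) :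
    (E.comap (Ev.observe ψ)).Computes (.inr (.sub (f .op))) (.inr (.sub (f .cl)))
      (α.map (Sum.map id (.sub ∘ f ∘ .sub))) y := by
  refine Computes.comap (op := .inr .op) (cl := .inr .cl) ?_ hE.fin_fwd (by simp [Ev.observe, h])
    (by simp [Ev.observe, h])
  have : α.map (Sum.map id (.sub ∘ f ∘ .sub)) =
      ((α.map (Sum.map id Marker.sub)).map (Sum.map id (.sub ∘ f)) : List (A ⊕ Marker N)) := by
    simp [Sum.map_comp_map, Function.comp_assoc]
  rwa [this, filterMap_observe_map h]

theorem isRev_observe {E : Ev (A ⊕ Marker M) B} {ψ : N → Option (Marker M)} {f : Marker M → N}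
    (hE : E.IsRev (.inr .op) (.inr .cl)) (h : ∀ m, ψ (f m) = some m) :
    (E.comap (Ev.observe ψ)).IsRev (.inr (.sub (f .op))) (.inr (.sub (f .cl))) :=
  hE.comap (by simp [Ev.observe, h]) (by simp [Ev.observe, h])

/-! #### Simple expressions -/

/-- States of the evaluator of a simple expression. -/
inductive BaseState
  | inn | back | fin

instance : Fintype BaseState :=
  ⟨⟨↑[BaseState.inn, BaseState.back, BaseState.fin], by simp⟩, by rintro ⟨⟩ <;> simp⟩

/-- Transitions of the evaluator of a simple expression: the output is produced after the input word
has been read. -/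
inductive BaseTr (v : List B) : BaseState → A ⊕ Marker S → List B → BaseState → Prop
  | letter {a} : BaseTr v .inn (.inl a) [] .inn
  | output : BaseTr v .inn (.inr .cl) v .back
  | back_letter {a} : BaseTr v .back (.inl a) [] .fin
  | back_op : BaseTr v .back (.inr .op) [] .fin

/-- The evaluator of a simple expression. -/
def baseEv (A : Type*) (S : Type) (v : List B) : Ev (A ⊕ Marker S) B where
  Q := BaseState
  fintype := inferInstance
  fwd
    | .back => false
    | _ => true
  tr := BaseTr v
  inn := .inn
  fin := .fin

theorem isRev_baseEv (v : List B) : (baseEv A S v).IsRev (.inr .op) (.inr .cl) where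
  det := by
    intro p x o q o' q' h h'
    cases h <;> cases h' <;> exact ⟨rfl, rfl⟩
  codet := by
    intro p x o q o' p' h h'
    cases h <;> cases h' <;> rfl
  inn_fwd := rfl
  fin_fwd := rfl
  inn_op := by intro p o h; cases h
  fin_cl := by intro o q h; cases h

/-- The output must be produced exactly once, and entering and leaving do not belong to the machine.
So it is produced on reading the closing parenthesis, and the head bounces over the symbol on its
left, a letter or the opening parenthesis, to stand before the closing one again. -/
theorem computes_baseEv (v : List B) (w : List A) :
    (baseEv A S v).Computes (.inr .op) (.inr .cl) (w.map .inl) v := by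
  have h1 := run_scan (E := baseEv A S v) (p := .inn) rfl (γ := w.map .inl) (fun x hx => by
    obtain ⟨a, -, rfl⟩ := List.mem_map.1 hx
    exact BaseTr.letter) [.inr .op] [.inr .cl]
  have h2 : (baseEv A S v).Step ((w.map Sum.inl).reverse ++ [.inr .op], .inn, [.inr .cl]) v
      ((w.map Sum.inl).reverse ++ [.inr .op], .back, [.inr .cl]) :=
    .fb rfl rfl BaseTr.output
  have h3 : (baseEv A S v).Step ((w.map Sum.inl).reverse ++ [.inr .op], .back, [.inr .cl]) []
      ((w.map Sum.inl).reverse ++ [.inr .op], .fin, [.inr .cl]) := by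
    rw [← List.map_reverse]
    rcases w.reverse with _ | ⟨a, u⟩
    · exact .bf rfl rfl BaseTr.back_op
    · exact .bf rfl rfl BaseTr.back_letter
  exact h1.trans (h2.run.silent h3.run)

theorem evaluates_base (L : Language A) (v : List B) : (baseEv A S v).Evaluates (base L)
    fun w => {y | w ∈ L ∧ y = v} where
  rev := isRev_baseEv v
  sound := by
    rintro β ⟨h, e⟩
    obtain e := wrap_inj.1 e
    refine ⟨v, ⟨h, rfl⟩, ?_⟩
    rw [e, List.map_map]
    exact computes_baseEv v _
  complete := by
    rintro w _ ⟨h, rfl⟩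
    refine ⟨w.map .inl, by simp, ⟨h, rfl⟩, ?_⟩
    rw [List.map_map]
    exact computes_baseEv _ w

section Binary

variable {M₁ M₂ : Type}

/-- The opening parentheses of two subexpressions. -/
def opPair (A : Type*) (M₁ M₂ : Type) : Bool → A ⊕ Marker (Marker M₁ ⊕ Marker M₂)
  | false => .inr (.sub (.inl .op))
  | true => .inr (.sub (.inr .op))

/-- The closing parentheses of two subexpressions. -/
def clPair (A : Type*) (M₁ M₂ : Type) : Bool → A ⊕ Marker (Marker M₁ ⊕ Marker M₂)
  | false => .inr (.sub (.inl .cl))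
  | true => .inr (.sub (.inr .cl))

/-- The evaluators of two subexpressions, reading the markers of the whole expression. -/
def pair (E₁ : Ev (A ⊕ Marker M₁) B) (E₂ : Ev (A ⊕ Marker M₂) B) :
    Bool → Ev (A ⊕ Marker (Marker M₁ ⊕ Marker M₂)) B
  | false => E₁.comap (observe (Sum.elim some fun _ => none))
  | true => E₂.comap (observe (Sum.elim (fun _ => none) some))

variable {E₁ : Ev (A ⊕ Marker M₁) B} {E₂ : Ev (A ⊕ Marker M₂) B}

theorem isRev_pair (h₁ : E₁.IsRev (.inr .op) (.inr .cl)) (h₂ : E₂.IsRev (.inr .op) (.inr .cl)) :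
    ∀ i, (pair E₁ E₂ i).IsRev (opPair A M₁ M₂ i) (clPair A M₁ M₂ i)
  | false => isRev_observe (ψ := Sum.elim some fun _ => none) (f := Sum.inl) h₁ fun _ => rfl
  | true => isRev_observe (ψ := Sum.elim (fun _ => none) some) (f := Sum.inr) h₂ fun _ => rfl

theorem card_comp_pair (T : Frame Bool (A ⊕ Marker (Marker M₁ ⊕ Marker M₂))) :
    Fintype.card (T.comp (pair E₁ E₂) (opPair A M₁ M₂) (clPair A M₁ M₂)).Q =
      Fintype.card E₁.Q + Fintype.card E₂.Q + Fintype.card T.Z := by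
  rw [Frame.card_comp, Fintype.sum_bool, add_comm, add_comm (Fintype.card E₁.Q)]
  rfl

/-- A word of the first subexpression, with the markers of the whole expression. -/
def leftWord (α : List (A ⊕ M₁)) : List (A ⊕ Marker (Marker M₁ ⊕ Marker M₂)) :=
  α.map (Sum.map id (.sub ∘ .inl ∘ .sub))

/-- A word of the second subexpression, with the markers of the whole expression. -/
def rightWord (α : List (A ⊕ M₂)) : List (A ⊕ Marker (Marker M₁ ⊕ Marker M₂)) :=
  α.map (Sum.map id (.sub ∘ .inr ∘ .sub))

theorem map_wrap_left (α : List (A ⊕ M₁)) :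
    ((wrap α).map (Sum.map id Sum.inl)).map (Sum.map id Marker.sub) =
      opPair A M₁ M₂ false :: (leftWord α ++ [clPair A M₁ M₂ false]) := by
  simp [wrap_eq, opPair, clPair, leftWord, Sum.map_comp_map]

theorem map_wrap_right (α : List (A ⊕ M₂)) :
    ((wrap α).map (Sum.map id Sum.inr)).map (Sum.map id Marker.sub) =
      opPair A M₁ M₂ true :: (rightWord α ++ [clPair A M₁ M₂ true]) := by
  simp [wrap_eq, opPair, clPair, rightWord, Sum.map_comp_map]

theorem computes_pair_false (hE : E₁.IsRev (.inr .op) (.inr .cl)) {α : List (A ⊕ M₁)} {y : List B}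
    (h : E₁.Computes (.inr .op) (.inr .cl) (α.map (Sum.map id .sub)) y) :
    (pair E₁ E₂ false).Computes (opPair A M₁ M₂ false) (clPair A M₁ M₂ false) (leftWord α) y :=
  h.observe (ψ := Sum.elim some fun _ => none) (f := Sum.inl) hE fun _ => rfl

theorem computes_pair_true (hE : E₂.IsRev (.inr .op) (.inr .cl)) {α : List (A ⊕ M₂)} {y : List B}
    (h : E₂.Computes (.inr .op) (.inr .cl) (α.map (Sum.map id .sub)) y) :
    (pair E₁ E₂ true).Computes (opPair A M₁ M₂ true) (clPair A M₁ M₂ true) (rightWord α) y :=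
  h.observe (ψ := Sum.elim (fun _ => none) some) (f := Sum.inr) hE fun _ => rfl

theorem forall_mem_leftWord {p : A ⊕ Marker (Marker M₁ ⊕ Marker M₂) → Prop} {α : List (A ⊕ M₁)}
    (h : ∀ a, p (.inl a)) (h' : ∀ m, p (.inr (.sub (.inl (.sub m))))) :
    ∀ x ∈ (leftWord α : List (A ⊕ Marker (Marker M₁ ⊕ Marker M₂))), p x := by
  intro x hx
  obtain ⟨a | m, -, rfl⟩ := List.mem_map.1 hx
  · exact h a
  · exact h' m

theorem forall_mem_rightWord {p : A ⊕ Marker (Marker M₁ ⊕ Marker M₂) → Prop} {α : List (A ⊕ M₂)}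
    (h : ∀ a, p (.inl a)) (h' : ∀ m, p (.inr (.sub (.inr (.sub m))))) :
    ∀ x ∈ (rightWord α : List (A ⊕ Marker (Marker M₁ ⊕ Marker M₂))), p x := by
  intro x hx
  obtain ⟨a | m, -, rfl⟩ := List.mem_map.1 hx
  · exact h a
  · exact h' m

variable {P : List A → Set (List (A ⊕ Marker M₁))} {Q : List A → Set (List (A ⊕ Marker M₂))}
  {R₁ R₂ : List A → Language B}

/-! #### Sums -/

/-- States of the evaluator of a sum. -/
inductive SumState
  | inn | fin

instance : Fintype SumState :=
  ⟨⟨↑[SumState.inn, SumState.fin], by simp⟩, by rintro ⟨⟩ <;> simp⟩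

/-- The frame of the evaluator of a sum. -/
def sumFrame (A : Type*) (M₁ M₂ : Type) : Frame Bool (A ⊕ Marker (Marker M₁ ⊕ Marker M₂)) where
  Z := SumState
  fintype := inferInstance
  fwd _ := true
  keep _ _ := False
  move _ _ _ := False
  src _ := .inn
  ret _ := .fin
  inn := .inn
  fin := .fin

theorem opPair_injective : Function.Injective (opPair A M₁ M₂) := by
  rintro (_ | _) (_ | _) h <;> first | rfl | cases h

theorem clPair_injective : Function.Injective (clPair A M₁ M₂) := by
  rintro (_ | _) (_ | _) h <;> first | rfl | cases h

theorem clPair_ne (i : Bool) : clPair A M₁ M₂ i ≠ .inr .op := by cases i <;> rintro ⟨⟩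

theorem opPair_ne (i : Bool) : opPair A M₁ M₂ i ≠ .inr .cl := by cases i <;> rintro ⟨⟩

theorem isRev_sumFrame :
    (sumFrame A M₁ M₂).IsRev (opPair A M₁ M₂) (clPair A M₁ M₂) (.inr .op) (.inr .cl) where
  op_injective := opPair_injective
  cl_injective := clPair_injective
  cl_ne := clPair_ne
  op_ne := opPair_ne
  det := False.elim
  codet := False.elim
  keep_move := False.elim
  move_keep := False.elim
  keep_src _ := id
  move_src _ _ := id
  keep_ret _ := id
  move_ret _ _ := id
  keep_inn := id
  move_inn _ := id
  keep_fin := id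
  move_fin _ := id
  inn_fwd := rfl

/-- The first symbol inside is the opening parenthesis of the subexpression that was used, so it
decides which machine is called. -/
theorem exists_evaluates_sum (hP : IsParsing P) (hQ : IsParsing Q) (h₁ : E₁.Evaluates P R₁)
    (h₂ : E₂.Evaluates Q R₂) : ∃ E : Ev (A ⊕ Marker (Marker M₁ ⊕ Marker M₂)) B,
      E.Evaluates (sum P Q) (fun w => R₁ w + R₂ w) ∧
      Fintype.card E.Q = Fintype.card E₁.Q + Fintype.card E₂.Q + 2 := by
  have hrev := isRev_pair h₁.rev h₂.rev
  have run : ∀ i γ y, (pair E₁ E₂ i).Computes (opPair A M₁ M₂ i) (clPair A M₁ M₂ i) γ y →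
      ((sumFrame A M₁ M₂).comp (pair E₁ E₂) (opPair A M₁ M₂) (clPair A M₁ M₂)).Computes
        (.inr .op) (.inr .cl) (opPair A M₁ M₂ i :: (γ ++ [clPair A M₁ M₂ i])) y := by
    intro i γ y h
    have h1 := (Frame.run_call (T := sumFrame A M₁ M₂) (L := [.inr .op]) (V := [.inr .cl])
      (hrev i) rfl h).silent (Frame.run_ret (hrev i) rfl)
    exact computes_of_run h1 (by simp) (by simp)
  refine ⟨_, ⟨isRev_sumFrame.comp rfl hrev, fun β h => ?_, fun w y h => ?_⟩, card_comp_pair _⟩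
  · rcases (mem_sum_iff hP hQ).1 h with ⟨α, hα, rfl⟩ | ⟨α, hα, rfl⟩
    · obtain ⟨y, hy, h1⟩ := h₁.sound α hα
      refine ⟨y, (Language.mem_add _ _ _).2 (.inl (by simpa using hy)), ?_⟩
      rw [map_wrap_left]
      exact run false _ _ (computes_pair_false h₁.rev h1)
    · obtain ⟨y, hy, h1⟩ := h₂.sound α hα
      refine ⟨y, (Language.mem_add _ _ _).2 (.inr (by simpa using hy)), ?_⟩
      rw [map_wrap_right]
      exact run true _ _ (computes_pair_true h₂.rev h1)
  · rcases h with h | h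
    · obtain ⟨α, rfl, hα, h1⟩ := h₁.complete w y h
      refine ⟨(wrap α).map (Sum.map id Sum.inl), by simp, .inl ⟨_, hα, rfl⟩, ?_⟩
      rw [map_wrap_left]
      exact run false _ _ (computes_pair_false h₁.rev h1)
    · obtain ⟨α, rfl, hα, h1⟩ := h₂.complete w y h
      refine ⟨(wrap α).map (Sum.map id Sum.inr), by simp, .inr ⟨_, hα, rfl⟩, ?_⟩
      rw [map_wrap_right]
      exact run true _ _ (computes_pair_true h₂.rev h1)

/-! #### Products -/

/-- States of the evaluators of products. -/
inductive ProdState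
  | inn | mid | fin

instance : Fintype ProdState :=
  ⟨⟨↑[ProdState.inn, ProdState.mid, ProdState.fin], by simp⟩, by rintro ⟨⟩ <;> simp⟩

/-- The frame of the evaluator of a Cauchy product. -/
def cauchyFrame (A : Type*) (M₁ M₂ : Type) : Frame Bool (A ⊕ Marker (Marker M₁ ⊕ Marker M₂)) where
  Z := ProdState
  fintype := inferInstance
  fwd _ := true
  keep _ _ := False
  move _ _ _ := False
  src i := cond i .mid .inn
  ret i := cond i .fin .mid
  inn := .inn
  fin := .fin

theorem isRev_cauchyFrame :
    (cauchyFrame A M₁ M₂).IsRev (opPair A M₁ M₂) (clPair A M₁ M₂) (.inr .op) (.inr .cl) where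
  op_injective := opPair_injective
  cl_injective := clPair_injective
  cl_ne := clPair_ne
  op_ne := opPair_ne
  det := False.elim
  codet := False.elim
  keep_move := False.elim
  move_keep := False.elim
  keep_src _ := id
  move_src _ _ := id
  keep_ret _ := id
  move_ret _ _ := id
  keep_inn := id
  move_inn _ := id
  keep_fin := id
  move_fin _ := id
  inn_fwd := rfl

/-- Loops of the evaluator of a reverse Cauchy product. -/
def rcauchyKeep : ProdState → A ⊕ Marker (Marker M₁ ⊕ Marker M₂) → Prop
  | _, .inl _ => True
  | _, .inr .op => False
  | _, .inr .cl => False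
  | .inn, .inr (.sub (.inl _)) => True
  | .inn, .inr (.sub (.inr _)) => False
  | .mid, .inr (.sub (.inl m)) => m ≠ .op
  | .mid, .inr (.sub (.inr m)) => m ≠ .cl
  | .fin, .inr (.sub (.inl _)) => False
  | .fin, .inr (.sub (.inr _)) => True

/-- The frame of the evaluator of a reverse Cauchy product: the second word is evaluated first. -/
def rcauchyFrame (A : Type*) (M₁ M₂ : Type) : Frame Bool (A ⊕ Marker (Marker M₁ ⊕ Marker M₂)) where
  Z := ProdState
  fintype := inferInstance
  fwd
    | .mid => false
    | _ => true
  keep := rcauchyKeep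
  move _ _ _ := False
  src i := cond i .inn .mid
  ret i := cond i .mid .fin
  inn := .inn
  fin := .fin

/-- The loops of a state avoid the symbol on which it calls and the symbol on which a return enters
it; with no moves, this is all there is to check. -/
theorem isRev_rcauchyFrame :
    (rcauchyFrame A M₁ M₂).IsRev (opPair A M₁ M₂) (clPair A M₁ M₂) (.inr .op) (.inr .cl) where
  op_injective := opPair_injective
  cl_injective := clPair_injective
  cl_ne := clPair_ne
  op_ne := opPair_ne
  det := False.elim
  codet := False.elim
  keep_move _ := id
  move_keep := False.elim
  keep_src i := by cases i <;> simp [rcauchyFrame, rcauchyKeep, opPair]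
  move_src _ _ := id
  keep_ret i := by cases i <;> simp [rcauchyFrame, rcauchyKeep, clPair]
  move_ret _ _ := id
  keep_inn := id
  move_inn _ := id
  keep_fin := id
  move_fin _ := id
  inn_fwd := rfl

/-- Common to both products: only the order `op'` of the outputs and the run on a parsing depend on
the frame. -/
theorem exists_evaluates_prod {F : Frame Bool (A ⊕ Marker (Marker M₁ ⊕ Marker M₂))}
    {R : List A → Language B} {op' : List B → List B → List B} (hP : IsParsing P)
    (hQ : IsParsing Q) (h₁ : E₁.Evaluates P R₁) (h₂ : E₂.Evaluates Q R₂)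
    (hF : F.IsRev (opPair A M₁ M₂) (clPair A M₁ M₂) (.inr .op) (.inr .cl))
    (hf : F.fwd F.fin = true)
    (hR : ∀ w y, y ∈ R w ↔ ∃ u v, w = u ++ v ∧ ∃ y₁ ∈ R₁ u, ∃ y₂ ∈ R₂ v, y = op' y₁ y₂)
    (run : ∀ α₁ α₂ y₁ y₂,
      (pair E₁ E₂ false).Computes (opPair A M₁ M₂ false) (clPair A M₁ M₂ false) (leftWord α₁) y₁ →
      (pair E₁ E₂ true).Computes (opPair A M₁ M₂ true) (clPair A M₁ M₂ true) (rightWord α₂) y₂ →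
      (F.comp (pair E₁ E₂) (opPair A M₁ M₂) (clPair A M₁ M₂)).Computes (.inr .op) (.inr .cl)
        ((opPair A M₁ M₂ false :: (leftWord α₁ ++ [clPair A M₁ M₂ false])) ++
          opPair A M₁ M₂ true :: (rightWord α₂ ++ [clPair A M₁ M₂ true])) (op' y₁ y₂)) :
    (F.comp (pair E₁ E₂) (opPair A M₁ M₂) (clPair A M₁ M₂)).Evaluates (cauchy P Q) R := by
  refine ⟨hF.comp hf (isRev_pair h₁.rev h₂.rev), fun β h => ?_, fun w y h => ?_⟩
  · obtain ⟨α₁, α₂, hα₁, hα₂, rfl⟩ := (mem_cauchy_iff hP hQ).1 h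
    obtain ⟨y₁, hy₁, h3⟩ := h₁.sound _ hα₁
    obtain ⟨y₂, hy₂, h4⟩ := h₂.sound _ hα₂
    refine ⟨op' y₁ y₂, (hR _ _).2 ⟨_, _, by simp, _, hy₁, _, hy₂, rfl⟩, ?_⟩
    rw [List.map_append, map_wrap_left, map_wrap_right]
    exact run _ _ _ _ (computes_pair_false h₁.rev h3) (computes_pair_true h₂.rev h4)
  · obtain ⟨_, _, rfl, y₁, hy₁, y₂, hy₂, rfl⟩ := (hR _ _).1 h
    obtain ⟨α₁, rfl, hα₁, h3⟩ := h₁.complete _ _ hy₁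
    obtain ⟨α₂, rfl, hα₂, h4⟩ := h₂.complete _ _ hy₂
    refine ⟨_, ?_, ⟨_, _, rfl, _, hα₁, _, hα₂, rfl⟩, ?_⟩
    · simp
    · rw [List.map_append, map_wrap_left, map_wrap_right]
      exact run _ _ _ _ (computes_pair_false h₁.rev h3) (computes_pair_true h₂.rev h4)

theorem exists_evaluates_cauchy (hP : IsParsing P) (hQ : IsParsing Q) (h₁ : E₁.Evaluates P R₁)
    (h₂ : E₂.Evaluates Q R₂) : ∃ E : Ev (A ⊕ Marker (Marker M₁ ⊕ Marker M₂)) B,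
      E.Evaluates (cauchy P Q) (fun w => {y | ∃ u v, w = u ++ v ∧ y ∈ R₁ u * R₂ v}) ∧
      Fintype.card E.Q = Fintype.card E₁.Q + Fintype.card E₂.Q + 3 := by
  have hrev := isRev_pair h₁.rev h₂.rev
  refine ⟨_, exists_evaluates_prod (F := cauchyFrame A M₁ M₂) (op' := (· ++ ·)) hP hQ h₁ h₂
    isRev_cauchyFrame rfl (fun w y => ?_) (fun α₁ α₂ y₁ y₂ h3 h4 => ?_), card_comp_pair _⟩
  · refine exists_congr fun u => exists_congr fun v => and_congr_right fun _ => ?_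
    exact Language.mem_mul.trans (by simp only [eq_comm])
  · have h5 := (Frame.run_call (T := cauchyFrame A M₁ M₂) (L := [.inr .op])
      (V := opPair A M₁ M₂ true :: (rightWord α₂ ++ clPair A M₁ M₂ true :: [.inr .cl]))
      (hrev false) rfl h3).silent (Frame.run_ret (hrev false) rfl)
    have h6 := (Frame.run_call (T := cauchyFrame A M₁ M₂)
      (L := clPair A M₁ M₂ false :: ((leftWord α₁).reverse ++ opPair A M₁ M₂ false :: [.inr .op]))
      (V := [.inr .cl]) (hrev true) rfl h4).silent (Frame.run_ret (hrev true) rfl)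
    exact computes_of_run (h5.trans h6) (by simp) (by simp)

/-- The head skips the first factor, evaluates the second, goes back to the opening parenthesis of
the first, evaluates it, and skips the second. -/
theorem exists_evaluates_rcauchy (hP : IsParsing P) (hQ : IsParsing Q) (h₁ : E₁.Evaluates P R₁)
    (h₂ : E₂.Evaluates Q R₂) : ∃ E : Ev (A ⊕ Marker (Marker M₁ ⊕ Marker M₂)) B,
      E.Evaluates (cauchy P Q) (fun w => {y | ∃ u v, w = u ++ v ∧ y ∈ R₂ v * R₁ u}) ∧
      Fintype.card E.Q = Fintype.card E₁.Q + Fintype.card E₂.Q + 3 := by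
  have hrev := isRev_pair h₁.rev h₂.rev
  refine ⟨_, exists_evaluates_prod (F := rcauchyFrame A M₁ M₂) (op' := fun y z => z ++ y) hP hQ h₁ h₂
    isRev_rcauchyFrame rfl (fun w y => ?_) (fun α₁ α₂ y₁ y₂ h3 h4 => ?_), card_comp_pair _⟩
  · refine exists_congr fun u => exists_congr fun v => and_congr_right fun _ => ?_
    refine Language.mem_mul.trans ⟨?_, ?_⟩
    · rintro ⟨y₂, h3, y₁, h4, rfl⟩
      exact ⟨y₁, h4, y₂, h3, rfl⟩
    · rintro ⟨y₁, h4, y₂, h3, rfl⟩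
      exact ⟨y₂, h3, y₁, h4, rfl⟩
  · have h5 := Frame.run_keep (T := rcauchyFrame A M₁ M₂) (E := pair E₁ E₂) (op := opPair A M₁ M₂)
      (cl := clPair A M₁ M₂) (z := .inn)
      (γ := opPair A M₁ M₂ false :: (leftWord α₁ ++ [clPair A M₁ M₂ false])) (L := [.inr .op])
      (V := opPair A M₁ M₂ true :: (rightWord α₂ ++ clPair A M₁ M₂ true :: [.inr .cl])) rfl
      (by
        simp only [List.mem_cons, List.mem_append, List.not_mem_nil, or_false]
        rintro x (rfl | hx | rfl)
        · trivial
        · exact forall_mem_leftWord (fun _ => trivial) (fun _ => trivial) x hx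
        · trivial)
    have h6 := (Frame.run_call (T := rcauchyFrame A M₁ M₂)
      (L := (opPair A M₁ M₂ false :: (leftWord α₁ ++ [clPair A M₁ M₂ false])).reverse ++ [.inr .op])
      (V := [.inr .cl]) (hrev true) rfl h4).silent (Frame.run_ret_back (hrev true) rfl)
    have h7 := Frame.run_keep_back (T := rcauchyFrame A M₁ M₂) (E := pair E₁ E₂)
      (op := opPair A M₁ M₂) (cl := clPair A M₁ M₂) (z := .mid)
      (γ := leftWord α₁ ++ clPair A M₁ M₂ false :: opPair A M₁ M₂ true :: rightWord α₂)
      (L := opPair A M₁ M₂ false :: [.inr .op])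
      (V := clPair A M₁ M₂ true :: [.inr .cl]) rfl
      (by
        simp only [List.mem_cons, List.mem_append]
        rintro x (hx | rfl | rfl | hx)
        · exact forall_mem_leftWord (fun _ => trivial) (fun _ => by simp [rcauchyFrame, rcauchyKeep]) x hx
        · simp [rcauchyFrame, rcauchyKeep, clPair]
        · simp [rcauchyFrame, rcauchyKeep, opPair]
        · exact forall_mem_rightWord (fun _ => trivial) (fun _ => by simp [rcauchyFrame, rcauchyKeep]) x hx)
    have h8 := (Frame.run_call_back (T := rcauchyFrame A M₁ M₂) (L := [.inr .op])
      (V := opPair A M₁ M₂ true :: (rightWord α₂ ++ clPair A M₁ M₂ true :: [.inr .cl]))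
      (hrev false) rfl h3).silent (Frame.run_ret (hrev false) rfl)
    have h9 := Frame.run_keep (T := rcauchyFrame A M₁ M₂) (E := pair E₁ E₂) (op := opPair A M₁ M₂)
      (cl := clPair A M₁ M₂) (z := .fin)
      (γ := opPair A M₁ M₂ true :: (rightWord α₂ ++ [clPair A M₁ M₂ true]))
      (L := clPair A M₁ M₂ false :: ((leftWord α₁).reverse ++ opPair A M₁ M₂ false :: [.inr .op]))
      (V := [.inr .cl]) rfl
      (by
        simp only [List.mem_cons, List.mem_append, List.not_mem_nil, or_false]
        rintro x (rfl | hx | rfl)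
        · trivial
        · exact forall_mem_rightWord (fun _ => trivial) (fun _ => trivial) x hx
        · trivial)
    simp only [List.reverse_append, List.reverse_cons, List.append_assoc, List.cons_append,
      List.nil_append, List.reverse_nil] at h5 h6 h7 h8 h9
    have h10 := h5.trans (h6.trans (h7.trans (h8.silent h9)))
    exact computes_of_run h10 (by simp) (by simp)

end Binary

end Ev

theorem Language.mem_prod_map {A B : Type*} {R : A → Language B} {us : List A} : ∀ {y : List B},
    y ∈ (us.map R).prod ↔ ∃ ys, List.Forall₂ (fun u y => y ∈ R u) us ys ∧ y = ys.flatten := by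
  induction us with
  | nil =>
    intro y
    constructor
    · intro h
      exact ⟨[], .nil, h⟩
    · rintro ⟨ys, h, rfl⟩
      cases h
      exact Language.nil_mem_one
  | cons u us ih =>
    intro y
    rw [List.map_cons, List.prod_cons, Language.mem_mul]
    constructor
    · rintro ⟨a, ha, b, hb, rfl⟩
      obtain ⟨ys, h, rfl⟩ := ih.1 hb
      exact ⟨a :: ys, .cons ha h, rfl⟩
    · rintro ⟨ys, h, rfl⟩
      cases h with
      | cons h h' => exact ⟨_, h, _, ih.2 ⟨_, h', rfl⟩, rfl⟩

theorem Language.mem_prod_reverse_map {A B : Type*} {R : A → Language B} {us : List A} {y : List B} :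
    y ∈ (us.map R).reverse.prod ↔
      ∃ ys, List.Forall₂ (fun u y => y ∈ R u) us ys ∧ y = ys.reverse.flatten := by
  rw [← List.map_reverse, Language.mem_prod_map]
  constructor
  · rintro ⟨ys, h, rfl⟩
    exact ⟨ys.reverse, by simpa using List.rel_reverse h, by simp⟩
  · rintro ⟨ys, h, rfl⟩
    exact ⟨ys.reverse, List.rel_reverse h, rfl⟩

namespace Ev

/-! ### Evaluators of stars and reverse stars. -/

section Unary

variable {A B : Type*} {M : Type} {E : Ev (A ⊕ Marker M) B} {P : List A → Set (List (A ⊕ Marker M))}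
  {R : List A → Language B}

/-- The evaluator of the argument of a star, reading the markers of the star. -/
def lift (E : Ev (A ⊕ Marker M) B) (_ : Unit) : Ev (A ⊕ Marker (Marker M)) B := E.comap (observe some)

/-- The opening parenthesis of the argument of a star. -/
def opLift (A : Type*) (M : Type) (_ : Unit) : A ⊕ Marker (Marker M) := .inr (.sub .op)

/-- The closing parenthesis of the argument of a star. -/
def clLift (A : Type*) (M : Type) (_ : Unit) : A ⊕ Marker (Marker M) := .inr (.sub .cl)

/-- A word of the argument of a star, with the markers of the star. -/
def liftWord (α : List (A ⊕ M)) : List (A ⊕ Marker (Marker M)) :=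
  α.map (Sum.map id (.sub ∘ .sub))

/-- A word of the argument of a star, with its parentheses. -/
def liftBlock (α : List (A ⊕ M)) : List (A ⊕ Marker (Marker M)) :=
  opLift A M () :: (liftWord α ++ [clLift A M ()])

theorem map_flatten_wrap (zs : List (List (A ⊕ M))) :
    ((zs.map wrap).flatten).map (Sum.map id Marker.sub) = (zs.map liftBlock).flatten := by
  induction zs with
  | nil => rfl
  | cons z zs ih =>
    rw [List.map_cons, List.flatten_cons, List.map_append, ih, List.map_cons, List.flatten_cons]
    simp [wrap_eq, liftBlock, opLift, clLift, liftWord, Sum.map_comp_map]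

theorem forall_mem_liftBlock {p : A ⊕ Marker (Marker M) → Prop} {α : List (A ⊕ M)}
    (h : ∀ a, p (.inl a)) (h' : ∀ m, p (.inr (.sub m))) : ∀ x ∈ liftBlock α, p x := by
  intro x hx
  simp only [liftBlock, List.mem_cons, List.mem_append, List.not_mem_nil, or_false] at hx
  rcases hx with rfl | hx | rfl
  · exact h' _
  · obtain ⟨a | m, -, rfl⟩ := List.mem_map.1 hx
    · exact h a
    · exact h' _
  · exact h' _

theorem isRev_lift (h : E.IsRev (.inr .op) (.inr .cl)) (i : Unit) :
    (lift E i).IsRev (opLift A M i) (clLift A M i) :=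
  isRev_observe (ψ := some) (f := id) h fun _ => rfl

theorem card_comp_lift (T : Frame Unit (A ⊕ Marker (Marker M))) :
    Fintype.card (T.comp (lift E) (opLift A M) (clLift A M)).Q =
      Fintype.card E.Q + Fintype.card T.Z := by
  rw [Frame.card_comp, add_comm]
  simp only [Finset.univ_unique, Finset.sum_singleton]
  rfl

/-- Shared by the two stars, which differ in the order `op'` of the outputs and in the frame. -/
theorem evaluates_lift {F : Frame Unit (A ⊕ Marker (Marker M))} {R' : List A → Language B}
    {op' : List (List B) → List B} (hP : IsParsing P) (hE : E.Evaluates P R)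
    (hF : F.IsRev (opLift A M) (clLift A M) (.inr .op) (.inr .cl))
    (hf : F.fwd F.fin = true)
    (hR : ∀ w y, y ∈ R' w ↔ ∃ us, w = us.flatten ∧
      ∃ ys, List.Forall₂ (fun u y => y ∈ R u) us ys ∧ y = op' ys)
    (run : ∀ zs ys, List.Forall₂ (fun z y => (lift E ()).Computes (opLift A M ()) (clLift A M ())
        (liftWord z) y) zs ys →
      (F.comp (lift E) (opLift A M) (clLift A M)).Computes (.inr .op) (.inr .cl)
        (zs.map liftBlock).flatten (op' ys)) :
    (F.comp (lift E) (opLift A M) (clLift A M)).Evaluates (star P) R' := by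
  have hobs : ∀ {α y}, E.Computes (.inr .op) (.inr .cl) (α.map (Sum.map id .sub)) y →
      (lift E ()).Computes (opLift A M ()) (clLift A M ()) (liftWord α) y :=
    fun h => h.observe (ψ := some) (f := id) hE.rev fun _ => rfl
  refine ⟨hF.comp hf (isRev_lift hE.rev), fun β h => ?_, fun w y h => ?_⟩
  · obtain ⟨zs, hzs, rfl⟩ := (mem_star_iff_map hP).1 h
    have h1 : ∃ ys, List.Forall₂ (fun u y => y ∈ R u) (zs.map proj) ys ∧
        List.Forall₂ (fun z y => (lift E ()).Computes (opLift A M ()) (clLift A M ())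
          (liftWord z) y) zs ys := by
      clear h
      induction zs with
      | nil => exact ⟨[], .nil, .nil⟩
      | cons z zs ih =>
        simp only [List.forall_mem_cons] at hzs
        obtain ⟨ys, h1, h2⟩ := ih hzs.2
        obtain ⟨y, h3, h4⟩ := hE.sound z hzs.1
        exact ⟨y :: ys, .cons h3 h1, .cons (hobs h4) h2⟩
    obtain ⟨ys, h2, h3⟩ := h1
    refine ⟨op' ys, (hR _ _).2 ⟨_, ?_, ys, h2, rfl⟩, ?_⟩
    · simp [proj_flatten, Function.comp_def]
    · rw [map_flatten_wrap]
      exact run _ _ h3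
  · obtain ⟨us, rfl, ys, h1, rfl⟩ := (hR _ _).1 h
    have h2 : ∃ zs : List (List (A ⊕ M)), zs.map proj = us ∧ (∀ z ∈ zs, wrap z ∈ P (proj z)) ∧
        List.Forall₂ (fun z y => (lift E ()).Computes (opLift A M ()) (clLift A M ())
          (liftWord z) y) zs ys := by
      clear h
      induction h1 with
      | nil => exact ⟨[], rfl, by simp, .nil⟩
      | cons h _ ih =>
        obtain ⟨zs, rfl, h3, h4⟩ := ih
        obtain ⟨z, rfl, h5, h6⟩ := hE.complete _ _ h
        exact ⟨z :: zs, rfl, by simpa using ⟨h5, h3⟩, .cons (hobs h6) h4⟩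
    obtain ⟨zs, rfl, h3, h4⟩ := h2
    have h5 : proj (zs.map wrap).flatten = (zs.map proj).flatten := by
      simp [proj_flatten, Function.comp_def]
    refine ⟨(zs.map wrap).flatten, h5, ?_, ?_⟩
    · rw [← h5]
      exact (mem_star_iff_map hP).2 ⟨zs, h3, rfl⟩
    · rw [map_flatten_wrap]
      exact run _ _ h4

/-- The frame of the evaluator of a star. -/
def starFrame (A : Type*) (M : Type) : Frame Unit (A ⊕ Marker (Marker M)) where
  Z := Unit
  fintype := inferInstance
  fwd _ := true
  keep _ _ := False
  move _ _ _ := False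
  src _ := ()
  ret _ := ()
  inn := ()
  fin := ()

theorem isRev_starFrame :
    (starFrame A M).IsRev (opLift A M) (clLift A M) (.inr .op) (.inr .cl) where
  op_injective _ _ _ := rfl
  cl_injective _ _ _ := rfl
  cl_ne _ := by rintro ⟨⟩
  op_ne _ := by rintro ⟨⟩
  det := False.elim
  codet := False.elim
  keep_move := False.elim
  move_keep := False.elim
  keep_src _ := id
  move_src _ _ := id
  keep_ret _ := id
  move_ret _ _ := id
  keep_inn := id
  move_inn _ := id
  keep_fin := id
  move_fin _ := id
  inn_fwd := rfl

theorem exists_evaluates_star (hP : IsParsing P) (hE : E.Evaluates P R) :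
    ∃ E' : Ev (A ⊕ Marker (Marker M)) B, E'.Evaluates (star P)
      (fun w => {y | ∃ us : List (List A), w = us.flatten ∧ y ∈ (us.map R).prod}) ∧
      Fintype.card E'.Q = Fintype.card E.Q + 1 := by
  refine ⟨_, evaluates_lift (F := starFrame A M) (op' := List.flatten) hP hE isRev_starFrame rfl
    (fun w y => ?_) (fun zs ys h => ?_), card_comp_lift _⟩
  · exact exists_congr fun us => and_congr_right fun _ => Language.mem_prod_map
  · have key : ∀ L V, ((starFrame A M).comp (lift E) (opLift A M) (clLift A M)).Run
        (L, .inl (), (zs.map liftBlock).flatten ++ V) ys.flatten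
        ((zs.map liftBlock).flatten.reverse ++ L, .inl (), V) := by
      induction h with
      | nil => exact fun L V => .nil _
      | @cons z y zs ys h _ ih =>
        intro L V
        have h1 := (Frame.run_call (T := starFrame A M) (L := L)
          (V := (zs.map liftBlock).flatten ++ V) (isRev_lift hE.rev ()) rfl h).silent
          (Frame.run_ret (isRev_lift hE.rev ()) rfl)
        have h2 := h1.trans (ih _ _)
        simp only [List.map_cons, List.flatten_cons, liftBlock, List.reverse_append,
          List.reverse_cons, List.append_assoc, List.cons_append, List.nil_append] at h2 ⊢
        exact h2
    exact computes_of_run (key _ _) rfl rfl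

/-- States of the evaluator of a reverse star. -/
inductive RStarState
  | inn | call | back | fin

instance : Fintype RStarState :=
  ⟨⟨↑[RStarState.inn, RStarState.call, RStarState.back, RStarState.fin], by simp⟩,
    by rintro ⟨⟩ <;> simp⟩

/-- Loops of the evaluator of a reverse star. -/
def rstarKeep : RStarState → A ⊕ Marker (Marker M) → Prop
  | _, .inl _ => True
  | _, .inr .op => False
  | _, .inr .cl => False
  | .inn, .inr (.sub _) => True
  | .call, .inr (.sub m) => m ≠ .op
  | .back, .inr (.sub m) => m ≠ .op ∧ m ≠ .cl
  | .fin, .inr (.sub _) => True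

/-- Moves of the evaluator of a reverse star. -/
inductive RStarMove : RStarState → A ⊕ Marker (Marker M) → RStarState → Prop
  | turn : RStarMove .inn (.inr .cl) .call
  | next : RStarMove .back (.inr (.sub .op)) .call
  | leave : RStarMove .call (.inr .op) .fin

/-- The frame of the evaluator of a reverse star: the words are evaluated from right to left. -/
def rstarFrame (A : Type*) (M : Type) : Frame Unit (A ⊕ Marker (Marker M)) where
  Z := RStarState
  fintype := inferInstance
  fwd
    | .call => false
    | .back => false
    | _ => true
  keep := rstarKeep
  move := RStarMove
  src _ := .call
  ret _ := .back
  inn := .inn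
  fin := .fin

theorem isRev_rstarFrame :
    (rstarFrame A M).IsRev (opLift A M) (clLift A M) (.inr .op) (.inr .cl) where
  op_injective _ _ _ := rfl
  cl_injective _ _ _ := rfl
  cl_ne _ := by rintro ⟨⟩
  op_ne _ := by rintro ⟨⟩
  det h h' := by cases h <;> cases h' <;> rfl
  codet h h' := by cases h <;> cases h' <;> rfl
  keep_move h h' := by cases h' <;> simp [rstarFrame, rstarKeep] at h
  move_keep h h' := by cases h <;> simp [rstarFrame, rstarKeep] at h'
  keep_src _ h := h rfl
  move_src _ _ h := by cases h
  keep_ret _ h := h.2 rfl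
  move_ret _ _ h := by cases h
  keep_inn := id
  move_inn _ h := by cases h
  keep_fin := id
  move_fin _ h := by cases h
  inn_fwd := rfl

/-- The head goes to the end and works backwards: each block is found by its opening parenthesis,
evaluated, and crossed again to the left. The separate state `back` prevents a second evaluation. At
the outer parenthesis the head turns and returns to the end. -/
theorem exists_evaluates_rstar (hP : IsParsing P) (hE : E.Evaluates P R) :
    ∃ E' : Ev (A ⊕ Marker (Marker M)) B, E'.Evaluates (star P)
      (fun w => {y | ∃ us : List (List A), w = us.flatten ∧ y ∈ (us.map R).reverse.prod}) ∧
      Fintype.card E'.Q = Fintype.card E.Q + 4 := by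
  refine ⟨_, evaluates_lift (F := rstarFrame A M) (op' := fun ys => ys.reverse.flatten) hP hE
    isRev_rstarFrame rfl (fun w y => ?_) (fun zs ys h => ?_), card_comp_lift _⟩
  · exact exists_congr fun us => and_congr_right fun _ => Language.mem_prod_reverse_map
  -- Induction on the list fits the order of evaluation: the tail is treated first, then the head.
  · have key : ∀ L V, ((rstarFrame A M).comp (lift E) (opLift A M) (clLift A M)).Run
        ((zs.map liftBlock).flatten.reverse ++ L, .inl .call, V) ys.reverse.flatten
        (L, .inl .call, (zs.map liftBlock).flatten ++ V) := by
      induction h with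
      | nil => exact fun L V => .nil _
      | @cons z y zs ys h _ ih =>
        intro L V
        have h0 := ih ((liftBlock z).reverse ++ L) V
        have h1 := Frame.run_keep_back (T := rstarFrame A M) (E := lift E) (op := opLift A M)
          (cl := clLift A M) (z := .call) (γ := liftWord z ++ [clLift A M ()])
          (L := opLift A M () :: L) (V := (zs.map liftBlock).flatten ++ V) rfl (by
            simp only [List.mem_append, List.mem_cons, List.not_mem_nil, or_false]
            rintro x (hx | rfl)
            · obtain ⟨a | m, -, rfl⟩ := List.mem_map.1 hx
              · trivial
              · simp [rstarFrame, rstarKeep]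
            · simp [rstarFrame, rstarKeep, clLift])
        have h2 := (Frame.run_call_back (T := rstarFrame A M) (L := L)
          (V := (zs.map liftBlock).flatten ++ V) (isRev_lift hE.rev ()) rfl h).silent
          (Frame.run_ret_back (isRev_lift hE.rev ()) rfl)
        have h3 := Frame.run_keep_back (T := rstarFrame A M) (E := lift E) (op := opLift A M)
          (cl := clLift A M) (z := .back) (γ := liftWord z) (L := opLift A M () :: L)
          (V := clLift A M () :: ((zs.map liftBlock).flatten ++ V)) rfl (by
            intro x hx
            obtain ⟨a | m, -, rfl⟩ := List.mem_map.1 hx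
            · trivial
            · simp [rstarFrame, rstarKeep])
        have h4 := Frame.run_bb (T := rstarFrame A M) (E := lift E) (op := opLift A M)
          (cl := clLift A M) (z := .back) (z' := .call) (x := opLift A M ()) (L := L)
          (V := liftWord z ++ clLift A M () :: ((zs.map liftBlock).flatten ++ V)) rfl rfl .next
        simp only [List.reverse_append, List.reverse_cons, List.append_assoc, List.cons_append,
          List.nil_append, List.reverse_nil, liftBlock] at h0 h1 h2 h3 h4
        have h5 := h0.trans (h1.trans (h2.silent (Run.silent h3 h4)))
        simpa [liftBlock] using h5
    have h1 := Frame.run_keep (T := rstarFrame A M) (E := lift E) (op := opLift A M)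
      (cl := clLift A M) (z := .inn) (γ := (zs.map liftBlock).flatten) (L := [.inr .op])
      (V := [.inr .cl]) rfl (by
        intro x hx
        obtain ⟨l, hl, hx⟩ := List.mem_flatten.1 hx
        obtain ⟨z, -, rfl⟩ := List.mem_map.1 hl
        exact forall_mem_liftBlock (fun _ => trivial) (fun _ => trivial) x hx)
    have h2 := Frame.run_fb (T := rstarFrame A M) (E := lift E) (op := opLift A M)
      (cl := clLift A M) (z := .inn) (z' := .call) (x := .inr .cl)
      (L := (zs.map liftBlock).flatten.reverse ++ [.inr .op]) (V := []) rfl rfl .turn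
    have h3 := Frame.run_bf (T := rstarFrame A M) (E := lift E) (op := opLift A M)
      (cl := clLift A M) (z := .call) (z' := .fin) (x := .inr .op) (L := [])
      (V := (zs.map liftBlock).flatten ++ [.inr .cl]) rfl rfl .leave
    have h4 := Frame.run_keep (T := rstarFrame A M) (E := lift E) (op := opLift A M)
      (cl := clLift A M) (z := .fin) (γ := (zs.map liftBlock).flatten) (L := [.inr .op])
      (V := [.inr .cl]) rfl (by
        intro x hx
        obtain ⟨l, hl, hx⟩ := List.mem_flatten.1 hx
        obtain ⟨z, -, rfl⟩ := List.mem_map.1 hl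
        exact forall_mem_liftBlock (fun _ => trivial) (fun _ => trivial) x hx)
    exact computes_of_run (h1.trans (h2.trans ((key _ _).silent (Run.silent h3 h4)))) rfl rfl

end Unary

/-! ### Evaluators of Hadamard products. -/

section Hadamard

variable {A B : Type*} {M₁ M₂ : Type} {E₁ : Ev (A ⊕ Marker M₁) B} {E₂ : Ev (A ⊕ Marker M₂) B}
  {P : List A → Set (List (A ⊕ Marker M₁))} {Q : List A → Set (List (A ⊕ Marker M₂))}
  {R₁ R₂ : List A → Language B}

/-- States of the evaluator of a Hadamard product. -/
inductive HadState
  | inn | back | mid | fin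

instance : Fintype HadState :=
  ⟨⟨↑[HadState.inn, HadState.back, HadState.mid, HadState.fin], by simp⟩, by rintro ⟨⟩ <;> simp⟩

/-- Loops of the evaluator of a Hadamard product. -/
def hadKeep : HadState → A ⊕ Marker (Marker M₁ ⊕ Marker M₂) → Prop
  | _, .inl _ => True
  | _, .inr .op => False
  | _, .inr .cl => False
  | .inn, .inr (.sub m) => m ≠ .inl .op
  | .back, .inr (.sub m) => m ≠ .inl .cl
  | .mid, .inr (.sub m) => m ≠ .inr .op
  | .fin, .inr (.sub m) => m ≠ .inr .cl

/-- Moves of the evaluator of a Hadamard product. -/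
inductive HadMove : HadState → A ⊕ Marker (Marker M₁ ⊕ Marker M₂) → HadState → Prop
  | turn : HadMove .back (.inr .op) .mid

/-- The frame of the evaluator of a Hadamard product. -/
def hadFrame (A : Type*) (M₁ M₂ : Type) : Frame Bool (A ⊕ Marker (Marker M₁ ⊕ Marker M₂)) where
  Z := HadState
  fintype := inferInstance
  fwd
    | .back => false
    | _ => true
  keep := hadKeep
  move := HadMove
  src i := cond i .mid .inn
  ret i := cond i .fin .back
  inn := .inn
  fin := .fin

theorem isRev_hadFrame :
    (hadFrame A M₁ M₂).IsRev (opPair A M₁ M₂) (clPair A M₁ M₂) (.inr .op) (.inr .cl) where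
  op_injective := opPair_injective
  cl_injective := clPair_injective
  cl_ne := clPair_ne
  op_ne := opPair_ne
  det h h' := by cases h; cases h'; rfl
  codet h h' := by cases h; cases h'; rfl
  keep_move h h' := by cases h'; exact h
  move_keep h h' := by cases h; exact h'
  keep_src i h := by cases i <;> exact h rfl
  move_src i _ h := by cases i <;> cases h
  keep_ret i h := by cases i <;> exact h rfl
  move_ret i _ h := by cases i <;> cases h
  keep_inn := id
  move_inn _ h := by cases h
  keep_fin := id
  move_fin _ h := by cases h
  inn_fwd := rfl

theorem filterMap_observe_left (γ : List (A ⊕ (Marker M₁ ⊕ Marker M₂))) :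
    (γ.map (Sum.map id Marker.sub)).filterMap (observe (Sum.elim some fun _ => none)) =
      restrictLeft γ := by
  rw [List.filterMap_map, restrictLeft]
  congr 1
  funext x
  rcases x with a | m | m <;> rfl

theorem filterMap_observe_right (γ : List (A ⊕ (Marker M₁ ⊕ Marker M₂))) :
    (γ.map (Sum.map id Marker.sub)).filterMap (observe (Sum.elim (fun _ => none) some)) =
      restrictRight γ := by
  rw [List.filterMap_map, restrictRight]
  congr 1
  funext x
  rcases x with a | m | m <;> rfl

theorem exists_split_of_filterMap {X Y : Type*} {φ : X → Option Y} {l : List X} {a b : Y} {m : List Y}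
    (h : l.filterMap φ = a :: (m ++ [b])) : ∃ l₁ a' l₂ b' l₃, l = l₁ ++ a' :: (l₂ ++ b' :: l₃) ∧
      (∀ x ∈ l₁, φ x = none) ∧ φ a' = some a ∧ l₂.filterMap φ = m ∧ φ b' = some b ∧
      ∀ x ∈ l₃, φ x = none := by
  obtain ⟨l₁, a', l', rfl, h1, h2, h3⟩ := List.filterMap_eq_cons_iff.1 h
  obtain ⟨l₂, l'', rfl, h4, h5⟩ := List.filterMap_eq_append_iff.1 h3
  obtain ⟨l₄, b', l₃, rfl, h6, h7, h8⟩ := List.filterMap_eq_cons_iff.1 h5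
  refine ⟨l₁, a', l₂ ++ l₄, b', l₃, by simp, h1, h2, ?_, h7, List.filterMap_eq_nil_iff.1 h8⟩
  rw [List.filterMap_append, h4, List.filterMap_eq_nil_iff.2 h6, List.append_nil]

theorem observe_eq_some_inr {N M : Type} {ψ : N → Option M} {x : A ⊕ Marker N} {m : M}
    (h : observe ψ x = some (.inr m)) : ∃ n, x = .inr (.sub n) ∧ ψ n = some m := by
  rcases x with a | _ | _ | n
  · simp [observe] at h
  · simp [observe] at h
  · simp [observe] at h
  · exact ⟨n, rfl, by simpa [observe] using h⟩

/-- Each evaluator ignores the markers of the other argument, so both can run on the same word. In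
between, the head goes back to the outer opening parenthesis. -/
theorem computes_had {γ : List (A ⊕ (Marker M₁ ⊕ Marker M₂))} {α₁ : List (A ⊕ M₁)}
    {α₂ : List (A ⊕ M₂)} {y₁ y₂ : List B} (h₁ : E₁.IsRev (.inr .op) (.inr .cl))
    (h₂ : E₂.IsRev (.inr .op) (.inr .cl)) (hl : restrictLeft γ = wrap α₁)
    (hr : restrictRight γ = wrap α₂)
    (hy₁ : E₁.Computes (.inr .op) (.inr .cl) (α₁.map (Sum.map id .sub)) y₁)
    (hy₂ : E₂.Computes (.inr .op) (.inr .cl) (α₂.map (Sum.map id .sub)) y₂) :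
    ((hadFrame A M₁ M₂).comp (pair E₁ E₂) (opPair A M₁ M₂) (clPair A M₁ M₂)).Computes
      (.inr .op) (.inr .cl) (γ.map (Sum.map id .sub)) (y₁ ++ y₂) := by
  have hrev := isRev_pair h₁ h₂
  rw [← filterMap_observe_left, wrap_eq] at hl
  rw [← filterMap_observe_right, wrap_eq] at hr
  have hin : ∀ x ∈ γ.map (Sum.map id Marker.sub), ∃ z : A ⊕ (Marker M₁ ⊕ Marker M₂),
      x = Sum.map id Marker.sub z := by
    intro x hx
    obtain ⟨z, -, rfl⟩ := List.mem_map.1 hx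
    exact ⟨z, rfl⟩
  obtain ⟨l₁, a, l₂, b, l₃, h3, h4, h5, h6, h7, -⟩ := exists_split_of_filterMap hl
  obtain ⟨r₁, c, r₂, d, r₃, h8, h9, h10, h11, h12, h13⟩ := exists_split_of_filterMap hr
  obtain ⟨m | m, rfl, h14⟩ := observe_eq_some_inr h5 <;> cases h14
  obtain ⟨m | m, rfl, h14⟩ := observe_eq_some_inr h7 <;> cases h14
  obtain ⟨m | m, rfl, h14⟩ := observe_eq_some_inr h10 <;> cases h14
  obtain ⟨m | m, rfl, h14⟩ := observe_eq_some_inr h12 <;> cases h14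
  have h15 : (pair E₁ E₂ false).Computes (opPair A M₁ M₂ false) (clPair A M₁ M₂ false) l₂ y₁ := by
    rw [← h6] at hy₁
    exact hy₁.comap h₁.fin_fwd rfl rfl
  have h16 : (pair E₁ E₂ true).Computes (opPair A M₁ M₂ true) (clPair A M₁ M₂ true) r₂ y₂ := by
    rw [← h11] at hy₂
    exact hy₂.comap h₂.fin_fwd rfl rfl
  have s1 := Frame.run_keep (T := hadFrame A M₁ M₂) (E := pair E₁ E₂) (op := opPair A M₁ M₂)
    (cl := clPair A M₁ M₂) (z := .inn) (γ := l₁) (L := [.inr .op])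
    (V := opPair A M₁ M₂ false :: (l₂ ++ clPair A M₁ M₂ false :: (l₃ ++ [.inr .cl]))) rfl (by
      intro x hx
      have hx' := h4 x hx
      obtain ⟨z, rfl⟩ := hin x (by rw [h3]; simp [hx])
      rcases z with a | m
      · trivial
      · rintro rfl
        cases hx')
  have s2 := (Frame.run_call (T := hadFrame A M₁ M₂) (L := l₁.reverse ++ [.inr .op])
    (V := l₃ ++ [.inr .cl]) (hrev false) rfl h15).silent (Frame.run_ret_back (hrev false) rfl)
  -- The state `back` loops on all inner markers but the closing parenthesis of the first argument,
  -- which does not occur in what is crossed here.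
  have s3 := Frame.run_keep_back (T := hadFrame A M₁ M₂) (E := pair E₁ E₂) (op := opPair A M₁ M₂)
    (cl := clPair A M₁ M₂) (z := .back) (γ := l₁ ++ opPair A M₁ M₂ false :: l₂) (L := [.inr .op])
    (V := clPair A M₁ M₂ false :: (l₃ ++ [.inr .cl])) rfl (by
      intro x hx
      obtain ⟨z, rfl⟩ := hin x (by
        rw [h3]
        rcases List.mem_append.1 hx with hx | hx
        · simp [hx]
        · rcases List.mem_cons.1 hx with rfl | hx
          · simp [opPair]
          · simp [hx])
      rcases z with a | m
      · trivial
      · rintro rfl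
        rcases List.mem_append.1 hx with hx | hx
        · cases h4 _ hx
        · rcases List.mem_cons.1 hx with hx | hx
          · cases hx
          · have : (.inr .cl : A ⊕ Marker M₁) ∈ α₁.map (Sum.map id .sub) := by
              rw [← h6]
              exact List.mem_filterMap.2 ⟨_, hx, rfl⟩
            exact cl_notMem_map_sub _ this)
  have s4 := Frame.run_bf (T := hadFrame A M₁ M₂) (E := pair E₁ E₂) (op := opPair A M₁ M₂)
    (cl := clPair A M₁ M₂) (z := .back) (z' := .mid) (x := .inr .op) (L := [])
    (V := γ.map (Sum.map id .sub) ++ [.inr .cl]) rfl rfl .turn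
  have s5 := Frame.run_keep (T := hadFrame A M₁ M₂) (E := pair E₁ E₂) (op := opPair A M₁ M₂)
    (cl := clPair A M₁ M₂) (z := .mid) (γ := r₁) (L := [.inr .op])
    (V := opPair A M₁ M₂ true :: (r₂ ++ clPair A M₁ M₂ true :: (r₃ ++ [.inr .cl]))) rfl (by
      intro x hx
      have hx' := h9 x hx
      obtain ⟨z, rfl⟩ := hin x (by rw [h8]; simp [hx])
      rcases z with a | m
      · trivial
      · rintro rfl
        cases hx')
  have s6 := (Frame.run_call (T := hadFrame A M₁ M₂) (L := r₁.reverse ++ [.inr .op])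
    (V := r₃ ++ [.inr .cl]) (hrev true) rfl h16).silent (Frame.run_ret (hrev true) rfl)
  have s7 := Frame.run_keep (T := hadFrame A M₁ M₂) (E := pair E₁ E₂) (op := opPair A M₁ M₂)
    (cl := clPair A M₁ M₂) (z := .fin) (γ := r₃)
    (L := clPair A M₁ M₂ true :: (r₂.reverse ++ opPair A M₁ M₂ true :: (r₁.reverse ++ [.inr .op])))
    (V := [.inr .cl]) rfl (by
      intro x hx
      have hx' := h13 x hx
      obtain ⟨z, rfl⟩ := hin x (by rw [h8]; simp [hx])
      rcases z with a | m
      · trivial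
      · rintro rfl
        cases hx')
  have e1 : γ.map (Sum.map id Marker.sub) ++ [.inr .cl] = l₁ ++ opPair A M₁ M₂ false ::
      (l₂ ++ clPair A M₁ M₂ false :: (l₃ ++ [.inr .cl])) := by
    rw [h3]; simp [opPair, clPair]
  have e2 : γ.map (Sum.map id Marker.sub) ++ [.inr .cl] = r₁ ++ opPair A M₁ M₂ true ::
      (r₂ ++ clPair A M₁ M₂ true :: (r₃ ++ [.inr .cl])) := by
    rw [h8]; simp [opPair, clPair]
  rw [List.append_assoc] at s3
  simp only [List.reverse_append, List.reverse_cons, List.append_assoc, List.cons_append,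
    List.nil_append] at s3
  rw [← e1] at s3
  rw [← e1] at s1
  rw [← e2] at s5
  have h17 := s1.trans (s2.silent (Run.silent s3 (Run.silent s4 (s5.trans (Run.nil _)))))
  exact computes_of_run (h17.trans (s6.silent s7)) rfl (by rw [h8]; simp [opPair, clPair])

theorem exists_evaluates_had (hP : IsParsing P) (hQ : IsParsing Q) (h₁ : E₁.Evaluates P R₁)
    (h₂ : E₂.Evaluates Q R₂) : ∃ E : Ev (A ⊕ Marker (Marker M₁ ⊕ Marker M₂)) B,
      E.Evaluates (had P Q) (fun w => R₁ w * R₂ w) ∧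
      Fintype.card E.Q = Fintype.card E₁.Q + Fintype.card E₂.Q + 4 := by
  refine ⟨_, ⟨isRev_hadFrame.comp rfl (isRev_pair h₁.rev h₂.rev), fun β h => ?_, fun w y h => ?_⟩,
    card_comp_pair _⟩
  · obtain ⟨β', h3, h4, h5, -⟩ := mem_had_iff.1 h
    obtain rfl := wrap_inj.1 h3
    obtain ⟨α₁, h6, h7⟩ := hP h4
    obtain ⟨α₂, h8, h9⟩ := hQ h5
    rw [h6, ← h7] at h4
    rw [h8, ← h9] at h5
    obtain ⟨y₁, h10, h11⟩ := h₁.sound _ h4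
    obtain ⟨y₂, h12, h13⟩ := h₂.sound _ h5
    rw [h7] at h10
    rw [h9] at h12
    exact ⟨y₁ ++ y₂, Language.append_mem_mul h10 h12,
      computes_had h₁.rev h₂.rev h6 h8 h11 h13⟩
  · obtain ⟨y₁, h3, y₂, h4, rfl⟩ := Language.mem_mul.1 h
    obtain ⟨α₁, rfl, h5, h6⟩ := h₁.complete _ _ h3
    obtain ⟨α₂, h7, h8, h9⟩ := h₂.complete _ _ h4
    obtain ⟨γ, h10, h11, h12⟩ := exists_had hP hQ h5 h8
    refine ⟨γ, ?_, h10, computes_had h₁.rev h₂.rev h11 h12 h6 h9⟩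
    rw [← proj_restrictLeft, h11, proj_wrap]

end Hadamard

end Ev

/-! #### Words with separators -/

/-- The word `f s x f (s + 1) x ⋯ x f (s + m)`. -/
def List.joined {X : Type*} (f : ℕ → List X) (x : X) : ℕ → ℕ → List X
  | s, 0 => f s
  | s, m + 1 => f s ++ x :: List.joined f x (s + 1) m

namespace List

variable {X : Type*} {f : ℕ → List X} {x : X}

theorem joined_zero (s : ℕ) : joined f x s 0 = f s := rfl

theorem joined_succ (s m : ℕ) : joined f x s (m + 1) = f s ++ x :: joined f x (s + 1) m := rfl

theorem joined_add (m m' : ℕ) : ∀ s, joined f x s (m + m' + 1) =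
    joined f x s m ++ x :: joined f x (s + m + 1) m' := by
  induction m with
  | zero => intro s; rw [Nat.zero_add]; rfl
  | succ m ih =>
    intro s
    rw [show m + 1 + m' + 1 = m + m' + 1 + 1 by ring, joined_succ, ih, joined_succ,
      show s + 1 + m + 1 = s + (m + 1) + 1 by ring]
    simp

theorem joined_succ_right (s m : ℕ) :
    joined f x s (m + 1) = joined f x s m ++ x :: f (s + m + 1) := joined_add m 0 s

theorem joined_shift (m : ℕ) : ∀ s, joined (fun i => f (i + 1)) x s m = joined f x (s + 1) m := by
  induction m with
  | zero => exact fun _ => rfl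
  | succ m ih => intro s; rw [joined_succ, joined_succ, ih]

theorem mem_joined {m : ℕ} {z : X} : ∀ {s}, z ∈ joined f x s m →
    z = x ∨ ∃ i, s ≤ i ∧ i ≤ s + m ∧ z ∈ f i := by
  induction m with
  | zero => exact fun {s} h => .inr ⟨s, le_rfl, le_rfl, h⟩
  | succ m ih =>
    intro s h
    rw [joined_succ, List.mem_append, List.mem_cons] at h
    rcases h with h | h | h
    · exact .inr ⟨s, le_rfl, by omega, h⟩
    · exact .inl h
    · rcases ih h with h | ⟨i, h1, h2, h3⟩
      · exact .inl h
      · exact .inr ⟨i, by omega, by omega, h3⟩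

theorem exists_joined_eq_cons {s : ℕ} {z : X} {u : List X} (h : f s = z :: u) (m : ℕ) :
    ∃ u', joined f x s m = z :: u' := by
  cases m with
  | zero => exact ⟨u, h⟩
  | succ m => exact ⟨_, by rw [joined_succ, h, List.cons_append]⟩

theorem exists_joined_eq_concat {s m : ℕ} {z : X} {u : List X} (h : f (s + m) = u ++ [z]) :
    ∃ u', joined f x s m = u' ++ [z] := by
  cases m with
  | zero => exact ⟨u, h⟩
  | succ m =>
    refine ⟨joined f x s m ++ x :: u, ?_⟩
    rw [joined_succ_right, add_assoc, h]
    simp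

theorem exists_eq_cons_concat {l u v : List X} {y z : X} (h : l = y :: u) (h' : l = v ++ [z])
    (hne : y ≠ z) : ∃ w, l = y :: (w ++ [z]) := by
  subst h
  cases v with
  | nil => simp only [List.nil_append, List.cons.injEq] at h'; exact absurd h'.1 hne
  | cons a v =>
    simp only [List.cons_append, List.cons.injEq] at h'
    exact ⟨v, by rw [h'.2]⟩

end List

open List (joined joined_zero joined_succ joined_add joined_succ_right mem_joined)

namespace Ev

/-! ### Parsings for a `k`-star as tapes. -/

section KStarTape

variable {A B : Type*} {S : Type} {k : ℕ}

/-- The symbols of the parsings for a `k`-star. -/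
abbrev KSym (A : Type*) (k : ℕ) (S : Type) := A ⊕ Marker (Unit ⊕ (ZMod k × Marker S))

/-- The separator. -/
def sep : KSym A k S := .inr (.sub (.inl ()))

/-- The markers of the argument with an index. -/
def ind (j : ZMod k) (m : Marker S) : KSym A k S := .inr (.sub (.inr (j, m)))

/-- The opening parentheses of the argument. -/
def opInd (A : Type*) (S : Type) (j : ZMod k) : KSym A k S := ind j .op

/-- The closing parentheses of the argument. -/
def clInd (A : Type*) (S : Type) (j : ZMod k) : KSym A k S := ind j .cl

/-- The markers with index `j`, without their index. -/
def only (j : ZMod k) : Unit ⊕ (ZMod k × Marker S) → Option (Marker S)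
  | .inl _ => none
  | .inr (l, m) => if l = j then some m else none

/-- The evaluators of the blocks with index `j`. -/
def indexed (k : ℕ) (E : Ev (A ⊕ Marker S) B) (j : ZMod k) : Ev (KSym A k S) B :=
  E.comap (observe (only j))

theorem isRev_indexed {E : Ev (A ⊕ Marker S) B} (h : E.IsRev (.inr .op) (.inr .cl)) (j : ZMod k) :
    (indexed k E j).IsRev (opInd A S j) (clInd A S j) :=
  isRev_observe (ψ := only j) (f := fun m => .inr (j, m)) h fun _ => by simp [only]

/-- Letters and markers of the argument. -/
def IsInner (x : KSym A k S) : Prop := ∃ z : A ⊕ (ZMod k × Marker S), x = Sum.map id (.sub ∘ .inr) z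

/-- The segments `f 1, …, f (k' + p + 1)` between the separators of a parsing for a `k`-star with
`p + 1` blocks, where `k = k' + 1`; `y s` is the output on the block that starts at position `s`. -/
structure IsTape (E : Ev (A ⊕ Marker S) B) (k k' p : ℕ) (f : ℕ → List (KSym A k S))
    (y : ℕ → List B) : Prop where
  inner : ∀ i, ∀ x ∈ f i, IsInner x
  block : ∀ s, 1 ≤ s → s ≤ p + 1 → ∃ W, joined f sep s k' =
      opInd A S (s : ZMod k) :: (W ++ [clInd A S (s : ZMod k)]) ∧
    (indexed k E s).Computes (opInd A S (s : ZMod k)) (clInd A S (s : ZMod k)) W (y s) ∧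
    opInd A S (s : ZMod k) ∉ W ∧ clInd A S (s : ZMod k) ∉ W
  overlap : ∀ s k'', 1 ≤ s → s ≤ p → k' = k'' + 1 → ∃ W, joined f sep (s + 1) k'' =
      opInd A S ((s + 1 : ℕ) : ZMod k) :: (W ++ [clInd A S (s : ZMod k)]) ∧
    opInd A S ((s + 1 : ℕ) : ZMod k) ∉ W ∧ clInd A S (s : ZMod k) ∉ W

theorem filterMap_observe_only (j : ZMod k) (α : List (A ⊕ (ZMod k × Marker S))) :
    (α.map (Sum.map id (.sub ∘ .inr)) : List (KSym A k S)).filterMap (observe (only j)) =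
      select j α := by
  induction α with
  | nil => rfl
  | cons x α ih =>
    rcases x with a | ⟨l, m⟩
    · exact congrArg (List.cons (Sum.inl a)) ih
    · by_cases h : l = j
      · subst h
        rw [List.map_cons, List.filterMap_cons_some (b := .inr m) (by simp [observe, only]), ih,
          select_inr_self]
      · rw [List.map_cons, List.filterMap_cons_none (by simp [observe, only, h]), ih,
          select_inr_of_ne h]

theorem filterMap_joined (j : ZMod k) (α : ℕ → List (A ⊕ (ZMod k × Marker S))) (m : ℕ) : ∀ s,
    (joined (fun i => (α i).map (Sum.map id (.sub ∘ .inr))) (sep : KSym A k S) s m).filterMap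
      (observe (only j)) = select j (concat α s (m + 1)) := by
  induction m with
  | zero =>
    intro s
    rw [joined_zero, filterMap_observe_only, concat_succ, concat_zero, List.append_nil]
  | succ m ih =>
    intro s
    rw [joined_succ, List.filterMap_append, filterMap_observe_only,
      List.filterMap_cons_none (by rfl), ih, concat_succ _ s, select_append]

theorem map_longWord (m : ℕ) : ∀ α : ℕ → List (A ⊕ (ZMod k × Marker S)),
    (longWord (m + 1) α).map (Sum.map id Marker.sub) =
      joined (fun i => (α i).map (Sum.map id (.sub ∘ .inr))) (sep : KSym A k S) 1 m := by
  induction m with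
  | zero => intro α; rw [longWord_succ]; simp [joined_zero, Sum.map_comp_map]
  | succ m ih =>
    intro α
    rw [longWord_succ, if_neg (Nat.succ_ne_zero _), List.map_append, List.map_cons, ih, joined_succ,
      ← List.joined_shift (f := fun i => (α i).map (Sum.map id (Marker.sub ∘ Sum.inr))), List.map_map,
      Sum.map_comp_map]
    rfl

variable [NeZero k] {E : Ev (A ⊕ Marker S) B} {n : ℕ} {β : ℕ → List (A ⊕ (ZMod k × S))}

/-- The projection on the index of a block is a word in parentheses, so the parentheses of the block
occur at its two ends and not in between. The overlap of two consecutive blocks is part of both, and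
inherits this. -/
theorem isTape_decorate {k' p : ℕ} (hE : E.IsRev (.inr .op) (.inr .cl)) (hk : k = k' + 1)
    (hn : n = k' + p + 1) (y : ℕ → List B)
    (hy : ∀ s : ℕ, 1 ≤ s → s ≤ p + 1 → E.Computes (.inr .op) (.inr .cl)
      ((select (s : ZMod k) (concat β s k)).map (Sum.map id .sub)) (y s)) :
    IsTape E k k' p (fun i => (decorate n β i).map (Sum.map id (.sub ∘ .inr))) y := by
  set f : ℕ → List (KSym A k S) := fun i => (decorate n β i).map (Sum.map id (.sub ∘ .inr)) with hf
  have hop : ∀ s, s ≤ p + 1 → ∃ u, f s = opInd A S (s : ZMod k) :: u := by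
    intro s h2
    refine ⟨((β s).map emb ++ closing A S k s).map (Sum.map id (.sub ∘ .inr)), ?_⟩
    rw [hf]
    simp only [decorate, opening]
    rw [if_pos (by omega), List.cons_append, List.nil_append, List.map_cons]
    rfl
  have hcl : ∀ s, 1 ≤ s → ∃ u, f (s + k') = u ++ [clInd A S (s : ZMod k)] := by
    intro s h2
    refine ⟨(opening A S k n (s + k') ++ (β (s + k')).map emb).map (Sum.map id (.sub ∘ .inr)), ?_⟩
    rw [hf]
    simp only [decorate, closing]
    rw [if_pos (by omega), ← List.append_assoc, List.map_append]
    congr 1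
    have : ((s + k' + 1 : ℕ) : ZMod k) = s := by
      rw [add_assoc, ← hk]; simp
    rw [this]
    rfl
  have hblock : ∀ s, 1 ≤ s → s ≤ p + 1 → ∃ W, joined f sep s k' =
      opInd A S (s : ZMod k) :: (W ++ [clInd A S (s : ZMod k)]) ∧
    (indexed k E s).Computes (opInd A S (s : ZMod k)) (clInd A S (s : ZMod k)) W (y s) ∧
    opInd A S (s : ZMod k) ∉ W ∧ clInd A S (s : ZMod k) ∉ W := by
    intro s h1 h2
    obtain ⟨u, hu⟩ := hop s h2
    obtain ⟨v, hv⟩ := hcl s h1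
    obtain ⟨u', hu'⟩ := List.exists_joined_eq_cons (x := sep) hu k'
    obtain ⟨v', hv'⟩ := List.exists_joined_eq_concat (x := sep) hv
    obtain ⟨W, hW⟩ := List.exists_eq_cons_concat hu' hv' (by simp [opInd, clInd, ind])
    have h3 := filterMap_joined (s : ZMod k) (decorate n β) k' s
    rw [← hk, select_concat_decorate h1 (by omega)] at h3
    have h4 : W.filterMap (observe (only (s : ZMod k))) =
        (select (s : ZMod k) (concat β s k)).map (Sum.map id .sub) := by
      have h5 := (congrArg (List.filterMap (observe (only (s : ZMod k)))) hW).symm.trans h3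
      rw [List.filterMap_cons_some (b := .inr .op) (by simp [observe, only, opInd, ind]),
        List.filterMap_append, List.filterMap_cons_some (b := .inr .cl)
          (by simp [observe, only, clInd, ind]), wrap_eq] at h5
      simpa using h5
    refine ⟨W, hW, ?_, fun h => ?_, fun h => ?_⟩
    · have h6 := hy s h1 h2
      rw [← h4] at h6
      exact h6.comap hE.fin_fwd (by simp [observe, only, opInd, ind])
        (by simp [observe, only, clInd, ind])
    · have : (.inr .op : A ⊕ Marker S) ∈ W.filterMap (observe (only (s : ZMod k))) :=
        List.mem_filterMap.2 ⟨_, h, by simp [observe, only, opInd, ind]⟩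
      rw [h4] at this
      obtain ⟨a | m, -, h⟩ := List.mem_map.1 this <;> cases h
    · have : (.inr .cl : A ⊕ Marker S) ∈ W.filterMap (observe (only (s : ZMod k))) :=
        List.mem_filterMap.2 ⟨_, h, by simp [observe, only, clInd, ind]⟩
      rw [h4] at this
      obtain ⟨a | m, -, h⟩ := List.mem_map.1 this <;> cases h
  refine ⟨fun i x hx => ?_, hblock, fun s k'' h1 h2 hk'' => ?_⟩
  · obtain ⟨z, -, rfl⟩ := List.mem_map.1 hx
    exact ⟨z, rfl⟩
  · obtain ⟨u, hu⟩ := hop (s + 1) (by omega)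
    obtain ⟨v, hv⟩ := hcl s h1
    obtain ⟨u', hu'⟩ := List.exists_joined_eq_cons (x := sep) hu k''
    rw [hk'', ← add_assoc, add_right_comm] at hv
    obtain ⟨v', hv'⟩ := List.exists_joined_eq_concat (x := sep) hv
    obtain ⟨W, hW⟩ := List.exists_eq_cons_concat hu' hv' (by simp [opInd, clInd, ind])
    refine ⟨W, hW, fun h => ?_, fun h => ?_⟩
    -- The overlap is a prefix of block `s + 1`, which has no second opening parenthesis, and a
    -- suffix of block `s`, which has no earlier closing one.
    · obtain ⟨W', h3, -, h4, -⟩ := hblock (s + 1) (by omega) (by omega)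
      rw [hk'', joined_succ_right, hW, List.cons_append, List.cons.injEq] at h3
      refine h4 ?_
      obtain ⟨v₁, hv₁⟩ := hcl (s + 1) (by omega)
      rw [show s + 1 + k'' + 1 = s + 1 + k' by omega, hv₁] at h3
      have h6 : (W ++ clInd A S (s : ZMod k) :: sep :: v₁) ++ [clInd A S ((s + 1 : ℕ) : ZMod k)] =
          W' ++ [clInd A S ((s + 1 : ℕ) : ZMod k)] := by simpa using h3.2
      rw [← List.append_cancel_right h6]
      exact List.mem_append_left _ h
    · obtain ⟨W', h3, -, -, h4⟩ := hblock s h1 (by omega)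
      obtain ⟨v₁, hv₁⟩ := hop s (by omega)
      rw [hk'', joined_succ, hW, hv₁, List.cons_append, List.cons.injEq] at h3
      have h6 : (v₁ ++ sep :: opInd A S ((s + 1 : ℕ) : ZMod k) :: W) ++ [clInd A S (s : ZMod k)] =
          W' ++ [clInd A S (s : ZMod k)] := by simpa using h3.2
      rw [← List.append_cancel_right h6] at h4
      exact h4 (by simp [h])

end KStarTape

end Ev

namespace Ev

theorem Run.map {X B : Type*} {E E' : Ev X B} (g : E.Q → E'.Q) (hg : ∀ p, E'.fwd (g p) = E.fwd p)
    (hg' : ∀ {p x o q}, E.tr p x o q → E'.tr (g p) x o (g q))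
    {c d : List X × E.Q × List X} {y : List B} (h : E.Run c y d) :
    E'.Run (c.1, g c.2.1, c.2.2) y (d.1, g d.2.1, d.2.2) := by
  induction h with
  | nil => exact .nil _
  | cons h _ ih =>
    refine .cons ?_ ih
    cases h with
    | ff h h' h'' => exact .ff ((hg _).trans h) ((hg _).trans h') (hg' h'')
    | fb h h' h'' => exact .fb ((hg _).trans h) ((hg _).trans h') (hg' h'')
    | bf h h' h'' => exact .bf ((hg _).trans h) ((hg _).trans h') (hg' h'')
    | bb h h' h'' => exact .bb ((hg _).trans h) ((hg _).trans h') (hg' h'')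

/-! ### The frame common to `k`-stars and reverse `k`-stars. -/

section Wrap

variable {A B : Type*} {S : Type} {k : ℕ} {T : Frame (ZMod k) (KSym A k S)}

/-- Control states of the evaluator of a `k`-star outside of the evaluation of the blocks. -/
inductive WrapState
  | inn | first | short | scan | last | fin

instance : Fintype WrapState :=
  ⟨⟨↑[WrapState.inn, WrapState.first, WrapState.short, WrapState.scan, WrapState.last,
    WrapState.fin], by simp⟩, by rintro ⟨⟩ <;> simp⟩

/-- Loops of the evaluator of a `k`-star. -/
inductive WrapKeep (T : Frame (ZMod k) (KSym A k S)) : WrapState ⊕ T.Z → KSym A k S → Prop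
  | inn_letter {a} : WrapKeep T (.inl .inn) (.inl a)
  | inn_sep {u} : WrapKeep T (.inl .inn) (.inr (.sub (.inl u)))
  | scan_letter {a} : WrapKeep T (.inl .scan) (.inl a)
  | scan_sub {m} : WrapKeep T (.inl .scan) (.inr (.sub m))
  | core {z x} : T.keep z x → WrapKeep T (.inr z) x

/-- Moves of the evaluator of a `k`-star. -/
inductive WrapMove (T : Frame (ZMod k) (KSym A k S)) :
    WrapState ⊕ T.Z → KSym A k S → WrapState ⊕ T.Z → Prop
  | first {j} : j = 1 → WrapMove T (.inl .inn) (.inr (.sub (.inr (j, .op)))) (.inl .first)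
  | enter {z} : z = T.inn → WrapMove T (.inl .first) (.inr .op) (.inr z)
  | core {z x z'} : T.move z x z' → WrapMove T (.inr z) x (.inr z')
  | leave {z} : z = T.fin → WrapMove T (.inr z) (.inr .op) (.inl .scan)
  | last : WrapMove T (.inl .scan) (.inr .cl) (.inl .last)
  | long {j} : WrapMove T (.inl .last) (.inr (.sub (.inr (j, .cl)))) (.inl .fin)
  | short : WrapMove T (.inl .inn) (.inr .cl) (.inl .short)
  | short_sep {u} : WrapMove T (.inl .short) (.inr (.sub (.inl u))) (.inl .fin)
  | short_op : WrapMove T (.inl .short) (.inr .op) (.inl .fin)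

/-- The frame of the evaluator of a `k`-star, given a frame `T` that evaluates the blocks in turn, from
and to the opening parenthesis. -/
def wrapFrame (T : Frame (ZMod k) (KSym A k S)) : Frame (ZMod k) (KSym A k S) where
  Z := WrapState ⊕ T.Z
  fintype := inferInstance
  fwd
    | .inl .first => false
    | .inl .short => false
    | .inl .last => false
    | .inl _ => true
    | .inr z => T.fwd z
  keep := WrapKeep T
  move := WrapMove T
  src i := .inr (T.src i)
  ret i := .inr (T.ret i)
  inn := .inl .inn
  fin := .inl .fin

/-- Short and long parsings separate at the opening parenthesis with index `1`. They can meet again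
in `fin` without spoiling co-determinism because the symbol read last differs: a closing parenthesis
of the argument for long ones, a separator or the outer opening parenthesis for short ones. -/
theorem isRev_wrapFrame (hT : T.IsRev (opInd A S) (clInd A S) (.inr .op) (.inr .op)) :
    (wrapFrame T).IsRev (opInd A S) (clInd A S) (.inr .op) (.inr .cl) where
  op_injective := hT.op_injective
  cl_injective := hT.cl_injective
  cl_ne := hT.cl_ne
  op_ne i := by rintro ⟨⟩
  det := by
    intro z x z' z'' h h'
    cases h with
    | first => cases h'; rfl
    | enter h => cases h' with | enter h' => rw [h, h']
    | core h =>
      cases h' with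
      | core h' => rw [hT.det h h']
      | leave h' => subst h'; exact (hT.move_fin _ h).elim
    | leave h =>
      cases h' with
      | core h' => subst h; exact (hT.move_fin _ h').elim
      | leave => rfl
    | _ => cases h'; rfl
  codet := by
    intro z x z' z'' h h'
    cases h with
    | first => cases h'; rfl
    | enter h =>
      cases h' with
      | enter => rfl
      | core h' => subst h; exact (hT.move_inn _ h').elim
    | core h =>
      cases h' with
      | enter h' => subst h'; exact (hT.move_inn _ h).elim
      | core h' => rw [hT.codet h h']
    | leave h => cases h' with | leave h' => rw [h, h']
    | _ => cases h'; rfl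
  keep_move := by
    intro z x z' h h'
    cases h' with
    | core h' => cases h with | core h => exact hT.keep_move h h'
    | leave h' => cases h with | core h => subst h'; exact hT.keep_fin h
    | _ => cases h
  move_keep := by
    intro z x z' h h'
    cases h with
    | core h => cases h' with | core h' => exact hT.move_keep h h'
    | enter h => cases h' with | core h' => subst h; exact hT.keep_inn h'
    | _ => cases h'
  keep_src i h := by cases h with | core h => exact hT.keep_src i h
  move_src i z h := by
    generalize hx : opInd A S i = x at h
    change WrapMove T (.inr (T.src i)) x z at h
    cases h with
    | core h => subst hx; exact hT.move_src i _ h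
    | leave h => exact hT.op_ne i hx
  keep_ret i h := by cases h with | core h => exact hT.keep_ret i h
  move_ret i z h := by
    generalize hx : clInd A S i = x at h
    change WrapMove T z x (.inr (T.ret i)) at h
    cases h with
    | core h => subst hx; exact hT.move_ret i _ h
    | enter h => exact hT.cl_ne i hx
  keep_inn h := by cases h
  move_inn z h := by cases h
  keep_fin h := by cases h
  move_fin z h := by cases h
  inn_fwd := rfl

variable [NeZero k] {E : Ev (A ⊕ Marker S) B}

theorem card_wrapFrame_comp : Fintype.card ((wrapFrame T).comp (indexed k E) (opInd A S)
    (clInd A S)).Q = k * Fintype.card E.Q + Fintype.card T.Z + 6 := by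
  have h1 : Fintype.card (wrapFrame T).Z = 6 + Fintype.card T.Z :=
    Fintype.card_sum
  have h2 : ∑ j : ZMod k, Fintype.card (indexed k E j).Q = k * Fintype.card E.Q := by
    have : ∀ j : ZMod k, Fintype.card (indexed k E j).Q = Fintype.card E.Q := fun _ => rfl
    simp [this, ZMod.card]
  rw [Frame.card_comp, h1, h2]
  ring

theorem computes_short {l : List (KSym A k S)} (h : ∀ x ∈ l, (∃ a, x = .inl a) ∨ x = sep)
    (h' : l = [] ∨ ∃ l', l = l' ++ [sep]) :
    ((wrapFrame T).comp (indexed k E) (opInd A S) (clInd A S)).Computes (.inr .op) (.inr .cl) l [] := by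
  have h1 := Frame.run_keep (T := wrapFrame T) (E := indexed k E) (op := opInd A S)
    (cl := clInd A S) (z := .inl .inn) (γ := l) (L := [.inr .op]) (V := [.inr .cl]) rfl (by
      intro x hx
      rcases h x hx with ⟨a, rfl⟩ | rfl
      · exact .inn_letter
      · exact .inn_sep)
  have h2 := Frame.run_fb (T := wrapFrame T) (E := indexed k E) (op := opInd A S)
    (cl := clInd A S) (z := .inl .inn) (z' := .inl .short) (x := .inr .cl)
    (L := l.reverse ++ [.inr .op]) (V := []) rfl rfl .short
  refine computes_of_run (h1.trans (h2.trans ?_)) rfl rfl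
  rcases h' with rfl | ⟨l', rfl⟩
  · exact Frame.run_bf (T := wrapFrame T) (E := indexed k E) (op := opInd A S)
      (cl := clInd A S) (z := .inl .short) (z' := .inl .fin) (x := .inr .op)
      (L := []) (V := [.inr .cl]) rfl rfl .short_op
  · rw [List.reverse_append]
    exact Frame.run_bf (T := wrapFrame T) (E := indexed k E) (op := opInd A S)
      (cl := clInd A S) (z := .inl .short) (z' := .inl .fin) (x := sep)
      (L := l'.reverse ++ [.inr .op]) (V := [.inr .cl]) rfl rfl .short_sep

theorem computes_long {l W : List (KSym A k S)} {j : ZMod k} {y : List B}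
    (hT : T.fwd T.inn = true) (hT' : T.fwd T.fin = false) (h : ∀ x ∈ l, IsInner x ∨ x = sep)
    (hl : l = opInd A S 1 :: (W ++ [clInd A S j]))
    (hy : (T.comp (indexed k E) (opInd A S) (clInd A S)).Run
      ([.inr .op], .inl T.inn, l ++ [.inr .cl]) y ([.inr .op], .inl T.fin, l ++ [.inr .cl])) :
    ((wrapFrame T).comp (indexed k E) (opInd A S) (clInd A S)).Computes (.inr .op) (.inr .cl) l y := by
  have h1 := Frame.run_fb (T := wrapFrame T) (E := indexed k E) (op := opInd A S)
    (cl := clInd A S) (z := .inl .inn) (z' := .inl .first) (x := opInd A S 1)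
    (L := [.inr .op]) (V := W ++ [clInd A S j] ++ [.inr .cl]) rfl rfl (.first rfl)
  rw [← List.cons_append, ← hl] at h1
  have h2 := Frame.run_bf (T := wrapFrame T) (E := indexed k E) (op := opInd A S)
    (cl := clInd A S) (z := .inl .first) (z' := .inr T.inn) (x := .inr .op)
    (L := []) (V := l ++ [.inr .cl]) rfl hT (.enter rfl)
  -- The core of the frame is a copy of `T`, so the run of `T` is a run of the whole machine.
  have h3 := Run.map (E' := (wrapFrame T).comp (indexed k E) (opInd A S) (clInd A S))
    (Sum.map Sum.inr id) (by rintro (z | z) <;> rfl) (by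
      intro p x o q h
      cases h with
      | keep h => exact Frame.Tr.keep (T := wrapFrame T) (.core h)
      | move h => exact Frame.Tr.move (T := wrapFrame T) (.core h)
      | call h h' => exact Frame.Tr.call (T := wrapFrame T) (congrArg _ h) h'
      | inner h => exact Frame.Tr.inner (T := wrapFrame T) h
      | ret h h' => exact Frame.Tr.ret (T := wrapFrame T) h (congrArg _ h')) hy
  have h4 := Frame.run_bf (T := wrapFrame T) (E := indexed k E) (op := opInd A S)
    (cl := clInd A S) (z := .inr T.fin) (z' := .inl .scan) (x := .inr .op)
    (L := []) (V := l ++ [.inr .cl]) hT' rfl (.leave rfl)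
  have h5 := Frame.run_keep (T := wrapFrame T) (E := indexed k E) (op := opInd A S)
    (cl := clInd A S) (z := .inl .scan) (γ := l) (L := [.inr .op]) (V := [.inr .cl]) rfl (by
      intro x hx
      rcases h x hx with ⟨a | m, rfl⟩ | rfl
      · exact .scan_letter
      · exact .scan_sub
      · exact .scan_sub)
  have h6 := Frame.run_fb (T := wrapFrame T) (E := indexed k E) (op := opInd A S)
    (cl := clInd A S) (z := .inl .scan) (z' := .inl .last) (x := .inr .cl)
    (L := l.reverse ++ [.inr .op]) (V := []) rfl rfl .last
  have h7 := Frame.run_bf (T := wrapFrame T) (E := indexed k E) (op := opInd A S)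
    (cl := clInd A S) (z := .inl .last) (z' := .inl .fin) (x := clInd A S j)
    (L := W.reverse ++ [opInd A S 1] ++ [.inr .op]) (V := [.inr .cl]) rfl rfl .long
  have e : clInd A S j :: (W.reverse ++ [opInd A S 1] ++ [.inr .op]) = l.reverse ++ [.inr .op] := by
    rw [hl]; simp
  rw [e] at h7
  exact computes_of_run (h1.trans (h2.trans (h3.silent (h4.trans (h5.trans (h6.trans h7)))))) rfl rfl

variable {P : List A → Set (List (A ⊕ Marker S))} {R : List A → Language B}

theorem exists_sound_blocks (hP : IsParsing P) (hE : E.Evaluates P R) {m : ℕ}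
    (b : ℕ → List (A ⊕ S)) (u : ℕ → List A)
    (h : ∀ s, 1 ≤ s → s ≤ m → wrap (b s) ∈ P (u s)) : ∃ y : ℕ → List B, ∀ s, 1 ≤ s → s ≤ m →
      y s ∈ R (u s) ∧ E.Computes (.inr .op) (.inr .cl) ((b s).map (Sum.map id .sub)) (y s) := by
  have : ∀ s, ∃ y, 1 ≤ s → s ≤ m →
      y ∈ R (u s) ∧ E.Computes (.inr .op) (.inr .cl) ((b s).map (Sum.map id .sub)) y := by
    intro s
    by_cases hs : 1 ≤ s ∧ s ≤ m
    · have h1 := h s hs.1 hs.2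
      obtain ⟨β, h2, h3⟩ := hP h1
      obtain rfl := wrap_inj.1 h2
      rw [← h3] at h1 ⊢
      obtain ⟨y, h4, h5⟩ := hE.sound _ h1
      exact ⟨y, fun _ _ => ⟨h4, h5⟩⟩
    · exact ⟨[], fun h1 h2 => absurd ⟨h1, h2⟩ hs⟩
  choose y hy using this
  exact ⟨y, hy⟩

theorem exists_complete_blocks (hE : E.Evaluates P R) {m : ℕ} (u : ℕ → List A) (y : ℕ → List B)
    (h : ∀ s, 1 ≤ s → s ≤ m → y s ∈ R (u s)) : ∃ b : ℕ → List (A ⊕ S), ∀ s, 1 ≤ s → s ≤ m →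
      proj (b s) = u s ∧ wrap (b s) ∈ P (u s) ∧
        E.Computes (.inr .op) (.inr .cl) ((b s).map (Sum.map id .sub)) (y s) := by
  have : ∀ s, ∃ b, 1 ≤ s → s ≤ m → proj b = u s ∧ wrap b ∈ P (u s) ∧
      E.Computes (.inr .op) (.inr .cl) (b.map (Sum.map id .sub)) (y s) := by
    intro s
    by_cases hs : 1 ≤ s ∧ s ≤ m
    · obtain ⟨b, hb⟩ := hE.complete _ _ (h s hs.1 hs.2)
      exact ⟨b, fun _ _ => hb⟩
    · exact ⟨[], fun h1 h2 => absurd ⟨h1, h2⟩ hs⟩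
  choose b hb using this
  exact ⟨b, hb⟩

/-- Leaves to `T` only the run on a tape with at least one block. For completeness, `exists_isBody`
assembles a parsing from parsings of the blocks with the prescribed outputs. -/
theorem evaluates_wrapFrame {L : Language A} {R' : List A → Language B}
    {op' : List (List B) → List B} (hP : IsParsing P) (hE : E.Evaluates P R)
    (hT : T.IsRev (opInd A S) (clInd A S) (.inr .op) (.inr .op)) (hT' : T.fwd T.fin = false)
    (hop : op' [] = [])
    (hR : ∀ w y, y ∈ R' w ↔ ∃ us, w = us.flatten ∧ (∀ u ∈ us, u ∈ L) ∧
      ∃ ys, List.Forall₂ (fun u y => y ∈ R u) (RTE.blocks k us) ys ∧ y = op' ys)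
    (run : ∀ k' p f y, k = k' + 1 → IsTape E k k' p f y →
      (T.comp (indexed k E) (opInd A S) (clInd A S)).Run
        ([.inr .op], .inl T.inn, joined f sep 1 (k' + p) ++ [.inr .cl])
        (op' ((List.range' 1 (p + 1)).map y))
        ([.inr .op], .inl T.fin, joined f sep 1 (k' + p) ++ [.inr .cl])) :
    ((wrapFrame T).comp (indexed k E) (opInd A S) (clInd A S)).Evaluates (kstar k L P) R' := by
  have hpos : 0 < k := Nat.pos_of_ne_zero (NeZero.ne k)
  have short : ∀ us : List (List A),
      ((wrapFrame T).comp (indexed k E) (opInd A S) (clInd A S)).Computes (.inr .op) (.inr .cl)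
        ((shortWord us).map (Sum.map id .sub)) [] := by
    intro us
    refine computes_short (fun x hx => ?_) ?_
    · obtain ⟨z, hz, rfl⟩ := List.mem_map.1 hx
      simp only [shortWord, List.mem_flatten, List.mem_map] at hz
      obtain ⟨_, ⟨u, -, rfl⟩, hz⟩ := hz
      simp only [List.mem_append, List.mem_map, List.mem_cons, List.not_mem_nil, or_false] at hz
      rcases hz with ⟨a, -, rfl⟩ | rfl
      · exact .inl ⟨a, rfl⟩
      · exact .inr rfl
    · rcases List.eq_nil_or_concat us with rfl | ⟨us, u, rfl⟩
      · exact .inl rfl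
      · exact .inr ⟨((shortWord us).map (Sum.map id .sub)) ++ u.map .inl, by simp [shortWord, sep]⟩
  have long : ∀ (n : ℕ) (β : ℕ → List (A ⊕ (ZMod k × S))) (y : ℕ → List B), k ≤ n →
      (∀ s : ℕ, 1 ≤ s → s ≤ n + 1 - k → E.Computes (.inr .op) (.inr .cl)
        ((select (s : ZMod k) (concat β s k)).map (Sum.map id .sub)) (y s)) →
      ((wrapFrame T).comp (indexed k E) (opInd A S) (clInd A S)).Computes (.inr .op) (.inr .cl)
        ((longWord n (decorate n β)).map (Sum.map id .sub))
        (op' ((List.range' 1 (n + 1 - k)).map y)) := by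
    intro n β y hk hy
    -- A block contains `k'` separators, and there are `p + 1 = n + 1 - k` blocks.
    obtain ⟨k', hk'⟩ : ∃ k', k = k' + 1 := ⟨k - 1, by omega⟩
    obtain ⟨p, hp⟩ : ∃ p, n = k' + p + 1 := ⟨n - k, by omega⟩
    have hnk : n + 1 - k = p + 1 := by omega
    rw [hnk] at hy ⊢
    have ht := isTape_decorate hE.rev hk' hp y hy
    have e : (longWord n (decorate n β)).map (Sum.map id Marker.sub) =
        joined (fun i => (decorate n β i).map (Sum.map id (Marker.sub ∘ Sum.inr)))
          (sep : KSym A k S) 1 (k' + p) := by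
      conv_lhs => rw [hp]
      rw [map_longWord, ← hp]
    rw [e]
    obtain ⟨W, h1, -⟩ := ht.block 1 le_rfl (by omega)
    obtain ⟨W', h2, -⟩ := ht.block (p + 1) (by omega) le_rfl
    have h3 : ∃ l, joined (fun i => (decorate n β i).map (Sum.map id (Marker.sub ∘ Sum.inr)))
        (sep : KSym A k S) 1 (k' + p) = opInd A S 1 :: l := by
      rw [Nat.cast_one] at h1
      cases p with
      | zero => exact ⟨_, h1⟩
      | succ p => exact ⟨_, by rw [← add_assoc, joined_add, h1, List.cons_append]⟩
    have h4 : ∃ l, joined (fun i => (decorate n β i).map (Sum.map id (Marker.sub ∘ Sum.inr)))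
        (sep : KSym A k S) 1 (k' + p) = l ++ [clInd A S ((p + 1 : ℕ) : ZMod k)] := by
      cases p with
      | zero => exact ⟨_, by rw [← List.cons_append] at h2; exact h2⟩
      | succ p =>
        rw [show k' + (p + 1) = p + k' + 1 by ring, joined_add, show 1 + p + 1 = p + 1 + 1 by ring,
          h2, ← List.cons_append, ← List.cons_append, ← List.append_assoc]
        exact ⟨_, rfl⟩
    obtain ⟨l, h3⟩ := h3
    obtain ⟨l', h4⟩ := h4
    obtain ⟨W, hW⟩ := List.exists_eq_cons_concat h3 h4 (by simp [opInd, clInd, ind])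
    refine computes_long hT.inn_fwd hT' (fun x hx => ?_) hW (run k' p _ y hk' ht)
    rcases mem_joined hx with h | ⟨i, -, -, h⟩
    · exact .inr h
    · exact .inl (ht.inner i x h)
  refine ⟨(isRev_wrapFrame hT).comp rfl (isRev_indexed hE.rev), fun β h => ?_, fun w y h => ?_⟩
  · rcases (mem_kstar_iff hP).1 h with ⟨us, h1, h2, h3, h4⟩ | ⟨n, β', hk, h1, h2, h3, h4, h5⟩
    · obtain rfl := wrap_inj.1 h4
      refine ⟨[], (hR _ _).2 ⟨us, h3, h2, [], ?_, hop.symm⟩, short us⟩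
      rw [blocks_eq_nil h1]
      exact .nil
    · obtain rfl := wrap_inj.1 h5
      obtain ⟨y, hy⟩ := exists_sound_blocks hP hE (m := n + 1 - k) _ _
        fun s h6 h7 => h4 s h6 (by omega)
      refine ⟨_, (hR _ _).2 ⟨_, h2, ?_, _, ?_, rfl⟩, long n β' y hk fun s h6 h7 => (hy s h6 h7).2⟩
      · intro u hu
        obtain ⟨i, hi, rfl⟩ := List.mem_map.1 hu
        simp only [List.mem_range'_1] at hi
        exact h1 i hi.1 (by omega)
      · rw [blocks_map_range', List.range'_eq_map_range, List.map_map, List.forall₂_map_left_iff,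
          List.forall₂_map_right_iff, List.forall₂_same]
        intro i hi
        rw [List.mem_range] at hi
        have := (hy (i + 1) (by omega) (by omega)).1
        rwa [Function.comp_apply, add_comm 1 i]
  · obtain ⟨us, rfl, h1, ys, h2, rfl⟩ := (hR _ _).1 h
    by_cases hk : us.length < k
    · refine ⟨shortWord us, by simp, (mem_kstar_iff hP).2 (.inl ⟨us, hk, h1, rfl, rfl⟩), ?_⟩
      rw [blocks_eq_nil hk] at h2
      cases h2
      rw [hop]
      exact short us
    · push Not at hk
      obtain ⟨u, hu⟩ := exists_eq_map_range' us
      obtain ⟨y, hy⟩ := exists_eq_map_range' ys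
      have hl : us.length + 1 - k = ys.length := by
        rw [← h2.length_eq, hu, blocks_map_range']; simp
      rw [hu, blocks_map_range', hy, ← hl, List.range'_eq_map_range, List.map_map,
        List.forall₂_map_left_iff, List.forall₂_map_right_iff, List.forall₂_same] at h2
      have h3 : ∀ s, 1 ≤ s → s ≤ us.length + 1 - k → y s ∈ R (concat u s k) := by
        intro s h3 h4
        have := h2 (s - 1) (by rw [List.mem_range]; omega)
        rw [Function.comp_apply, Nat.sub_add_cancel h3, Nat.add_sub_cancel' h3] at this
        exact this
      obtain ⟨b, hb⟩ := exists_complete_blocks hE _ y h3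
      obtain ⟨β, h4, h5, h6⟩ := exists_isBody (k := k) (n := us.length) u b fun s h4 h5 =>
        (hb s h4 (by omega)).1
      have h7 : us.flatten = concat (fun i => proj (β i)) 1 us.length := by
        conv_lhs => rw [hu, flatten_map_range']
        exact concat_congr fun i h7 h8 => (h5 i h7 (by omega)).symm
      refine ⟨longWord us.length (decorate us.length β), ?_, (mem_kstar_iff hP).2
        (.inr ⟨us.length, β, hk, fun i h8 h9 => ?_, h7, h4, fun s h8 h9 => ?_, rfl⟩), ?_⟩
      · rw [proj_longWord, h7]
        simp
      · rw [h5 i h8 h9]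
        have h10 : u i ∈ (List.range' 1 us.length).map u :=
          List.mem_map.2 ⟨i, by simp; omega, rfl⟩
        rw [← hu] at h10
        exact h1 _ h10
      · rw [h6 s h8 h9, concat_congr fun i h10 h11 => h5 i (by omega) (by omega)]
        exact (hb s h8 (by omega)).2.1
      · rw [hy, ← hl]
        exact long _ β y hk fun s h8 h9 => by
          rw [h6 s h8 (by omega)]
          exact (hb s h8 h9).2.2

end Wrap

end Ev

namespace Ev

/-! ### Evaluating the blocks from left to right. -/

section KStar

variable {A B : Type*} {S : Type} {k : ℕ}

/-- Control states of the evaluation of the blocks for a `k`-star, up to an index. -/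
inductive KStarState
  | call | done | turn | back | next | rewind

instance : Fintype KStarState :=
  ⟨⟨↑[KStarState.call, KStarState.done, KStarState.turn, KStarState.back, KStarState.next,
    KStarState.rewind], by simp⟩, by rintro ⟨⟩ <;> simp⟩

/-- Loops of the evaluation of the blocks for a `k`-star. -/
inductive KStarKeep : KStarState × ZMod k → KSym A k S → Prop
  | back_letter {j a} : KStarKeep (.back, j) (.inl a)
  | back_sep {j u} : KStarKeep (.back, j) (.inr (.sub (.inl u)))
  | back {j l m} : (l, m) ≠ (j + 1, Marker.op) → (l, m) ≠ (j, Marker.cl) →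
      KStarKeep (.back, j) (.inr (.sub (.inr (l, m))))
  | rewind_letter {j a} : KStarKeep (.rewind, j) (.inl a)
  | rewind {j m} : KStarKeep (.rewind, j) (.inr (.sub (.inr m)))

/-- Moves of the evaluation of the blocks for a `k`-star. -/
inductive KStarMove : KStarState × ZMod k → KSym A k S → KStarState × ZMod k → Prop
  | turn {j u} : k ≠ 1 → KStarMove (.done, j) (.inr (.sub (.inl u))) (.turn, j)
  | back {j l} : l = j → KStarMove (.turn, j) (.inr (.sub (.inr (l, .cl)))) (.back, j)
  | next {j l} : l = j + 1 → KStarMove (.back, j) (.inr (.sub (.inr (l, .op)))) (.next, j)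
  | call {j l u} : k ≠ 1 → l = j + 1 → KStarMove (.next, j) (.inr (.sub (.inl u))) (.call, l)
  | call_one {j l u} : k = 1 → l = j + 1 → KStarMove (.done, j) (.inr (.sub (.inl u))) (.call, l)
  | last {j} : KStarMove (.done, j) (.inr .cl) (.rewind, j)
  | rewind {j l u} : j = l + 1 → KStarMove (.rewind, j) (.inr (.sub (.inl u))) (.rewind, l)

theorem KStarMove.det {z z' z'' : KStarState × ZMod k} {x : KSym A k S} (h : KStarMove z x z')
    (h' : KStarMove z x z'') : z' = z'' := by
  cases h <;> cases h' <;> simp_all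

theorem KStarMove.codet {z z' z'' : KStarState × ZMod k} {x : KSym A k S} (h : KStarMove z x z'')
    (h' : KStarMove z' x z'') : z = z' := by
  cases h <;> cases h' <;> simp_all

theorem KStarMove.not_keep {z z' : KStarState × ZMod k} {x : KSym A k S} (h : KStarMove z x z') :
    ¬ KStarKeep z x := by
  rintro h'
  cases h <;> cases h' <;> simp_all

theorem KStarMove.not_keep_right {z z' : KStarState × ZMod k} {x : KSym A k S}
    (h : KStarMove z x z') : ¬ KStarKeep z' x := by
  rintro h'
  cases h <;> cases h' <;> simp_all

variable [NeZero k]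

/-- The frame for the evaluation of the blocks for a `k`-star, from left to right. -/
def kstarFrame (A : Type*) (S : Type) (k : ℕ) [NeZero k] : Frame (ZMod k) (KSym A k S) where
  Z := KStarState × ZMod k
  fintype := inferInstance
  fwd z := match z.1 with
    | .call => true
    | .done => true
    | _ => false
  keep := KStarKeep
  move := KStarMove
  src j := (.call, j)
  ret j := (.done, j)
  inn := (.call, 1)
  fin := (.rewind, 2)

theorem opInd_injective : Function.Injective (opInd A S : ZMod k → KSym A k S) := by
  intro i j h
  simpa [opInd, ind] using h

theorem clInd_injective : Function.Injective (clInd A S : ZMod k → KSym A k S) := by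
  intro i j h
  simpa [clInd, ind] using h

theorem isRev_kstarFrame :
    (kstarFrame A S k).IsRev (opInd A S) (clInd A S) (.inr .op) (.inr .op) where
  op_injective := opInd_injective
  cl_injective := clInd_injective
  cl_ne _ := by rintro ⟨⟩
  op_ne _ := by rintro ⟨⟩
  det := KStarMove.det
  codet := KStarMove.codet
  keep_move h h' := KStarMove.not_keep h' h
  move_keep := KStarMove.not_keep_right
  keep_src _ h := by cases h
  move_src _ _ h := by cases h
  keep_ret _ h := by cases h
  move_ret _ _ h := by cases h
  keep_inn h := by cases h
  move_inn _ h := by cases h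
  keep_fin h := by cases h
  move_fin _ h := by cases h
  inn_fwd := rfl

variable {E : Ev (A ⊕ Marker S) B} {k' p : ℕ} {f : ℕ → List (KSym A k S)} {y : ℕ → List B}

theorem run_block (hE : E.IsRev (.inr .op) (.inr .cl)) (h : IsTape E k k' p f y) {s : ℕ} (h1 : 1 ≤ s)
    (h2 : s ≤ p + 1) (L V : List (KSym A k S)) :
    ((kstarFrame A S k).comp (indexed k E) (opInd A S) (clInd A S)).Run
      (L, .inl (.call, s), joined f sep s k' ++ V) (y s)
      ((joined f sep s k').reverse ++ L, .inl (.done, s), V) := by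
  obtain ⟨W, h3, h4, -⟩ := h.block s h1 h2
  have h5 := (Frame.run_call (T := kstarFrame A S k) (L := L) (V := V)
    (isRev_indexed hE (s : ZMod k)) rfl h4).silent (Frame.run_ret (isRev_indexed hE (s : ZMod k)) rfl)
  rw [h3]
  simp only [List.reverse_append, List.reverse_cons, List.append_assoc, List.cons_append,
    List.nil_append, List.reverse_nil] at h5 ⊢
  exact h5

/-- The next block starts inside the current one, and no counting is needed to find it: going back
from the end of the current block, its opening parenthesis is the first with the next index. For `k
= 1` blocks do not overlap and the separator leads straight to the next one. -/
theorem run_next (hk : k = k' + 1) (h : IsTape E k k' p f y) {s : ℕ} (h1 : 1 ≤ s)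
    (h2 : s ≤ p) (m : ℕ) (L V : List (KSym A k S)) :
    ((kstarFrame A S k).comp (indexed k E) (opInd A S) (clInd A S)).Run
      ((joined f sep s k').reverse ++ L, .inl (.done, s), sep :: (joined f sep (s + k' + 1) m ++ V)) []
      (sep :: ((f s).reverse ++ L), .inl (.call, ((s + 1 : ℕ) : ZMod k)),
        joined f sep (s + 1) (k' + m) ++ V) := by
  rcases k' with _ | k''
  · rw [zero_add, joined_zero]
    exact Frame.run_ff (T := kstarFrame A S k) (z := (.done, s))
      (z' := (.call, ((s + 1 : ℕ) : ZMod k))) (x := sep) rfl rfl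
      (.call_one hk (by push_cast; rfl))
  · obtain ⟨W, h3, h4, h5⟩ := h.overlap s k'' h1 h2 rfl
    have hk' : k ≠ 1 := by omega
    have e : ((s + 1 : ℕ) : ZMod k) = (s : ZMod k) + 1 := by push_cast; rfl
    have r1 := Frame.run_fb (T := kstarFrame A S k) (E := indexed k E) (op := opInd A S)
      (cl := clInd A S) (z := (.done, s)) (z' := (.turn, s)) (x := sep)
      (L := (joined f sep s (k'' + 1)).reverse ++ L)
      (V := joined f sep (s + (k'' + 1) + 1) m ++ V) rfl rfl (.turn hk')
    have r2 := Frame.run_bb (T := kstarFrame A S k) (E := indexed k E) (op := opInd A S)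
      (cl := clInd A S) (z := (.turn, s)) (z' := (.back, s)) (x := clInd A S s)
      (L := W.reverse ++ opInd A S ((s + 1 : ℕ) : ZMod k) :: sep :: ((f s).reverse ++ L))
      (V := sep :: (joined f sep (s + (k'' + 1) + 1) m ++ V)) rfl rfl (.back rfl)
    have r3 := Frame.run_keep_back (T := kstarFrame A S k) (E := indexed k E) (op := opInd A S)
      (cl := clInd A S) (z := (.back, s)) (γ := W)
      (L := opInd A S ((s + 1 : ℕ) : ZMod k) :: sep :: ((f s).reverse ++ L))
      (V := clInd A S s :: sep :: (joined f sep (s + (k'' + 1) + 1) m ++ V)) rfl (by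
        intro x hx
        have h6 : x ∈ joined f sep (s + 1) k'' := by rw [h3]; simp [hx]
        rcases mem_joined h6 with rfl | ⟨i, -, -, h7⟩
        · exact .back_sep
        · obtain ⟨a | ⟨l, n⟩, rfl⟩ := h.inner i x h7
          · exact .back_letter
          · refine .back ?_ ?_
            · rintro ⟨⟩
              rw [e] at h4
              exact h4 hx
            · rintro ⟨⟩
              exact h5 hx)
    have r4 := Frame.run_bb (T := kstarFrame A S k) (E := indexed k E) (op := opInd A S)
      (cl := clInd A S) (z := (.back, s)) (z' := (.next, s)) (x := opInd A S ((s + 1 : ℕ) : ZMod k))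
      (L := sep :: ((f s).reverse ++ L))
      (V := W ++ clInd A S s :: sep :: (joined f sep (s + (k'' + 1) + 1) m ++ V)) rfl rfl (.next e)
    have r5 := Frame.run_bf (T := kstarFrame A S k) (E := indexed k E) (op := opInd A S)
      (cl := clInd A S) (z := (.next, s)) (z' := (.call, ((s + 1 : ℕ) : ZMod k))) (x := sep)
      (L := (f s).reverse ++ L)
      (V := opInd A S ((s + 1 : ℕ) : ZMod k) ::
        (W ++ clInd A S s :: sep :: (joined f sep (s + (k'' + 1) + 1) m ++ V))) rfl rfl
      (.call hk' e)
    have e1 : joined f sep (s + 1) (k'' + 1 + m) = opInd A S ((s + 1 : ℕ) : ZMod k) ::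
        (W ++ clInd A S s :: sep :: joined f sep (s + (k'' + 1) + 1) m) := by
      rw [add_right_comm, joined_add, h3, show s + 1 + k'' + 1 = s + (k'' + 1) + 1 by ring]
      simp
    have e2 : (joined f sep s (k'' + 1)).reverse ++ L = clInd A S s ::
        (W.reverse ++ opInd A S ((s + 1 : ℕ) : ZMod k) :: sep :: ((f s).reverse ++ L)) := by
      rw [joined_succ, h3]
      simp
    rw [e1]
    rw [e2] at r1 ⊢
    simpa using r1.trans (r2.trans (r3.trans (r4.trans r5)))

theorem run_blocks (hE : E.IsRev (.inr .op) (.inr .cl)) (hk : k = k' + 1) (h : IsTape E k k' p f y)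
    (V : List (KSym A k S)) (m : ℕ) : ∀ (s : ℕ) (_ : 1 ≤ s) (_ : s + m ≤ p + 1) (L : List (KSym A k S)),
    ((kstarFrame A S k).comp (indexed k E) (opInd A S) (clInd A S)).Run
      (L, .inl (.call, s), joined f sep s (k' + m) ++ V) (concat y s (m + 1))
      ((joined f sep s (k' + m)).reverse ++ L, .inl (.done, ((s + m : ℕ) : ZMod k)), V) := by
  induction m with
  | zero =>
    intro s h1 h2 L
    rw [concat_succ, concat_zero, List.append_nil]
    exact run_block hE h h1 h2 L V
  | succ m ih =>
    intro s h1 h2 L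
    have r1 := run_block hE h h1 (by omega) L (sep :: (joined f sep (s + k' + 1) m ++ V))
    have r2 := run_next (E := E) hk h h1 (by omega) m L V
    have r3 := ih (s + 1) (by omega) (by omega) (sep :: ((f s).reverse ++ L))
    have e1 : joined f sep s (k' + (m + 1)) = joined f sep s k' ++ sep :: joined f sep (s + k' + 1) m := by
      rw [← add_assoc, joined_add]
    have e2 : joined f sep s (k' + (m + 1)) = f s ++ sep :: joined f sep (s + 1) (k' + m) := by
      rw [← add_assoc, joined_succ]
    rw [show s + (m + 1) = s + 1 + m by ring, concat_succ _ s]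
    have r4 := (r1.silent r2).trans r3
    have e3 : (joined f sep s (k' + (m + 1))).reverse ++ L =
        (joined f sep (s + 1) (k' + m)).reverse ++ (sep :: ((f s).reverse ++ L)) := by
      rw [e2]; simp
    rw [e3, e1]
    simpa using r4

/-- The state still carries the index of the last block, and co-determinism does not allow the
different indices to merge. Subtracting `1` at each separator brings the index to a value that does
not depend on the number of factors. -/
theorem run_rewind (h : ∀ i, ∀ x ∈ f i, IsInner x) (s m : ℕ) :
    ∀ (j : ZMod k) (L V : List (KSym A k S)),
    ((kstarFrame A S k).comp (indexed k E) (opInd A S) (clInd A S)).Run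
      ((joined f sep s m).reverse ++ L, .inl (.rewind, j), V) []
      (L, .inl (.rewind, j - m), joined f sep s m ++ V) := by
  have key : ∀ (i : ℕ) (j : ZMod k) (L V : List (KSym A k S)),
      ((kstarFrame A S k).comp (indexed k E) (opInd A S) (clInd A S)).Run
        ((f i).reverse ++ L, .inl (.rewind, j), V) [] (L, .inl (.rewind, j), f i ++ V) := by
    intro i j L V
    exact Frame.run_keep_back (T := kstarFrame A S k) (z := (.rewind, j)) rfl (by
      intro x hx
      obtain ⟨a | m, rfl⟩ := h i x hx
      · exact .rewind_letter
      · exact .rewind)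
  induction m with
  | zero =>
    intro j L V
    rw [Nat.cast_zero, sub_zero]
    exact key s j L V
  | succ m ih =>
    intro j L V
    have r1 := key (s + m + 1) j (sep :: ((joined f sep s m).reverse ++ L)) V
    have r2 := Frame.run_bb (T := kstarFrame A S k) (E := indexed k E) (op := opInd A S)
      (cl := clInd A S) (z := (.rewind, j)) (z' := (.rewind, j - 1)) (x := sep)
      (L := (joined f sep s m).reverse ++ L) (V := f (s + m + 1) ++ V) rfl rfl (.rewind (by ring))
    have r3 := ih (j - 1) L (sep :: (f (s + m + 1) ++ V))
    have r4 := r1.trans (r2.trans r3)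
    rw [joined_succ_right, show j - ((m + 1 : ℕ) : ZMod k) = j - 1 - m by push_cast; ring]
    simpa using r4

variable {P : List A → Set (List (A ⊕ Marker S))} {R : List A → Language B}

theorem exists_evaluates_kstar {L : Language A} (hP : IsParsing P) (hE : E.Evaluates P R) :
    ∃ E' : Ev (KSym A k S) B, E'.Evaluates (kstar k L P)
      (fun w => {y | ∃ us : List (List A), w = us.flatten ∧ (∀ u ∈ us, u ∈ L) ∧
        y ∈ ((RTE.blocks k us).map R).prod}) ∧
      Fintype.card E'.Q = k * Fintype.card E.Q + 6 * k + 6 := by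
  refine ⟨_, evaluates_wrapFrame (T := kstarFrame A S k) (op' := List.flatten) hP hE
    isRev_kstarFrame rfl rfl (fun w y => ?_) (fun k' p f y hk h => ?_), ?_⟩
  · exact exists_congr fun us => and_congr_right fun _ => and_congr_right fun _ =>
      Language.mem_prod_map
  · have r1 := run_blocks hE.rev hk h [.inr .cl] p 1 le_rfl (by omega) [.inr .op]
    have r2 := Frame.run_fb (T := kstarFrame A S k) (E := indexed k E) (op := opInd A S)
      (cl := clInd A S) (z := (.done, ((1 + p : ℕ) : ZMod k)))
      (z' := (.rewind, ((1 + p : ℕ) : ZMod k))) (x := .inr .cl)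
      (L := (joined f sep 1 (k' + p)).reverse ++ [.inr .op]) (V := []) rfl rfl .last
    have r3 := run_rewind (k := k) (E := E) h.inner 1 (k' + p) ((1 + p : ℕ) : ZMod k) [.inr .op]
      [.inr .cl]
    -- The last block has index `1 + p` and there are `k' + p` separators, so rewinding ends at `1 -
    -- k' = 2 - k`, that is `2` modulo `k`, as in the final state of the frame.
    have e : ((1 + p : ℕ) : ZMod k) - ((k' + p : ℕ) : ZMod k) = 2 := by
      have : (k' : ZMod k) + 1 = 0 := by
        have : ((k' + 1 : ℕ) : ZMod k) = 0 := by rw [← hk]; exact ZMod.natCast_self k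
        simpa using this
      push_cast
      linear_combination -this
    rw [e] at r3
    rw [Nat.cast_one] at r1
    exact r1.silent (Run.silent r2 r3)
  · rw [card_wrapFrame_comp]
    have : Fintype.card (kstarFrame A S k).Z = 6 * k := by
      change Fintype.card (KStarState × ZMod k) = 6 * k
      rw [Fintype.card_prod, ZMod.card]
      rfl
    rw [this]

end KStar

end Ev

namespace Ev

/-! ### Evaluating the blocks from right to left. -/

section KRStar

variable {A B : Type*} {S : Type} {k : ℕ}

/-- Control states of the evaluation of the blocks for a reverse `k`-star, up to an index. -/
inductive KRStarState
  | count | close | call | back | left | turn | ahead | right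

instance : Fintype KRStarState :=
  ⟨⟨↑[KRStarState.count, KRStarState.close, KRStarState.call, KRStarState.back, KRStarState.left,
    KRStarState.turn, KRStarState.ahead, KRStarState.right], by simp⟩, by rintro ⟨⟩ <;> simp⟩

/-- Loops of the evaluation of the blocks for a reverse `k`-star. -/
inductive KRStarKeep : KRStarState × ZMod k → KSym A k S → Prop
  | count_letter {j a} : KRStarKeep (.count, j) (.inl a)
  | count {j m} : KRStarKeep (.count, j) (.inr (.sub (.inr m)))
  | call_letter {j a} : KRStarKeep (.call, j) (.inl a)
  | call_sep {j u} : KRStarKeep (.call, j) (.inr (.sub (.inl u)))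
  | call {j l m} : (l, m) ≠ (j, Marker.op) → (l, m) ≠ (j, Marker.cl) →
      KRStarKeep (.call, j) (.inr (.sub (.inr (l, m))))
  | back_letter {j a} : KRStarKeep (.back, j) (.inl a)
  | back_sep {j u} : KRStarKeep (.back, j) (.inr (.sub (.inl u)))
  | back {j l m} : (l, m) ≠ (j, Marker.op) → (l, m) ≠ (j, Marker.cl) →
      KRStarKeep (.back, j) (.inr (.sub (.inr (l, m))))
  | ahead_letter {j a} : KRStarKeep (.ahead, j) (.inl a)
  | ahead_sep {j u} : KRStarKeep (.ahead, j) (.inr (.sub (.inl u)))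
  | ahead {j l m} : (l, m) ≠ (j, Marker.op) → (l + 1, m) ≠ (j, Marker.cl) →
      KRStarKeep (.ahead, j) (.inr (.sub (.inr (l, m))))

/-- Moves of the evaluation of the blocks for a reverse `k`-star. -/
inductive KRStarMove : KRStarState × ZMod k → KSym A k S → KRStarState × ZMod k → Prop
  | count {j l u} : l = j + 1 → KRStarMove (.count, j) (.inr (.sub (.inl u))) (.count, l)
  | last {j l} : l = j + 1 → KRStarMove (.count, j) (.inr .cl) (.close, l)
  | close {j l} : l = j → KRStarMove (.close, j) (.inr (.sub (.inr (l, .cl)))) (.call, j)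
  | left {j l} : l = j → KRStarMove (.back, j) (.inr (.sub (.inr (l, .op)))) (.left, j)
  | turn {j u} : k ≠ 1 → KRStarMove (.left, j) (.inr (.sub (.inl u))) (.turn, j)
  | ahead {j l} : l = j → KRStarMove (.turn, j) (.inr (.sub (.inr (l, .op)))) (.ahead, j)
  | right {j l} : j = l + 1 → KRStarMove (.ahead, j) (.inr (.sub (.inr (l, .cl)))) (.right, j)
  | next {j l u} : k ≠ 1 → j = l + 1 → KRStarMove (.right, j) (.inr (.sub (.inl u))) (.close, l)
  | next_one {j l u} : k = 1 → j = l + 1 → KRStarMove (.left, j) (.inr (.sub (.inl u))) (.close, l)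

theorem KRStarMove.det {z z' z'' : KRStarState × ZMod k} {x : KSym A k S} (h : KRStarMove z x z')
    (h' : KRStarMove z x z'') : z' = z'' := by
  cases h <;> cases h' <;> simp_all

theorem KRStarMove.codet {z z' z'' : KRStarState × ZMod k} {x : KSym A k S}
    (h : KRStarMove z x z'') (h' : KRStarMove z' x z'') : z = z' := by
  cases h <;> cases h' <;> simp_all

theorem KRStarMove.not_keep {z z' : KRStarState × ZMod k} {x : KSym A k S}
    (h : KRStarMove z x z') : ¬ KRStarKeep z x := by
  rintro h'
  cases h <;> cases h' <;> simp_all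

theorem KRStarMove.not_keep_right {z z' : KRStarState × ZMod k} {x : KSym A k S}
    (h : KRStarMove z x z') : ¬ KRStarKeep z' x := by
  rintro h'
  cases h <;> cases h' <;> simp_all

theorem KRStarKeep.call_ne {j : ZMod k} {m : Marker S}
    (h : KRStarKeep (.call, j) (ind j m : KSym A k S)) : m ≠ .op := by
  generalize hx : (ind j m : KSym A k S) = x at h
  rintro rfl
  cases h <;> simp_all [ind]

theorem KRStarKeep.back_ne {j : ZMod k} {m : Marker S}
    (h : KRStarKeep (.back, j) (ind j m : KSym A k S)) : m ≠ .cl := by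
  generalize hx : (ind j m : KSym A k S) = x at h
  rintro rfl
  cases h <;> simp_all [ind]

variable [NeZero k]

/-- The frame for the evaluation of the blocks for a reverse `k`-star, from right to left. -/
def krstarFrame (A : Type*) (S : Type) (k : ℕ) [NeZero k] : Frame (ZMod k) (KSym A k S) where
  Z := KRStarState × ZMod k
  fintype := inferInstance
  fwd z := match z.1 with
    | .count => true
    | .turn => true
    | .ahead => true
    | .right => true
    | _ => false
  keep := KRStarKeep
  move := KRStarMove
  src j := (.call, j)
  ret j := (.back, j)
  inn := (.count, 1)
  fin := (.left, 1)

theorem isRev_krstarFrame :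
    (krstarFrame A S k).IsRev (opInd A S) (clInd A S) (.inr .op) (.inr .op) where
  op_injective := opInd_injective
  cl_injective := clInd_injective
  cl_ne _ := by rintro ⟨⟩
  op_ne _ := by rintro ⟨⟩
  det := KRStarMove.det
  codet := KRStarMove.codet
  keep_move h h' := KRStarMove.not_keep h' h
  move_keep := KRStarMove.not_keep_right
  keep_src _ h := KRStarKeep.call_ne h rfl
  move_src _ _ h := by cases h
  keep_ret _ h := KRStarKeep.back_ne h rfl
  move_ret _ _ h := by cases h
  keep_inn h := by cases h
  move_inn _ h := by cases h
  keep_fin h := by cases h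
  move_fin _ h := by cases h
  inn_fwd := rfl

variable {E : Ev (A ⊕ Marker S) B} {k' p : ℕ} {f : ℕ → List (KSym A k S)} {y : ℕ → List B}

/-- A block is reached at its right end. The head goes back to the opening parenthesis, the block is
evaluated, and the head goes back again in another state, so that the evaluation is not repeated. -/
theorem run_block_back (hE : E.IsRev (.inr .op) (.inr .cl)) (h : IsTape E k k' p f y) {s : ℕ}
    (h1 : 1 ≤ s) (h2 : s ≤ p + 1) (L V : List (KSym A k S)) :
    ((krstarFrame A S k).comp (indexed k E) (opInd A S) (clInd A S)).Run
      ((joined f sep s k').reverse ++ L, .inl (.close, s), V) (y s)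
      (L, .inl (.left, s), joined f sep s k' ++ V) := by
  obtain ⟨W, h3, h4, h5, h6⟩ := h.block s h1 h2
  have hW : ∀ x ∈ W, x = sep ∨ (∃ a, x = .inl a) ∨ ∃ l m, x = .inr (.sub (.inr (l, m))) ∧
      (l, m) ≠ ((s : ZMod k), Marker.op) ∧ (l, m) ≠ ((s : ZMod k), Marker.cl) := by
    intro x hx
    have h7 : x ∈ joined f sep s k' := by rw [h3]; simp [hx]
    rcases mem_joined h7 with rfl | ⟨i, -, -, h7⟩
    · exact .inl rfl
    · obtain ⟨a | ⟨l, n⟩, rfl⟩ := h.inner i x h7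
      · exact .inr (.inl ⟨a, rfl⟩)
      · refine .inr (.inr ⟨l, n, rfl, ?_, ?_⟩)
        · rintro ⟨⟩
          exact h5 hx
        · rintro ⟨⟩
          exact h6 hx
  have r1 := Frame.run_bb (T := krstarFrame A S k) (E := indexed k E) (op := opInd A S)
    (cl := clInd A S) (z := (.close, s)) (z' := (.call, s)) (x := clInd A S s)
    (L := W.reverse ++ opInd A S s :: L) (V := V) rfl rfl (.close rfl)
  have r2 := Frame.run_keep_back (T := krstarFrame A S k) (E := indexed k E) (op := opInd A S)
    (cl := clInd A S) (z := (.call, s)) (γ := W) (L := opInd A S s :: L) (V := clInd A S s :: V) rfl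
    (by
      intro x hx
      rcases hW x hx with rfl | ⟨a, rfl⟩ | ⟨l, n, rfl, h8, h9⟩
      · exact .call_sep
      · exact .call_letter
      · exact .call h8 h9)
  have r3 := (Frame.run_call_back (T := krstarFrame A S k) (L := L) (V := V)
    (isRev_indexed hE (s : ZMod k)) rfl h4).silent
    (Frame.run_ret_back (isRev_indexed hE (s : ZMod k)) rfl)
  have r4 := Frame.run_keep_back (T := krstarFrame A S k) (E := indexed k E) (op := opInd A S)
    (cl := clInd A S) (z := (.back, s)) (γ := W) (L := opInd A S s :: L) (V := clInd A S s :: V) rfl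
    (by
      intro x hx
      rcases hW x hx with rfl | ⟨a, rfl⟩ | ⟨l, n, rfl, h8, h9⟩
      · exact .back_sep
      · exact .back_letter
      · exact .back h8 h9)
  have r5 := Frame.run_bb (T := krstarFrame A S k) (E := indexed k E) (op := opInd A S)
    (cl := clInd A S) (z := (.back, s)) (z' := (.left, s)) (x := opInd A S s)
    (L := L) (V := W ++ clInd A S s :: V) rfl rfl (.left rfl)
  have r6 := r1.trans (r2.trans (r3.silent (r4.trans r5)))
  rw [h3]
  simp only [List.reverse_append, List.reverse_cons, List.append_assoc, List.cons_append,
    List.nil_append, List.reverse_nil] at r6 ⊢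
  exact r6

/-- Mirror image of `run_next`: to the right of the opening of block `s + 1`, the first closing
parenthesis with index `s` ends block `s`. The separators at both ends of the overlap are read only
to turn round; for `k = 1` the head just crosses one separator. -/
theorem run_next_back (hk : k = k' + 1) (h : IsTape E k k' p f y) {s : ℕ} (h1 : 1 ≤ s)
    (h2 : s ≤ p) (m : ℕ) (L V : List (KSym A k S)) :
    ((krstarFrame A S k).comp (indexed k E) (opInd A S) (clInd A S)).Run
      (sep :: ((f s).reverse ++ L), .inl (.left, ((s + 1 : ℕ) : ZMod k)),
        joined f sep (s + 1) (k' + m) ++ V) []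
      ((joined f sep s k').reverse ++ L, .inl (.close, s),
        sep :: (joined f sep (s + k' + 1) m ++ V)) := by
  have e : ((s + 1 : ℕ) : ZMod k) = (s : ZMod k) + 1 := by push_cast; rfl
  rcases k' with _ | k''
  · rw [zero_add, joined_zero]
    exact Frame.run_bb (T := krstarFrame A S k) (z := (.left, ((s + 1 : ℕ) : ZMod k)))
      (z' := (.close, s)) (x := sep) rfl rfl (.next_one hk e)
  · obtain ⟨W, h3, h4, h5⟩ := h.overlap s k'' h1 h2 rfl
    have hk' : k ≠ 1 := by omega
    have r1 := Frame.run_bf (T := krstarFrame A S k) (E := indexed k E) (op := opInd A S)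
      (cl := clInd A S) (z := (.left, ((s + 1 : ℕ) : ZMod k)))
      (z' := (.turn, ((s + 1 : ℕ) : ZMod k))) (x := sep)
      (L := (f s).reverse ++ L) (V := opInd A S ((s + 1 : ℕ) : ZMod k) ::
        (W ++ clInd A S s :: sep :: (joined f sep (s + (k'' + 1) + 1) m ++ V))) rfl rfl (.turn hk')
    have r2 := Frame.run_ff (T := krstarFrame A S k) (E := indexed k E) (op := opInd A S)
      (cl := clInd A S) (z := (.turn, ((s + 1 : ℕ) : ZMod k)))
      (z' := (.ahead, ((s + 1 : ℕ) : ZMod k))) (x := opInd A S ((s + 1 : ℕ) : ZMod k))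
      (L := sep :: ((f s).reverse ++ L))
      (V := W ++ clInd A S s :: sep :: (joined f sep (s + (k'' + 1) + 1) m ++ V)) rfl rfl (.ahead rfl)
    have r3 := Frame.run_keep (T := krstarFrame A S k) (E := indexed k E) (op := opInd A S)
      (cl := clInd A S) (z := (.ahead, ((s + 1 : ℕ) : ZMod k))) (γ := W)
      (L := opInd A S ((s + 1 : ℕ) : ZMod k) :: sep :: ((f s).reverse ++ L))
      (V := clInd A S s :: sep :: (joined f sep (s + (k'' + 1) + 1) m ++ V)) rfl (by
        intro x hx
        have h6 : x ∈ joined f sep (s + 1) k'' := by rw [h3]; simp [hx]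
        rcases mem_joined h6 with rfl | ⟨i, -, -, h7⟩
        · exact .ahead_sep
        · obtain ⟨a | ⟨l, n⟩, rfl⟩ := h.inner i x h7
          · exact .ahead_letter
          · refine .ahead ?_ ?_
            · rintro ⟨⟩
              exact h4 hx
            · intro h8
              simp only [Prod.mk.injEq, e, add_left_inj] at h8
              obtain ⟨rfl, rfl⟩ := h8
              exact h5 hx)
    have r4 := Frame.run_ff (T := krstarFrame A S k) (E := indexed k E) (op := opInd A S)
      (cl := clInd A S) (z := (.ahead, ((s + 1 : ℕ) : ZMod k)))
      (z' := (.right, ((s + 1 : ℕ) : ZMod k))) (x := clInd A S s)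
      (L := W.reverse ++ opInd A S ((s + 1 : ℕ) : ZMod k) :: sep :: ((f s).reverse ++ L))
      (V := sep :: (joined f sep (s + (k'' + 1) + 1) m ++ V)) rfl rfl (.right e)
    have r5 := Frame.run_fb (T := krstarFrame A S k) (E := indexed k E) (op := opInd A S)
      (cl := clInd A S) (z := (.right, ((s + 1 : ℕ) : ZMod k))) (z' := (.close, s)) (x := sep)
      (L := clInd A S s ::
        (W.reverse ++ opInd A S ((s + 1 : ℕ) : ZMod k) :: sep :: ((f s).reverse ++ L)))
      (V := joined f sep (s + (k'' + 1) + 1) m ++ V) rfl rfl (.next hk' e)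
    have e1 : joined f sep (s + 1) (k'' + 1 + m) = opInd A S ((s + 1 : ℕ) : ZMod k) ::
        (W ++ clInd A S s :: sep :: joined f sep (s + (k'' + 1) + 1) m) := by
      rw [add_right_comm, joined_add, h3, show s + 1 + k'' + 1 = s + (k'' + 1) + 1 by ring]
      simp
    have e2 : (joined f sep s (k'' + 1)).reverse ++ L = clInd A S s ::
        (W.reverse ++ opInd A S ((s + 1 : ℕ) : ZMod k) :: sep :: ((f s).reverse ++ L)) := by
      rw [joined_succ, h3]
      simp
    rw [e1, e2]
    simpa using r1.trans (r2.trans (r3.trans (r4.trans r5)))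

theorem run_blocks_back (hE : E.IsRev (.inr .op) (.inr .cl)) (hk : k = k' + 1)
    (h : IsTape E k k' p f y) (V : List (KSym A k S)) (m : ℕ) :
    ∀ (s : ℕ) (_ : 1 ≤ s) (_ : s + m ≤ p + 1) (L : List (KSym A k S)),
    ((krstarFrame A S k).comp (indexed k E) (opInd A S) (clInd A S)).Run
      ((joined f sep s (k' + m)).reverse ++ L, .inl (.close, ((s + m : ℕ) : ZMod k)), V)
      ((List.range' s (m + 1)).map y).reverse.flatten
      (L, .inl (.left, s), joined f sep s (k' + m) ++ V) := by
  induction m with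
  | zero =>
    intro s h1 h2 L
    have := run_block_back hE h h1 h2 L V
    simpa using this
  | succ m ih =>
    intro s h1 h2 L
    have r1 := ih (s + 1) (by omega) (by omega) (sep :: ((f s).reverse ++ L))
    have r2 := run_next_back (E := E) hk h h1 (by omega) m L V
    have r3 := run_block_back hE h h1 (by omega) L (sep :: (joined f sep (s + k' + 1) m ++ V))
    have e1 : joined f sep s (k' + (m + 1)) = joined f sep s k' ++ sep :: joined f sep (s + k' + 1) m := by
      rw [← add_assoc, joined_add]
    have e2 : joined f sep s (k' + (m + 1)) = f s ++ sep :: joined f sep (s + 1) (k' + m) := by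
      rw [← add_assoc, joined_succ]
    have r4 := (r1.silent r2).trans r3
    have e3 : (joined f sep s (k' + (m + 1))).reverse ++ L =
        (joined f sep (s + 1) (k' + m)).reverse ++ (sep :: ((f s).reverse ++ L)) := by
      rw [e2]; simp
    have e4 : ((List.range' s (m + 1 + 1)).map y).reverse.flatten =
        ((List.range' (s + 1) (m + 1)).map y).reverse.flatten ++ y s := by
      rw [List.range'_succ]; simp
    rw [show s + (m + 1) = s + 1 + m by ring, e4, e3, e1]
    simpa using r4

/-- The index of the last block must be known before the evaluation starts from the right, hence
this first pass. -/
theorem run_count (h : ∀ i, ∀ x ∈ f i, IsInner x) (m : ℕ) :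
    ∀ (s : ℕ) (j : ZMod k) (L V : List (KSym A k S)),
    ((krstarFrame A S k).comp (indexed k E) (opInd A S) (clInd A S)).Run
      (L, .inl (.count, j), joined f sep s m ++ V) []
      ((joined f sep s m).reverse ++ L, .inl (.count, j + m), V) := by
  have key : ∀ (i : ℕ) (j : ZMod k) (L V : List (KSym A k S)),
      ((krstarFrame A S k).comp (indexed k E) (opInd A S) (clInd A S)).Run
        (L, .inl (.count, j), f i ++ V) [] ((f i).reverse ++ L, .inl (.count, j), V) := by
    intro i j L V
    exact Frame.run_keep (T := krstarFrame A S k) (z := (.count, j)) rfl (by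
      intro x hx
      obtain ⟨a | m, rfl⟩ := h i x hx
      · exact .count_letter
      · exact .count)
  induction m with
  | zero =>
    intro s j L V
    rw [Nat.cast_zero, add_zero]
    exact key s j L V
  | succ m ih =>
    intro s j L V
    have r1 := key s j L (sep :: (joined f sep (s + 1) m ++ V))
    have r2 := Frame.run_ff (T := krstarFrame A S k) (E := indexed k E) (op := opInd A S)
      (cl := clInd A S) (z := (.count, j)) (z' := (.count, j + 1)) (x := sep)
      (L := (f s).reverse ++ L) (V := joined f sep (s + 1) m ++ V) rfl rfl (.count rfl)
    have r3 := ih (s + 1) (j + 1) (sep :: ((f s).reverse ++ L)) V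
    have r4 := r1.trans (r2.trans r3)
    rw [joined_succ, show j + ((m + 1 : ℕ) : ZMod k) = j + 1 + m by push_cast; ring]
    simpa using r4

variable {P : List A → Set (List (A ⊕ Marker S))} {R : List A → Language B}

theorem exists_evaluates_krstar {L : Language A} (hP : IsParsing P) (hE : E.Evaluates P R) :
    ∃ E' : Ev (KSym A k S) B, E'.Evaluates (kstar k L P)
      (fun w => {y | ∃ us : List (List A), w = us.flatten ∧ (∀ u ∈ us, u ∈ L) ∧
        y ∈ ((RTE.blocks k us).map R).reverse.prod}) ∧
      Fintype.card E'.Q = k * Fintype.card E.Q + 8 * k + 6 := by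
  refine ⟨_, evaluates_wrapFrame (T := krstarFrame A S k) (op' := fun ys => ys.reverse.flatten) hP hE
    isRev_krstarFrame rfl rfl (fun w y => ?_) (fun k' p f y hk h => ?_), ?_⟩
  · exact exists_congr fun us => and_congr_right fun _ => and_congr_right fun _ =>
      Language.mem_prod_reverse_map
  · have r1 := run_count (k := k) (E := E) h.inner (k' + p) 1 1 [.inr .op] [.inr .cl]
    -- Starting at `1` and adding `1` for each of the `k' + p` separators and for the closing
    -- parenthesis gives `k + p + 1`, the index `1 + p` of the last block.
    have e : ((1 + p : ℕ) : ZMod k) = 1 + ((k' + p : ℕ) : ZMod k) + 1 := by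
      have : (k' : ZMod k) + 1 = 0 := by
        have : ((k' + 1 : ℕ) : ZMod k) = 0 := by rw [← hk]; exact ZMod.natCast_self k
        simpa using this
      push_cast
      linear_combination -this
    have r2 := Frame.run_fb (T := krstarFrame A S k) (E := indexed k E) (op := opInd A S)
      (cl := clInd A S) (z := (.count, 1 + ((k' + p : ℕ) : ZMod k)))
      (z' := (.close, ((1 + p : ℕ) : ZMod k))) (x := .inr .cl)
      (L := (joined f sep 1 (k' + p)).reverse ++ [.inr .op]) (V := []) rfl rfl (.last e)
    have r3 := run_blocks_back hE.rev hk h [.inr .cl] p 1 le_rfl (by omega) [.inr .op]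
    rw [Nat.cast_one] at r3
    exact r1.trans (r2.trans r3)
  · rw [card_wrapFrame_comp]
    have : Fintype.card (krstarFrame A S k).Z = 8 * k := by
      change Fintype.card (KRStarState × ZMod k) = 8 * k
      rw [Fintype.card_prod, ZMod.card]
      rfl
    rw [this]

end KRStar

end Ev

/-! ### State bound for the evaluator. -/

namespace RTE

variable {A B : Type*}

theorem card_bound_sum {c a b F G x y : ℕ} (ha : a + 4 ≤ 5 * F * x) (hb : b + 4 ≤ 5 * G * y)
    (hc : c ≤ a + b + 3) : c + 4 ≤ 5 * (1 + F + G) * max x y := by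
  have h1 := Nat.mul_le_mul_left (5 * F) (le_max_left x y)
  have h2 := Nat.mul_le_mul_left (5 * G) (le_max_right x y)
  nlinarith

theorem card_bound_star {c a F x : ℕ} (hx : 1 ≤ x) (ha : a + 4 ≤ 5 * F * x) (hc : c ≤ a + 4) :
    c + 4 ≤ 5 * (1 + F) * x := by
  nlinarith

theorem card_bound_had {c a b F G x y : ℕ} (ha : a + 4 ≤ 5 * F * x) (hb : b + 4 ≤ 5 * G * y)
    (hc : c ≤ a + b + 4) : c + 4 ≤ 5 * (1 + F + G) * (x + y) := by
  nlinarith [Nat.zero_le (F * y), Nat.zero_le (G * x)]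

/-- The `k` copies of the argument are paid by the term `k * x` of the width. The control states,
linear in `k`, are paid by the term `k` of the size times the term `2` of the width. -/
theorem card_bound_kstar {c a F x k l : ℕ} (ha : a + 4 ≤ 5 * F * x) (hc : c ≤ k * a + 8 * k + 6) :
    c + 4 ≤ 5 * (1 + l + F + k + 1) * (2 + k * x) := by
  have h1 := Nat.mul_le_mul_left k ha
  nlinarith [Nat.zero_le (k * x), Nat.zero_le (l * (k * x)), Nat.zero_le (k * (k * x))]

/-- The summand `4` is kept for the endmarkers. Without `k`-stars each operator adds at most `4`
states to those of its arguments, less than its share of `5`. -/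
theorem exists_evaluates (h : RTE A B) : ∃ E : Ev h.Sym B, E.Evaluates h.parse h.rsem ∧
    Fintype.card E.Q + 4 ≤ 5 * h.size * h.width ∧
    (¬ h.UsesKStar → Fintype.card E.Q + 4 ≤ 5 * h.size) := by
  induction h with
  | base e v =>
    refine ⟨_, Ev.evaluates_base _ v, ?_⟩
    have h1 : 3 + 4 ≤ 5 * (base e v : RTE A B).size := by
      have := three_le_size (base e v)
      omega
    refine ⟨?_, fun _ => h1⟩
    rw [width, mul_one]
    exact h1
  | sum f g hf hg =>
    obtain ⟨F, hF, h1, h2⟩ := hf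
    obtain ⟨G, hG, h3, h4⟩ := hg
    obtain ⟨E, hE, h5⟩ := Ev.exists_evaluates_sum (isParsing_parse f) (isParsing_parse g) hF hG
    refine ⟨E, hE, card_bound_sum h1 h3 (by omega), fun h => ?_⟩
    simp only [UsesKStar, not_or] at h
    have h6 := h2 h.1
    have h7 := h4 h.2
    simp only [size]; omega
  | cauchy f g hf hg =>
    obtain ⟨F, hF, h1, h2⟩ := hf
    obtain ⟨G, hG, h3, h4⟩ := hg
    obtain ⟨E, hE, h5⟩ := Ev.exists_evaluates_cauchy (isParsing_parse f) (isParsing_parse g) hF hG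
    refine ⟨E, hE, card_bound_sum h1 h3 (by omega), fun h => ?_⟩
    simp only [UsesKStar, not_or] at h
    have h6 := h2 h.1
    have h7 := h4 h.2
    simp only [size]; omega
  | rcauchy f g hf hg =>
    obtain ⟨F, hF, h1, h2⟩ := hf
    obtain ⟨G, hG, h3, h4⟩ := hg
    obtain ⟨E, hE, h5⟩ := Ev.exists_evaluates_rcauchy (isParsing_parse f) (isParsing_parse g) hF hG
    refine ⟨E, hE, card_bound_sum h1 h3 (by omega), fun h => ?_⟩
    simp only [UsesKStar, not_or] at h
    have h6 := h2 h.1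
    have h7 := h4 h.2
    simp only [size]; omega
  | star f hf =>
    obtain ⟨F, hF, h1, h2⟩ := hf
    obtain ⟨E, hE, h5⟩ := Ev.exists_evaluates_star (isParsing_parse f) hF
    refine ⟨E, hE, card_bound_star f.one_le_width h1 (by omega), fun h => ?_⟩
    have h6 := h2 h
    simp only [size]; omega
  | rstar f hf =>
    obtain ⟨F, hF, h1, h2⟩ := hf
    obtain ⟨E, hE, h5⟩ := Ev.exists_evaluates_rstar (isParsing_parse f) hF
    refine ⟨E, hE, card_bound_star f.one_le_width h1 (by omega), fun h => ?_⟩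
    have h6 := h2 h
    simp only [size]; omega
  | had f g hf hg =>
    obtain ⟨F, hF, h1, h2⟩ := hf
    obtain ⟨G, hG, h3, h4⟩ := hg
    obtain ⟨E, hE, h5⟩ := Ev.exists_evaluates_had (isParsing_parse f) (isParsing_parse g) hF hG
    refine ⟨E, hE, card_bound_had h1 h3 (by omega), fun h => ?_⟩
    simp only [UsesKStar, not_or] at h
    have h6 := h2 h.1
    have h7 := h4 h.2
    simp only [size]; omega
  | kstar k e f hf =>
    obtain ⟨F, hF, h1, -⟩ := hf
    obtain ⟨E, hE, h5⟩ := Ev.exists_evaluates_kstar (k := k) (L := e.matches') (isParsing_parse f) hF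
    refine ⟨E, hE, card_bound_kstar h1 (by omega), fun h => (h trivial).elim⟩
  | krstar k e f hf =>
    obtain ⟨F, hF, h1, -⟩ := hf
    obtain ⟨E, hE, h5⟩ := Ev.exists_evaluates_krstar (k := k) (L := e.matches') (isParsing_parse f) hF
    refine ⟨E, hE, card_bound_kstar h1 (by omega), fun h => (h trivial).elim⟩

end RTE

/-! ### Determinism gives at most one output for each word. -/

namespace TwoWayTransducer

variable {X B Q : Type*} {T : TwoWayTransducer X B Q}

theorem Run.trans {c d e : List (TapeSym X) × Q × List (TapeSym X)} {y z : List B} (h : T.Run c y d)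
    (h' : T.Run d z e) : T.Run c (y ++ z) e := by
  induction h with
  | nil => exact h'
  | cons h _ ih =>
    rw [List.append_assoc]
    exact .cons h (ih h')

theorem Step.run {c d : List (TapeSym X) × Q × List (TapeSym X)} {o : List B} (h : T.Step c o d) :
    T.Run c o d := by
  simpa using Run.cons h (.nil d)

theorem Step.unique (hT : T.IsReversible) {c d d' : List (TapeSym X) × Q × List (TapeSym X)}
    {o o' : List B} (h : T.Step c o d) (h' : T.Step c o' d') : o = o' ∧ d = d' := by
  obtain ⟨u, p, v⟩ := c
  generalize hc : (u, p, v) = c at h h'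
  cases h with
  | ff h1 h2 h3 =>
    generalize hc' : (_, _, _) = c' at h'
    cases h' with
    | ff h4 h5 h6 => cases hc'; obtain rfl := hT.det _ _ _ _ h3 h6; exact ⟨rfl, rfl⟩
    | fb h4 h5 h6 => cases hc'; obtain rfl := hT.det _ _ _ _ h3 h6; exact absurd h2 h5
    | bf h4 h5 h6 => cases hc'; exact absurd h1 h4
    | bb h4 h5 h6 => cases hc'; exact absurd h1 h4
  | fb h1 h2 h3 =>
    generalize hc' : (_, _, _) = c' at h'
    cases h' with
    | ff h4 h5 h6 => cases hc'; obtain rfl := hT.det _ _ _ _ h3 h6; exact absurd h5 h2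
    | fb h4 h5 h6 => cases hc'; obtain rfl := hT.det _ _ _ _ h3 h6; exact ⟨rfl, rfl⟩
    | bf h4 h5 h6 => cases hc'; exact absurd h1 h4
    | bb h4 h5 h6 => cases hc'; exact absurd h1 h4
  | bf h1 h2 h3 =>
    generalize hc' : (_, _, _) = c' at h'
    cases h' with
    | ff h4 h5 h6 => cases hc'; exact absurd h4 h1
    | fb h4 h5 h6 => cases hc'; exact absurd h4 h1
    | bf h4 h5 h6 =>
      simp only [Prod.mk.injEq] at hc'
      obtain ⟨h7, rfl, rfl⟩ := hc'
      obtain ⟨rfl, h8⟩ := List.append_inj' h7 rfl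
      cases h8
      obtain rfl := hT.det _ _ _ _ h3 h6
      exact ⟨rfl, rfl⟩
    | bb h4 h5 h6 =>
      simp only [Prod.mk.injEq] at hc'
      obtain ⟨h7, rfl, rfl⟩ := hc'
      obtain ⟨rfl, h8⟩ := List.append_inj' h7 rfl
      cases h8
      obtain rfl := hT.det _ _ _ _ h3 h6
      exact absurd h2 h5
  | bb h1 h2 h3 =>
    generalize hc' : (_, _, _) = c' at h'
    cases h' with
    | ff h4 h5 h6 => cases hc'; exact absurd h4 h1
    | fb h4 h5 h6 => cases hc'; exact absurd h4 h1
    | bf h4 h5 h6 =>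
      simp only [Prod.mk.injEq] at hc'
      obtain ⟨h7, rfl, rfl⟩ := hc'
      obtain ⟨rfl, h8⟩ := List.append_inj' h7 rfl
      cases h8
      obtain rfl := hT.det _ _ _ _ h3 h6
      exact absurd h5 h2
    | bb h4 h5 h6 =>
      simp only [Prod.mk.injEq] at hc'
      obtain ⟨h7, rfl, rfl⟩ := hc'
      obtain ⟨rfl, h8⟩ := List.append_inj' h7 rfl
      cases h8
      obtain rfl := hT.det _ _ _ _ h3 h6
      exact ⟨rfl, rfl⟩

theorem not_step_of_fwd {u : List (TapeSym X)} {q : Q} (hq : q ∈ T.fwd) {o d} :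
    ¬ T.Step (u, q, []) o d := by
  intro h
  generalize hc : (u, q, ([] : List (TapeSym X))) = c at h
  cases h with
  | ff | fb => cases hc
  | bf h | bb h => cases hc; exact h hq

/-- A forward state at the right end has nothing to read, so a run that ends there cannot be
continued; two such runs from the same configuration take the same steps. -/
theorem Run.unique (hT : T.IsReversible) {c : List (TapeSym X) × Q × List (TapeSym X)}
    {u u' : List (TapeSym X)} {q q' : Q} {y y' : List B} (hq : q ∈ T.fwd) (hq' : q' ∈ T.fwd)
    (h : T.Run c y (u, q, [])) (h' : T.Run c y' (u', q', [])) : y = y' := by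
  generalize hd : (u, q, ([] : List (TapeSym X))) = d at h
  induction h generalizing y' with
  | nil =>
    subst hd
    cases h' with
    | nil => rfl
    | cons h => exact (not_step_of_fwd hq h).elim
  | cons h _ ih =>
    cases h' with
    | nil => exact (not_step_of_fwd hq' h).elim
    | cons h1 h2 =>
      obtain ⟨rfl, rfl⟩ := h.unique hT h1
      rw [ih h2 hd]

theorem mem_sem_iff (hT : T.IsReversible) {w : List X} {y : List B} (h : y ∈ T.sem w) (y') :
    y' ∈ T.sem w ↔ y' = y := by
  constructor
  · rintro ⟨q', hq', h'⟩
    obtain ⟨q, hq, h⟩ := h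
    exact Run.unique hT (T.final_fwd hq') (T.final_fwd hq) h' h
  · rintro rfl
    exact h

end TwoWayTransducer

/-! ### Adding the endmarkers. -/

namespace Ev

variable {X B : Type*}

/-- The states that handle the endmarkers. -/
inductive EndState
  | start | enter | leave | halt

instance : Fintype EndState :=
  ⟨⟨↑[EndState.start, EndState.enter, EndState.leave, EndState.halt], by simp⟩,
    by rintro ⟨⟩ <;> simp⟩

/-- Transitions of a machine extended to the endmarkers. -/
inductive EndTr (E : Ev X B) (op cl : X) :
    EndState ⊕ E.Q → TapeSym X → List B → EndState ⊕ E.Q → Prop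
  | start : EndTr E op cl (.inl .start) .lend [] (.inl .enter)
  | enter : EndTr E op cl (.inl .enter) (.sym op) [] (.inr E.inn)
  | inner {p x o q} : E.tr p x o q → EndTr E op cl (.inr p) (.sym x) o (.inr q)
  | leave : EndTr E op cl (.inr E.fin) (.sym cl) [] (.inl .leave)
  | halt : EndTr E op cl (.inl .leave) .rend [] (.inl .halt)

open Classical in
/-- The two-way transducer that runs a machine between the endmarkers. -/
noncomputable def toTwoWay (E : Ev X B) (op cl : X) : TwoWayTransducer X B (EndState ⊕ E.Q) where
  fwd := {q | Sum.elim (fun _ => true) E.fwd q = true}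
  init := .inl .start
  final := {.inl .halt}
  trans := {t | ∃ o, EndTr E op cl t.1 t.2.1 o t.2.2}
  out t := if h : ∃ o, EndTr E op cl t.1 t.2.1 o t.2.2 then h.choose else []
  init_fwd := rfl
  final_fwd := by rintro _ rfl; rfl
  eq_init := by
    rintro p q ⟨o, h⟩ -
    cases h
    rfl
  mem_final := by
    rintro p q ⟨o, h⟩ -
    cases h
    rfl

variable {E : Ev X B} {op cl : X}

theorem EndTr.det (hE : E.IsRev op cl) {p a o q o' q'} (h : EndTr E op cl p a o q)
    (h' : EndTr E op cl p a o' q') : o = o' ∧ q = q' := by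
  cases h with
  | start | enter | halt => cases h'; exact ⟨rfl, rfl⟩
  | inner h =>
    cases h' with
    | inner h' => obtain ⟨rfl, rfl⟩ := hE.det h h'; exact ⟨rfl, rfl⟩
    | leave => exact (hE.fin_cl h).elim
  | leave =>
    cases h' with
    | inner h' => exact (hE.fin_cl h').elim
    | leave => exact ⟨rfl, rfl⟩

theorem EndTr.codet (hE : E.IsRev op cl) {p p' a o q o'} (h : EndTr E op cl p a o q)
    (h' : EndTr E op cl p' a o' q) : p = p' := by
  cases h with
  | start | leave | halt => cases h'; rfl
  | inner h =>
    cases h' with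
    | inner h' => rw [hE.codet h h']
    | enter => exact (hE.inn_op h).elim
  | enter =>
    cases h' with
    | inner h' => exact (hE.inn_op h').elim
    | enter => rfl

theorem isReversible_toTwoWay (hE : E.IsRev op cl) : (toTwoWay E op cl).IsReversible where
  det := by
    rintro p a q q' ⟨o, h⟩ ⟨o', h'⟩
    exact (h.det hE h').2
  codet := by
    rintro p p' a q ⟨o, h⟩ ⟨o', h'⟩
    exact h.codet hE h'
  final_eq := ⟨_, rfl⟩

/-- The output of a transition is a choice, which the determinism of `E` makes harmless. -/
theorem out_toTwoWay (hE : E.IsRev op cl) {p a o q} (h : EndTr E op cl p a o q) :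
    (toTwoWay E op cl).out (p, a, q) = o := by
  have h1 : ∃ o, EndTr E op cl p a o q := ⟨o, h⟩
  have h2 : (toTwoWay E op cl).out (p, a, q) = h1.choose := dif_pos h1
  rw [h2]
  exact (h1.choose_spec.det hE h).1

theorem run_toTwoWay (hE : E.IsRev op cl) {c d : List X × E.Q × List X} {y : List B}
    (h : E.Run c y d) : (toTwoWay E op cl).Run
      (.lend :: c.1.reverse.map .sym, .inr c.2.1, c.2.2.map .sym ++ [.rend]) y
      (.lend :: d.1.reverse.map .sym, .inr d.2.1, d.2.2.map .sym ++ [.rend]) := by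
  induction h with
  | nil => exact .nil _
  | cons h _ ih =>
    refine .cons ?_ ih
    cases h with
    | @ff L V x o p q h h' h'' =>
      have h1 := EndTr.inner (op := op) (cl := cl) h''
      have := TwoWayTransducer.Step.ff (T := toTwoWay E op cl)
        (u := .lend :: L.reverse.map .sym) (v := V.map .sym ++ [.rend]) (a := .sym x)
        (p := .inr p) (q := .inr q) h h' ⟨_, h1⟩
      rw [out_toTwoWay hE h1] at this
      simpa using this
    | @fb L V x o p q h h' h'' =>
      have h1 := EndTr.inner (op := op) (cl := cl) h''
      have := TwoWayTransducer.Step.fb (T := toTwoWay E op cl)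
        (u := .lend :: L.reverse.map .sym) (v := V.map .sym ++ [.rend]) (a := .sym x)
        (p := .inr p) (q := .inr q) h (Bool.eq_false_iff.1 h') ⟨_, h1⟩
      rw [out_toTwoWay hE h1] at this
      simpa using this
    | @bf L V x o p q h h' h'' =>
      have h1 := EndTr.inner (op := op) (cl := cl) h''
      have := TwoWayTransducer.Step.bf (T := toTwoWay E op cl)
        (u := .lend :: L.reverse.map .sym) (v := V.map .sym ++ [.rend]) (a := .sym x)
        (p := .inr p) (q := .inr q) (Bool.eq_false_iff.1 h) h' ⟨_, h1⟩
      rw [out_toTwoWay hE h1] at this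
      simpa using this
    | @bb L V x o p q h h' h'' =>
      have h1 := EndTr.inner (op := op) (cl := cl) h''
      have := TwoWayTransducer.Step.bb (T := toTwoWay E op cl)
        (u := .lend :: L.reverse.map .sym) (v := V.map .sym ++ [.rend]) (a := .sym x)
        (p := .inr p) (q := .inr q) (Bool.eq_false_iff.1 h) (Bool.eq_false_iff.1 h') ⟨_, h1⟩
      rw [out_toTwoWay hE h1] at this
      simpa using this

theorem mem_sem_toTwoWay (hE : E.IsRev op cl) {β : List X} {y : List B} (h : E.Computes op cl β y) :
    y ∈ (toTwoWay E op cl).sem (op :: (β ++ [cl])) := by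
  have step : ∀ {u v : List (TapeSym X)} {a p q}, EndTr E op cl p a [] q →
      p ∈ (toTwoWay E op cl).fwd → q ∈ (toTwoWay E op cl).fwd →
      (toTwoWay E op cl).Run (u, p, a :: v) [] (u ++ [a], q, v) := by
    intro u v a p q h1 h2 h3
    have := (TwoWayTransducer.Step.ff (u := u) (v := v) h2 h3 ⟨_, h1⟩).run
    rwa [out_toTwoWay hE h1] at this
  have h1 := step (u := []) (v := (op :: (β ++ [cl])).map .sym ++ [.rend]) (.start (E := E) (op := op)
    (cl := cl)) rfl rfl
  have h2 := step (u := [.lend]) (v := (β ++ [cl]).map .sym ++ [.rend]) (.enter (E := E) (op := op)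
    (cl := cl)) rfl hE.inn_fwd
  have h3 := run_toTwoWay hE h
  have h4 := step (u := .lend :: (β.reverse ++ [op]).reverse.map .sym) (v := [.rend])
    (.leave (E := E) (op := op) (cl := cl)) hE.fin_fwd rfl
  have h5 := step (u := .lend :: (β.reverse ++ [op]).reverse.map .sym ++ [.sym cl]) (v := [])
    (.halt (E := E) (op := op) (cl := cl)) rfl rfl
  refine ⟨.inl .halt, rfl, ?_⟩
  change (toTwoWay E op cl).Run ([], .inl .start, _) _ _
  have h6 := h1.trans (h2.trans (h3.trans (h4.trans h5)))
  simpa [TwoWayTransducer.tape] using h6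

end Ev

/-- Soundness gives an output of `h` for each parsing, completeness reaches all the outputs, and
determinism excludes any other output of the transducer on a parsing. -/
theorem RTE.exists_evaluator {A B : Type*} (h : RTE A B) :
    ∃ (Q : Type) (_ : Fintype Q) (T : TwoWayTransducer h.Sym B Q),
      T.IsReversible ∧ (∀ w, h.rsem w = {y | ∃ α ∈ h.parse w, y ∈ T.sem α}) ∧
      Fintype.card Q ≤ 5 * h.size * h.width ∧ (¬ h.UsesKStar → Fintype.card Q ≤ 5 * h.size) := by
  obtain ⟨E, hE, h1, h2⟩ := h.exists_evaluates
  have hc : Fintype.card (Ev.EndState ⊕ E.Q) = Fintype.card E.Q + 4 := by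
    rw [Fintype.card_sum, add_comm]
    rfl
  have hrev := Ev.isReversible_toTwoWay hE.rev
  refine ⟨Ev.EndState ⊕ E.Q, inferInstance, E.toTwoWay (.inr .op) (.inr .cl), hrev, fun w => ?_,
    hc.trans_le h1, fun h => hc.trans_le (h2 h)⟩
  ext y
  constructor
  · intro hy
    obtain ⟨β, -, h3, h4⟩ := hE.complete w y hy
    refine ⟨_, h3, ?_⟩
    have := Ev.mem_sem_toTwoWay hE.rev h4
    rwa [← wrap_eq] at this
  · rintro ⟨α, h3, h4⟩
    obtain ⟨β, rfl, rfl⟩ := isParsing_parse h h3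
    obtain ⟨y', h5, h6⟩ := hE.sound β h3
    have h7 := Ev.mem_sem_toTwoWay hE.rev h6
    rw [← wrap_eq] at h7
    rwa [(TwoWayTransducer.mem_sem_iff hrev h7 y).1 h4]

theorem mainTheorem1 {A B : Type*} [Finite A] [Finite B] (h : RTE A B) :
    -- the parsing relation
    ({w | (h.parse w).Nonempty} = h.dom ∧
      h.udom = Parsing.fdom h.parse ∧
      ∀ w ∈ h.dom, ∀ α ∈ h.parse w, Parsing.proj α = w) ∧
    -- the evaluator
    (∃ (Q : Type) (_ : Fintype Q) (T : TwoWayTransducer h.Sym B Q),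
      T.IsReversible ∧
      (∀ w, h.rsem w = {y | ∃ α ∈ h.parse w, y ∈ T.sem α}) ∧
      Fintype.card Q ≤ 5 * h.size * h.width ∧
      (¬ h.UsesKStar → Fintype.card Q ≤ 5 * h.size)) ∧
    -- the parser
    (∃ (Q : Type) (_ : Fintype Q) (P : OneWayTransducer A h.Sym Q),
      (∀ w, P.sem w = h.parse w) ∧
      Fintype.card Q ≤ h.size ^ h.width ∧
      (¬ h.UsesHadamard → ¬ h.UsesKStar → Fintype.card Q ≤ h.size)) := by
  refine ⟨⟨?_, h.udom_eq_fdom, fun w _ α hα => (RTE.isParsing_parse h).proj_eq hα⟩,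
    h.exists_evaluator, h.exists_parser⟩
  ext w
  exact h.parse_nonempty_iff w
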